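/- Let $X$ be a compact complex manifold of dimension $d\ge 1$ and $D\subset X$ a smooth (closed, complex) hypersurface. Local coordinates $z=(z_1,\dots,z_d)$ are called adapted if $D$ is given by $z_1=0$ in their domain. Let $\mathcal E^{p,q}(*\bar *D)$ be the space of smooth $(p,q)$-forms $\omega$ on $X\setminus D$ such that near each point of $D$, in adapted coordinates, $z_1^m\bar z_1^l\,\omega$ extends smoothly across $D$ for some $m,l\ge 0$ (quasi-meromorphic forms), and let $\mathcal E^{p,q}(*D)$ be the subspace where one can take $l=0$ (semi-meromorphic forms). Put $$H_A^{d,d}(*\bar *D)=\frac{\mathcal E^{d,d}(*\bar *D)}{\partial\mathcal E^{d-1,d}(*\bar *D)+\bar\partial\mathcal E^{d,d-1}(*\bar *D)},\qquad H_\partial^{d,0}(*D)=\frac{\mathcal E^{d,0}(*D)}{\partial\mathcal E^{d-1,0}(*D)},$$ and let $H_A^{d-1,d-1}(D)=\mathcal E^{d-1,d-1}(D)/(\operatorname{im}\partial+\operatorname{im}\bar\partial)$ and $H_\partial^{d-1,0}(D)=\mathcal E^{d-1,0}(D)/\operatorname{im}\partial$, formed with smooth forms on $D$. Given a finite cover of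 $X$ by adapted charts with coordinates $z_j=(z_{j,1},\dots,z_{j,d})$ and a subordinate smooth partition of unity $(\rho_j)$, the residues are defined as follows. * For $\omega\in\mathcal E^{d,d}(*\bar *D)$ write $\omega=\dfrac{dz_{j,1}\wedge d\bar z_{j,1}}{z_{j,1}^{m_j}\bar z_{j,1}^{l_j}}\wedge\widetilde\omega_j$ on $\operatorname{supp}\rho_j$, where $m_j,l_j\ge1$ and $\widetilde\omega_j$ is smooth and contains neither $dz_{j,1}$ nor $d\bar z_{j,1}$. The Aeppli residue $\mathrm{Res}_A(\omega)\in H_A^{d-1,d-1}(D)$ of the class of $\omega$ is the class of $$\sum_j\frac{1}{(m_j-1)!\,(l_j-1)!}\,\frac{\partial^{m_j+l_j-2}(\rho_j\widetilde\omega_j)}{\partial z_{j,1}^{m_j-1}\,\partial\bar z_{j,1}^{l_j-1}}\Big|_D .$$ * For $\alpha\in\mathcal E^{d,0}(*D)$ write $\alpha=\dfrac{dz_{j,1}}{z_{j,1}^{m_j}}\wedge\widetilde\alpha_j$ on $\operatorname{supp}\rho_j$, where $m_j\ge1$ and $\widetilde\alpha_j$ is smooth and does not contain $dz_{j,1}$.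 The conjugate Dolbeault residue $\mathrm{Res}_\partial(\alpha)\in H_\partial^{d-1,0}(D)$ of the class of $\alpha$ is the class of $\sum_j\frac{1}{(m_j-1)!}\,\partial^{m_j-1}(\rho_j\widetilde\alpha_j)/\partial z_{j,1}^{m_j-1}\big|_D$. * If $\beta$ is a meromorphic $(d,0)$-form whose pole along $D$ has order one, and locally $\beta=\frac{dz_1}{z_1}\wedge\widetilde\beta+\tau$ in adapted coordinates, with $\widetilde\beta,\tau$ smooth and $\tau$ not containing $dz_1$, then its Poincaré residue is the form $\mathrm{Res}\,\beta=\widetilde\beta|_D$ on $D$. Then the following hold. (a) If a class $c\in H_A^{d,d}(*\bar *D)$ has a semi-meromorphic representative, then $\mathrm{Res}_A(c)=0$, for every choice of representative, coordinates, partition of unity and pole orders $m_j,l_j$ in the definition of $\mathrm{Res}_A(c)$. (b) Let $\alpha$ and $\beta$ be meromorphic $(d,0)$-forms on $X$ with poles along $D$ (and no other poles), the pole of $\beta$ being of order one. Then $\alpha\in\mathcal E^{d,0}(*D)$, $\alpha\wedge\bar\beta\in\mathcal E^{d,d}(*\bar *D)$, the Poincaré residue $\mathrm{Res}\,\beta$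 exists and is unique, the class $\big[R\wedge\overline{\mathrm{Res}\,\beta}\big]_A\in H_A^{d-1,d-1}(D)$ is the same for every smooth $(d-1,0)$-form $R$ representing $\mathrm{Res}_\partial\,\alpha$ (for any choices in the definition of $\mathrm{Res}_\partial\,\alpha$; at least one such $R$ exists), and, denoting it by $\big[\mathrm{Res}_\partial\,\alpha\wedge\overline{\mathrm{Res}\,\beta}\big]_A$, $$\mathrm{Res}_A(\alpha\wedge\bar\beta)=(-1)^{d-1}\big[\mathrm{Res}_\partial\,\alpha\wedge\overline{\mathrm{Res}\,\beta}\big]_A,$$ for every choice of representative, coordinates, partition of unity and pole orders in the definition of $\mathrm{Res}_A$. -/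

import Mathlib

open scoped Manifold ContDiff Topology ComplexConjugate TensorProduct
open Manifold

noncomputable section

/-! ### Multilinear algebra on `ℂⁿ` -/

/-- The model space `ℂⁿ`. -/
abbrev Cn (n : ℕ) : Type := Fin n → ℂ

/-- Complex-valued alternating `ℝ`-multilinear `k`-forms on `ℂⁿ` (complex-valued `k`-covectors). -/
abbrev Covec (n k : ℕ) : Type := (Cn n) [⋀^Fin k]→L[ℝ] ℂ

/-- Multiplication by `i` on `ℂⁿ`, as a real-linear map. -/
def mulI (n : ℕ) : Cn n →L[ℝ] Cn n :=
  (Complex.I • ContinuousLinearMap.id ℂ (Cn n)).restrictScalars ℝ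

section

variable {V : Type*} [NormedAddCommGroup V] [NormedSpace ℝ V] [NormedSpace ℂ V]
  [IsScalarTower ℝ ℂ V]

/-- The `ℂ`-linear part `v ↦ ½ (L v - i L (i v))` of a real-linear map. -/
def linPart {n : ℕ} (L : Cn n →L[ℝ] V) : Cn n →L[ℝ] V :=
  (1 / 2 : ℂ) • (L - Complex.I • L.comp (mulI n))

/-- The `ℂ`-antilinear part `v ↦ ½ (L v + i L (i v))` of a real-linear map. -/
def antilinPart {n : ℕ} (L : Cn n →L[ℝ] V) : Cn n →L[ℝ] V :=
  (1 / 2 : ℂ) • (L + Complex.I • L.comp (mulI n))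

/-- The Wirtinger derivative `∂/∂z₀` (first coordinate) of a vector-valued function on `ℂⁿ⁺¹`. -/
def wirt {n : ℕ} (F : Cn (n + 1) → V) : Cn (n + 1) → V :=
  fun y => linPart (fderiv ℝ F y) (Pi.single 0 1)

/-- The Wirtinger derivative `∂/∂z̄₀` (first coordinate) of a vector-valued function on `ℂⁿ⁺¹`. -/
def wirtBar {n : ℕ} (F : Cn (n + 1) → V) : Cn (n + 1) → V :=
  fun y => antilinPart (fderiv ℝ F y) (Pi.single 0 1)

end

/-- The wedge product `ℓ ∧ A` of a covector with a `k`-covector: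
`(ℓ ∧ A)(v₀, …, v_k) = ∑ (-1)^i ℓ(v_i) A(v₀, …, v̂_i, …, v_k)`. -/
def covWedge {n k : ℕ} (ℓ : Cn n →L[ℝ] ℂ) (A : Covec n k) : Covec n (k + 1) :=
  ContinuousAlternatingMap.alternatizeUncurryFin (ℓ.smulRight A)

/-- The covector `dz₀` on `ℂⁿ⁺¹`. -/
def dzZero (n : ℕ) : Cn (n + 1) →L[ℝ] ℂ := ContinuousLinearMap.proj 0

/-- The covector `dz̄₀` on `ℂⁿ⁺¹`. -/
def dzBarZero (n : ℕ) : Cn (n + 1) →L[ℝ] ℂ :=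
  (Complex.conjCLE : ℂ →L[ℝ] ℂ).comp (dzZero n)

/-- The wedge product of a `k`-covector and an `l`-covector, as an `m`-covector where `m = k + l`:
the signed sum over `(k,l)`-shuffles of the products `A(…) B(…)`. -/
def wedgeCovec {n k l m : ℕ} (h : k + l = m) (A : Covec n k) (B : Covec n l) : Covec n m :=
  { (((LinearMap.mul' ℝ ℂ).compAlternatingMap
      (A.toAlternatingMap.domCoprod B.toAlternatingMap)).domDomCongr
        (finSumFinEquiv.trans (finCongr h)) : (Cn n) [⋀^Fin m]→ₗ[ℝ] ℂ) with
    cont := by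
      change Continuous fun v : Fin m → Cn n =>
        (LinearMap.mul' ℝ ℂ) ((A.toAlternatingMap.domCoprod B.toAlternatingMap)
          (fun i => v ((finSumFinEquiv.trans (finCongr h)) i)))
      simp only [AlternatingMap.domCoprod_apply, sum_apply, map_sum]
      refine continuous_finsetSum _ fun σ _ => ?_
      induction σ using Quotient.inductionOn' with
      | h σ =>
        change Continuous fun v : Fin m → Cn n =>
          (LinearMap.mul' ℝ ℂ) (Equiv.Perm.sign σ •
            ((A fun i => v ((finSumFinEquiv.trans (finCongr h)) (σ (Sum.inl i)))) ⊗ₜ[ℝ]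
              (B fun i => v ((finSumFinEquiv.trans (finCongr h)) (σ (Sum.inr i))))))
        simp only [Units.smul_def, map_zsmul, LinearMap.mul'_apply]
        refine Continuous.zsmul (Continuous.mul ?_ ?_) _
        · exact A.cont.comp (continuous_pi fun i => continuous_apply _)
        · exact B.cont.comp (continuous_pi fun i => continuous_apply _) }

/-- The complex conjugate of a covector. -/
def conjCovec {n k : ℕ} (A : Covec n k) : Covec n k :=
  (Complex.conjCLE : ℂ →L[ℝ] ℂ).compContinuousAlternatingMap A

/-- `A` has bidegree `(p,q)`. The bihomogeneity forces `p + q = k` unless `A = 0`, and among the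
`k`-covectors it singles out exactly the span of the `dz_I ∧ dz̄_J` with `|I| = p`, `|J| = q`. -/
def HasBidegree {n k : ℕ} (p q : ℕ) (A : Covec n k) : Prop :=
  ∀ (c : ℂ) (v : Fin k → Cn n), A (fun j => c • v j) = c ^ p * (conj c) ^ q * A v

/-- `A` does not contain `dz₀`: its contraction with `∂/∂z₀ = ½ (e₀ - i·(i e₀))` vanishes. -/
def OmitsDz {n k : ℕ} (A : Covec (n + 1) k) : Prop :=
  ∀ (v : Fin k → Cn (n + 1)) (j : Fin k),
    A (Function.update v j (Pi.single 0 1)) =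
      Complex.I * A (Function.update v j (Pi.single 0 Complex.I))

/-- `A` does not contain `dz̄₀`: its contraction with `∂/∂z̄₀ = ½ (e₀ + i·(i e₀))` vanishes. -/
def OmitsDzBar {n k : ℕ} (A : Covec (n + 1) k) : Prop :=
  ∀ (v : Fin k → Cn (n + 1)) (j : Fin k),
    A (Function.update v j (Pi.single 0 1)) =
      -Complex.I * A (Function.update v j (Pi.single 0 Complex.I))

/-- The local operator `∂F = ∑ dz_j ∧ ∂F/∂z_j` on `k`-forms on open subsets of `ℂⁿ`. -/
def delLocal {n k : ℕ} (F : Cn n → Covec n k) : Cn n → Covec n (k + 1) :=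
  fun y => ContinuousAlternatingMap.alternatizeUncurryFin (linPart (fderiv ℝ F y))

/-- The local operator `∂̄F = ∑ dz̄_j ∧ ∂F/∂z̄_j` on `k`-forms on open subsets of `ℂⁿ`. -/
def delBarLocal {n k : ℕ} (F : Cn n → Covec n k) : Cn n → Covec n (k + 1) :=
  fun y => ContinuousAlternatingMap.alternatizeUncurryFin (antilinPart (fderiv ℝ F y))

/-! ### Differential forms on complex manifolds

A complex manifold of dimension `n` is a space `M` with `[ChartedSpace (Cn n) M]` and
`[IsManifold 𝓘(ℂ, Cn n) ω M]`. -/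

/-- A (not necessarily smooth) complex-valued `k`-form on the `n`-dimensional manifold `M`: a
`k`-covector on every tangent space. In Mathlib the tangent space at every point is the model space
by definition. -/
def Form (n : ℕ) (M : Type*) (k : ℕ) := M → Covec n k

instance (n : ℕ) (M : Type*) (k : ℕ) : AddCommGroup (Form n M k) :=
  inferInstanceAs (AddCommGroup (M → Covec n k))

instance (n : ℕ) (M : Type*) (k : ℕ) : Module ℂ (Form n M k) :=
  inferInstanceAs (Module ℂ (M → Covec n k))

section

variable {n : ℕ} {M : Type*} [TopologicalSpace M] [ChartedSpace (Cn n) M]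

/-- The holomorphic charts of `M`. -/
abbrev holCharts (n : ℕ) (M : Type*) [TopologicalSpace M] [ChartedSpace (Cn n) M] :
    Set (OpenPartialHomeomorph M (Cn n)) :=
  IsManifold.maximalAtlas 𝓘(ℂ, Cn n) ω M

/-- The expression of a form in the chart `φ`, i.e. its pullback under `φ⁻¹`. It is meaningful on
`φ.target`. -/
def inChart {k : ℕ} (φ : OpenPartialHomeomorph M (Cn n)) (θ : Form n M k) : Cn n → Covec n k :=
  fun y => (θ (φ.symm y)).compContinuousLinearMap
    ((mfderiv 𝓘(ℂ, Cn n) 𝓘(ℂ, Cn n) φ.symm y : Cn n →L[ℂ] Cn n).restrictScalars ℝ)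

/-- `∂θ`, computed in the preferred chart at each point (for smooth `θ` any holomorphic chart gives
the same value). -/
def del {k : ℕ} (θ : Form n M k) : Form n M (k + 1) :=
  fun x => (delLocal (inChart (chartAt (Cn n) x) θ) (chartAt (Cn n) x x)).compContinuousLinearMap
    ((mfderiv 𝓘(ℂ, Cn n) 𝓘(ℂ, Cn n) (chartAt (Cn n) x) x : Cn n →L[ℂ] Cn n).restrictScalars ℝ)

/-- `∂̄θ`, computed in the preferred chart at each point. -/
def delBar {k : ℕ} (θ : Form n M k) : Form n M (k + 1) :=
  fun x => (delBarLocal (inChart (chartAt (Cn n) x) θ)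
    (chartAt (Cn n) x x)).compContinuousLinearMap
    ((mfderiv 𝓘(ℂ, Cn n) 𝓘(ℂ, Cn n) (chartAt (Cn n) x) x : Cn n →L[ℂ] Cn n).restrictScalars ℝ)

/-- The form `θ` is smooth on the set `U`. -/
def SmoothOn {k : ℕ} (U : Set M) (θ : Form n M k) : Prop :=
  ∀ φ ∈ holCharts n M, ContDiffOn ℝ ∞ (inChart φ θ) (φ.target ∩ φ.symm ⁻¹' U)

/-- The wedge product of forms. -/
def wedge {k l m : ℕ} (h : k + l = m) (θ : Form n M k) (η : Form n M l) : Form n M m :=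
  fun x => wedgeCovec h (θ x) (η x)

/-- The complex conjugate of a form. -/
def conjForm {k : ℕ} (θ : Form n M k) : Form n M k := fun x => conjCovec (θ x)

theorem inChart_add {k : ℕ} (φ : OpenPartialHomeomorph M (Cn n)) (θ η : Form n M k) :
    inChart φ (θ + η) = inChart φ θ + inChart φ η := rfl

theorem inChart_smul {k : ℕ} (φ : OpenPartialHomeomorph M (Cn n)) (c : ℂ) (θ : Form n M k) :
    inChart φ (c • θ) = c • inChart φ θ := rfl

theorem inChart_zero {k : ℕ} (φ : OpenPartialHomeomorph M (Cn n)) :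
    inChart φ (0 : Form n M k) = 0 := rfl

theorem SmoothOn.zero {k : ℕ} (U : Set M) : SmoothOn U (0 : Form n M k) := fun φ _ => by
  rw [inChart_zero]; exact contDiffOn_const

theorem SmoothOn.add {k : ℕ} {U : Set M} {θ η : Form n M k} (hθ : SmoothOn U θ)
    (hη : SmoothOn U η) : SmoothOn U (θ + η) := fun φ hφ => by
  rw [inChart_add]; exact (hθ φ hφ).add (hη φ hφ)

theorem SmoothOn.smul {k : ℕ} {U : Set M} (c : ℂ) {θ : Form n M k} (hθ : SmoothOn U θ) :
    SmoothOn U (c • θ) := fun φ hφ => by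
  rw [inChart_smul]; exact (hθ φ hφ).const_smul c

end

theorem HasBidegree.zero {n k p q : ℕ} : HasBidegree p q (0 : Covec n k) := by
  intro c v; simp

theorem HasBidegree.add {n k p q : ℕ} {A B : Covec n k} (hA : HasBidegree p q A)
    (hB : HasBidegree p q B) : HasBidegree p q (A + B) := by
  intro c v
  have h1 := hA c v
  have h2 := hB c v
  simp only [ContinuousAlternatingMap.add_apply, h1, h2]; ring

theorem HasBidegree.smul {n k p q : ℕ} (a : ℂ) {A : Covec n k} (hA : HasBidegree p q A) :
    HasBidegree p q (a • A) := by
  intro c v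
  have h1 := hA c v
  simp only [ContinuousAlternatingMap.smul_apply, h1, smul_eq_mul]; ring

/-! ### Cohomology in top degree of a complex manifold -/

section

variable (n : ℕ) (M : Type*) [TopologicalSpace M] [ChartedSpace (Cn n) M]

/-- The space `E^{p,q}(M)` of smooth `(p,q)`-forms, as forms of degree `k` (with `k = p + q`). -/
def smoothForms (p q k : ℕ) : Submodule ℂ (Form n M k) where
  carrier := {θ | SmoothOn Set.univ θ ∧ ∀ x, HasBidegree p q (θ x)}
  zero_mem' := ⟨SmoothOn.zero _, fun _ => HasBidegree.zero⟩
  add_mem' h₁ h₂ := ⟨h₁.1.add h₂.1, fun x => (h₁.2 x).add (h₂.2 x)⟩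
  smul_mem' c _ h := ⟨h.1.smul c, fun x => (h.2 x).smul c⟩

/-- The image of `∂ : E^{p-1,q}(M) → E^{p,q}(M)` (zero if `p = 0`). -/
def delImage (p q : ℕ) : (k : ℕ) → Submodule ℂ (Form n M k)
  | 0 => ⊥
  | k + 1 => Submodule.span ℂ
      {θ | ∃ p', p' + 1 = p ∧ ∃ η ∈ smoothForms n M p' q k, θ = del η}

/-- The image of `∂̄ : E^{p,q-1}(M) → E^{p,q}(M)` (zero if `q = 0`). -/
def delBarImage (p q : ℕ) : (k : ℕ) → Submodule ℂ (Form n M k)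
  | 0 => ⊥
  | k + 1 => Submodule.span ℂ
      {θ | ∃ q', q' + 1 = q ∧ ∃ η ∈ smoothForms n M p q' k, θ = delBar η}

/-- The Aeppli cohomology group `H_A^{n,n}(M) = ker(∂∂̄) / (im ∂ + im ∂̄)` of an `n`-dimensional
complex manifold. In this top bidegree every smooth form lies in `ker(∂∂̄)`. -/
abbrev AeppliTop : Type _ :=
  smoothForms n M n n (n + n) ⧸
    (delImage n M n n (n + n) ⊔ delBarImage n M n n (n + n)).submoduleOf
      (smoothForms n M n n (n + n))

/-- The conjugate Dolbeault cohomology group `H_∂^{n,0}(M) = ker(∂) / im(∂)` of an `n`-dimensional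
complex manifold. Every smooth `(n,0)`-form lies in `ker(∂)`. -/
abbrev ConjDolbeaultTop : Type _ :=
  smoothForms n M n 0 n ⧸ (delImage n M n 0 n).submoduleOf (smoothForms n M n 0 n)

end

/-! ### Forms with poles along a smooth hypersurface

The hypersurface is given by an embedding `i : D → X`, where `dim X = n + 1` and `dim D = n`. -/

section

variable {n : ℕ} {X : Type*} [TopologicalSpace X] [ChartedSpace (Cn (n + 1)) X] {D : Type*}

/-- `i : D → X` is the inclusion of a smooth hypersurface: a holomorphic embedding of complex
manifolds, of codimension one, with closed image. -/
structure IsSmoothHypersurface (n : ℕ) {X : Type*} [TopologicalSpace X]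
    [ChartedSpace (Cn (n + 1)) X] {D : Type*} [TopologicalSpace D] [ChartedSpace (Cn n) D] (i : D → X) : Prop where
  isSmoothEmbedding : IsSmoothEmbedding 𝓘(ℂ, Cn n) 𝓘(ℂ, Cn (n + 1)) ω i
  isClosed_range : IsClosed (Set.range i)

/-- A holomorphic chart of `X` with coordinates `(z₀, …, z_n)` in which `D` is given by `z₀ = 0`
(the chart need not meet `D`). -/
structure IsAdapted (i : D → X) (φ : OpenPartialHomeomorph X (Cn (n + 1))) : Prop where
  mem_holCharts : φ ∈ holCharts (n + 1) X
  mem_iff : ∀ x ∈ φ.source, x ∈ Set.range i ↔ φ x 0 = 0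

/-- In a neighbourhood of every point of `D`, `z₀^a z̄₀^b θ` extends smoothly across `D` for some
`a, b`, where `b` is subject to the restriction `P b`. -/
def PolesAlong (i : D → X) (P : ℕ → Prop) {k : ℕ} (θ : Form (n + 1) X k) : Prop :=
  ∀ φ, IsAdapted i φ → ∀ x ∈ φ.source, x ∈ Set.range i →
    ∃ a b : ℕ, P b ∧ ∃ g : Cn (n + 1) → Covec (n + 1) k, ContDiffAt ℝ ∞ g (φ x) ∧
      ∀ᶠ y in 𝓝 (φ x), y 0 ≠ 0 → (y 0 ^ a * (conj (y 0)) ^ b) • inChart φ θ y = g y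

theorem PolesAlong.zero (i : D → X) {P : ℕ → Prop} (hP : P 0) {k : ℕ} :
    PolesAlong i P (0 : Form (n + 1) X k) := fun φ _ x _ _ =>
  ⟨0, 0, hP, 0, contDiffAt_const, Filter.Eventually.of_forall fun y _ => by
    simp [inChart_zero]⟩

theorem PolesAlong.smul {i : D → X} {P : ℕ → Prop} {k : ℕ} (c : ℂ) {θ : Form (n + 1) X k}
    (h : PolesAlong i P θ) : PolesAlong i P (c • θ) := fun φ hφ x hx hxD => by
  obtain ⟨a, b, hb, g, hg, he⟩ := h φ hφ x hx hxD
  refine ⟨a, b, hb, c • g, hg.const_smul c, he.mono fun y hy h0 => ?_⟩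
  rw [inChart_smul, Pi.smul_apply, Pi.smul_apply, smul_comm, hy h0]

theorem PolesAlong.add {i : D → X} {P : ℕ → Prop} (hP : ∀ b b', P b → P b' → P (b + b')) {k : ℕ}
    {θ η : Form (n + 1) X k} (h : PolesAlong i P θ) (h' : PolesAlong i P η) :
    PolesAlong i P (θ + η) := fun φ hφ x hx hxD => by
  obtain ⟨a, b, hb, g, hg, he⟩ := h φ hφ x hx hxD
  obtain ⟨a', b', hb', g', hg', he'⟩ := h' φ hφ x hx hxD
  have hz : ContDiff ℝ ∞ fun y : Cn (n + 1) => y 0 := contDiff_apply ℝ ℂ (0 : Fin (n + 1))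
  have hw : ContDiff ℝ ∞ fun y : Cn (n + 1) => conj (y 0) :=
    Complex.conjCLE.contDiff.comp hz
  refine ⟨a + a', b + b', hP _ _ hb hb',
    fun y => (y 0 ^ a' * (conj (y 0)) ^ b') • g y + (y 0 ^ a * (conj (y 0)) ^ b) • g' y, ?_, ?_⟩
  · exact ((((hz.pow _).mul (hw.pow _)).contDiffAt).smul hg).add
      ((((hz.pow _).mul (hw.pow _)).contDiffAt).smul hg')
  · filter_upwards [he, he'] with y hy hy' h0
    rw [← hy h0, ← hy' h0, inChart_add, Pi.add_apply, smul_add, smul_smul, smul_smul]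
    congr 2 <;> ring

/-- The space `E^{p,q}(*\bar{*}D)` of quasi-meromorphic `(p,q)`-forms with polar set in `D`. Only the
values off `D` matter. -/
def quasiForms (n : ℕ) {X : Type*} [TopologicalSpace X]
    [ChartedSpace (Cn (n + 1)) X] {D : Type*} (i : D → X) (p q k : ℕ) : Submodule ℂ (Form (n + 1) X k) where
  carrier := {θ | SmoothOn (Set.range i)ᶜ θ ∧ (∀ x ∉ Set.range i, HasBidegree p q (θ x)) ∧
    PolesAlong i (fun _ => True) θ}
  zero_mem' := ⟨SmoothOn.zero _, fun _ _ => HasBidegree.zero, PolesAlong.zero i trivial⟩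
  add_mem' h₁ h₂ := ⟨h₁.1.add h₂.1, fun x hx => (h₁.2.1 x hx).add (h₂.2.1 x hx),
    h₁.2.2.add (fun _ _ _ _ => trivial) h₂.2.2⟩
  smul_mem' c _ h := ⟨h.1.smul c, fun x hx => (h.2.1 x hx).smul c, h.2.2.smul c⟩

/-- The space `E^{p,q}(*D)` of semi-meromorphic `(p,q)`-forms with polar set in `D`. Only the
values off `D` matter. -/
def semiForms (n : ℕ) {X : Type*} [TopologicalSpace X]
    [ChartedSpace (Cn (n + 1)) X] {D : Type*} (i : D → X) (p q k : ℕ) : Submodule ℂ (Form (n + 1) X k) where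
  carrier := {θ | SmoothOn (Set.range i)ᶜ θ ∧ (∀ x ∉ Set.range i, HasBidegree p q (θ x)) ∧
    PolesAlong i (fun b => b = 0) θ}
  zero_mem' := ⟨SmoothOn.zero _, fun _ _ => HasBidegree.zero, PolesAlong.zero i (P := fun b => b = 0) rfl⟩
  add_mem' h₁ h₂ := ⟨h₁.1.add h₂.1, fun x hx => (h₁.2.1 x hx).add (h₂.2.1 x hx),
    h₁.2.2.add (fun _ _ h h' => by rw [h, h']) h₂.2.2⟩
  smul_mem' c _ h := ⟨h.1.smul c, fun x hx => (h.2.1 x hx).smul c, h.2.2.smul c⟩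

/-- `∂E^{n,n+1}(*\bar{*}D) + ∂̄E^{n+1,n}(*\bar{*}D)` inside `E^{n+1,n+1}(*\bar{*}D)`. Forms are
compared off `D`. -/
def quasiExact (n : ℕ) {X : Type*} [TopologicalSpace X]
    [ChartedSpace (Cn (n + 1)) X] {D : Type*} (i : D → X) :
    Submodule ℂ (quasiForms n i (n + 1) (n + 1) (n + n + 1 + 1)) :=
  Submodule.span ℂ {θ | ∃ η ∈ quasiForms n i n (n + 1) (n + n + 1),
      ∀ x ∉ Set.range i, (θ : Form (n + 1) X (n + n + 1 + 1)) x = del η x} ⊔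
    Submodule.span ℂ {θ | ∃ η ∈ quasiForms n i (n + 1) n (n + n + 1),
      ∀ x ∉ Set.range i, (θ : Form (n + 1) X (n + n + 1 + 1)) x = delBar η x}

/-- `∂E^{n,0}(*D)` inside `E^{n+1,0}(*D)`. Forms are compared off `D`. -/
def semiDelExact (n : ℕ) {X : Type*} [TopologicalSpace X]
    [ChartedSpace (Cn (n + 1)) X] {D : Type*} (i : D → X) : Submodule ℂ (semiForms n i (n + 1) 0 (n + 1)) :=
  Submodule.span ℂ {θ | ∃ η ∈ semiForms n i n 0 n,
      ∀ x ∉ Set.range i, (θ : Form (n + 1) X (n + 1)) x = del η x}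

/-- The Aeppli cohomology group `H_A^{d,d}(*\bar{*}D)`, `d = n + 1 = dim X`. -/
abbrev AeppliPolar (n : ℕ) {X : Type*} [TopologicalSpace X]
    [ChartedSpace (Cn (n + 1)) X] {D : Type*} (i : D → X) : Type _ :=
  quasiForms n i (n + 1) (n + 1) (n + n + 1 + 1) ⧸ quasiExact n i

/-- The conjugate Dolbeault cohomology group `H_∂^{d,0}(*D)`, `d = n + 1 = dim X`. -/
abbrev ConjDolbeaultPolar (n : ℕ) {X : Type*} [TopologicalSpace X]
    [ChartedSpace (Cn (n + 1)) X] {D : Type*} (i : D → X) : Type _ :=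
  semiForms n i (n + 1) 0 (n + 1) ⧸ semiDelExact n i

/-- The class `c ∈ H_A^{d,d}(*\bar{*}D)` is semi-meromorphic: it has a semi-meromorphic
representative. -/
def IsSemiMeromorphicClass (i : D → X) (c : AeppliPolar n i) : Prop :=
  ∃ θ : quasiForms n i (n + 1) (n + 1) (n + n + 1 + 1),
    (θ : Form (n + 1) X (n + n + 1 + 1)) ∈ semiForms n i (n + 1) (n + 1) (n + n + 1 + 1) ∧
      Submodule.Quotient.mk θ = c

/-- `θ` is a meromorphic `(p,0)`-form with poles along `D`: a holomorphic `(p,0)`-form on `X ∖ D`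
such that, locally at the points of `D`, `z₀^m θ` extends to a holomorphic form for some `m`.
(A `(p,0)`-form is holomorphic if its coefficients are, i.e. if it is complex differentiable as
a covector-valued function.) -/
structure IsMeromorphicForm (i : D → X) (p : ℕ) {k : ℕ} (θ : Form (n + 1) X k) : Prop where
  bidegree : ∀ x ∉ Set.range i, HasBidegree p 0 (θ x)
  holomorphic : ∀ φ ∈ holCharts (n + 1) X,
    DifferentiableOn ℂ (inChart φ θ) (φ.target ∩ φ.symm ⁻¹' (Set.range i)ᶜ)
  pole : ∀ φ, IsAdapted i φ → ∀ x ∈ φ.source, x ∈ Set.range i →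
    ∃ m : ℕ, ∃ g : Cn (n + 1) → Covec (n + 1) k, AnalyticAt ℂ g (φ x) ∧
      ∀ᶠ y in 𝓝 (φ x), y 0 ≠ 0 → y 0 ^ m • inChart φ θ y = g y

/-- The meromorphic form `θ` has a pole of order (at most) one along `D`. -/
def HasSimplePole (i : D → X) {k : ℕ} (θ : Form (n + 1) X k) : Prop :=
  ∀ φ, IsAdapted i φ → ∀ x ∈ φ.source, x ∈ Set.range i →
    ∃ g : Cn (n + 1) → Covec (n + 1) k, AnalyticAt ℂ g (φ x) ∧
      ∀ᶠ y in 𝓝 (φ x), y 0 ≠ 0 → y 0 • inChart φ θ y = g y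

/-! ### Residues -/

variable [TopologicalSpace D] [ChartedSpace (Cn n) D]

/-- The pullback to `D`, at the point `p`, of the form on `φ.target` whose value at `φ (i p)` is
`A`. It is meaningful if `i p ∈ φ.source`. -/
def restrictToD (i : D → X) (φ : OpenPartialHomeomorph X (Cn (n + 1))) (p : D) {k : ℕ}
    (A : Covec (n + 1) k) : Covec n k :=
  A.compContinuousLinearMap
    ((mfderiv 𝓘(ℂ, Cn n) 𝓘(ℂ, Cn (n + 1)) (fun q => φ (i q)) p :
      Cn n →L[ℂ] Cn (n + 1)).restrictScalars ℝ)

/-- `B` is the Poincaré residue of `β`: near every point of `D`, in some adapted coordinates,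
`β = dz₀/z₀ ∧ g + τ` with `g`, `τ` smooth and `τ` not containing `dz₀`, and `B = g|_D`. -/
def IsPoincareResidue (i : D → X) {k : ℕ} (β : Form (n + 1) X (k + 1)) (B : Form n D k) : Prop :=
  ∀ p : D, ∃ φ, IsAdapted i φ ∧ i p ∈ φ.source ∧
    ∃ (g : Cn (n + 1) → Covec (n + 1) k) (τ : Cn (n + 1) → Covec (n + 1) (k + 1)),
      ContDiffAt ℝ ∞ g (φ (i p)) ∧ ContDiffAt ℝ ∞ τ (φ (i p)) ∧
      (∀ᶠ y in 𝓝 (φ (i p)), OmitsDz (τ y)) ∧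
      (∀ᶠ y in 𝓝 (φ (i p)), y 0 ≠ 0 →
        inChart φ β y = (y 0)⁻¹ • covWedge (dzZero n) (g y) + τ y) ∧
      B p = restrictToD i φ p (g (φ (i p)))

/-- The choices entering the residues: a finite cover of `X` by adapted charts `φ j` and
a subordinate smooth partition of unity `ρ`. -/
structure ResidueCover (n : ℕ) {X : Type*} [TopologicalSpace X]
    [ChartedSpace (Cn (n + 1)) X] {D : Type*} (i : D → X) where
  /-- The number of charts. -/
  N : ℕ
  /-- The charts. -/
  φ : Fin N → OpenPartialHomeomorph X (Cn (n + 1))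
  /-- The partition of unity. -/
  ρ : SmoothPartitionOfUnity (Fin N) 𝓘(ℝ, Cn (n + 1)) X Set.univ
  adapted : ∀ j, IsAdapted i (φ j)
  subordinate : ρ.IsSubordinate fun j => (φ j).source

open Classical in
/-- The term `1/(a! b!) ∂^{a+b}(ρ_j g)/∂z₀^a ∂z̄₀^b |_D` of a residue, extended by zero outside of
the chart. Here `g` is a form on `(φ j).target`, differentiated coefficientwise. -/
def ResidueCover.term {i : D → X} (C : ResidueCover n i) (j : Fin C.N) (a b : ℕ) {k : ℕ}
    (g : Cn (n + 1) → Covec (n + 1) k) : Form n D k :=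
  fun p => if i p ∈ (C.φ j).source then
    (1 / ((a.factorial : ℂ) * (b.factorial : ℂ))) • restrictToD i (C.φ j) p
      (wirt^[a] (wirtBar^[b] fun y => ((C.ρ j ((C.φ j).symm y) : ℝ) : ℂ) • g y) (C.φ j (i p)))
  else 0

/-- `R` is the form `R_{ρ,z}(α)` on `D` for some choice of `ρ` and `z`:
writing `α = dz₀ ∧ g_j / z₀^m` on `supp ρ_j`, where `g_j` is smooth and does not contain `dz₀`,
`R = ∑_j 1/(m-1)! ∂^{m-1}(ρ_j g_j)/∂z₀^{m-1} |_D`. Here `m = a j + 1`. -/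
def IsConjDolbeaultResidueForm (i : D → X) {k : ℕ} (α : Form (n + 1) X (k + 1))
    (R : Form n D k) : Prop :=
  ∃ (C : ResidueCover n i) (a : Fin C.N → ℕ) (g : Fin C.N → Cn (n + 1) → Covec (n + 1) k),
    (∀ j, ContDiffOn ℝ ∞ (g j) (C.φ j).target) ∧
    (∀ j, ∀ y ∈ (C.φ j).target, OmitsDz (g j y)) ∧
    (∀ j, ∀ x ∈ tsupport (C.ρ j), x ∉ Set.range i →
      inChart (C.φ j) α (C.φ j x) =
        (C.φ j x 0 ^ (a j + 1))⁻¹ • covWedge (dzZero n) (g j (C.φ j x))) ∧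
    R = ∑ j, C.term j (a j) 0 (g j)

/-- `R` is the form `Res_{ρ,z}(θ)` on `D` for some choice of `ρ` and `z`:
writing `θ = dz₀ ∧ dz̄₀ ∧ g_j / (z₀^m z̄₀^l)` on `supp ρ_j`, where `g_j` is smooth and contains
neither `dz₀` nor `dz̄₀`,
`R = ∑_j 1/((m-1)! (l-1)!) ∂^{m+l-2}(ρ_j g_j)/∂z₀^{m-1} ∂z̄₀^{l-1} |_D`.
Here `m = a j + 1` and `l = b j + 1`. -/
def IsAeppliResidueForm (i : D → X) {k : ℕ} (θ : Form (n + 1) X (k + 1 + 1))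
    (R : Form n D k) : Prop :=
  ∃ (C : ResidueCover n i) (a b : Fin C.N → ℕ) (g : Fin C.N → Cn (n + 1) → Covec (n + 1) k),
    (∀ j, ContDiffOn ℝ ∞ (g j) (C.φ j).target) ∧
    (∀ j, ∀ y ∈ (C.φ j).target, OmitsDz (g j y) ∧ OmitsDzBar (g j y)) ∧
    (∀ j, ∀ x ∈ tsupport (C.ρ j), x ∉ Set.range i →
      inChart (C.φ j) θ (C.φ j x) =
        (C.φ j x 0 ^ (a j + 1) * (conj (C.φ j x 0)) ^ (b j + 1))⁻¹ •
          covWedge (dzZero n) (covWedge (dzBarZero n) (g j (C.φ j x)))) ∧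
    R = ∑ j, C.term j (a j) (b j) (g j)

/-- All values of the conjugate Dolbeault residue `Res_∂` of a class in `H_∂^{d,0}(*D)`, over all
choices of a representative, of coordinates, of a partition of unity and of pole orders. -/
def conjDolbeaultResidues (i : D → X) (c : ConjDolbeaultPolar n i) : Set (ConjDolbeaultTop n D) :=
  {s | ∃ α : semiForms n i (n + 1) 0 (n + 1), Submodule.Quotient.mk α = c ∧
    ∃ R : smoothForms n D n 0 n, IsConjDolbeaultResidueForm i α.1 R.1 ∧
      Submodule.Quotient.mk R = s}

/-- All values of the Aeppli residue `Res_A` of a class in `H_A^{d,d}(*\bar{*}D)`, over all choices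
of a representative, of coordinates, of a partition of unity and of pole orders. That
`Res_A(c)` is well defined and equal to `s` means that this set is `{s}`. -/
def aeppliResidues (i : D → X) (c : AeppliPolar n i) : Set (AeppliTop n D) :=
  {s | ∃ θ : quasiForms n i (n + 1) (n + 1) (n + n + 1 + 1), Submodule.Quotient.mk θ = c ∧
    ∃ R : smoothForms n D n n (n + n), IsAeppliResidueForm i θ.1 R.1 ∧
      Submodule.Quotient.mk R = s}

end

end

/-! Let dim X = n + 1, so that the sign in (b) is (-1)^n. The main point is a description of the
residue that mentions neither pole orders nor numerators. If f = G / (z₀^(a+1) z̄₀^(b+1)) near a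
point q with z₀ = 0, then along the ray q + tζe₀ with |ζ| = 1 one has t²f = t^(-(a+b)) ζ^b ζ̄^a G.
By Taylor's formula this has a finite part as t → 0+, and its mean over ζ is ∂^a ∂̄^b G(q) / (a!
b!), the derivatives being taken in z₀ (`IsResAt.of_contDiffAt`). Finite parts are unique, so the
number `resF f q` depends only on f off the hyperplane. It vanishes on ∂f/∂z₀ and ∂f/∂z̄₀
(`resF_wirt`, `resF_wirtBar`) and commutes with derivatives along the hyperplane (`resF_dC`). Hence,
if η is supported in an adapted chart, the residue form of ∂η or ∂̄η in that chart is exact on D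
(`residueIn_delM_mem`).

Independence of the chart: for a pole 1/(z₀z̄₀) the residue is a boundary value and transforms
pointwise as a form on D (`residueIn_eq_of_simple`). Higher poles are lowered modulo exact forms: if
f = G / (z₀^(a+2) z̄₀^(b+1)), then f + (a+1)⁻¹ ∂(z₀f)/∂z₀ equals (a+1)⁻¹ ∂G/∂z₀ divided by z₀^(a+1)
z̄₀^(b+1), and similarly in z̄₀ (`residueIn_sub_mem_of_exponents`). Partitions of unity globalize
this: every residue form allowed by the definition is a `residueSum C θ`, and its class depends only
on the class of θ (`IsAeppliResidueForm.exists_eq`, `residue_sub_mem`).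

For (a), a semi-meromorphic coefficient is written with a pole z̄₀⁻¹ and a numerator divisible by
z̄₀. The factor z̄₀ passes through all derivatives ∂/∂z₀ and vanishes on D, so the residue form is
zero (`residueIn_eq_zero_of_semi`). It must also be shown that some residue form exists. Smoothness
at a point is a condition on each finite order of differentiation separately, so the pole orders of
a given representative need not be bounded near a point of D. Therefore the class is first
represented by a form that extends smoothly across D: the mean of f over rotations of z₀ differs
from f by a sum of derivatives (`wirt_add_wirtBar_rotMean`), and the mean of a function with a pole
in z₀ alone is smooth, because a smooth function of weight a under rotations is divisible by z₀^a.

For (b), a (k,0)-covector of degree k is complex multilinear, so near D the form β is u dz₀ ∧ ⋯ ∧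
dz_n / z₀ with u holomorphic. In α ∧ β̄ the only pole in z̄₀ is z̄₀⁻¹, so no derivative ∂/∂z̄₀ is
taken, and ū is a constant for ∂/∂z₀. Thus the residue form of α wedged with the conjugate of Res β
equals, term by term, (-1)^n times the residue form of α ∧ β̄; the sign comes from moving dz̄₀
across an n-form (`wedge_term_eq`). Since β and Res β are holomorphic, ∂η ∧ β̄ = ∂(η ∧ β̄), and
likewise on D; so neither the representative of the class of α nor that of its residue matters
(`wedge_mk_eq`, `IsLeadingForm.wedge_mem_aeppliExact`). -/

noncomputable section

/-! ### Wirtinger derivatives -/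

set_option linter.unusedSectionVars false

section Wirtinger

variable {V W : Type*} [NormedAddCommGroup V] [NormedSpace ℝ V] [NormedSpace ℂ V]
  [IsScalarTower ℝ ℂ V] [NormedAddCommGroup W] [NormedSpace ℝ W] [NormedSpace ℂ W]
  [IsScalarTower ℝ ℂ W] {m : ℕ}

/-- The part `v ↦ ½ (L v - c L (i v))` of a real-linear map: the `ℂ`-linear part for `c = i`, the
`ℂ`-antilinear part for `c = -i`. -/
def typePart (c : ℂ) (L : Cn m →L[ℝ] V) : Cn m →L[ℝ] V :=
  (1 / 2 : ℂ) • (L - c • L.comp (mulI m))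

theorem antilinPart_eq_typePart (L : Cn m →L[ℝ] V) :
    antilinPart L = typePart (-Complex.I) L := by
  ext v
  change (1 / 2 : ℂ) • (L v + Complex.I • L (mulI m v)) =
    (1 / 2 : ℂ) • (L v - -Complex.I • L (mulI m v))
  rw [neg_smul, sub_neg_eq_add]

theorem typePart_apply (c : ℂ) (L : Cn m →L[ℝ] V) (v : Cn m) :
    typePart c L v = (1 / 2 : ℂ) • (L v - c • L (Complex.I • v)) := rfl

/-- The complex directional derivative of type `c` in the direction `v`: `∂_v` for `c = i` and
`∂̄_v` for `c = -i`. -/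
def dC (c : ℂ) (v : Cn m) (F : Cn m → V) : Cn m → V := fun y => typePart c (fderiv ℝ F y) v

theorem dC_apply (c : ℂ) (v : Cn m) (F : Cn m → V) (y : Cn m) :
    dC c v F y = (1 / 2 : ℂ) • (fderiv ℝ F y v - c • fderiv ℝ F y (Complex.I • v)) := rfl

theorem wirt_eq_dC {n : ℕ} : (wirt : (Cn (n + 1) → V) → _) = dC Complex.I (Pi.single 0 1) := rfl

theorem wirtBar_eq_dC {n : ℕ} :
    (wirtBar : (Cn (n + 1) → V) → _) = dC (-Complex.I) (Pi.single 0 1) := by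
  funext F y
  simp [wirtBar, dC, antilinPart_eq_typePart]

theorem Filter.EventuallyEq.dC {c : ℂ} {v : Cn m} {F G : Cn m → V} {p : Cn m}
    (h : F =ᶠ[𝓝 p] G) : dC c v F =ᶠ[𝓝 p] dC c v G := by
  filter_upwards [h.eventuallyEq_nhds] with y hy
  rw [dC_apply, dC_apply, hy.fderiv_eq]

theorem Filter.EventuallyEq.dC_iterate {c : ℂ} {v : Cn m} {F G : Cn m → V} {p : Cn m}
    (h : F =ᶠ[𝓝 p] G) (k : ℕ) : (_root_.dC c v)^[k] F =ᶠ[𝓝 p] (_root_.dC c v)^[k] G := by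
  induction k with
  | zero => exact h
  | succ k ih => rw [Function.iterate_succ_apply', Function.iterate_succ_apply']; exact ih.dC

theorem ContDiffAt.dC {c : ℂ} {v : Cn m} {F : Cn m → V} {p : Cn m} {k l : WithTop ℕ∞}
    (h : ContDiffAt ℝ l F p) (hkl : k + 1 ≤ l) : ContDiffAt ℝ k (dC c v F) p := by
  have h1 : ContDiffAt ℝ k (fderiv ℝ F) p := h.fderiv_right hkl
  have h2 := h1.clm_apply (contDiffAt_const (c := v))
  have h3 := h1.clm_apply (contDiffAt_const (c := Complex.I • v))
  exact (h2.sub (h3.const_smul c)).const_smul (1 / 2 : ℂ)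

theorem ContDiffAt.dC_infty {c : ℂ} {v : Cn m} {F : Cn m → V} {p : Cn m}
    (h : ContDiffAt ℝ ∞ F p) : ContDiffAt ℝ ∞ (_root_.dC c v F) p := h.dC (by simp)

theorem ContDiffAt.dC_iterate {c : ℂ} {v : Cn m} {F : Cn m → V} {p : Cn m} {k : WithTop ℕ∞}
    (j : ℕ) (h : ContDiffAt ℝ (k + j) F p) : ContDiffAt ℝ k ((_root_.dC c v)^[j] F) p := by
  induction j generalizing k with
  | zero => simpa using h
  | succ j ih =>
    rw [Function.iterate_succ_apply']
    refine (ih (k := k + 1) ?_).dC le_rfl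
    have : k + 1 + (j : WithTop ℕ∞) = k + ((j + 1 : ℕ) : WithTop ℕ∞) := by
      push_cast; rw [add_assoc, add_comm 1]
    rwa [this]

theorem infty_add_natCast (j : ℕ) : (∞ : WithTop ℕ∞) + (j : WithTop ℕ∞) = ∞ := by
  change ((⊤ : ℕ∞) : WithTop ℕ∞) + ((j : ℕ∞) : WithTop ℕ∞) = _
  rw [← WithTop.coe_add, top_add]

theorem ContDiffAt.dC_iterate_infty {c : ℂ} {v : Cn m} {F : Cn m → V} {p : Cn m}
    (j : ℕ) (h : ContDiffAt ℝ ∞ F p) : ContDiffAt ℝ ∞ ((_root_.dC c v)^[j] F) p :=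
  ContDiffAt.dC_iterate j (by rwa [infty_add_natCast])

theorem ContDiffAt.eventually_differentiableAt {F : Cn m → V} {p : Cn m} {k : WithTop ℕ∞}
    (h : ContDiffAt ℝ k F p) (hk : 1 ≤ k) : ∀ᶠ y in 𝓝 p, DifferentiableAt ℝ F y :=
  ((h.of_le hk).eventually (by simp)).mono fun _ hy => hy.differentiableAt (by simp)

theorem dC_smul {c : ℂ} {v : Cn m} {f : Cn m → ℂ} {F : Cn m → V} {y : Cn m}
    (hf : DifferentiableAt ℝ f y) (hF : DifferentiableAt ℝ F y) :
    dC c v (fun y => f y • F y) y = f y • dC c v F y + dC c v f y • F y := by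
  simp only [dC_apply, fderiv_fun_smul hf hF, add_apply, smul_apply,
    ContinuousLinearMap.smulRight_apply, smul_add, smul_sub, smul_eq_mul]
  module

theorem dC_mul {c : ℂ} {v : Cn m} {f F : Cn m → ℂ} {y : Cn m}
    (hf : DifferentiableAt ℝ f y) (hF : DifferentiableAt ℝ F y) :
    dC c v (fun y => f y * F y) y = f y * dC c v F y + dC c v f y * F y :=
  dC_smul (V := ℂ) hf hF

theorem dC_const {c : ℂ} {v : Cn m} (a : V) (y : Cn m) : dC c v (fun _ => a) y = 0 := by
  simp [dC_apply]

/-- Multiplication by a nonzero constant also preserves failure of differentiability, so the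
identity holds for every F, with the default value 0 of the derivative where none exists. -/
theorem dC_const_smul {c : ℂ} {v : Cn m} (a : ℂ) (F : Cn m → V) (y : Cn m) :
    dC c v (fun y => a • F y) y = a • dC c v F y := by
  have : fderiv ℝ (fun y => a • F y) y = a • fderiv ℝ F y := by
    by_cases ha : a = 0
    · simp [ha]
    · let := invertibleOfNonzero ha
      exact fderiv_const_smul_of_invertible (f := F) a
  simp only [dC_apply, this, smul_apply]
  module

theorem dC_clm {c : ℂ} {v : Cn m} (L : V →L[ℂ] W) {F : Cn m → V} {y : Cn m}
    (hF : DifferentiableAt ℝ F y) : dC c v (fun y => L (F y)) y = L (dC c v F y) := by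
  have : fderiv ℝ (fun y => L (F y)) y = (L.restrictScalars ℝ).comp (fderiv ℝ F y) :=
    ((L.restrictScalars ℝ).hasFDerivAt.comp y hF.hasFDerivAt).fderiv
  simp [dC_apply, this]

theorem fderiv_fderiv_apply {F : Cn m → V} {y : Cn m} (hF : ContDiffAt ℝ 2 F y) (v w : Cn m) :
    fderiv ℝ (fun y => fderiv ℝ F y v) y w = fderiv ℝ (fderiv ℝ F) y w v := by
  have : DifferentiableAt ℝ (fderiv ℝ F) y :=
    (hF.fderiv_right (m := 1) (by norm_num)).differentiableAt (by simp)
  rw [fderiv_clm_apply this (by fun_prop)]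
  simp

theorem fderiv_dC {c : ℂ} {v : Cn m} {F : Cn m → V} {y : Cn m} (hF : ContDiffAt ℝ 2 F y)
    (w : Cn m) : fderiv ℝ (dC c v F) y w = (1 / 2 : ℂ) •
      (fderiv ℝ (fderiv ℝ F) y w v - c • fderiv ℝ (fderiv ℝ F) y w (Complex.I • v)) := by
  have h0 : DifferentiableAt ℝ (fderiv ℝ F) y :=
    (hF.fderiv_right (m := 1) (by norm_num)).differentiableAt (by simp)
  have h1 (v : Cn m) : DifferentiableAt ℝ (fun y => fderiv ℝ F y v) y :=
    h0.clm_apply (by fun_prop)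
  have : fderiv ℝ (dC c v F) y = (1 / 2 : ℂ) • (fderiv ℝ (fun y => fderiv ℝ F y v) y -
      c • fderiv ℝ (fun y => fderiv ℝ F y (Complex.I • v)) y) := by
    have h2 := ((h1 v).hasFDerivAt.sub ((h1 (Complex.I • v)).hasFDerivAt.const_smul c)).const_smul
      (1 / 2 : ℂ)
    exact h2.fderiv
  rw [this]
  simp [fderiv_fderiv_apply hF]

/-- Both operators are constant combinations of real directional derivatives along v, iv and w, iw,
so this is the symmetry of the second derivative. -/
theorem dC_comm {c c' : ℂ} {v w : Cn m} {F : Cn m → V} {y : Cn m} (hF : ContDiffAt ℝ 2 F y) :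
    dC c v (dC c' w F) y = dC c' w (dC c v F) y := by
  have hs : IsSymmSndFDerivAt ℝ F y := hF.isSymmSndFDerivAt (by simp)
  rw [dC_apply, dC_apply]
  simp only [fderiv_dC hF]
  rw [hs.eq v w, hs.eq v (Complex.I • w), hs.eq (Complex.I • v) w,
    hs.eq (Complex.I • v) (Complex.I • w)]
  module

/-- The factor ½(1 - ci) is 1 for c = i and 0 for c = -i. For the conjugate coordinate below, the
factor ½(1 + ci) takes the opposite values. -/
theorem dC_coord (c : ℂ) (v : Cn m) (k : Fin m) (y : Cn m) :
    dC c v (fun y => y k) y = (1 / 2) * (1 - c * Complex.I) * v k := by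
  have : fderiv ℝ (fun y : Cn m => y k) y = ContinuousLinearMap.proj k :=
    (ContinuousLinearMap.proj (R := ℝ) (φ := fun _ : Fin m => ℂ) k).fderiv
  simp [dC_apply, this]; ring

theorem dC_conj_coord (c : ℂ) (v : Cn m) (k : Fin m) (y : Cn m) :
    dC c v (fun y => conj (y k)) y = (1 / 2) * (1 + c * Complex.I) * conj (v k) := by
  have : fderiv ℝ (fun y : Cn m => conj (y k)) y =
      (Complex.conjCLE : ℂ →L[ℝ] ℂ).comp (ContinuousLinearMap.proj k) :=
    ((Complex.conjCLE : ℂ →L[ℝ] ℂ).comp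
      (ContinuousLinearMap.proj (R := ℝ) (φ := fun _ : Fin m => ℂ) k)).fderiv
  simp [dC_apply, this]; ring

theorem contDiff_coord (k : Fin m) {l : WithTop ℕ∞} : ContDiff ℝ l fun y : Cn m => y k :=
  contDiff_apply ℝ ℂ k

theorem contDiff_conj_coord (k : Fin m) {l : WithTop ℕ∞} :
    ContDiff ℝ l fun y : Cn m => conj (y k) :=
  Complex.conjCLE.contDiff.comp (contDiff_coord k)

theorem dC_comm_eventually {c c' : ℂ} {v w : Cn m} {F : Cn m → V} {p : Cn m}
    (hF : ContDiffAt ℝ 2 F p) : dC c v (dC c' w F) =ᶠ[𝓝 p] dC c' w (dC c v F) :=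
  (hF.eventually (by simp)).mono fun _ hy => dC_comm hy

/-- A single derivative commutes with an iterated one. -/
theorem dC_iterate_comm {c c' : ℂ} {v w : Cn m} {F : Cn m → V} {p : Cn m} (j : ℕ)
    (hF : ContDiffAt ℝ (j + 1 : ℕ) F p) :
    (dC c v)^[j] (dC c' w F) =ᶠ[𝓝 p] dC c' w ((dC c v)^[j] F) := by
  induction j with
  | zero => rfl
  | succ j ih =>
    rw [Function.iterate_succ_apply', Function.iterate_succ_apply']
    have h1 := (ih (hF.of_le (by exact_mod_cast Nat.le_succ _))).dC (c := c) (v := v)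
    refine h1.trans (dC_comm_eventually ?_)
    refine ContDiffAt.dC_iterate j (hF.of_le ?_)
    exact_mod_cast (by omega : 2 + j ≤ j + 1 + 1)

/-- Serves for the factors z̄₀ and ū with u holomorphic, which are constants for ∂/∂z₀. -/
theorem dC_iterate_smul_of_zero {c : ℂ} {v : Cn m} {f : Cn m → ℂ} {p : Cn m}
    (hf : ∀ᶠ y in 𝓝 p, DifferentiableAt ℝ f y)
    (ha : ∀ᶠ y in 𝓝 p, dC c v f y = 0) {F : Cn m → V} (j : ℕ) (hF : ContDiffAt ℝ j F p) :
    (dC c v)^[j] (fun y => f y • F y) =ᶠ[𝓝 p] fun y => f y • (dC c v)^[j] F y := by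
  induction j with
  | zero => rfl
  | succ j ih =>
    rw [Function.iterate_succ_apply']
    refine (ih (hF.of_le (by exact_mod_cast Nat.le_succ _))).dC.trans ?_
    have h1 : ContDiffAt ℝ 1 ((dC c v)^[j] F) p :=
      ContDiffAt.dC_iterate j (hF.of_le (by exact_mod_cast (by omega : 1 + j ≤ j + 1)))
    filter_upwards [hf, ha, h1.eventually_differentiableAt le_rfl] with y h1 h2 h3
    rw [dC_smul h1 h3, h2, Function.iterate_succ_apply']; simp

end Wirtinger

/-! ### Pointwise residues of scalar functions -/

-- In s = 1/t the sum is a polynomial without constant term. A real polynomial with a finite limit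
-- at infinity is constant, hence zero here; this is applied to the real and imaginary parts.
open Filter in
theorem eq_zero_of_tendsto_sum_inv_pow {N : ℕ} {c : ℕ → ℂ} {l : ℂ}
    (h : Tendsto (fun t : ℝ => ∑ k ∈ Finset.range N, c k * ((t : ℂ)⁻¹) ^ (k + 1))
      (𝓝[>] 0) (𝓝 l)) : l = 0 := by
  have key (φ : ℂ →L[ℝ] ℝ) : φ l = 0 := by
    let P : Polynomial ℝ := ∑ k ∈ Finset.range N, Polynomial.C (φ (c k)) * Polynomial.X ^ (k + 1)
    have h1 : Tendsto (fun s : ℝ => P.eval s) atTop (𝓝 (φ l)) := by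
      have h2 := (φ.continuous.tendsto l).comp (h.comp tendsto_inv_atTop_nhdsGT_zero)
      refine h2.congr fun s => ?_
      simp only [Function.comp_apply, P, Polynomial.eval_finsetSum, Polynomial.eval_mul,
        Polynomial.eval_C, Polynomial.eval_pow, Polynomial.eval_X, map_sum]
      refine Finset.sum_congr rfl fun k _ => ?_
      have : c k * ((s⁻¹ : ℝ) : ℂ)⁻¹ ^ (k + 1) = (s ^ (k + 1) : ℝ) • c k := by
        rw [Complex.real_smul]; push_cast; rw [inv_inv, mul_comm]
      rw [this, map_smul, smul_eq_mul, mul_comm]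
    obtain ⟨h3, h4⟩ := (Polynomial.tendsto_nhds_iff P).1 h1
    have h5 : P = Polynomial.C (P.coeff 0) := Polynomial.eq_C_of_degree_le_zero h4
    have h6 : P.coeff 0 = 0 := by
      simp [P, Polynomial.finsetSum_coeff, Polynomial.coeff_X_pow]
    rw [h6, map_zero] at h5
    rw [← h3, h5, Polynomial.leadingCoeff_zero]
  exact Complex.ext (key Complex.reCLM) (key Complex.imCLM)

section Residue

variable {n : ℕ}

/-- Along the ray `q + t ζ e₀`, `t² f` has the finite part `l`: up to a polynomial in `t⁻¹` without
constant term it tends to `l` as `t → 0+`. -/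
def HasFinitePart (f : Cn (n + 1) → ℂ) (q : Cn (n + 1)) (ζ l : ℂ) : Prop :=
  ∃ (N : ℕ) (c : ℕ → ℂ), Filter.Tendsto (fun t : ℝ => (t : ℂ) ^ 2 * f (q + Pi.single 0 (t * ζ)) -
    ∑ k ∈ Finset.range N, c k * ((t : ℂ)⁻¹) ^ (k + 1)) (𝓝[>] 0) (𝓝 l)

theorem HasFinitePart.add {f f' : Cn (n + 1) → ℂ} {q : Cn (n + 1)} {ζ l l' : ℂ}
    (h : HasFinitePart f q ζ l) (h' : HasFinitePart f' q ζ l') :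
    HasFinitePart (f + f') q ζ (l + l') := by
  obtain ⟨N, c, h⟩ := h
  obtain ⟨N', c', h'⟩ := h'
  refine ⟨max N N', fun k => (if k < N then c k else 0) + (if k < N' then c' k else 0),
    (h.add h').congr fun t => ?_⟩
  have e (M : ℕ) (hM : M ≤ max N N') (d : ℕ → ℂ) :
      ∑ k ∈ Finset.range (max N N'), (if k < M then d k else 0) * ((t : ℂ)⁻¹) ^ (k + 1) =
        ∑ k ∈ Finset.range M, d k * ((t : ℂ)⁻¹) ^ (k + 1) := by
    symm
    rw [← Finset.sum_subset (Finset.range_mono hM)]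
    · refine Finset.sum_congr rfl fun k hk => ?_
      rw [if_pos (Finset.mem_range.1 hk)]
    · intro k _ hk
      rw [if_neg (by simpa using hk), zero_mul]
  simp only [add_mul, Finset.sum_add_distrib, Pi.add_apply]
  rw [e N (le_max_left _ _), e N' (le_max_right _ _)]
  ring

theorem HasFinitePart.const_mul {f : Cn (n + 1) → ℂ} {q : Cn (n + 1)} {ζ l : ℂ} (a : ℂ)
    (h : HasFinitePart f q ζ l) : HasFinitePart (fun y => a * f y) q ζ (a * l) := by
  obtain ⟨N, c, h⟩ := h
  refine ⟨N, fun k => a * c k, (h.const_mul a).congr fun t => ?_⟩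
  simp only [mul_sub, Finset.mul_sum, mul_assoc]
  ring

/-- The difference of the two expansions is a convergent polynomial in t⁻¹ without constant term,
and its limit l - l' must be zero. -/
theorem HasFinitePart.eq {f : Cn (n + 1) → ℂ} {q : Cn (n + 1)} {ζ l l' : ℂ}
    (h : HasFinitePart f q ζ l) (h' : HasFinitePart f q ζ l') : l = l' := by
  obtain ⟨N, c, h⟩ := h.add (h'.const_mul (-1))
  have : (fun t : ℝ => (t : ℂ) ^ 2 * (f + fun y => -1 * f y) (q + Pi.single 0 (t * ζ)) -
      ∑ k ∈ Finset.range N, c k * ((t : ℂ)⁻¹) ^ (k + 1)) =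
      fun t : ℝ => ∑ k ∈ Finset.range N, (-c k) * ((t : ℂ)⁻¹) ^ (k + 1) := by
    funext t
    simp
  rw [this] at h
  have := eq_zero_of_tendsto_sum_inv_pow h
  linear_combination this

theorem tendsto_ray (q : Cn (n + 1)) (ζ : ℂ) :
    Filter.Tendsto (fun t : ℝ => q + (Pi.single 0 (t * ζ) : Cn (n + 1))) (𝓝 0) (𝓝 q) := by
  have : Continuous fun t : ℝ => q + (Pi.single 0 (t * ζ) : Cn (n + 1)) := by
    have h1 : Continuous fun z : ℂ => (Pi.single 0 z : Cn (n + 1)) :=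
      continuous_single (A := fun _ : Fin (n + 1) => ℂ) 0
    exact continuous_const.add (h1.comp (by fun_prop))
  have h := this.tendsto 0
  simpa using h

theorem ray_apply_zero {q : Cn (n + 1)} (hq : q 0 = 0) (t ζ : ℂ) :
    (q + (Pi.single 0 (t * ζ) : Cn (n + 1))) 0 = t * ζ := by simp [hq]

theorem HasFinitePart.congr {f f' : Cn (n + 1) → ℂ} {q : Cn (n + 1)} (hq : q 0 = 0) {ζ l : ℂ}
    (hζ : ζ ≠ 0) (h : HasFinitePart f q ζ l) (he : ∀ᶠ y in 𝓝 q, y 0 ≠ 0 → f y = f' y) :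
    HasFinitePart f' q ζ l := by
  obtain ⟨N, c, h⟩ := h
  refine ⟨N, c, h.congr' ?_⟩
  have h1 := ((tendsto_ray q ζ).mono_left (nhdsWithin_le_nhds (s := Set.Ioi 0))).eventually he
  filter_upwards [h1, self_mem_nhdsWithin] with t ht ht0
  rw [ht]
  rw [ray_apply_zero hq]
  exact mul_ne_zero (by exact_mod_cast (ne_of_gt ht0)) hζ

/-- The number `r` is the residue of `f` along `z₀ = 0` at `q`: the mean over the directions of the
finite parts of `t² f`. -/
def IsResAt (f : Cn (n + 1) → ℂ) (q : Cn (n + 1)) (r : ℂ) : Prop :=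
  ∃ L : ℝ → ℂ, Continuous L ∧ (∀ θ : ℝ, HasFinitePart f q (Complex.exp (θ * Complex.I)) (L θ)) ∧
    r = (2 * Real.pi : ℂ)⁻¹ * ∫ θ in (0 : ℝ)..(2 * Real.pi), L θ

theorem IsResAt.eq {f : Cn (n + 1) → ℂ} {q : Cn (n + 1)} {r r' : ℂ} (h : IsResAt f q r)
    (h' : IsResAt f q r') : r = r' := by
  obtain ⟨L, -, hL, rfl⟩ := h
  obtain ⟨L', -, hL', rfl⟩ := h'
  rw [show L = L' from funext fun θ => (hL θ).eq (hL' θ)]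

theorem IsResAt.add {f f' : Cn (n + 1) → ℂ} {q : Cn (n + 1)} {r r' : ℂ} (h : IsResAt f q r)
    (h' : IsResAt f' q r') : IsResAt (f + f') q (r + r') := by
  obtain ⟨L, hc, hL, rfl⟩ := h
  obtain ⟨L', hc', hL', rfl⟩ := h'
  refine ⟨L + L', hc.add hc', fun θ => (hL θ).add (hL' θ), ?_⟩
  have := intervalIntegral.integral_add (hc.intervalIntegrable 0 (2 * Real.pi))
    (hc'.intervalIntegrable 0 (2 * Real.pi)) (μ := MeasureTheory.volume)
  simp only [Pi.add_apply]
  rw [this, mul_add]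

theorem IsResAt.const_mul {f : Cn (n + 1) → ℂ} {q : Cn (n + 1)} {r : ℂ} (a : ℂ)
    (h : IsResAt f q r) : IsResAt (fun y => a * f y) q (a * r) := by
  obtain ⟨L, hc, hL, rfl⟩ := h
  refine ⟨fun θ => a * L θ, continuous_const.mul hc, fun θ => (hL θ).const_mul a, ?_⟩
  rw [intervalIntegral.integral_const_mul]; ring

theorem IsResAt.congr {f f' : Cn (n + 1) → ℂ} {q : Cn (n + 1)} (hq : q 0 = 0) {r : ℂ}
    (h : IsResAt f q r) (he : ∀ᶠ y in 𝓝 q, y 0 ≠ 0 → f y = f' y) : IsResAt f' q r := by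
  obtain ⟨L, hc, hL, rfl⟩ := h
  exact ⟨L, hc, fun θ => (hL θ).congr hq (Complex.exp_ne_zero _) he, rfl⟩

theorem IsResAt.zero (q : Cn (n + 1)) : IsResAt 0 q 0 := by
  refine ⟨0, continuous_zero, fun θ => ⟨0, 0, ?_⟩, by simp⟩
  simp

/-- A function with the bounded singularity `G / (z₀ z̄₀)` has the residue `G(q)`. -/
theorem IsResAt.of_tendsto {f : Cn (n + 1) → ℂ} {q : Cn (n + 1)} (hq : q 0 = 0) {r : ℂ}
    (h : Filter.Tendsto (fun y => y 0 * conj (y 0) * f y) (𝓝[{y | y 0 ≠ 0}] q) (𝓝 r)) :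
    IsResAt f q r := by
  refine ⟨fun _ => r, continuous_const, fun θ => ⟨0, 0, ?_⟩, ?_⟩
  · have h1 : Filter.Tendsto (fun t : ℝ => q + (Pi.single 0 (t * Complex.exp (θ * Complex.I)) :
        Cn (n + 1))) (𝓝[>] 0) (𝓝[{y | y 0 ≠ 0}] q) := by
      refine tendsto_nhdsWithin_iff.2 ⟨(tendsto_ray q _).mono_left nhdsWithin_le_nhds, ?_⟩
      filter_upwards [self_mem_nhdsWithin] with t ht
      rw [ray_apply_zero hq]
      exact mul_ne_zero (by exact_mod_cast (ne_of_gt ht)) (Complex.exp_ne_zero _)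
    refine (h.comp h1).congr fun t => ?_
    simp only [Function.comp_apply, ray_apply_zero hq, Finset.range_zero, Finset.sum_empty,
      sub_zero, map_mul, Complex.conj_ofReal, ← Complex.exp_conj, Complex.conj_I]
    rw [show (t : ℂ) * Complex.exp (θ * Complex.I) * (t * Complex.exp (θ * -Complex.I)) =
      t ^ 2 * (Complex.exp (θ * Complex.I) * Complex.exp (θ * -Complex.I)) by ring,
      ← Complex.exp_add]
    simp
  · have : (Real.pi : ℂ) ≠ 0 := by exact_mod_cast Real.pi_ne_zero
    simp
    field_simp

/-- The value at `q` of the residue of `G / (z₀^{a+1} z̄₀^{b+1})`. -/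
def resVal (a b : ℕ) (G : Cn (n + 1) → ℂ) : Cn (n + 1) → ℂ :=
  fun q => ((a.factorial : ℂ) * (b.factorial : ℂ))⁻¹ * wirt^[a] (wirtBar^[b] G) q

theorem fderiv_single_eq (F : Cn (n + 1) → ℂ) (y : Cn (n + 1)) (ζ : ℂ) :
    fderiv ℝ F y (Pi.single 0 ζ) = ζ * wirt F y + conj ζ * wirtBar F y := by
  have h1 : (Pi.single 0 ζ : Cn (n + 1)) = ζ.re • (Pi.single 0 1 : Cn (n + 1)) +
      ζ.im • (Complex.I • (Pi.single 0 1 : Cn (n + 1))) := by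
    ext k
    refine Fin.cases ?_ (fun k => ?_) k
    · simp
    · simp
  rw [h1, map_add, map_smul, map_smul, wirt_eq_dC, wirtBar_eq_dC, dC_apply, dC_apply]
  obtain ⟨x, y, rfl⟩ : ∃ x y : ℝ, ζ = x + y * Complex.I := ⟨ζ.re, ζ.im, by simp⟩
  simp only [Complex.add_re, Complex.ofReal_re, Complex.mul_re, Complex.I_re, mul_zero,
    Complex.ofReal_im, Complex.I_im, mul_one, sub_self, add_zero, Complex.add_im, Complex.mul_im,
    zero_add, map_add, map_mul, Complex.conj_ofReal, Complex.conj_I, smul_eq_mul,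
    Complex.real_smul]
  linear_combination (y : ℂ) * (fderiv ℝ F _ (Complex.I • Pi.single 0 1)) * Complex.I_mul_I

theorem hasDerivAt_ray {F : Cn (n + 1) → ℂ} {q : Cn (n + 1)} {ζ : ℂ} {t : ℝ}
    (hF : DifferentiableAt ℝ F (q + Pi.single 0 (t * ζ))) :
    HasDerivAt (fun t : ℝ => F (q + Pi.single 0 (t * ζ)))
      (ζ * wirt F (q + Pi.single 0 (t * ζ)) + conj ζ * wirtBar F (q + Pi.single 0 (t * ζ))) t := by
  rw [← fderiv_single_eq]
  have h1 : HasDerivAt (fun t : ℝ => q + (Pi.single 0 (t * ζ) : Cn (n + 1)))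
      (Pi.single 0 ζ) t := by
    refine HasDerivAt.const_add q ?_
    rw [hasDerivAt_pi]
    intro k
    refine Fin.cases ?_ (fun k => ?_) k
    · simpa using (Complex.ofRealCLM.hasDerivAt (x := t)).mul_const ζ
    · simpa using hasDerivAt_const t (0 : ℂ)
  exact hF.hasFDerivAt.comp_hasDerivAt t h1

/-- Along the ray, d/dt acts as ζ ∂/∂z₀ + ζ̄ ∂/∂z̄₀. The two operators commute, so the powers of
their sum follow the binomial theorem. -/
theorem deriv_iterate_ray (q : Cn (n + 1)) (ζ : ℂ) (k : ℕ) {G : Cn (n + 1) → ℂ}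
    (hG : ContDiffAt ℝ k G q) :
    deriv^[k] (fun t : ℝ => G (q + Pi.single 0 (t * ζ))) =ᶠ[𝓝 0] fun t : ℝ =>
      ∑ ij ∈ Finset.HasAntidiagonal.antidiagonal k, (k.choose ij.1 : ℂ) *
        (ζ ^ ij.1 * (conj ζ) ^ ij.2 * wirt^[ij.1] (wirtBar^[ij.2] G) (q + Pi.single 0 (t * ζ))) := by
  induction k with
  | zero => simp
  | succ k ih =>
    rw [Function.iterate_succ_apply']
    have ih := ih (hG.of_le (by exact_mod_cast Nat.le_succ k))
    refine ih.deriv.trans ?_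
    have h1 : ∀ᶠ y in 𝓝 q, ∀ ij ∈ Finset.HasAntidiagonal.antidiagonal k,
        DifferentiableAt ℝ (wirt^[ij.1] (wirtBar^[ij.2] G)) y ∧
        wirtBar (wirt^[ij.1] (wirtBar^[ij.2] G)) y = wirt^[ij.1] (wirtBar^[ij.2 + 1] G) y := by
      rw [Filter.eventually_all_finset]
      rintro ⟨i, j⟩ hij
      rw [Finset.HasAntidiagonal.mem_antidiagonal] at hij
      simp only at hij
      have hj : ContDiffAt ℝ (i + 1 : ℕ) (wirtBar^[j] G) q := by
        rw [wirtBar_eq_dC]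
        exact ContDiffAt.dC_iterate j (hG.of_le (by exact_mod_cast (by omega : i + 1 + j ≤ k + 1)))
      have hi : ContDiffAt ℝ 1 (wirt^[i] (wirtBar^[j] G)) q := by
        rw [wirt_eq_dC]
        exact ContDiffAt.dC_iterate i (hj.of_le (by exact_mod_cast (by omega : 1 + i ≤ i + 1)))
      have hc := dC_iterate_comm (c := Complex.I) (v := Pi.single 0 1) (c' := -Complex.I)
        (w := Pi.single 0 1) i hj
      filter_upwards [hi.eventually_differentiableAt le_rfl, hc] with y h1 h2
      refine ⟨h1, ?_⟩
      rw [Function.iterate_succ_apply', wirt_eq_dC]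
      simp only [wirtBar_eq_dC] at h2 ⊢
      exact h2.symm
    filter_upwards [(tendsto_ray q ζ).eventually h1] with t ht
    rw [HasDerivAt.deriv (HasDerivAt.fun_sum fun ij hij =>
      ((hasDerivAt_ray (ht ij hij).1).const_mul (ζ ^ ij.1 * (conj ζ) ^ ij.2)).const_mul
        (k.choose ij.1 : ℂ))]
    -- Pascal's rule splits the binomial sum of order k + 1 into the two sums produced by ζ ∂/∂z₀
    -- and ζ̄ ∂/∂z̄₀.
    rw [Finset.sum_antidiagonal_choose_succ_mul (R := ℂ) (fun i j => ζ ^ i * (conj ζ) ^ j *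
      wirt^[i] (wirtBar^[j] G) (q + (Pi.single 0 ((t : ℂ) * ζ) : Cn (n + 1)))) k]
    rw [← Finset.sum_add_distrib]
    refine Finset.sum_congr rfl fun ij hij => ?_
    rw [(ht ij hij).2, ← Nat.choose_symm_of_eq_add (Finset.HasAntidiagonal.mem_antidiagonal.1 hij).symm,
      Function.iterate_succ_apply' wirt]
    ring

theorem integral_exp_pow (i j : ℕ) :
    ∫ θ in (0 : ℝ)..(2 * Real.pi), Complex.exp (θ * Complex.I) ^ i *
      (conj (Complex.exp (θ * Complex.I))) ^ j = if i = j then 2 * (Real.pi : ℂ) else 0 := by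
  have h1 (θ : ℝ) : Complex.exp (θ * Complex.I) ^ i * (conj (Complex.exp (θ * Complex.I))) ^ j =
      Complex.exp ((((i : ℂ) - j) * Complex.I) * θ) := by
    rw [← Complex.exp_conj, ← Complex.exp_nat_mul, ← Complex.exp_nat_mul, ← Complex.exp_add]
    congr 1
    simp
    ring
  simp_rw [h1]
  split_ifs with h
  · simp [h]
  · have h2 : ((i : ℂ) - j) * Complex.I ≠ 0 := by
      refine mul_ne_zero (sub_ne_zero.2 ?_) Complex.I_ne_zero
      exact_mod_cast h
    rw [integral_exp_mul_complex h2]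
    have : Complex.exp (((i : ℂ) - j) * Complex.I * ((2 * Real.pi : ℝ) : ℂ)) = 1 := by
      rw [Complex.exp_eq_one_iff]
      exact ⟨(i : ℤ) - j, by push_cast; ring⟩
    rw [this]; simp

/-- As ζ⁻¹ = ζ̄ on the unit circle, t²f = t^(-(a+b)) ζ^b ζ̄^a G(q + tζe₀). The Taylor terms of G of
order below a + b give negative powers of t, the term of order a + b gives the finite part, and the
mean over ζ keeps only its (a,b) monomial. Since `IsResAt` involves f alone, the value does not
depend on a, b and G. Only a + b derivatives of G are needed. -/
theorem IsResAt.of_contDiffAt {f G : Cn (n + 1) → ℂ} {q : Cn (n + 1)} (hq : q 0 = 0) {a b : ℕ}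
    (hG : ContDiffAt ℝ (a + b : ℕ) G q)
    (h : ∀ᶠ y in 𝓝 q, y 0 ≠ 0 → y 0 ^ (a + 1) * (conj (y 0)) ^ (b + 1) * f y = G y) :
    IsResAt f q (resVal a b G q) := by
  set m := a + b with hm
  let D (i j : ℕ) : ℂ := wirt^[i] (wirtBar^[j] G) q
  let T (ζ : ℂ) (k : ℕ) : ℂ := ∑ ij ∈ Finset.HasAntidiagonal.antidiagonal k, (k.choose ij.1 : ℂ) *
    (ζ ^ ij.1 * (conj ζ) ^ ij.2 * D ij.1 ij.2)
  let e (θ : ℝ) : ℂ := Complex.exp (θ * Complex.I)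
  have he (θ : ℝ) : e θ * conj (e θ) = 1 := by
    simp only [e]
    rw [← Complex.exp_conj, ← Complex.exp_add]; simp
  have he0 (θ : ℝ) : e θ ≠ 0 := Complex.exp_ne_zero _
  have hec : Continuous e := by fun_prop
  let L (θ : ℝ) : ℂ := e θ ^ b * conj (e θ) ^ a * ((m.factorial : ℂ)⁻¹ * T (e θ) m)
  refine ⟨L, ?_, fun θ => ?_, ?_⟩
  · have : Continuous fun θ => conj (e θ) := Complex.continuous_conj.comp hec
    fun_prop
  -- The Taylor term of order m - 1 - k, divided by t^m, produces the power t^(-(k+1)); the orders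
  -- 0, …, m - 1 fill the whole polar part.
  · refine ⟨m, fun k => e θ ^ b * conj (e θ) ^ a *
      (((m - 1 - k).factorial : ℂ)⁻¹ * T (e θ) (m - 1 - k)), ?_⟩
    set g : ℝ → ℂ := fun t : ℝ => G (q + Pi.single 0 (t * e θ)) with hg
    have hgd : ContDiffAt ℝ m g 0 := by
      have h1 : ContDiff ℝ m fun t : ℝ => q + (Pi.single 0 (t * e θ) : Cn (n + 1)) := by
        refine contDiff_const.add (contDiff_pi.2 fun k => ?_)
        refine Fin.cases ?_ (fun k => ?_) k
        · simpa using Complex.ofRealCLM.contDiff.mul contDiff_const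
        · simpa using contDiff_const
      refine ContDiffAt.comp (0 : ℝ) ?_ h1.contDiffAt
      simpa using hG
    obtain ⟨u, hu, hgu⟩ := hgd.contDiffOn (m := m) le_rfl (by simp)
    obtain ⟨δ, hδ, hδu⟩ := Metric.mem_nhds_iff.1 hu
    have hT := taylor_isLittleO (convex_ball (0 : ℝ) δ) (Metric.mem_ball_self hδ)
      (hgu.mono hδu)
    rw [nhdsWithin_eq_nhds.2 (Metric.ball_mem_nhds _ hδ)] at hT
    have hder (k : ℕ) (hk : k ≤ m) :
        iteratedDerivWithin k g (Metric.ball 0 δ) 0 = T (e θ) k := by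
      rw [iteratedDerivWithin_of_isOpen_eq_iterate Metric.isOpen_ball (Metric.mem_ball_self hδ)]
      rw [(deriv_iterate_ray q (e θ) k (hG.of_le (by exact_mod_cast hk))).eq_of_nhds]
      simp [T, D]
    have h3 : Filter.Tendsto (fun t : ℝ => ((t : ℂ) ^ m)⁻¹ *
        (g t - ∑ k ∈ Finset.range (m + 1), ((k.factorial : ℂ)⁻¹ * t ^ k) * T (e θ) k))
        (𝓝[>] 0) (𝓝 0) := by
      have h4 := (hT.tendsto_inv_smul_nhds_zero).mono_left (nhdsWithin_le_nhds (s := Set.Ioi 0))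
      refine h4.congr fun t => ?_
      rw [taylor_within_apply, Complex.real_smul]
      simp only [sub_zero]
      congr 2
      · push_cast; rfl
      · refine Finset.sum_congr rfl fun k hk => ?_
        rw [hder k (by simpa [Nat.lt_succ_iff] using hk), Complex.real_smul]
        push_cast; rfl
    have h5 := (h3.const_mul (e θ ^ b * conj (e θ) ^ a)).add_const (L θ)
    rw [mul_zero, zero_add] at h5
    refine h5.congr' ?_
    have h6 := ((tendsto_ray q (e θ)).mono_left (nhdsWithin_le_nhds (s := Set.Ioi 0))).eventually h
    filter_upwards [h6, self_mem_nhdsWithin] with t ht ht0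
    have ht0' : (t : ℂ) ≠ 0 := by exact_mod_cast (ne_of_gt ht0)
    rw [ray_apply_zero hq] at ht
    have h7 : g t = (t * e θ) ^ (a + 1) * conj (t * e θ) ^ (b + 1) *
        f (q + Pi.single 0 (t * e θ)) := (ht (mul_ne_zero ht0' (he0 θ))).symm
    have h8 : e θ ^ b * conj (e θ) ^ a * (((t : ℂ) ^ m)⁻¹ * g t) =
        t ^ 2 * f (q + Pi.single 0 (t * e θ)) := by
      rw [h7, map_mul, Complex.conj_ofReal, hm]
      have : e θ ^ b * conj (e θ) ^ a * (((t : ℂ) ^ (a + b))⁻¹ *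
          ((t * e θ) ^ (a + 1) * (t * conj (e θ)) ^ (b + 1) * f (q + Pi.single 0 (t * e θ)))) =
          ((t : ℂ) ^ (a + b))⁻¹ * t ^ (a + b) * (e θ * conj (e θ)) ^ (a + b + 1) *
            (t ^ 2 * f (q + Pi.single 0 (t * e θ))) := by ring
      rw [this, he, inv_mul_cancel₀ (pow_ne_zero _ ht0')]; ring
    rw [mul_sub, mul_sub, h8, Finset.sum_range_succ, ← Finset.sum_range_reflect]
    simp only [L]
    have h9 : ∀ k ∈ Finset.range m, e θ ^ b * conj (e θ) ^ a * (((t : ℂ) ^ m)⁻¹ *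
        ((((m - 1 - k).factorial : ℂ))⁻¹ * (t : ℂ) ^ (m - 1 - k) * T (e θ) (m - 1 - k))) =
        e θ ^ b * conj (e θ) ^ a * (((m - 1 - k).factorial : ℂ)⁻¹ * T (e θ) (m - 1 - k)) *
          ((t : ℂ)⁻¹) ^ (k + 1) := by
      intro k hk
      have hk := Finset.mem_range.1 hk
      have : ((t : ℂ) ^ m)⁻¹ * (t : ℂ) ^ (m - 1 - k) = ((t : ℂ)⁻¹) ^ (k + 1) := by
        have : (t : ℂ) ^ m = t ^ (m - 1 - k) * t ^ (k + 1) := by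
          rw [← pow_add]; congr 1; omega
        rw [this, inv_pow]
        field_simp
      rw [← this]; ring
    rw [← Finset.sum_congr rfl h9, ← Finset.mul_sum, ← Finset.mul_sum]
    field_simp
    ring
  · have h1 (θ : ℝ) : L θ = ∑ ij ∈ Finset.HasAntidiagonal.antidiagonal m, ((m.factorial : ℂ)⁻¹ *
        (m.choose ij.1 : ℂ) * D ij.1 ij.2) *
        (e θ ^ (b + ij.1) * (conj (e θ)) ^ (a + ij.2)) := by
      simp only [L, T, Finset.mul_sum]
      refine Finset.sum_congr rfl fun ij _ => ?_
      ring
    simp_rw [h1]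
    rw [intervalIntegral.integral_finsetSum]
    · simp_rw [intervalIntegral.integral_const_mul]
      -- By orthogonality of characters the (i,j) term survives only if b + i = a + j; together with
      -- i + j = a + b this forces (i,j) = (a,b).
      rw [Finset.sum_eq_single (a, b)]
      · simp only [e]
        rw [integral_exp_pow, if_pos (by omega), resVal]
        have hpi : (Real.pi : ℂ) ≠ 0 := by exact_mod_cast Real.pi_ne_zero
        have h2 : ((m.choose a : ℕ) : ℂ) * (a.factorial * b.factorial) = m.factorial := by
          have := Nat.choose_mul_factorial_mul_factorial (n := m) (k := a) (by omega)
          rw [show m - a = b by omega] at this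
          exact_mod_cast (by rw [← this]; ring)
        have ha : (a.factorial : ℂ) ≠ 0 := by exact_mod_cast a.factorial_ne_zero
        have hb : (b.factorial : ℂ) ≠ 0 := by exact_mod_cast b.factorial_ne_zero
        have hm0 : (m.factorial : ℂ) ≠ 0 := by exact_mod_cast m.factorial_ne_zero
        rw [← h2] at hm0 ⊢
        have hch : ((m.choose a : ℕ) : ℂ) ≠ 0 := left_ne_zero_of_mul hm0
        simp only [D]
        field_simp
      · rintro ⟨i, j⟩ hij hne
        rw [Finset.HasAntidiagonal.mem_antidiagonal] at hij
        simp only at hij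
        simp only [e]
        rw [integral_exp_pow, if_neg, mul_zero]
        intro h
        apply hne
        simp only [Prod.mk.injEq]
        omega
      · intro h
        simp [hm] at h
    · intro ij _
      have : Continuous fun θ => conj (e θ) := Complex.continuous_conj.comp hec
      refine Continuous.intervalIntegrable ?_ _ _
      fun_prop

end Residue

theorem natCast_le_infty (k : ℕ) : (k : WithTop ℕ∞) ≤ ∞ := by
  change ((k : ℕ∞) : WithTop ℕ∞) ≤ ((⊤ : ℕ∞) : WithTop ℕ∞)
  exact_mod_cast le_top

/-- Being of class C^k at a point is an open condition for finite k, whereas smoothness at a point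
is not. Passing to nearby points therefore always goes through a finite order. -/
theorem natCast_ne_infty (k : ℕ) : (k : WithTop ℕ∞) ≠ ∞ := by
  change ((k : ℕ∞) : WithTop ℕ∞) ≠ ((⊤ : ℕ∞) : WithTop ℕ∞)
  exact fun h => ENat.natCast_ne_top k (WithTop.coe_injective h)

/-! ### Functions with poles along z₀ = 0 and the formal properties of their residues -/

section Polar

variable {n : ℕ}

/-- `z₀^(a+1) z̄₀^(b+1)`. -/
def poleMon (a b : ℕ) (y : Cn (n + 1)) : ℂ := y 0 ^ (a + 1) * (conj (y 0)) ^ (b + 1)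

theorem poleMon_ne_zero {a b : ℕ} {y : Cn (n + 1)} (hy : y 0 ≠ 0) : poleMon a b y ≠ 0 :=
  mul_ne_zero (pow_ne_zero _ hy) (pow_ne_zero _ (by simpa using hy))

theorem contDiff_poleMon (a b : ℕ) {l : WithTop ℕ∞} :
    ContDiff ℝ l (poleMon a b : Cn (n + 1) → ℂ) :=
  ((contDiff_coord 0).pow _).mul ((contDiff_conj_coord 0).pow _)

theorem dC_pow {m : ℕ} {c : ℂ} {v : Cn m} {f : Cn m → ℂ} {y : Cn m} (hf : DifferentiableAt ℝ f y)
    (k : ℕ) : dC c v (fun y => f y ^ (k + 1)) y = (k + 1) * f y ^ k * dC c v f y := by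
  induction k with
  | zero => simp
  | succ k ih =>
    have : (fun y => f y ^ (k + 1 + 1)) = fun y => f y ^ (k + 1) * f y := by
      funext y; rw [pow_succ]
    rw [this, dC_mul (f := fun y => f y ^ (k + 1)) (hf.pow _) hf, ih]
    push_cast; ring

theorem dC_poleMon (c : ℂ) (v : Cn (n + 1)) (a b : ℕ) (y : Cn (n + 1)) :
    dC c v (poleMon a b) y =
      (a + 1) * y 0 ^ a * (conj (y 0)) ^ (b + 1) * ((1 / 2) * (1 - c * Complex.I) * v 0) +
      (b + 1) * y 0 ^ (a + 1) * (conj (y 0)) ^ b *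
        ((1 / 2) * (1 + c * Complex.I) * conj (v 0)) := by
  have h1 : DifferentiableAt ℝ (fun y : Cn (n + 1) => y 0) y :=
    (contDiff_coord 0 (l := 1)).differentiable (by simp) y
  have h2 : DifferentiableAt ℝ (fun y : Cn (n + 1) => conj (y 0)) y :=
    (contDiff_conj_coord 0 (l := 1)).differentiable (by simp) y
  unfold poleMon
  rw [dC_mul (f := fun y : Cn (n + 1) => y 0 ^ (a + 1))
    (F := fun y : Cn (n + 1) => conj (y 0) ^ (b + 1)) (h1.pow _) (h2.pow _), dC_pow h1, dC_pow h2,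
    dC_coord, dC_conj_coord]
  ring

/-- The function `f` has at `p` at most a pole `z₀^-(a+1) z̄₀^-(b+1)`: `z₀^(a+1) z̄₀^(b+1) f` extends to
a function that is smooth at `p`. -/
def PolarAt (f : Cn (n + 1) → ℂ) (p : Cn (n + 1)) : Prop :=
  ∃ (a b : ℕ) (G : Cn (n + 1) → ℂ), ContDiffAt ℝ ∞ G p ∧
    ∀ᶠ y in 𝓝 p, y 0 ≠ 0 → poleMon a b y * f y = G y

theorem PolarAt.congr {f f' : Cn (n + 1) → ℂ} {p : Cn (n + 1)} (h : PolarAt f p)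
    (he : ∀ᶠ y in 𝓝 p, y 0 ≠ 0 → f y = f' y) : PolarAt f' p := by
  obtain ⟨a, b, G, hG, h⟩ := h
  refine ⟨a, b, G, hG, ?_⟩
  filter_upwards [h, he] with y h1 h2 h3
  rw [← h2 h3, h1 h3]

/-- The exponents in `poleMon` are at least one, so a spare factor z₀z̄₀ is put into the numerator.
-/
theorem PolarAt.of_exponents {f G : Cn (n + 1) → ℂ} {p : Cn (n + 1)} {a b : ℕ}
    (hG : ContDiffAt ℝ ∞ G p)
    (h : ∀ᶠ y in 𝓝 p, y 0 ≠ 0 → y 0 ^ a * (conj (y 0)) ^ b * f y = G y) : PolarAt f p := by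
  refine ⟨a, b, fun y => y 0 * conj (y 0) * G y,
    ((contDiff_coord 0).mul (contDiff_conj_coord 0)).contDiffAt.mul hG, ?_⟩
  filter_upwards [h] with y hy h0
  rw [← hy h0, poleMon]; ring

theorem PolarAt.of_contDiffAt {f : Cn (n + 1) → ℂ} {p : Cn (n + 1)} (hf : ContDiffAt ℝ ∞ f p) :
    PolarAt f p :=
  PolarAt.of_exponents (a := 0) (b := 0) hf (Filter.Eventually.of_forall fun y _ => by simp)

theorem PolarAt.add {f f' : Cn (n + 1) → ℂ} {p : Cn (n + 1)} (h : PolarAt f p)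
    (h' : PolarAt f' p) : PolarAt (f + f') p := by
  obtain ⟨a, b, G, hG, h⟩ := h
  obtain ⟨a', b', G', hG', h'⟩ := h'
  refine PolarAt.of_exponents (a := a + 1 + (a' + 1)) (b := b + 1 + (b' + 1))
    (G := fun y => poleMon a' b' y * G y + poleMon a b y * G' y)
    (((contDiff_poleMon a' b').contDiffAt.mul hG).add
      ((contDiff_poleMon a b).contDiffAt.mul hG')) ?_
  filter_upwards [h, h'] with y h1 h2 h0
  rw [← h1 h0, ← h2 h0, poleMon, poleMon, Pi.add_apply]; ring

theorem PolarAt.mul {f f' : Cn (n + 1) → ℂ} {p : Cn (n + 1)} (h : PolarAt f p)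
    (h' : PolarAt f' p) : PolarAt (fun y => f y * f' y) p := by
  obtain ⟨a, b, G, hG, h⟩ := h
  obtain ⟨a', b', G', hG', h'⟩ := h'
  refine PolarAt.of_exponents (a := a + 1 + (a' + 1)) (b := b + 1 + (b' + 1)) (hG.mul hG') ?_
  filter_upwards [h, h'] with y h1 h2 h0
  rw [← h1 h0, ← h2 h0, poleMon, poleMon]; ring

theorem PolarAt.const_mul {f : Cn (n + 1) → ℂ} {p : Cn (n + 1)} (c : ℂ) (h : PolarAt f p) :
    PolarAt (fun y => c * f y) p := (PolarAt.of_contDiffAt contDiffAt_const).mul h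

theorem PolarAt.zero (p : Cn (n + 1)) : PolarAt 0 p :=
  PolarAt.of_contDiffAt (contDiffAt_const (c := (0 : ℂ)))

theorem PolarAt.sum {ι : Type*} {s : Finset ι} {f : ι → Cn (n + 1) → ℂ} {p : Cn (n + 1)}
    (h : ∀ j ∈ s, PolarAt (f j) p) : PolarAt (∑ j ∈ s, f j) p := by
  classical
  induction s using Finset.induction_on with
  | empty => exact PolarAt.zero p
  | insert j s hj ih =>
    rw [Finset.sum_insert hj]
    exact (h j (Finset.mem_insert_self _ _)).add
      (ih fun k hk => h k (Finset.mem_insert_of_mem hk))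

/-- The differentiated form of `z₀^(a+1) z̄₀^(b+1) f = G`. -/
theorem poleMon_mul_dC {f G : Cn (n + 1) → ℂ} {p : Cn (n + 1)} {a b : ℕ}
    (hG : ContDiffAt ℝ 1 G p) (h : ∀ᶠ y in 𝓝 p, y 0 ≠ 0 → poleMon a b y * f y = G y)
    (c : ℂ) (v : Cn (n + 1)) : ∀ᶠ y in 𝓝 p, y 0 ≠ 0 →
      poleMon a b y * dC c v f y + dC c v (poleMon a b) y * f y = dC c v G y := by
  filter_upwards [h.eventually_nhds, hG.eventually_differentiableAt le_rfl] with y hy hGy h0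
  have h1 : ∀ᶠ y' in 𝓝 y, y' 0 ≠ 0 := (continuous_apply 0).continuousAt.eventually_ne h0
  have h2 : (fun y => poleMon a b y * f y) =ᶠ[𝓝 y] G := by
    filter_upwards [h1, hy] with y' h3 h4 using h4 h3
  -- Off z₀ = 0 the function f is locally a quotient of differentiable functions, which supplies its
  -- differentiability.
  have h3 : f =ᶠ[𝓝 y] fun y => (poleMon a b y)⁻¹ * G y := by
    filter_upwards [h1, h2] with y' h3 h4
    rw [← h4, inv_mul_cancel_left₀ (poleMon_ne_zero h3)]
  have hM : DifferentiableAt ℝ (poleMon a b : Cn (n + 1) → ℂ) y :=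
    (contDiff_poleMon a b (l := 1)).differentiable (by simp) y
  have hf : DifferentiableAt ℝ f y :=
    ((hM.inv (poleMon_ne_zero h0)).mul hGy).congr_of_eventuallyEq h3
  rw [← h2.dC.eq_of_nhds, dC_mul hM hf]

/-- With M = `poleMon a b`, multiplying the differentiated relation once more by M gives M² ∂f = M
∂G - (∂M) G, whose right side is smooth at p. Pole orders at most double. -/
theorem PolarAt.dC {f : Cn (n + 1) → ℂ} {p : Cn (n + 1)} (h : PolarAt f p) (c : ℂ)
    (v : Cn (n + 1)) : PolarAt (dC c v f) p := by
  obtain ⟨a, b, G, hG, h⟩ := h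
  refine PolarAt.of_exponents (a := a + 1 + (a + 1)) (b := b + 1 + (b + 1))
    (G := fun y => poleMon a b y * _root_.dC c v G y - _root_.dC c v (poleMon a b) y * G y) ?_ ?_
  · exact ((contDiff_poleMon a b).contDiffAt.mul hG.dC_infty).sub
      ((contDiff_poleMon a b).contDiffAt.dC_infty.mul hG)
  · filter_upwards [h, poleMon_mul_dC (hG.of_le (natCast_le_infty 1)) h c v] with y h1 h2 h0
    rw [← h1 h0, ← h2 h0]
    have : y 0 ^ (a + 1 + (a + 1)) * conj (y 0) ^ (b + 1 + (b + 1)) =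
        poleMon a b y * poleMon a b y := by rw [poleMon]; ring
    rw [this]; ring

open Classical in
/-- The residue of `f` along `z₀ = 0` at `q`. -/
def resF (f : Cn (n + 1) → ℂ) (q : Cn (n + 1)) : ℂ :=
  if h : ∃ r, IsResAt f q r then h.choose else 0

theorem IsResAt.resF_eq {f : Cn (n + 1) → ℂ} {q : Cn (n + 1)} {r : ℂ} (h : IsResAt f q r) :
    resF f q = r := by
  have : ∃ r, IsResAt f q r := ⟨r, h⟩
  rw [resF, dif_pos this]
  exact this.choose_spec.eq h

theorem PolarAt.isResAt {f : Cn (n + 1) → ℂ} {p : Cn (n + 1)} (hp : p 0 = 0) (h : PolarAt f p) :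
    IsResAt f p (resF f p) := by
  obtain ⟨a, b, G, hG, h⟩ := h
  have h1 := IsResAt.of_contDiffAt hp (hG.of_le (natCast_le_infty _)) h
  rwa [h1.resF_eq]

theorem resF_add {f f' : Cn (n + 1) → ℂ} {p : Cn (n + 1)} (hp : p 0 = 0) (h : PolarAt f p)
    (h' : PolarAt f' p) : resF (f + f') p = resF f p + resF f' p :=
  ((h.isResAt hp).add (h'.isResAt hp)).resF_eq

theorem resF_const_mul {f : Cn (n + 1) → ℂ} {p : Cn (n + 1)} (hp : p 0 = 0) (h : PolarAt f p)
    (c : ℂ) : resF (fun y => c * f y) p = c * resF f p :=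
  ((h.isResAt hp).const_mul c).resF_eq

theorem resF_sum {ι : Type*} {s : Finset ι} {f : ι → Cn (n + 1) → ℂ} {p : Cn (n + 1)}
    (hp : p 0 = 0) (h : ∀ j ∈ s, PolarAt (f j) p) :
    resF (∑ j ∈ s, f j) p = ∑ j ∈ s, resF (f j) p := by
  classical
  induction s using Finset.induction_on with
  | empty => simpa using (IsResAt.zero p).resF_eq
  | insert j s hj ih =>
    rw [Finset.sum_insert hj, Finset.sum_insert hj, resF_add hp (h j (Finset.mem_insert_self _ _))
      (PolarAt.sum fun k hk => h k (Finset.mem_insert_of_mem hk)),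
      ih fun k hk => h k (Finset.mem_insert_of_mem hk)]

theorem resF_congr {f f' : Cn (n + 1) → ℂ} {p : Cn (n + 1)} (hp : p 0 = 0)
    (he : ∀ᶠ y in 𝓝 p, y 0 ≠ 0 → f y = f' y) : resF f p = resF f' p := by
  classical
  have h1 (r : ℂ) : IsResAt f p r ↔ IsResAt f' p r :=
    ⟨fun h => h.congr hp he, fun h => h.congr hp (he.mono fun y hy h0 => (hy h0).symm)⟩
  by_cases h : ∃ r, IsResAt f p r
  · obtain ⟨r, hr⟩ := h
    rw [hr.resF_eq, ((h1 r).1 hr).resF_eq]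
  · have h' : ¬ ∃ r, IsResAt f' p r := by simpa only [h1] using h
    rw [resF, resF, dif_neg h, dif_neg h']

theorem resF_eq_resVal {f G : Cn (n + 1) → ℂ} {q : Cn (n + 1)} (hq : q 0 = 0) {a b : ℕ}
    (hG : ContDiffAt ℝ (a + b : ℕ) G q)
    (h : ∀ᶠ y in 𝓝 q, y 0 ≠ 0 → poleMon a b y * f y = G y) : resF f q = resVal a b G q :=
  (IsResAt.of_contDiffAt hq hG h).resF_eq

/-- The relation between f and G persists at nearby points, and so does the finite regularity
C^(a+b), which is all that the residue formula uses. Hence the same a, b, G compute the residue at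
all nearby points of the hyperplane. -/
theorem resF_eventuallyEq_resVal {f G : Cn (n + 1) → ℂ} {p : Cn (n + 1)} {a b : ℕ}
    (hG : ContDiffAt ℝ ∞ G p)
    (h : ∀ᶠ y in 𝓝 p, y 0 ≠ 0 → poleMon a b y * f y = G y) :
    ∀ᶠ q in 𝓝 p, q 0 = 0 → resF f q = resVal a b G q := by
  have h1 : ContDiffAt ℝ (a + b : ℕ) G p := hG.of_le (natCast_le_infty _)
  filter_upwards [h.eventually_nhds, h1.eventually (natCast_ne_infty _)] with q h2 h3 h0
  exact resF_eq_resVal h0 h3 h2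

theorem ContDiffAt.resVal {G : Cn (n + 1) → ℂ} {p : Cn (n + 1)} (a b : ℕ)
    (hG : ContDiffAt ℝ ∞ G p) : ContDiffAt ℝ ∞ (resVal a b G) p := by
  refine contDiffAt_const.mul ?_
  rw [wirt_eq_dC, wirtBar_eq_dC]
  exact (hG.dC_iterate_infty b).dC_iterate_infty a

/-- The residue of a total derivative `∂f/∂z₀` vanishes. -/
theorem resF_wirt {f : Cn (n + 1) → ℂ} {p : Cn (n + 1)} (hp : p 0 = 0) (h : PolarAt f p) :
    resF (wirt f) p = 0 := by
  obtain ⟨a, b, G, hG, h⟩ := h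
  have hd := poleMon_mul_dC (hG.of_le (natCast_le_infty 1)) h Complex.I (Pi.single 0 1)
  rw [← wirt_eq_dC] at hd
  have hG1 : ContDiffAt ℝ ∞ (wirt G) p := hG.dC_infty
  -- With M = `poleMon a b`, the quotient rule gives ∂f = ∂G/M - (a+1) G/(z₀M). The residues of the
  -- two terms cancel because (a+1)/(a+1)! = 1/a!.
  have h1 : IsResAt (fun y => (poleMon a b y)⁻¹ * wirt G y) p (resVal a b (wirt G) p) := by
    refine IsResAt.of_contDiffAt hp (hG1.of_le (natCast_le_infty _)) (Filter.Eventually.of_forall ?_)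
    intro y h0
    exact mul_inv_cancel_left₀ (poleMon_ne_zero h0) _
  have h2 : IsResAt (fun y => (poleMon (a + 1) b y)⁻¹ * G y) p (resVal (a + 1) b G p) := by
    refine IsResAt.of_contDiffAt hp (hG.of_le (natCast_le_infty _)) (Filter.Eventually.of_forall ?_)
    intro y h0
    exact mul_inv_cancel_left₀ (poleMon_ne_zero h0) _
  have h3 := (h1.add (h2.const_mul (-(a + 1)))).congr (f' := wirt f) hp (by
    filter_upwards [h, hd] with y h4 h5 h0
    have h6 := h5 h0
    have hGy := (h4 h0).symm
    rw [wirt_eq_dC, dC_poleMon] at h6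
    have h7 : poleMon a b y ≠ 0 := poleMon_ne_zero h0
    have h8 : (poleMon (a + 1) b y)⁻¹ = (y 0)⁻¹ * (poleMon a b y)⁻¹ := by
      rw [← mul_inv, poleMon, poleMon]; congr 1; ring
    simp only [Pi.add_apply, h8]
    rw [wirt_eq_dC, ← h6, hGy]
    simp only [Pi.single_eq_same, Complex.I_mul_I]
    have h9 : poleMon a b y = y 0 * (y 0 ^ a * (conj (y 0)) ^ (b + 1)) := by rw [poleMon]; ring
    field_simp
    rw [h9]
    ring)
  rw [h3.resF_eq]
  have h9 : wirt^[a] (wirtBar^[b] (wirt G)) p = wirt^[a + 1] (wirtBar^[b] G) p := by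
    have := dC_iterate_comm (c := -Complex.I) (v := Pi.single 0 1) (c' := Complex.I)
      (w := Pi.single 0 1) b (hG.of_le (natCast_le_infty _))
    rw [← wirtBar_eq_dC, ← wirt_eq_dC] at this
    rw [wirt_eq_dC] at this ⊢
    rw [(this.dC_iterate a).eq_of_nhds]
    rfl
  rw [resVal, resVal, h9, Nat.factorial_succ]
  have ha : (a.factorial : ℂ) ≠ 0 := by exact_mod_cast a.factorial_ne_zero
  have hb : (b.factorial : ℂ) ≠ 0 := by exact_mod_cast b.factorial_ne_zero
  have ha1 : (a : ℂ) + 1 ≠ 0 := by exact_mod_cast a.succ_ne_zero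
  push_cast
  field_simp
  ring

/-- The residue of a total derivative `∂f/∂z̄₀` vanishes. -/
theorem resF_wirtBar {f : Cn (n + 1) → ℂ} {p : Cn (n + 1)} (hp : p 0 = 0) (h : PolarAt f p) :
    resF (wirtBar f) p = 0 := by
  obtain ⟨a, b, G, hG, h⟩ := h
  have hd := poleMon_mul_dC (hG.of_le (natCast_le_infty 1)) h (-Complex.I) (Pi.single 0 1)
  rw [← wirtBar_eq_dC] at hd
  have hG1 : ContDiffAt ℝ ∞ (wirtBar G) p := by rw [wirtBar_eq_dC]; exact hG.dC_infty
  have h1 : IsResAt (fun y => (poleMon a b y)⁻¹ * wirtBar G y) p (resVal a b (wirtBar G) p) := by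
    refine IsResAt.of_contDiffAt hp (hG1.of_le (natCast_le_infty _)) (Filter.Eventually.of_forall ?_)
    intro y h0
    exact mul_inv_cancel_left₀ (poleMon_ne_zero h0) _
  have h2 : IsResAt (fun y => (poleMon a (b + 1) y)⁻¹ * G y) p (resVal a (b + 1) G p) := by
    refine IsResAt.of_contDiffAt hp (hG.of_le (natCast_le_infty _)) (Filter.Eventually.of_forall ?_)
    intro y h0
    exact mul_inv_cancel_left₀ (poleMon_ne_zero h0) _
  have h3 := (h1.add (h2.const_mul (-(b + 1)))).congr (f' := wirtBar f) hp (by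
    filter_upwards [h, hd] with y h4 h5 h0
    have h6 := h5 h0
    have hGy := (h4 h0).symm
    rw [wirtBar_eq_dC, dC_poleMon] at h6
    have h7 : poleMon a b y ≠ 0 := poleMon_ne_zero h0
    have h0' : conj (y 0) ≠ 0 := by simpa using h0
    have h8 : (poleMon a (b + 1) y)⁻¹ = (conj (y 0))⁻¹ * (poleMon a b y)⁻¹ := by
      rw [← mul_inv, poleMon, poleMon]; congr 1; ring
    simp only [Pi.add_apply, h8]
    rw [wirtBar_eq_dC, ← h6, hGy]
    simp only [Pi.single_eq_same, neg_mul, Complex.I_mul_I, map_one]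
    have h9 : poleMon a b y = conj (y 0) * (y 0 ^ (a + 1) * (conj (y 0)) ^ b) := by
      rw [poleMon]; ring
    field_simp
    rw [h9]
    ring)
  rw [h3.resF_eq]
  rw [resVal, resVal, Nat.factorial_succ, Function.iterate_succ_apply]
  have ha : (a.factorial : ℂ) ≠ 0 := by exact_mod_cast a.factorial_ne_zero
  have hb : (b.factorial : ℂ) ≠ 0 := by exact_mod_cast b.factorial_ne_zero
  have hb1 : (b : ℂ) + 1 ≠ 0 := by exact_mod_cast b.succ_ne_zero
  push_cast
  field_simp
  ring

/-- The inclusion of the hyperplane `z₀ = 0`. -/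
def hyper (n : ℕ) : Cn n →L[ℂ] Cn (n + 1) :=
  ContinuousLinearMap.pi (Fin.cons 0 fun k => ContinuousLinearMap.proj k)

@[simp] theorem hyper_zero (w : Cn n) : hyper n w 0 = 0 := rfl

@[simp] theorem hyper_succ (w : Cn n) (k : Fin n) : hyper n w k.succ = w k := rfl

/-- The projection of `ℂⁿ⁺¹` to the last `n` coordinates. -/
def tailL (n : ℕ) : Cn (n + 1) →L[ℂ] Cn n :=
  ContinuousLinearMap.pi fun k => ContinuousLinearMap.proj k.succ

@[simp] theorem tailL_apply (y : Cn (n + 1)) (k : Fin n) : tailL n y k = y k.succ := rfl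

@[simp] theorem tailL_hyper (w : Cn n) : tailL n (hyper n w) = w := rfl

theorem hyper_tailL {y : Cn (n + 1)} (hy : y 0 = 0) : hyper n (tailL n y) = y := by
  ext k
  refine Fin.cases ?_ (fun k => ?_) k
  · exact hy.symm
  · rfl

theorem contDiff_hyper {l : WithTop ℕ∞} : ContDiff ℝ l (hyper n) :=
  ((hyper n).restrictScalars ℝ).contDiff

theorem dC_comp_hyper {F : Cn (n + 1) → ℂ} (c : ℂ) (v w : Cn n)
    (hF : DifferentiableAt ℝ F (hyper n w)) :
    dC c v (fun w => F (hyper n w)) w = dC c (hyper n v) F (hyper n w) := by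
  have : fderiv ℝ (fun w => F (hyper n w)) w =
      (fderiv ℝ F (hyper n w)).comp ((hyper n).restrictScalars ℝ) :=
    (hF.hasFDerivAt.comp w ((hyper n).restrictScalars ℝ).hasFDerivAt).fderiv
  simp [dC_apply, this]

/-- The residue of a polar function is a smooth function on `z₀ = 0`. -/
theorem PolarAt.contDiffAt_resF {f : Cn (n + 1) → ℂ} {w : Cn n} (h : PolarAt f (hyper n w)) :
    ContDiffAt ℝ ∞ (fun w => resF f (hyper n w)) w := by
  obtain ⟨a, b, G, hG, h⟩ := h
  have h1 := resF_eventuallyEq_resVal hG h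
  have h2 := (contDiff_hyper (l := 0)).continuous.continuousAt.eventually h1
  refine ((hG.resVal a b).comp w contDiff_hyper.contDiffAt).congr_of_eventuallyEq ?_
  filter_upwards [h2] with w' h3 using h3 rfl

/-- Taking residues commutes with derivatives along `z₀ = 0`. -/
theorem resF_dC {f : Cn (n + 1) → ℂ} {w : Cn n} (h : PolarAt f (hyper n w)) (c : ℂ) (v : Cn n) :
    resF (dC c (hyper n v) f) (hyper n w) = dC c v (fun w => resF f (hyper n w)) w := by
  obtain ⟨a, b, G, hG, h⟩ := h
  have h1 := resF_eventuallyEq_resVal hG h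
  have h2 := (contDiff_hyper (l := 0)).continuous.continuousAt.eventually h1
  have h3 : (fun w => resF f (hyper n w)) =ᶠ[𝓝 w] fun w => resVal a b G (hyper n w) := by
    filter_upwards [h2] with w' h3 using h3 rfl
  rw [h3.dC.eq_of_nhds, dC_comp_hyper c v w ((hG.resVal a b).differentiableAt (by simp))]
  -- Directions tangent to the hyperplane annihilate z₀ and z̄₀, so the pole factor is a constant
  -- for this derivative and the pole orders do not grow.
  have h4 : ∀ᶠ y in 𝓝 (hyper n w), y 0 ≠ 0 →
      poleMon a b y * dC c (hyper n v) f y = dC c (hyper n v) G y := by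
    filter_upwards [poleMon_mul_dC (hG.of_le (natCast_le_infty 1)) h c (hyper n v)] with y hy h0
    rw [← hy h0, dC_poleMon]
    simp
  have hG1 : ContDiffAt ℝ ∞ (dC c (hyper n v) G) (hyper n w) := hG.dC_infty
  rw [resF_eq_resVal (hyper_zero w) (hG1.of_le (natCast_le_infty _)) h4]
  have hb : ContDiffAt ℝ ∞ (wirtBar^[b] G) (hyper n w) := by
    rw [wirtBar_eq_dC]; exact hG.dC_iterate_infty b
  have h5 : wirt^[a] (wirtBar^[b] (dC c (hyper n v) G)) (hyper n w) =
      dC c (hyper n v) (wirt^[a] (wirtBar^[b] G)) (hyper n w) := by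
    have e1 := dC_iterate_comm (c := -Complex.I) (v := Pi.single 0 1) (c' := c)
      (w := hyper n v) b (hG.of_le (natCast_le_infty _))
    have e2 := dC_iterate_comm (c := Complex.I) (v := Pi.single 0 1) (c' := c)
      (w := hyper n v) a (hb.of_le (natCast_le_infty _))
    rw [← wirtBar_eq_dC] at e1
    rw [wirt_eq_dC]
    rw [(e1.dC_iterate a).eq_of_nhds, e2.eq_of_nhds]
  rw [resVal, h5]
  unfold resVal
  exact (dC_const_smul (V := ℂ) _ _ _).symm

end Polar

/-! ### Algebra of covectors -/

section Covectors

variable {n k : ℕ}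

instance finiteDimensional_covec_real (n k : ℕ) : FiniteDimensional ℝ (Covec n k) := by
  let b := Module.finBasis ℝ (Cn n)
  let L : Covec n k →ₗ[ℝ] ((Fin k → Fin (Module.finrank ℝ (Cn n))) → ℂ) :=
    { toFun := fun A s => A fun j => b (s j)
      map_add' := fun _ _ => rfl
      map_smul' := fun _ _ => rfl }
  refine Module.Finite.of_injective L fun A B h => ?_
  apply ContinuousAlternatingMap.toAlternatingMap_injective
  refine Module.Basis.ext_alternating b fun v _ => congrFun h v

instance finiteDimensional_covec (n k : ℕ) : FiniteDimensional ℂ (Covec n k) :=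
  Module.Finite.of_restrictScalars_finite ℝ ℂ _

/-- Evaluation of covectors. -/
def evalC (v : Fin k → Cn n) : Covec n k →L[ℂ] ℂ :=
  LinearMap.toContinuousLinearMap
    { toFun := fun A => A v
      map_add' := fun _ _ => rfl
      map_smul' := fun _ _ => rfl }

/-- Evaluation on tuples of basis vectors is an injective linear map into a finite product, and a
linear left inverse recovers the covector from its values. -/
theorem contDiffAt_covec_iff {E : Type*} [NormedAddCommGroup E] [NormedSpace ℝ E]
    {F : E → Covec n k} {x : E} {l : WithTop ℕ∞} :
    ContDiffAt ℝ l F x ↔ ∀ v, ContDiffAt ℝ l (fun y => F y v) x := by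
  refine ⟨fun h v => ((evalC v).restrictScalars ℝ).contDiff.contDiffAt.comp x h, fun h => ?_⟩
  let b := Module.finBasis ℝ (Cn n)
  let L : Covec n k →ₗ[ℝ] ((Fin k → Fin (Module.finrank ℝ (Cn n))) → ℂ) :=
    { toFun := fun A s => A fun j => b (s j)
      map_add' := fun _ _ => rfl
      map_smul' := fun _ _ => rfl }
  have hL : Function.Injective L := fun A B h => by
    apply ContinuousAlternatingMap.toAlternatingMap_injective
    exact Module.Basis.ext_alternating b fun v _ => congrFun h v
  obtain ⟨R, hR⟩ := L.exists_leftInverse_of_injective (LinearMap.ker_eq_bot.2 hL)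
  have hF : F = fun y => R.toContinuousLinearMap (L (F y)) := by
    funext y; exact (LinearMap.congr_fun hR (F y)).symm
  rw [hF]
  refine R.toContinuousLinearMap.contDiff.contDiffAt.comp x (contDiffAt_pi.2 fun s => h _)

theorem covWedge_apply (ℓ : Cn n →L[ℝ] ℂ) (A : Covec n k) (v : Fin (k + 1) → Cn n) :
    covWedge ℓ A v = ∑ j : Fin (k + 1), (-1) ^ (j : ℕ) * (ℓ (v j) * A (j.removeNth v)) := by
  rw [covWedge, ContinuousAlternatingMap.alternatizeUncurryFin_apply]
  refine Finset.sum_congr rfl fun j _ => ?_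
  simp [ContinuousLinearMap.smulRight_apply, zsmul_eq_mul]

theorem removeNth_succ_cons {α : Type*} {k : ℕ} (j : Fin (k + 1)) (V : α) (v : Fin (k + 1) → α) :
    j.succ.removeNth (Fin.cons V v : Fin (k + 2) → α) = Fin.cons V (j.removeNth v) := by
  funext l
  refine Fin.cases ?_ (fun l => ?_) l
  · simp [Fin.removeNth]
  · simp [Fin.removeNth, Fin.succ_succAbove_succ]

theorem covWedge_cons (ℓ : Cn n →L[ℝ] ℂ) (A : Covec n (k + 1)) (V : Cn n) (v : Fin (k + 1) → Cn n) :
    covWedge ℓ A (Fin.cons V v) = ℓ V * A v - covWedge ℓ (A.curryLeft V) v := by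
  rw [covWedge_apply, Fin.sum_univ_succ, covWedge_apply, sub_eq_add_neg, ← Finset.sum_neg_distrib]
  congr 1
  · simp
  · refine Finset.sum_congr rfl fun j _ => ?_
    rw [removeNth_succ_cons, ContinuousAlternatingMap.curryLeft_apply_apply]
    simp [pow_succ, Matrix.vecCons]

theorem covWedge_curryLeft (ℓ : Cn n →L[ℝ] ℂ) (A : Covec n (k + 1)) (V : Cn n) :
    (covWedge ℓ A).curryLeft V = ℓ V • A - covWedge ℓ (A.curryLeft V) := by
  ext v
  rw [ContinuousAlternatingMap.curryLeft_apply_apply]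
  exact covWedge_cons ℓ A V v

/-- The wedge product with a fixed covector as a linear map. -/
def covWedgeL (ℓ : Cn n →L[ℝ] ℂ) : Covec n k →L[ℂ] Covec n (k + 1) :=
  LinearMap.toContinuousLinearMap
    { toFun := covWedge ℓ
      map_add' := fun A B => by
        ext v; simp [covWedge_apply, mul_add, Finset.sum_add_distrib]
      map_smul' := fun c A => by
        ext v
        simp only [covWedge_apply, ContinuousAlternatingMap.smul_apply, smul_eq_mul,
          RingHom.id_apply, Finset.mul_sum]
        exact Finset.sum_congr rfl fun j _ => by ring }

theorem covWedge_smul (ℓ : Cn n →L[ℝ] ℂ) (c : ℂ) (A : Covec n k) :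
    covWedge ℓ (c • A) = c • covWedge ℓ A := (covWedgeL ℓ).map_smul c A

theorem covWedge_sub (ℓ : Cn n →L[ℝ] ℂ) (A B : Covec n k) :
    covWedge ℓ (A - B) = covWedge ℓ A - covWedge ℓ B := (covWedgeL ℓ).map_sub A B

theorem covWedge_zero (ℓ : Cn n →L[ℝ] ℂ) : covWedge ℓ (0 : Covec n k) = 0 := (covWedgeL ℓ).map_zero

theorem covec_eq_zero_of_lt (h : n + n < k) (A : Covec n k) : A = 0 := by
  have : Module.finrank ℝ (Cn n) < k := by
    rw [Module.finrank_pi_fintype]; simp [Complex.finrank_real_complex]; omega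
  ext v
  refine A.toAlternatingMap.map_linearDependent v fun hv => ?_
  have := hv.fintype_card_le_finrank
  simp at this
  omega

theorem finrank_Cn (n : ℕ) : Module.finrank ℝ (Cn n) = n + n := by
  rw [Module.finrank_pi_fintype]; simp [Complex.finrank_real_complex]; ring

/-- A real basis of `ℂⁿ`. -/
def realBasis (n : ℕ) : Module.Basis (Fin (n + n)) ℝ (Cn n) :=
  Module.finBasisOfFinrankEq ℝ (Cn n) (finrank_Cn n)

/-- A volume form on `ℂⁿ`. -/
def vol (n : ℕ) : Covec n (n + n) :=
  { (Complex.ofRealCLM.toLinearMap.compAlternatingMap (realBasis n).det :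
      (Cn n) [⋀^Fin (n + n)]→ₗ[ℝ] ℂ) with
    cont := by
      change Continuous fun v : Fin (n + n) → Cn n => (((realBasis n).det v : ℝ) : ℂ)
      refine Complex.continuous_ofReal.comp ?_
      change Continuous fun v => Matrix.det ((realBasis n).toMatrix v)
      refine Continuous.matrix_det (continuous_matrix fun i j => ?_)
      exact ((realBasis n).coord i).continuous_of_finiteDimensional.comp (continuous_apply j) }

theorem vol_apply (v : Fin (n + n) → Cn n) : vol n v = ((realBasis n).det v : ℝ) := rfl

theorem vol_realBasis : vol n (realBasis n) = 1 := by
  rw [vol_apply, Module.Basis.det_self]; simp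

theorem eq_smul_vol (A : Covec n (n + n)) : A = A (realBasis n) • vol n := by
  have h := A.toAlternatingMap
  have e : Function.Injective (ContinuousAlternatingMap.toAlternatingMap :
    Covec n (n + n) → _) := ContinuousAlternatingMap.toAlternatingMap_injective
  apply e
  refine Module.Basis.ext_alternating (realBasis n) fun v hv => ?_
  obtain ⟨σ, rfl⟩ : ∃ σ : Equiv.Perm (Fin (n + n)), v = σ :=
    ⟨Equiv.ofBijective v (Finite.injective_iff_bijective.1 hv), rfl⟩
  have h1 := A.toAlternatingMap.map_perm (realBasis n) σ
  have h2 := (vol n).toAlternatingMap.map_perm (realBasis n) σ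
  change A (realBasis n ∘ σ) = A (realBasis n) * vol n (realBasis n ∘ σ)
  change A (realBasis n ∘ σ) = σ.sign • A (realBasis n) at h1
  change vol n (realBasis n ∘ σ) = σ.sign • vol n (realBasis n) at h2
  rw [h1, h2, vol_realBasis]
  simp [Units.smul_def, mul_comm]

/-- A covector of top degree scales by the real determinant, and multiplication by c on ℂⁿ has real
determinant |c|^(2n) = cⁿ c̄ⁿ. -/
theorem hasBidegree_top {k : ℕ} (hk : k = n + n) (A : Covec n k) : HasBidegree n n A := by
  subst hk
  intro c v
  rw [eq_smul_vol A]
  change _ * vol n _ = _ * (_ * vol n _)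
  have : vol n (fun j => c • v j) = c ^ n * (conj c) ^ n * vol n v := by
    let L : Cn n →ₗ[ℝ] Cn n := (LinearMap.lsmul ℂ (Cn n) c).restrictScalars ℝ
    have h1 : (realBasis n).det (fun j => c • v j) = LinearMap.det L * (realBasis n).det v :=
      (realBasis n).det_comp L v
    have h2 : LinearMap.det L = Complex.normSq c ^ n := by
      rw [LinearMap.det_restrictScalars]
      have : LinearMap.det (LinearMap.lsmul ℂ (Cn n) c) = c ^ n := by
        have : LinearMap.lsmul ℂ (Cn n) c = c • LinearMap.id := rfl
        rw [this, LinearMap.det_smul]; simp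
      rw [this, map_pow, Algebra.norm_complex_apply]
    rw [vol_apply, h1, h2, vol_apply]
    push_cast
    rw [← mul_pow, Complex.mul_conj]
  rw [this]; ring

end Covectors

section Covectors

variable {n k : ℕ}

theorem exists_eq_smul_of_top (hk : k = n + n) (A : Covec n k) {B : Covec n k} (hB : B ≠ 0) :
    ∃ c : ℂ, A = c • B := by
  subst hk
  have h : B (realBasis n) ≠ 0 := fun h =>
    hB (by rw [eq_smul_vol B, h]; exact zero_smul ℂ (vol n))
  refine ⟨A (realBasis n) / B (realBasis n), ?_⟩
  have h2 : A (realBasis n) / B (realBasis n) * B (realBasis n) = A (realBasis n) :=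
    div_mul_cancel₀ _ h
  calc A = A (realBasis n) • vol n := eq_smul_vol A
    _ = (A (realBasis n) / B (realBasis n)) • (B (realBasis n) • vol n) := by rw [← mul_smul, h2]
    _ = _ := by rw [← eq_smul_vol B]

theorem covWedge_pullback {m : ℕ} (ℓ : Cn n →L[ℝ] ℂ) (A : Covec n k) (L : Cn m →L[ℝ] Cn n) :
    (covWedge ℓ A).compContinuousLinearMap L =
      covWedge (ℓ.comp L) (A.compContinuousLinearMap L) := by
  ext v
  simp only [ContinuousAlternatingMap.compContinuousLinearMap_apply, covWedge_apply]
  rfl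

theorem covWedge_cons_of_eq_zero {ℓ : Cn n →L[ℝ] ℂ} (A : Covec n k) (V : Cn n) {v : Fin k → Cn n}
    (h : ∀ j, ℓ (v j) = 0) : covWedge ℓ A (Fin.cons V v) = ℓ V * A v := by
  rw [covWedge_apply, Fin.sum_univ_succ]
  simp [h]

/-- The pullback of a covector along the projection `(z₀, …, z_n) ↦ (z₁, …, z_n)`. -/
def tailPull (A : Covec n k) : Covec (n + 1) k :=
  A.compContinuousLinearMap ((tailL n).restrictScalars ℝ)

/-- The restriction of a covector to the hyperplane `z₀ = 0`. -/
def hyperPull (A : Covec (n + 1) k) : Covec n k :=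
  A.compContinuousLinearMap ((hyper n).restrictScalars ℝ)

theorem tailPull_apply (A : Covec n k) (v : Fin k → Cn (n + 1)) :
    tailPull A v = A fun j => tailL n (v j) := rfl

theorem hyperPull_apply (A : Covec (n + 1) k) (v : Fin k → Cn n) :
    hyperPull A v = A fun j => hyper n (v j) := rfl

theorem hyperPull_tailPull (A : Covec n k) : hyperPull (tailPull A) = A := by
  ext v
  simp [hyperPull_apply, tailPull_apply, tailL_hyper]

theorem dzZero_apply (v : Cn (n + 1)) : dzZero n v = v 0 := rfl

theorem dzBarZero_apply (v : Cn (n + 1)) : dzBarZero n v = conj (v 0) := rfl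

/-- A volume form on `ℂⁿ⁺¹`, adapted to the first coordinate. -/
def volX (n : ℕ) : Covec (n + 1) (n + n + 1 + 1) :=
  covWedge (dzZero n) (covWedge (dzBarZero n) (tailPull (vol n)))

theorem covWedge_covWedge_apply (A : Covec (n + 1) k) (V W : Cn (n + 1))
    {v : Fin k → Cn (n + 1)} (h : ∀ j, v j 0 = 0) :
    covWedge (dzZero n) (covWedge (dzBarZero n) A) (Fin.cons V (Fin.cons W v)) =
      (V 0 * conj (W 0) - W 0 * conj (V 0)) * A v := by
  have h' : ∀ j, dzBarZero n (v j) = 0 := fun j => by rw [dzBarZero_apply, h j, map_zero]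
  rw [covWedge_apply, Fin.sum_univ_succ, Fin.sum_univ_succ, removeNth_succ_cons]
  have : ∀ j : Fin k, dzZero n ((Fin.cons V (Fin.cons W v) : Fin (k + 2) → Cn (n + 1)) j.succ.succ)
      = 0 := fun j => by simp [dzZero_apply, h]
  simp only [this, zero_mul, mul_zero, Finset.sum_const_zero, add_zero]
  simp only [Fin.removeNth_zero, Fin.tail_cons, Fin.cons_zero, Fin.cons_succ]
  rw [covWedge_cons_of_eq_zero A W h', covWedge_cons_of_eq_zero A V h', dzZero_apply, dzZero_apply,
    dzBarZero_apply, dzBarZero_apply]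
  simp
  ring

/-- The frame `e₀, i e₀, …` of `ℂⁿ⁺¹`. -/
def frameX (n : ℕ) : Fin (n + n + 1 + 1) → Cn (n + 1) :=
  Fin.cons (Pi.single 0 1) (Fin.cons (Pi.single 0 Complex.I) fun j => hyper n (realBasis n j))

/-- The coefficient of a covector of top degree with respect to `volX`. -/
def coefX (n : ℕ) : Covec (n + 1) (n + n + 1 + 1) →L[ℂ] ℂ := (Complex.I / 2) • evalC (frameX n)

theorem coefX_apply (A : Covec (n + 1) (n + n + 1 + 1)) :
    coefX n A = Complex.I / 2 * A (frameX n) := rfl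

/-- On the pair (e₀, ie₀) the form dz₀ ∧ dz̄₀ takes the value -2i, which the factor i/2 in `coefX`
turns into 1. -/
theorem coefX_covWedge (A : Covec (n + 1) (n + n)) :
    coefX n (covWedge (dzZero n) (covWedge (dzBarZero n) A)) = hyperPull A (realBasis n) := by
  rw [coefX_apply, frameX, covWedge_covWedge_apply]
  · simp only [Pi.single_eq_same, map_one, Complex.conj_I]
    rw [hyperPull_apply]
    linear_combination (-1) * (A fun j => hyper n (realBasis n j)) * Complex.I_mul_I
  · intro j; simp [hyper_zero]

theorem coefX_volX : coefX n (volX n) = 1 := by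
  rw [volX, coefX_covWedge, hyperPull_tailPull, vol_realBasis]

theorem eq_smul_volX (A : Covec (n + 1) (n + n + 1 + 1)) : A = coefX n A • volX n := by
  have h : volX n ≠ 0 := fun h => by
    have := coefX_volX (n := n); rw [h, map_zero] at this; exact zero_ne_one this
  obtain ⟨c, hc⟩ := exists_eq_smul_of_top (by omega) A h
  have : coefX n A = c := by rw [hc, map_smul, coefX_volX]; simp
  rw [this]; exact hc

/-! ### The operators `∂` and `∂̄` in coordinates -/

/-- The operator `∂` (for `c = i`) and `∂̄` (for `c = -i`) on open subsets of `ℂⁿ`. -/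
def delC (c : ℂ) (F : Cn n → Covec n k) : Cn n → Covec n (k + 1) :=
  fun y => ContinuousAlternatingMap.alternatizeUncurryFin (typePart c (fderiv ℝ F y))

theorem delBarLocal_eq_delC : (delBarLocal : (Cn n → Covec n k) → _) = delC (-Complex.I) := by
  funext F y
  rw [delBarLocal, delC, antilinPart_eq_typePart]

/-- The covector `dz_k` (for `c = i`) and `dz̄_k` (for `c = -i`). -/
def cProj (c : ℂ) (j : Fin n) : Cn n →L[ℝ] ℂ :=
  (Complex.ofRealCLM.comp (Complex.reCLM.comp (ContinuousLinearMap.proj j))) +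
    c • (Complex.ofRealCLM.comp (Complex.imCLM.comp (ContinuousLinearMap.proj j)))

theorem cProj_apply (c : ℂ) (j : Fin n) (v : Cn n) :
    cProj c j v = ((v j).re : ℂ) + c * ((v j).im : ℂ) := rfl

section

variable {V : Type*} [NormedAddCommGroup V] [NormedSpace ℝ V] [NormedSpace ℂ V]
  [IsScalarTower ℝ ℂ V]

theorem typePart_mulI {c : ℂ} (hc : c * c = -1) (L : Cn n →L[ℝ] V) (v : Cn n) :
    typePart c L (Complex.I • v) = c • typePart c L v := by
  rw [typePart_apply, typePart_apply, smul_smul Complex.I, Complex.I_mul_I, neg_one_smul, map_neg]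
  have h : c • c • L (Complex.I • v) = -L (Complex.I • v) := by
    rw [smul_smul, hc, neg_one_smul]
  rw [smul_comm c, smul_sub c, h]
  congr 1
  simp only [smul_neg]
  abel

theorem typePart_smul {c : ℂ} (hc : c * c = -1) (L : Cn n →L[ℝ] V) (z : ℂ) (v : Cn n) :
    typePart c L (z • v) = ((z.re : ℂ) + c * (z.im : ℂ)) • typePart c L v := by
  have : z • v = (z.re : ℝ) • v + (z.im : ℝ) • (Complex.I • v) := by
    conv_lhs => rw [← Complex.re_add_im z, add_smul, mul_smul]
    simp
  rw [this, map_add, map_smul, map_smul, typePart_mulI hc, add_smul, mul_comm, mul_smul]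
  exact congrArg₂ (· + ·) (algebraMap_smul ℂ z.re _).symm (algebraMap_smul ℂ z.im _).symm

theorem typePart_eq_sum {c : ℂ} (hc : c * c = -1) (L : Cn n →L[ℝ] V) (v : Cn n) :
    typePart c L v = ∑ j, cProj c j v • typePart c L (Pi.single j 1) := by
  have : v = ∑ j, v j • (Pi.single j 1 : Cn n) := by
    funext l
    simp [Finset.sum_apply, Pi.single_apply]
  conv_lhs => rw [this, map_sum]
  exact Finset.sum_congr rfl fun j _ => typePart_smul hc L _ _

end

theorem delC_eq_sum {c : ℂ} (hc : c * c = -1) (F : Cn n → Covec n k) (y : Cn n) :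
    delC c F y = ∑ j, covWedge (cProj c j) (dC c (Pi.single j 1) F y) := by
  have : typePart c (fderiv ℝ F y) =
      ∑ j, (cProj c j).smulRight (dC c (Pi.single j 1) F y) := by
    ext1 v
    rw [typePart_eq_sum hc]
    simp [dC]
  rw [delC, this]
  exact map_sum (ContinuousAlternatingMap.alternatizeUncurryFinCLM ℝ (Cn n) ℂ) _ _

/-- Expresses a coefficient of ∂F as a sum of scalar derivatives of coefficients of F, the shape to
which the residue calculus for functions applies. -/
theorem clm_delC {c : ℂ} (hc : c * c = -1) (L : Covec n (k + 1) →L[ℂ] ℂ) {F : Cn n → Covec n k}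
    {y : Cn n} (hF : DifferentiableAt ℝ F y) :
    L (delC c F y) = ∑ j, dC c (Pi.single j 1) (fun y => L (covWedge (cProj c j) (F y))) y := by
  rw [delC_eq_sum hc, map_sum]
  exact Finset.sum_congr rfl fun j _ =>
    (dC_clm (L.comp (covWedgeL (cProj c j))) hF).symm

theorem delC_add {c : ℂ} {F G : Cn n → Covec n k} {y : Cn n} (hF : DifferentiableAt ℝ F y)
    (hG : DifferentiableAt ℝ G y) : delC c (F + G) y = delC c F y + delC c G y := by
  rw [delC, fderiv_add hF hG, delC, delC, ← ContinuousAlternatingMap.alternatizeUncurryFin_add]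
  congr 1
  ext1 v
  simp only [typePart_apply, add_apply]
  module

/-- The contraction of a covector with `∂/∂z_j` (for `c = i`) or `∂/∂z̄_j` (for `c = -i`). -/
def iotaC (c : ℂ) (j : Fin n) (A : Covec n (k + 1)) : Covec n k :=
  typePart c A.curryLeft (Pi.single j 1)

/-- Contraction is an antiderivation and the wedge of dz_j with a top covector A is zero for degree
reasons, so dz_j ∧ ι_l A = dz_j(∂/∂z_l) A; the same holds for the conjugate type. -/
theorem covWedge_iotaC {c : ℂ} (hc : c * c = -1) (hk : k + 1 = n + n) (A : Covec n (k + 1))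
    (j l : Fin n) : covWedge (cProj c j) (iotaC c l A) = if j = l then A else 0 := by
  obtain _ | k := k
  · omega
  have h : ∀ V, covWedge (cProj c j) (A.curryLeft V) = cProj c j V • A := fun V => by
    have := covWedge_curryLeft (cProj c j) A V
    rw [covec_eq_zero_of_lt (by omega) (covWedge (cProj c j) A)] at this
    simp only [ContinuousAlternatingMap.curryLeft_zero, zero_apply] at this
    exact (sub_eq_zero.1 this.symm).symm
  rw [iotaC, typePart_apply, covWedge_smul, covWedge_sub, covWedge_smul, h, h]
  have h2 : (1 / 2 : ℂ) • (cProj c j (Pi.single l 1) • A -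
      c • cProj c j (Complex.I • (Pi.single l 1 : Cn n)) • A) =
      ((1 / 2 : ℂ) * (cProj c j (Pi.single l 1) -
        c * cProj c j (Complex.I • (Pi.single l 1 : Cn n)))) • A := by module
  rw [h2]
  simp only [cProj_apply, Pi.smul_apply, smul_eq_mul]
  split_ifs with hjl
  · subst hjl
    simp only [Pi.single_eq_same]
    have : (1 / 2 : ℂ) * ((((1 : ℂ).re : ℝ) : ℂ) + c * ((1 : ℂ).im : ℝ) -
      c * ((((Complex.I * 1).re : ℝ) : ℂ) + c * ((Complex.I * 1).im : ℝ))) = 1 := by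
      simp; linear_combination (-1 / 2) * hc
    rw [this, one_smul]
  · rw [Pi.single_eq_of_ne hjl]
    simp only [mul_zero, Complex.zero_re, Complex.zero_im, Complex.ofReal_zero, add_zero, sub_self]
    exact zero_smul ℂ A

/-- The source of all primitives below: a top form whose coefficient is a coordinate derivative of u
is ∂ or ∂̄ of u times a contracted constant form. -/
theorem delC_smul_iotaC {c : ℂ} (hc : c * c = -1) (hk : k + 1 = n + n) (A : Covec n (k + 1))
    (l : Fin n) {u : Cn n → ℂ} {y : Cn n} (hu : DifferentiableAt ℝ u y) :
    delC c (fun y => u y • iotaC c l A) y = dC c (Pi.single l 1) u y • A := by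
  rw [delC_eq_sum hc, Finset.sum_eq_single l]
  · rw [dC_smul hu (differentiableAt_const _), dC_const, smul_zero, zero_add, covWedge_smul,
      covWedge_iotaC hc hk, if_pos rfl]
  · intro j _ hj
    rw [dC_smul hu (differentiableAt_const _), dC_const, smul_zero, zero_add, covWedge_smul,
      covWedge_iotaC hc hk, if_neg hj]
    exact smul_zero (M := ℂ) (A := Covec n (k + 1)) _
  · simp

/-- Scaling all arguments of A, including the contracted one, gives zⁿ z̄ⁿ. The contracted vector is
not scaled, which costs z⁻¹ in that slot; this becomes z⁻¹ or its conjugate according to the type.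
-/
theorem iotaC_apply_smul {c : ℂ} (hc : c * c = -1) (hk : k + 1 = n + n) (A : Covec n (k + 1))
    (j : Fin n) {z : ℂ} (hz : z ≠ 0) (v : Fin k → Cn n) :
    iotaC c j A (fun l => z • v l) =
      z ^ n * conj z ^ n * (((z⁻¹).re : ℂ) + c * ((z⁻¹).im : ℂ)) * iotaC c j A v := by
  have h : ∀ V, A.curryLeft V (fun l => z • v l) =
      z ^ n * conj z ^ n * A.curryLeft (z⁻¹ • V) v := fun V => by
    rw [ContinuousAlternatingMap.curryLeft_apply_apply,
      ContinuousAlternatingMap.curryLeft_apply_apply, ← hasBidegree_top hk A]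
    congr 1
    funext l
    refine Fin.cases ?_ (fun l => ?_) l
    · simp [Matrix.vecCons, smul_smul, hz]
    · simp [Matrix.vecCons]
  have h2 : iotaC c j A (fun l => z • v l) =
      z ^ n * conj z ^ n * (typePart c A.curryLeft (z⁻¹ • Pi.single j 1)) v := by
    rw [iotaC, typePart_apply, typePart_apply]
    simp only [ContinuousAlternatingMap.smul_apply, ContinuousAlternatingMap.sub_apply, h]
    rw [smul_comm z⁻¹ Complex.I]
    simp only [smul_eq_mul]
    ring
  rw [h2, typePart_smul hc, ContinuousAlternatingMap.smul_apply, smul_eq_mul, ← mul_assoc]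
  rfl

theorem hasBidegree_iotaC {p : ℕ} (hp : p + 1 = n) (hk : k + 1 = n + n) (A : Covec n (k + 1))
    (j : Fin n) : HasBidegree p n (iotaC Complex.I j A) := by
  intro z v
  by_cases hz : z = 0
  · subst hz hp
    rw [map_zero, zero_pow (n := p + 1) (by omega), mul_zero, zero_mul]
    have : Nonempty (Fin k) := ⟨⟨0, by omega⟩⟩
    convert (iotaC Complex.I j A).map_zero using 2
    funext l; simp
  · have h4 : z ^ n = z ^ p * z := by rw [← hp, pow_succ]
    rw [iotaC_apply_smul Complex.I_mul_I hk A j hz, mul_comm Complex.I, Complex.re_add_im, h4]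
    field_simp

theorem hasBidegree_iotaC_bar {p : ℕ} (hp : p + 1 = n) (hk : k + 1 = n + n) (A : Covec n (k + 1))
    (j : Fin n) : HasBidegree n p (iotaC (-Complex.I) j A) := by
  intro z v
  by_cases hz : z = 0
  · subst hz hp
    rw [zero_pow (n := p + 1) (by omega), zero_mul, zero_mul]
    have : Nonempty (Fin k) := ⟨⟨0, by omega⟩⟩
    convert (iotaC (-Complex.I) j A).map_zero using 2
    funext l; simp
  · have h2 : ((z⁻¹.re : ℂ) + -Complex.I * (z⁻¹.im : ℂ)) = (conj z)⁻¹ := by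
      rw [← map_inv₀]
      apply Complex.ext <;> simp [neg_div]
    have h3 : conj z ≠ 0 := (map_ne_zero _).2 hz
    have h4 : conj z ^ n = conj z ^ p * conj z := by rw [← hp, pow_succ]
    rw [iotaC_apply_smul (by simp) hk A j hz, h2, h4]
    field_simp

end Covectors

/-! ### Pullbacks of local forms under holomorphic maps -/

section Pullback

variable {m n k : ℕ}

theorem typePart_comp {V W : Type*} [NormedAddCommGroup V] [NormedSpace ℝ V] [NormedSpace ℂ V]
    [IsScalarTower ℝ ℂ V] [NormedAddCommGroup W] [NormedSpace ℝ W] [NormedSpace ℂ W]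
    [IsScalarTower ℝ ℂ W] (c : ℂ) (L : Cn n →L[ℝ] V) (P : V →L[ℝ] W)
    (hP : ∀ (a : ℂ) v, P (a • v) = a • P v) (T : Cn m →L[ℝ] Cn n)
    (hT : ∀ v, T (Complex.I • v) = Complex.I • T v) (v : Cn m) :
    typePart c (P.comp (L.comp T)) v = P (typePart c L (T v)) := by
  simp only [typePart_apply, ContinuousLinearMap.comp_apply, hP, map_sub, hT]

/-- The derivative of the pullback is the pulled back derivative plus terms with the second
derivative of T. These are symmetric in two arguments, so alternation kills them, even after
multiplying one argument by i, because the derivative of T is complex linear near y. -/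
theorem delC_pullback {c : ℂ} {T : Cn m → Cn n} {y : Cn m} (hT : ContDiffAt ℝ 2 T y)
    (hTI : ∀ᶠ y' in 𝓝 y, ∀ v, fderiv ℝ T y' (Complex.I • v) = Complex.I • fderiv ℝ T y' v)
    {F : Cn n → Covec n k} (hF : DifferentiableAt ℝ F (T y)) :
    delC c (fun y' => (F (T y')).compContinuousLinearMap (fderiv ℝ T y')) y =
      (delC c F (T y)).compContinuousLinearMap (fderiv ℝ T y) := by
  have hT1 : DifferentiableAt ℝ T y := hT.differentiableAt (by norm_num)
  have hT2 : DifferentiableAt ℝ (fderiv ℝ T) y :=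
    (hT.fderiv_right (m := 1) (by norm_num)).differentiableAt (by norm_num)
  have hTI1 := hTI.self_of_nhds
  have hsymm : ∀ v w, fderiv ℝ (fderiv ℝ T) y v w = fderiv ℝ (fderiv ℝ T) y w v :=
    (hT.isSymmSndFDerivAt (by simp)).eq
  have hI2 : ∀ v w, fderiv ℝ (fderiv ℝ T) y w (Complex.I • v) =
      Complex.I • fderiv ℝ (fderiv ℝ T) y w v := fun v w => by
    have h1 : HasFDerivAt (fun y' => fderiv ℝ T y' (Complex.I • v))
        ((fderiv ℝ (fderiv ℝ T) y).flip (Complex.I • v)) y :=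
      ((ContinuousLinearMap.apply ℝ (Cn n) (Complex.I • v)).hasFDerivAt).comp y hT2.hasFDerivAt
    have h2 : HasFDerivAt (fun y' => Complex.I • fderiv ℝ T y' v)
        (Complex.I • (fderiv ℝ (fderiv ℝ T) y).flip v) y :=
      (((ContinuousLinearMap.apply ℝ (Cn n) v).hasFDerivAt).comp y hT2.hasFDerivAt).const_smul Complex.I
    have h3 := h1.unique (h2.congr_of_eventuallyEq (hTI.mono fun y' h => h v))
    exact congrArg (fun L => L w) h3
  have hcomp : DifferentiableAt ℝ (fun y' => F (T y')) y := hF.comp y hT1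
  have hd := fderiv_continuousAlternatingMapCompContinuousLinearMap hcomp hT2
  have hd1 : fderiv ℝ (fun y' => F (T y')) y = (fderiv ℝ F (T y)).comp (fderiv ℝ T y) :=
    fderiv_comp y hF hT1
  set D := fderiv ℝ T y with hD
  set H := fderiv ℝ (fderiv ℝ T) y with hH
  -- The second derivative with its first argument multiplied by i. It is again symmetric, since the
  -- second derivative commutes with i in either argument.
  let H' : Cn m →L[ℝ] Cn m →L[ℝ] Cn n := H.comp (mulI m)
  have hH' : ∀ v w, H' v w = H' w v := fun v w => by
    change H (Complex.I • v) w = H (Complex.I • w) v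
    rw [hsymm, hI2, hsymm (Complex.I • w), hI2, hsymm]
  have key : typePart c (fderiv ℝ (fun y' => (F (T y')).compContinuousLinearMap (fderiv ℝ T y')) y) =
      (ContinuousAlternatingMap.compContinuousLinearMapCLM D).comp
        ((typePart c (fderiv ℝ F (T y))).comp D) +
      ((1 / 2 : ℂ) • ((F (T y)).fderivCompContinuousLinearMap D ∘L H) -
        (c / 2) • ((F (T y)).fderivCompContinuousLinearMap D ∘L H')) := by
    rw [hd, hd1]
    ext1 v
    have h1 := typePart_comp c (fderiv ℝ F (T y))
      (ContinuousAlternatingMap.compContinuousLinearMapCLM D : Covec n k →L[ℝ] Covec m k)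
      (fun a v => rfl) D hTI1 v
    rw [typePart_apply] at h1 ⊢
    simp only [add_apply, ContinuousLinearMap.comp_apply,
      sub_apply, smul_apply] at h1 ⊢
    rw [← h1]
    change _ = _ + ((1 / 2 : ℂ) • _ - (c / 2) • ((F (T y)).fderivCompContinuousLinearMap D
      (H (Complex.I • v))))
    module
  rw [delC, key, ContinuousAlternatingMap.alternatizeUncurryFin_add]
  have e1 : ContinuousAlternatingMap.alternatizeUncurryFin
      ((1 / 2 : ℂ) • ((F (T y)).fderivCompContinuousLinearMap D ∘L H) -
        (c / 2) • ((F (T y)).fderivCompContinuousLinearMap D ∘L H')) = 0 := by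
    have e0 : ∀ P Q : Cn m →L[ℝ] Covec m k, P - (c / 2) • Q = P + (-(c / 2)) • Q := fun P Q => by
      ext1 v
      change P v - (c / 2) • Q v = P v + (-(c / 2)) • Q v
      module
    rw [e0, ContinuousAlternatingMap.alternatizeUncurryFin_add,
      ContinuousAlternatingMap.alternatizeUncurryFin_smul,
      ContinuousAlternatingMap.alternatizeUncurryFin_smul,
      ContinuousAlternatingMap.alternatizeUncurryFin_fderivCompContinuousLinearMap_eq_zero _ _ hsymm,
      ContinuousAlternatingMap.alternatizeUncurryFin_fderivCompContinuousLinearMap_eq_zero _ _ hH']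
    ext v
    simp
  rw [e1, add_zero]
  ext v
  simp only [delC, ContinuousAlternatingMap.alternatizeUncurryFin_apply,
    ContinuousAlternatingMap.compContinuousLinearMap_apply]
  rfl

theorem contDiffAt_pullback {T : Cn m → Cn n} {y : Cn m} (hT : ContDiffAt ℝ ∞ T y)
    {F : Cn n → Covec n k} {l : WithTop ℕ∞} (hl : l ≤ ∞) (hF : ContDiffAt ℝ l F (T y)) :
    ContDiffAt ℝ l (fun y' => (F (T y')).compContinuousLinearMap (fderiv ℝ T y')) y := by
  have h1 : ContDiffAt ℝ l (fun y' => F (T y')) y := hF.comp y (hT.of_le hl)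
  have h2 : ContDiffAt ℝ l (fderiv ℝ T) y :=
    (hT.fderiv_right (m := ∞) (by simp)).of_le hl
  refine contDiffAt_covec_iff.2 fun v => ?_
  have h3 : ContDiffAt ℝ l (fun y' =>
      ContinuousMultilinearMap.compContinuousLinearMapContinuousMultilinear ℝ
        (fun _ : Fin k => Cn m) (fun _ => Cn n) ℂ (fun _ => fderiv ℝ T y')) y :=
    (ContinuousMultilinearMap.contDiff _).contDiffAt.comp y (contDiffAt_pi.2 fun _ => h2)
  let L : Covec n k →L[ℝ] ContinuousMultilinearMap ℝ (fun _ : Fin k => Cn n) ℂ :=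
    ContinuousAlternatingMap.toContinuousMultilinearMapCLM ℝ
  have h4 : ContDiffAt ℝ l (fun y' => L (F (T y'))) y := L.contDiff.contDiffAt.comp y h1
  exact (ContinuousMultilinearMap.apply ℝ (fun _ : Fin k => Cn m) ℂ v).contDiff.contDiffAt.comp y
    (h3.clm_apply h4)

end Pullback

/-! ### Forms in holomorphic charts -/

section Charts

variable {m k : ℕ} {M : Type*} [TopologicalSpace M] [ChartedSpace (Cn m) M]

/-- The derivative of a chart, as a real-linear map. -/
def dChart (ψ : OpenPartialHomeomorph M (Cn m)) (x : M) : Cn m →L[ℝ] Cn m :=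
  (mfderiv 𝓘(ℂ, Cn m) 𝓘(ℂ, Cn m) ψ x : Cn m →L[ℂ] Cn m).restrictScalars ℝ

/-- The derivative of the inverse of a chart, as a real-linear map. -/
def dSymm (ψ : OpenPartialHomeomorph M (Cn m)) (y : Cn m) : Cn m →L[ℝ] Cn m :=
  (mfderiv 𝓘(ℂ, Cn m) 𝓘(ℂ, Cn m) ψ.symm y : Cn m →L[ℂ] Cn m).restrictScalars ℝ

theorem inChart_apply (φ : OpenPartialHomeomorph M (Cn m)) (θ : Form m M k) (y : Cn m) :
    inChart φ θ y = (θ (φ.symm y)).compContinuousLinearMap (dSymm φ y) := rfl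

open Classical in
/-- The form which is given by `F` in the chart `ψ` and vanishes outside of the domain of `ψ`. -/
def ofChart (ψ : OpenPartialHomeomorph M (Cn m)) (F : Cn m → Covec m k) : Form m M k :=
  fun x => if x ∈ ψ.source then (F (ψ x)).compContinuousLinearMap (dChart ψ x) else 0

theorem ofChart_of_mem {ψ : OpenPartialHomeomorph M (Cn m)} (F : Cn m → Covec m k) {x : M}
    (hx : x ∈ ψ.source) : ofChart ψ F x = (F (ψ x)).compContinuousLinearMap (dChart ψ x) :=
  if_pos hx

theorem ofChart_of_notMem {ψ : OpenPartialHomeomorph M (Cn m)} (F : Cn m → Covec m k) {x : M}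
    (hx : x ∉ ψ.source) : ofChart ψ F x = 0 := if_neg hx

/-- The operators `∂` (for `c = i`) and `∂̄` (for `c = -i`) on forms. -/
def delM (c : ℂ) (θ : Form m M k) : Form m M (k + 1) :=
  fun x => (delC c (inChart (chartAt (Cn m) x) θ) (chartAt (Cn m) x x)).compContinuousLinearMap
    (dChart (chartAt (Cn m) x) x)

theorem del_eq_delM : (del : Form m M k → _) = delM Complex.I := rfl

theorem delBar_eq_delM : (delBar : Form m M k → _) = delM (-Complex.I) := by
  funext θ x
  rw [delBar, delM, delBarLocal_eq_delC]; rfl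

/-- The form `θ` is smooth at the point `x`. -/
def SmoothAtPt (θ : Form m M k) (x : M) : Prop :=
  ∀ φ ∈ holCharts m M, x ∈ φ.source → ContDiffAt ℝ ∞ (inChart φ θ) (φ x)

theorem smoothOn_iff {U : Set M} (hU : IsOpen U) {θ : Form m M k} :
    SmoothOn U θ ↔ ∀ x ∈ U, SmoothAtPt θ x := by
  constructor
  · intro h x hx φ hφ hxφ
    have ho : IsOpen (φ.target ∩ φ.symm ⁻¹' U) := φ.isOpen_inter_preimage_symm hU
    refine (h φ hφ).contDiffAt (ho.mem_nhds ⟨φ.map_source hxφ, ?_⟩)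
    rw [Set.mem_preimage, φ.left_inv hxφ]; exact hx
  · intro h φ hφ y hy
    have := h _ hy.2 φ hφ (φ.map_target hy.1)
    rw [φ.right_inv hy.1] at this
    exact this.contDiffWithinAt

theorem inChart_congr {φ : OpenPartialHomeomorph M (Cn m)} {θ η : Form m M k} {x : M}
    (hx : x ∈ φ.source) (h : θ =ᶠ[𝓝 x] η) : inChart φ θ =ᶠ[𝓝 (φ x)] inChart φ η := by
  have : Filter.Tendsto φ.symm (𝓝 (φ x)) (𝓝 x) := by
    have := φ.continuousAt_symm (φ.map_source hx)
    rwa [ContinuousAt, φ.left_inv hx] at this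
  filter_upwards [this.eventually h] with y hy
  rw [inChart_apply, hy]; rfl

theorem SmoothAtPt.congr {θ η : Form m M k} {x : M} (h : SmoothAtPt θ x) (he : θ =ᶠ[𝓝 x] η) :
    SmoothAtPt η x := fun φ hφ hx =>
  (h φ hφ hx).congr_of_eventuallyEq (inChart_congr hx he.symm)

theorem SmoothAtPt.zero (x : M) : SmoothAtPt (0 : Form m M k) x := fun φ _ _ => by
  rw [inChart_zero]; exact contDiffAt_const

variable [IsManifold 𝓘(ℂ, Cn m) ω M]

theorem chartAt_mem_holCharts (x : M) : chartAt (Cn m) x ∈ holCharts m M :=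
  IsManifold.chart_mem_maximalAtlas x

section Transition

variable {φ ψ : OpenPartialHomeomorph M (Cn m)} (hφ : φ ∈ holCharts m M) (hψ : ψ ∈ holCharts m M)

include hφ

theorem mdifferentiableAt_chart {x : M} (hx : x ∈ φ.source) :
    MDifferentiableAt 𝓘(ℂ, Cn m) 𝓘(ℂ, Cn m) φ x :=
  (contMDiffAt_of_mem_maximalAtlas hφ hx).mdifferentiableAt (by simp)

theorem mdifferentiableAt_symm {y : Cn m} (hy : y ∈ φ.target) :
    MDifferentiableAt 𝓘(ℂ, Cn m) 𝓘(ℂ, Cn m) φ.symm y :=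
  (contMDiffAt_symm_of_mem_maximalAtlas hφ hy).mdifferentiableAt (by simp)

theorem dSymm_comp_dChart {x : M} (hx : x ∈ φ.source) :
    (dSymm φ (φ x)).comp (dChart φ x) = ContinuousLinearMap.id ℝ _ := by
  have h : OpenPartialHomeomorph.MDifferentiable 𝓘(ℂ, Cn m) 𝓘(ℂ, Cn m) φ :=
    ⟨fun y hy => (mdifferentiableAt_chart hφ hy).mdifferentiableWithinAt,
      fun y hy => (mdifferentiableAt_symm hφ hy).mdifferentiableWithinAt⟩
  have := h.symm_comp_deriv hx
  ext1 v
  exact congrArg (fun L : Cn m →L[ℂ] Cn m => L v) this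

theorem dChart_comp_dSymm {y : Cn m} (hy : y ∈ φ.target) :
    (dChart φ (φ.symm y)).comp (dSymm φ y) = ContinuousLinearMap.id ℝ _ := by
  have h : OpenPartialHomeomorph.MDifferentiable 𝓘(ℂ, Cn m) 𝓘(ℂ, Cn m) φ :=
    ⟨fun y hy => (mdifferentiableAt_chart hφ hy).mdifferentiableWithinAt,
      fun y hy => (mdifferentiableAt_symm hφ hy).mdifferentiableWithinAt⟩
  have := h.comp_symm_deriv hy
  ext1 v
  exact congrArg (fun L : Cn m →L[ℂ] Cn m => L v) this

include hψ

theorem contDiffAt_transition_complex {y : Cn m} (hy : y ∈ φ.target) (hy' : φ.symm y ∈ ψ.source) :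
    ContDiffAt ℂ ω (fun y => ψ (φ.symm y)) y := by
  rw [← contMDiffAt_iff_contDiffAt]
  exact (contMDiffAt_of_mem_maximalAtlas hψ hy').comp y (contMDiffAt_symm_of_mem_maximalAtlas hφ hy)

theorem contDiffAt_transition {y : Cn m} (hy : y ∈ φ.target) (hy' : φ.symm y ∈ ψ.source) :
    ContDiffAt ℝ ∞ (fun y => ψ (φ.symm y)) y :=
  ((contDiffAt_transition_complex hφ hψ hy hy').restrict_scalars ℝ).of_le (by simp)

theorem fderiv_transition {y : Cn m} (hy : y ∈ φ.target) (hy' : φ.symm y ∈ ψ.source) :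
    fderiv ℝ (fun y => ψ (φ.symm y)) y = (dChart ψ (φ.symm y)).comp (dSymm φ y) := by
  have h1 : DifferentiableAt ℂ (fun y => ψ (φ.symm y)) y :=
    (contDiffAt_transition_complex hφ hψ hy hy').differentiableAt (by simp)
  have h2 := mfderiv_comp y (mdifferentiableAt_chart hψ hy') (mdifferentiableAt_symm hφ hy)
  rw [mfderiv_eq_fderiv] at h2
  rw [h1.fderiv_restrictScalars ℝ]
  ext1 v
  exact congrArg (fun L : Cn m →L[ℂ] Cn m => L v) h2

theorem eventually_mem_transition {y : Cn m} (hy : y ∈ φ.target) (hy' : φ.symm y ∈ ψ.source) :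
    ∀ᶠ y' in 𝓝 y, y' ∈ φ.target ∧ φ.symm y' ∈ ψ.source :=
  (φ.isOpen_inter_preimage_symm ψ.open_source).mem_nhds ⟨hy, hy'⟩

theorem fderiv_transition_smul {y : Cn m} (hy : y ∈ φ.target) (hy' : φ.symm y ∈ ψ.source) (a : ℂ)
    (v : Cn m) : fderiv ℝ (fun y => ψ (φ.symm y)) y (a • v) =
      a • fderiv ℝ (fun y => ψ (φ.symm y)) y v := by
  have h1 : DifferentiableAt ℂ (fun y => ψ (φ.symm y)) y :=
    (contDiffAt_transition_complex hφ hψ hy hy').differentiableAt (by simp)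
  rw [h1.fderiv_restrictScalars ℝ]
  exact map_smul (fderiv ℂ _ y) a v

theorem inChart_transition (θ : Form m M k) {y : Cn m} (hy : y ∈ φ.target)
    (hy' : φ.symm y ∈ ψ.source) :
    inChart φ θ y = (inChart ψ θ (ψ (φ.symm y))).compContinuousLinearMap
      (fderiv ℝ (fun y => ψ (φ.symm y)) y) := by
  rw [fderiv_transition hφ hψ hy hy', inChart_apply, inChart_apply, ψ.left_inv hy']
  ext v
  simp only [ContinuousAlternatingMap.compContinuousLinearMap_apply]
  congr 1
  funext j
  have := dSymm_comp_dChart hψ hy'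
  exact (congrArg (fun L : Cn m →L[ℝ] Cn m => L (dSymm φ y (v j))) this).symm

omit hψ in
theorem ofChart_inChart (θ : Form m M k) {x : M} (hx : x ∈ φ.source) :
    ofChart φ (inChart φ θ) x = θ x := by
  rw [ofChart_of_mem _ hx, inChart_apply, φ.left_inv hx]
  ext v
  simp only [ContinuousAlternatingMap.compContinuousLinearMap_apply]
  congr 1
  funext j
  have := dSymm_comp_dChart hφ hx
  exact congrArg (fun L : Cn m →L[ℝ] Cn m => L (v j)) this

omit hψ in
theorem inChart_ofChart (F : Cn m → Covec m k) {y : Cn m} (hy : y ∈ φ.target) :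
    inChart φ (ofChart φ F) y = F y := by
  rw [inChart_apply, ofChart_of_mem _ (φ.map_target hy), φ.right_inv hy]
  ext v
  simp only [ContinuousAlternatingMap.compContinuousLinearMap_apply]
  congr 1
  funext j
  have := dChart_comp_dSymm hφ hy
  exact congrArg (fun L : Cn m →L[ℝ] Cn m => L (v j)) this

omit hψ in
theorem form_eq (θ : Form m M k) {x : M} (hx : x ∈ φ.source) :
    θ x = (inChart φ θ (φ x)).compContinuousLinearMap (dChart φ x) := by
  rw [← ofChart_of_mem _ hx, ofChart_inChart hφ θ hx]

theorem inChart_transition_eventually (θ : Form m M k) {y : Cn m} (hy : y ∈ φ.target)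
    (hy' : φ.symm y ∈ ψ.source) :
    inChart φ θ =ᶠ[𝓝 y] fun y => (inChart ψ θ (ψ (φ.symm y))).compContinuousLinearMap
      (fderiv ℝ (fun y => ψ (φ.symm y)) y) :=
  (eventually_mem_transition hφ hψ hy hy').mono fun _ h => inChart_transition hφ hψ θ h.1 h.2

theorem contDiffAt_inChart_transition {θ : Form m M k} {y : Cn m} (hy : y ∈ φ.target)
    (hy' : φ.symm y ∈ ψ.source) {l : WithTop ℕ∞} (hl : l ≤ ∞)
    (h : ContDiffAt ℝ l (inChart ψ θ) (ψ (φ.symm y))) : ContDiffAt ℝ l (inChart φ θ) y :=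
  (contDiffAt_pullback (contDiffAt_transition hφ hψ hy hy') hl h).congr_of_eventuallyEq
    (inChart_transition_eventually hφ hψ θ hy hy')

omit hφ in
theorem smoothAtPt_of_chart {θ : Form m M k} {x : M} (hx : x ∈ ψ.source)
    (h : ContDiffAt ℝ ∞ (inChart ψ θ) (ψ x)) : SmoothAtPt θ x := fun φ hφ hxφ => by
  refine contDiffAt_inChart_transition hφ hψ (φ.map_source hxφ) ?_ le_rfl ?_ <;>
    rwa [φ.left_inv hxφ]

theorem delC_transition {c : ℂ} {θ : Form m M k} {y : Cn m} (hy : y ∈ φ.target)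
    (hy' : φ.symm y ∈ ψ.source) (h : DifferentiableAt ℝ (inChart ψ θ) (ψ (φ.symm y))) :
    delC c (inChart φ θ) y = (delC c (inChart ψ θ) (ψ (φ.symm y))).compContinuousLinearMap
      (fderiv ℝ (fun y => ψ (φ.symm y)) y) := by
  rw [← delC_pullback ((contDiffAt_transition hφ hψ hy hy').of_le (natCast_le_infty 2))
    ((eventually_mem_transition hφ hψ hy hy').mono fun y' h' v =>
      fderiv_transition_smul hφ hψ h'.1 h'.2 Complex.I v) h]
  rw [delC, (inChart_transition_eventually hφ hψ θ hy hy').fderiv_eq]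
  rfl

-- Allows ∂ and ∂̄ to be computed in any holomorphic chart: the definition uses the preferred chart,
-- and `delC_transition` with the chain rule removes it.
omit hφ in
theorem delM_eq {c : ℂ} {θ : Form m M k} {x : M} (hx : x ∈ ψ.source)
    (h : DifferentiableAt ℝ (inChart ψ θ) (ψ x)) :
    delM c θ x = (delC c (inChart ψ θ) (ψ x)).compContinuousLinearMap (dChart ψ x) := by
  set χ := chartAt (Cn m) x with hχ
  have hχ' : χ ∈ holCharts m M := chartAt_mem_holCharts x
  have hxχ : x ∈ χ.source := mem_chart_source _ x
  have h1 : χ.symm (χ x) ∈ ψ.source := by rwa [χ.left_inv hxχ]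
  have := delC_transition (c := c) (θ := θ) hχ' hψ (χ.map_source hxχ) h1
    (by rwa [χ.left_inv hxχ])
  rw [delM, ← hχ, this, fderiv_transition hχ' hψ (χ.map_source hxχ) h1, χ.left_inv hxχ]
  ext v
  simp only [ContinuousAlternatingMap.compContinuousLinearMap_apply]
  congr 1
  funext j
  have := dSymm_comp_dChart hχ' hxχ
  exact congrArg (fun L : Cn m →L[ℝ] Cn m => dChart ψ x (L (v j))) this

omit hφ in
theorem inChart_delM {c : ℂ} {θ : Form m M k} {y : Cn m} (hy : y ∈ ψ.target)
    (h : DifferentiableAt ℝ (inChart ψ θ) y) :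
    inChart ψ (delM c θ) y = delC c (inChart ψ θ) y := by
  rw [inChart_apply, delM_eq hψ (ψ.map_target hy) (by rwa [ψ.right_inv hy]), ψ.right_inv hy]
  ext v
  simp only [ContinuousAlternatingMap.compContinuousLinearMap_apply]
  congr 1
  funext j
  have := dChart_comp_dSymm hψ hy
  exact congrArg (fun L : Cn m →L[ℝ] Cn m => L (v j)) this

end Transition

omit [IsManifold 𝓘(ℂ, Cn m) ω M] in
theorem delM_congr {c : ℂ} {θ η : Form m M k} {x : M} (h : θ =ᶠ[𝓝 x] η) :
    delM c θ x = delM c η x := by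
  rw [delM, delM, delC, (inChart_congr (mem_chart_source _ x) h).fderiv_eq]
  rfl

omit [IsManifold 𝓘(ℂ, Cn m) ω M] in
theorem delM_zero (c : ℂ) : delM c (0 : Form m M k) = 0 := by
  funext x
  rw [delM, inChart_zero, delC]
  ext v
  simp [typePart_apply, ContinuousAlternatingMap.alternatizeUncurryFin_apply, Pi.zero_def]
  rfl

end Charts

/-! ### Adapted charts and the charts which they induce on the hypersurface -/

section Adapted

variable {n : ℕ} {X : Type*} [TopologicalSpace X] [ChartedSpace (Cn (n + 1)) X]
  {D : Type*} {i : D → X}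

theorem IsAdapted.restr [IsManifold 𝓘(ℂ, Cn (n + 1)) ω X]
    {φ : OpenPartialHomeomorph X (Cn (n + 1))} (hφ : IsAdapted i φ) {s : Set X}
    (hs : IsOpen s) : IsAdapted i (φ.restr s) where
  mem_holCharts := restr_mem_maximalAtlas (contDiffGroupoid ω 𝓘(ℂ, Cn (n + 1))) hφ.mem_holCharts hs
  mem_iff x hx := hφ.mem_iff x (by simpa using hx.1)

theorem IsAdapted.apply_zero {φ : OpenPartialHomeomorph X (Cn (n + 1))} (hφ : IsAdapted i φ) {p : D}
    (hp : i p ∈ φ.source) : φ (i p) 0 = 0 := (hφ.mem_iff _ hp).1 ⟨p, rfl⟩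

theorem IsAdapted.hyper_tail {φ : OpenPartialHomeomorph X (Cn (n + 1))} (hφ : IsAdapted i φ) {p : D}
    (hp : i p ∈ φ.source) : hyper n (tailL n (φ (i p))) = φ (i p) :=
  hyper_tailL (hφ.apply_zero hp)

theorem IsAdapted.symm_mem_range {φ : OpenPartialHomeomorph X (Cn (n + 1))} (hφ : IsAdapted i φ)
    {y : Cn (n + 1)} (hy : y ∈ φ.target) : φ.symm y ∈ Set.range i ↔ y 0 = 0 := by
  rw [hφ.mem_iff _ (φ.map_target hy), φ.right_inv hy]

theorem trans_homeo_mem_holCharts {m : ℕ} {M : Type*} [TopologicalSpace M] [ChartedSpace (Cn m) M]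
    [IsManifold 𝓘(ℂ, Cn m) ω M] {φ : OpenPartialHomeomorph M (Cn m)} (hφ : φ ∈ holCharts m M)
    (A : Cn m ≃ₜ Cn m) (hA : ContDiff ℂ ω A) (hA' : ContDiff ℂ ω A.symm) :
    φ.transHomeomorph A ∈ holCharts m M := by
  apply OpenPartialHomeomorph.mem_maximalAtlas_of_contMDiffOn
  · exact hA.contMDiff.comp_contMDiffOn (contMDiffOn_of_mem_maximalAtlas hφ)
  · refine (contMDiffOn_symm_of_mem_maximalAtlas hφ).comp hA'.contMDiff.contMDiffOn ?_
    intro y hy; exact hy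

variable [IsManifold 𝓘(ℂ, Cn (n + 1)) ω X]

/-- A chart translated so that x has coordinates e₀ is shrunk until it misses D and z₀ does not
vanish; both sides of the defining equivalence are then false throughout. -/
theorem exists_isAdapted_of_notMem (hi : IsClosed (Set.range i)) {x : X} (hx : x ∉ Set.range i) :
    ∃ φ : OpenPartialHomeomorph X (Cn (n + 1)), IsAdapted i φ ∧ x ∈ φ.source := by
  let χ := chartAt (Cn (n + 1)) x
  let a : Cn (n + 1) := Pi.single 0 1 - χ x
  let A : Cn (n + 1) ≃ₜ Cn (n + 1) := Homeomorph.addRight a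
  have hA : ContDiff ℂ ω A := contDiff_id.add contDiff_const
  have hA' : ContDiff ℂ ω A.symm := contDiff_id.add contDiff_const
  let φ := χ.transHomeomorph A
  have hφ : φ ∈ holCharts (n + 1) X :=
    trans_homeo_mem_holCharts (chartAt_mem_holCharts x) A hA hA'
  have hxφ : x ∈ φ.source := mem_chart_source _ x
  have h0 : φ x 0 = 1 := by
    change (χ x + ((Pi.single 0 1 : Cn (n + 1)) - χ x) : Cn (n + 1)) 0 = (1 : ℂ)
    simp
  have ho : IsOpen (φ.source ∩ φ ⁻¹' {y | y 0 ≠ 0}) :=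
    φ.isOpen_inter_preimage (isOpen_ne.preimage (continuous_apply 0))
  refine ⟨φ.restr ((φ.source ∩ φ ⁻¹' {y | y 0 ≠ 0}) ∩ (Set.range i)ᶜ),
    ⟨restr_mem_maximalAtlas (contDiffGroupoid ω 𝓘(ℂ, Cn (n + 1))) hφ (ho.inter hi.isOpen_compl), ?_⟩, ?_⟩
  · intro y hy
    rw [OpenPartialHomeomorph.restr_source' _ _ (ho.inter hi.isOpen_compl)] at hy
    exact ⟨fun h => absurd h hy.2.2, fun h => absurd h hy.2.1.2⟩
  · rw [OpenPartialHomeomorph.restr_source' _ _ (ho.inter hi.isOpen_compl)]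
    exact ⟨hxφ, ⟨hxφ, by rw [Set.mem_preimage, Set.mem_ofPred_eq, h0]; exact one_ne_zero⟩, hx⟩

variable [TopologicalSpace D] [ChartedSpace (Cn n) D]

/-- In the charts of an immersion i reads u ↦ (u, 0) in ℂⁿ × F, where dim F = 1 by counting. A
linear change of coordinates moves F to the first coordinate, so D becomes z₀ = 0 once the chart is
small enough. -/
theorem exists_isAdapted_of_mem (hi : IsSmoothHypersurface n i) (p : D) :
    ∃ φ : OpenPartialHomeomorph X (Cn (n + 1)), IsAdapted i φ ∧ i p ∈ φ.source := by
  obtain ⟨F, _, _, hF⟩ := hi.isSmoothEmbedding.isImmersion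
  have h := hF p
  let dom := h.domChart
  let cod := h.codChart
  have : FiniteDimensional ℂ (Cn n × F) := Module.Finite.equiv h.equiv.symm.toLinearEquiv
  have : FiniteDimensional ℂ F := Module.Finite.of_surjective (LinearMap.snd ℂ (Cn n) F)
    LinearMap.snd_surjective
  have hF1 : Module.finrank ℂ F = Module.finrank ℂ ℂ := by
    have := h.equiv.toLinearEquiv.finrank_eq
    rw [Module.finrank_prod] at this
    simp at this ⊢
    omega
  let ℓ : F ≃ₗ[ℂ] ℂ := LinearEquiv.ofFinrankEq F ℂ hF1
  let B : (Cn n × F) ≃ₗ[ℂ] Cn (n + 1) :=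
    { toFun := fun w => Fin.cons (ℓ w.2) w.1
      invFun := fun y => (fun j => y j.succ, ℓ.symm (y 0))
      map_add' := fun v w => by
        funext j; refine Fin.cases ?_ (fun j => ?_) j <;> simp
      map_smul' := fun c w => by
        funext j; refine Fin.cases ?_ (fun j => ?_) j <;> simp
      left_inv := fun w => by simp
      right_inv := fun y => by
        funext j; refine Fin.cases ?_ (fun j => ?_) j <;> simp }
  let A : Cn (n + 1) ≃L[ℂ] Cn (n + 1) :=
    (h.equiv.symm.toLinearEquiv.trans B).toContinuousLinearEquiv
  have hA : ∀ u, A (h.equiv (u, 0)) = hyper n u := fun u => by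
    change B (h.equiv.symm (h.equiv (u, 0))) = _
    rw [ContinuousLinearEquiv.symm_apply_apply]
    funext j
    refine Fin.cases ?_ (fun j => ?_) j
    · change ℓ 0 = _; rw [map_zero, hyper_zero]
    · rw [hyper_succ]; rfl
  let φ₀ := cod.transHomeomorph A.toHomeomorph
  have hφ₀ : φ₀ ∈ holCharts (n + 1) X := trans_homeo_mem_holCharts h.codChart_mem_maximalAtlas _
    A.contDiff A.symm.contDiff
  have hloc : ∀ q ∈ dom.source, i q ∈ cod.source ∧ φ₀ (i q) = hyper n (dom q) := fun q hq => by
    refine ⟨h.source_subset_preimage_source hq, ?_⟩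
    have hq' : dom q ∈ (dom.extend 𝓘(ℂ, Cn n)).target := by simpa using dom.map_source hq
    have := h.writtenInCharts hq'
    simp only [Function.comp_apply, OpenPartialHomeomorph.extend_coe, modelWithCornersSelf_coe,
      OpenPartialHomeomorph.extend_coe_symm, modelWithCornersSelf_coe_symm, id] at this
    rw [dom.left_inv hq] at this
    change A (cod (i q)) = _
    rw [← hA]; exact congrArg A this
  -- As i is an embedding, the domain chart is the trace on D of an open set of X; inside it no
  -- other branch of D can occur.
  obtain ⟨U, hU, hUd⟩ := hi.isSmoothEmbedding.isEmbedding.isInducing.isOpen_iff.1 dom.open_source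
  -- Conversely, requiring the last n coordinates to lie in the target of the domain chart makes
  -- every point with z₀ = 0 a point of D.
  have ho : IsOpen (φ₀.source ∩ φ₀ ⁻¹' (tailL n ⁻¹' dom.target)) :=
    φ₀.isOpen_inter_preimage (dom.open_target.preimage (tailL n).continuous)
  have hos := ho.inter hU
  have htail : ∀ w, tailL n (hyper n w) = w := fun w => tailL_hyper w
  refine ⟨φ₀.restr ((φ₀.source ∩ φ₀ ⁻¹' (tailL n ⁻¹' dom.target)) ∩ U),
    ⟨restr_mem_maximalAtlas (contDiffGroupoid ω 𝓘(ℂ, Cn (n + 1))) hφ₀ hos, ?_⟩, ?_⟩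
  · intro x hx
    rw [OpenPartialHomeomorph.restr_source' _ _ hos] at hx
    constructor
    · rintro ⟨q, rfl⟩
      have hq : q ∈ dom.source := by rw [← hUd]; exact hx.2.2
      change φ₀ (i q) 0 = 0
      rw [(hloc q hq).2, hyper_zero]
    · intro h0
      change φ₀ x 0 = 0 at h0
      have hw : tailL n (φ₀ x) ∈ dom.target := hx.2.1.2
      have h1 := hloc _ (dom.map_target hw)
      rw [dom.right_inv hw, hyper_tailL h0] at h1
      exact ⟨_, φ₀.injOn h1.1 hx.1 h1.2⟩
  · rw [OpenPartialHomeomorph.restr_source' _ _ hos]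
    have h1 := hloc p h.mem_domChart_source
    refine ⟨h1.1, ⟨h1.1, ?_⟩, ?_⟩
    · change tailL n (φ₀ (i p)) ∈ dom.target
      rw [h1.2, htail]; exact dom.map_source h.mem_domChart_source
    · have : p ∈ i ⁻¹' U := by rw [hUd]; exact h.mem_domChart_source
      exact this

/-- Every point has arbitrarily small adapted charts. -/
theorem exists_isAdapted (hi : IsSmoothHypersurface n i) {x : X} {U : Set X} (hU : U ∈ 𝓝 x) :
    ∃ φ : OpenPartialHomeomorph X (Cn (n + 1)), IsAdapted i φ ∧ x ∈ φ.source ∧ φ.source ⊆ U := by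
  obtain ⟨φ, hφ, hx⟩ : ∃ φ : OpenPartialHomeomorph X (Cn (n + 1)), IsAdapted i φ ∧ x ∈ φ.source := by
    by_cases h : x ∈ Set.range i
    · obtain ⟨p, rfl⟩ := h
      exact exists_isAdapted_of_mem hi p
    · exact exists_isAdapted_of_notMem hi.isClosed_range h
  refine ⟨φ.restr (interior U), hφ.restr isOpen_interior, ?_, ?_⟩
  · rw [OpenPartialHomeomorph.restr_source' _ _ isOpen_interior]
    exact ⟨hx, mem_interior_iff_mem_nhds.2 hU⟩
  · rw [OpenPartialHomeomorph.restr_source' _ _ isOpen_interior]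
    exact fun y hy => interior_subset hy.2

/-- The chart of the hypersurface induced by an adapted chart. -/
def inducedChart [Nonempty D] (hi : IsSmoothHypersurface n i)
    {φ : OpenPartialHomeomorph X (Cn (n + 1))} (hφ : IsAdapted i φ) :
    OpenPartialHomeomorph D (Cn n) where
  toFun q := tailL n (φ (i q))
  invFun w := Function.invFun i (φ.symm (hyper n w))
  source := i ⁻¹' φ.source
  target := hyper n ⁻¹' φ.target
  map_source' q hq := by
    change hyper n (tailL n (φ (i q))) ∈ φ.target
    rw [hφ.hyper_tail hq]; exact φ.map_source hq
  map_target' w hw := by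
    have := (hφ.symm_mem_range hw).2 (hyper_zero w)
    change i (Function.invFun i _) ∈ φ.source
    rw [Function.invFun_eq this]
    exact φ.map_target hw
  left_inv' q hq := by
    rw [hφ.hyper_tail hq, φ.left_inv hq]
    exact Function.leftInverse_invFun hi.isSmoothEmbedding.isEmbedding.injective q
  right_inv' w hw := by
    have := (hφ.symm_mem_range hw).2 (hyper_zero w)
    rw [Function.invFun_eq this, φ.right_inv hw, tailL_hyper]
  open_source := φ.open_source.preimage hi.isSmoothEmbedding.isEmbedding.continuous
  open_target := φ.open_target.preimage (hyper n).continuous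
  continuousOn_toFun := (tailL n).continuous.comp_continuousOn
    (φ.continuousOn.comp hi.isSmoothEmbedding.isEmbedding.continuous.continuousOn fun _ h => h)
  continuousOn_invFun := by
    rw [hi.isSmoothEmbedding.isEmbedding.isInducing.continuousOn_iff]
    have : Set.EqOn (i ∘ fun w => Function.invFun i (φ.symm (hyper n w)))
        (fun w => φ.symm (hyper n w)) (hyper n ⁻¹' φ.target) := fun w hw =>
      Function.invFun_eq ((hφ.symm_mem_range hw).2 (hyper_zero w))
    exact (φ.continuousOn_symm.comp (hyper n).continuous.continuousOn fun _ h => h).congr this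

section Induced

variable [Nonempty D] (hi : IsSmoothHypersurface n i) {φ : OpenPartialHomeomorph X (Cn (n + 1))}
  (hφ : IsAdapted i φ)

theorem mem_inducedChart_source (q : D) : q ∈ (inducedChart hi hφ).source ↔ i q ∈ φ.source := Iff.rfl

theorem mem_inducedChart_target (w : Cn n) :
    w ∈ (inducedChart hi hφ).target ↔ hyper n w ∈ φ.target := Iff.rfl

theorem hyper_inducedChart {q : D} (hq : i q ∈ φ.source) :
    hyper n (inducedChart hi hφ q) = φ (i q) := hφ.hyper_tail hq

theorem apply_inducedChart_symm {w : Cn n} (hw : hyper n w ∈ φ.target) :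
    i ((inducedChart hi hφ).symm w) = φ.symm (hyper n w) :=
  Function.invFun_eq ((hφ.symm_mem_range hw).2 (hyper_zero w))

theorem contMDiffAt_clm {a b : ℕ} (L : Cn a →L[ℂ] Cn b) (x : Cn a) :
    ContMDiffAt 𝓘(ℂ, Cn a) 𝓘(ℂ, Cn b) ω L x := L.contMDiff.contMDiffAt

variable [IsManifold 𝓘(ℂ, Cn n) ω D]

/-- The inverse is continuous and becomes holomorphic after composition with i, where it is the
inverse of φ on the hyperplane. For an immersion this implies that the inverse itself is
holomorphic. -/
theorem inducedChart_mem_holCharts : inducedChart hi hφ ∈ holCharts n D := by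
  apply OpenPartialHomeomorph.mem_maximalAtlas_of_contMDiffOn
  · intro q hq
    refine ContMDiffAt.contMDiffWithinAt ?_
    have h1 : ContMDiffAt 𝓘(ℂ, Cn n) 𝓘(ℂ, Cn (n + 1)) ω (fun q => φ (i q)) q :=
      (contMDiffAt_of_mem_maximalAtlas hφ.mem_holCharts hq).comp q
        (hi.isSmoothEmbedding.contMDiff q)
    exact ContMDiffAt.comp (g := tailL n) q (contMDiffAt_clm (tailL n) (φ (i q))) h1
  · intro w hw
    refine ContMDiffAt.contMDiffWithinAt ?_
    obtain ⟨F, _, _, hF⟩ := hi.isSmoothEmbedding.isImmersion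
    rw [ContMDiffAt.iff_comp_isImmersionAtOfComplement (hF ((inducedChart hi hφ).symm w))]
    refine ⟨(inducedChart hi hφ).continuousAt_symm hw, ?_⟩
    have h1 : ContMDiffAt 𝓘(ℂ, Cn n) 𝓘(ℂ, Cn (n + 1)) ω (fun w => φ.symm (hyper n w)) w :=
      (contMDiffAt_symm_of_mem_maximalAtlas hφ.mem_holCharts hw).comp w
        (contMDiffAt_clm (hyper n) w)
    refine h1.congr_of_eventuallyEq ?_
    filter_upwards [(inducedChart hi hφ).open_target.mem_nhds hw] with w' hw'
    exact apply_inducedChart_symm hi hφ hw'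

/-- Near p, the map q ↦ φ(i q) is the induced chart followed by the linear inclusion of the
hyperplane. -/
theorem restrictToD_eq {k : ℕ} {p : D} (hp : i p ∈ φ.source) (A : Covec (n + 1) k) :
    restrictToD i φ p A =
      (hyperPull A).compContinuousLinearMap (dChart (inducedChart hi hφ) p) := by
  have h1 : (fun q => φ (i q)) =ᶠ[𝓝 p] hyper n ∘ inducedChart hi hφ := by
    filter_upwards [(inducedChart hi hφ).open_source.mem_nhds hp] with q hq
    exact (hyper_inducedChart hi hφ hq).symm
  have h2 : mfderiv 𝓘(ℂ, Cn n) 𝓘(ℂ, Cn (n + 1)) (fun q => φ (i q)) p =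
      (hyper n).comp (mfderiv 𝓘(ℂ, Cn n) 𝓘(ℂ, Cn n) (inducedChart hi hφ) p : Cn n →L[ℂ] Cn n) := by
    rw [h1.mfderiv_eq, mfderiv_comp p ((contMDiffAt_clm (hyper n) _).mdifferentiableAt (by simp))
      (mdifferentiableAt_chart (inducedChart_mem_holCharts hi hφ) hp), mfderiv_eq_fderiv,
      ContinuousLinearMap.fderiv]
    rfl
  ext v
  rw [restrictToD, ContinuousAlternatingMap.compContinuousLinearMap_apply]
  refine congrArg A (funext fun j => ?_)
  exact congrArg (fun L : Cn n →L[ℂ] Cn (n + 1) => L (v j)) h2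

end Induced

end Adapted

/-! ### Integrals depending smoothly on a parameter -/

section Parametric

variable {E W : Type} [NormedAddCommGroup E] [NormedSpace ℝ E]
  [NormedAddCommGroup W] [NormedSpace ℝ W] [CompleteSpace W]

/-- Projecting t to [a, b] makes the integrand jointly continuous on U × ℝ without changing the
integral. -/
theorem continuousOn_parametric_integral {F : E → ℝ → W} {U : Set E} {a b : ℝ} (hab : a ≤ b)
    (h : ∀ x ∈ U, ∀ t ∈ Set.Icc a b, ContinuousAt (Function.uncurry F) (x, t)) :
    ContinuousOn (fun x => ∫ t in a..b, F x t) U := by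
  rw [continuousOn_iff_continuous_domRestrict]
  have hc : Continuous (Function.uncurry fun (x : U) (t : ℝ) => F x (Set.projIcc a b hab t)) := by
    rw [continuous_iff_continuousAt]
    rintro ⟨x, t⟩
    exact ContinuousAt.comp (g := Function.uncurry F)
      (f := fun q : U × ℝ => ((q.1 : E), ((Set.projIcc a b hab q.2 : Set.Icc a b) : ℝ)))
      (h x x.2 _ (Set.projIcc a b hab t).2)
      ((continuous_subtype_val.comp continuous_fst).prodMk
        (continuous_subtype_val.comp (continuous_projIcc.comp continuous_snd))).continuousAt
  have := intervalIntegral.continuous_parametric_intervalIntegral_of_continuous'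
    (μ := MeasureTheory.volume) hc a b
  refine this.congr fun x => ?_
  refine intervalIntegral.integral_congr fun t ht => ?_
  rw [Set.uIcc_of_le hab] at ht
  simp only [Set.projIcc_of_mem hab ht]

/-- Differentiation under the integral sign, by induction on k. Compactness of [a, b] provides one
neighbourhood of p on which regularity and a bound for the derivative hold for all t at once. -/
theorem contDiffAt_parametric_integral (k : ℕ) {F : E → ℝ → W} {p : E} {a b : ℝ} (hab : a ≤ b)
    (h : ∀ t ∈ Set.Icc a b, ContDiffAt ℝ k (Function.uncurry F) (p, t)) :
    ContDiffAt ℝ k (fun x => ∫ t in a..b, F x t) p := by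
  induction k generalizing W with
  | zero =>
    have h1 : ∀ t ∈ Set.Icc a b, ∀ᶠ z : E × ℝ in 𝓝 (p, t),
        ContinuousAt (Function.uncurry F) (z.1, z.2) := fun t ht => by
      have := (h t ht).eventually (by simp)
      exact this.mono fun z hz => hz.continuousAt
    have h2 := isCompact_Icc.eventually_forall_of_forall_eventually
      (P := fun x t => ContinuousAt (Function.uncurry F) (x, t)) h1
    obtain ⟨U, hU, hUo⟩ := h2.exists_mem
    exact contDiffAt_zero.2 ⟨U, hU, continuousOn_parametric_integral hab hUo⟩
  | succ k ih =>
    have h1 : ∀ t ∈ Set.Icc a b, ∀ᶠ z : E × ℝ in 𝓝 (p, t),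
        ContDiffAt ℝ (k + 1 : ℕ) (Function.uncurry F) (z.1, z.2) := fun t ht => by
      have := (h t ht).eventually (natCast_ne_infty _)
      exact this
    let F' : E → ℝ → E →L[ℝ] W := fun x t =>
      (fderiv ℝ (Function.uncurry F) (x, t)).comp (ContinuousLinearMap.inl ℝ E ℝ)
    have hF' : ∀ z : E × ℝ, ContDiffAt ℝ (k + 1 : ℕ) (Function.uncurry F) z →
        ContDiffAt ℝ k (Function.uncurry F') z := fun z hz =>
      (hz.fderiv_right (m := k) (by push_cast; rfl)).clm_comp contDiffAt_const
    have hc : ContinuousOn (fun t => ‖F' p t‖) (Set.Icc a b) := fun t ht =>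
      ((hF' (p, t) (h t ht)).continuousAt.comp (f := fun t => (p, t))
        (by fun_prop : ContinuousAt (fun t => (p, t)) t)).norm.continuousWithinAt
    obtain ⟨C, hC⟩ := isCompact_Icc.bddAbove_image hc
    have h3 : ∀ t ∈ Set.Icc a b, ∀ᶠ z : E × ℝ in 𝓝 (p, t), ‖F' z.1 z.2‖ ≤ C + 1 := fun t ht => by
      have hcont : ContinuousAt (fun z : E × ℝ => ‖F' z.1 z.2‖) (p, t) :=
        (hF' (p, t) (h t ht)).continuousAt.norm
      exact (hcont.eventually_lt continuousAt_const
        (lt_of_le_of_lt (hC ⟨t, ht, rfl⟩) (lt_add_one C))).mono fun z hz => hz.le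
    have h2 := (isCompact_Icc.eventually_forall_of_forall_eventually
      (P := fun x t => ContDiffAt ℝ (k + 1 : ℕ) (Function.uncurry F) (x, t)) h1).and
      (isCompact_Icc.eventually_forall_of_forall_eventually (P := fun x t => ‖F' x t‖ ≤ C + 1) h3)
    obtain ⟨U, hU, hUo⟩ := h2.exists_mem
    push_cast
    rw [contDiffAt_succ_iff_hasFDerivAt]
    refine ⟨fun x => ∫ t in a..b, F' x t, ⟨interior U, interior_mem_nhds.2 hU, fun x hx => ?_⟩,
      ih fun t ht => hF' _ (h t ht)⟩
    have hcF : ∀ x ∈ interior U, ContinuousOn (F x) (Set.uIcc a b) := fun x hx t ht => by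
      rw [Set.uIcc_of_le hab] at ht
      exact (((hUo x (interior_subset hx)).1 t ht).continuousAt.comp (f := fun t => (x, t))
        (by fun_prop : ContinuousAt (fun t => (x, t)) t)).continuousWithinAt
    have hcF' : ContinuousOn (F' x) (Set.uIcc a b) := fun t ht => by
      rw [Set.uIcc_of_le hab] at ht
      exact ((hF' (x, t) ((hUo x (interior_subset hx)).1 t ht)).continuousAt.comp
        (f := fun t => (x, t)) (by fun_prop : ContinuousAt (fun t => (x, t)) t)).continuousWithinAt
    have hm : ∀ {G : ℝ → W}, ContinuousOn G (Set.uIcc a b) → MeasureTheory.AEStronglyMeasurable G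
        (MeasureTheory.volume.restrict (Set.uIoc a b)) := fun hG =>
      (hG.mono Set.uIoc_subset_uIcc).aestronglyMeasurable measurableSet_uIoc
    refine intervalIntegral.hasFDerivAt_integral_of_dominated_of_fderiv_le (s := interior U)
      (bound := fun _ => C + 1) (isOpen_interior.mem_nhds hx) ?_ (hcF x hx).intervalIntegrable
      ((hcF'.mono Set.uIoc_subset_uIcc).aestronglyMeasurable measurableSet_uIoc) ?_
      intervalIntegrable_const ?_
    · filter_upwards [isOpen_interior.mem_nhds hx] with x' hx'
      exact hm (hcF x' hx')
    · refine Filter.Eventually.of_forall fun t ht x' hx' => ?_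
      have ht' : t ∈ Set.Icc a b := by rw [← Set.uIcc_of_le hab]; exact Set.uIoc_subset_uIcc ht
      exact (hUo x' (interior_subset hx')).2 t ht'
    · refine Filter.Eventually.of_forall fun t ht x' hx' => ?_
      have ht' : t ∈ Set.Icc a b := by rw [← Set.uIcc_of_le hab]; exact Set.uIoc_subset_uIcc ht
      have hd : DifferentiableAt ℝ (Function.uncurry F) (x', t) :=
        ((hUo x' (interior_subset hx')).1 t ht').differentiableAt (by simp)
      have hin : HasFDerivAt (fun x : E => (x, t)) (ContinuousLinearMap.inl ℝ E ℝ) x' :=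
        hasFDerivAt_prodMk_left x' t
      exact hd.hasFDerivAt.comp x' hin

end Parametric

/-! ### Scaling the first coordinate, and division by it -/

section Scaling

variable {n : ℕ}

/-- The map `(z₀, z₁, …, z_n) ↦ (a z₀, z₁, …, z_n)`. -/
def scal (a : ℂ) (y : Cn (n + 1)) : Cn (n + 1) := Fin.cons (a * y 0) fun j => y j.succ

@[simp] theorem scal_zero_apply (a : ℂ) (y : Cn (n + 1)) : scal a y 0 = a * y 0 := rfl

@[simp] theorem scal_succ_apply (a : ℂ) (y : Cn (n + 1)) (j : Fin n) :
    scal a y j.succ = y j.succ := rfl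

theorem scal_one (y : Cn (n + 1)) : scal 1 y = y := by
  funext j; refine Fin.cases ?_ (fun j => ?_) j <;> simp

theorem scal_scal (a b : ℂ) (y : Cn (n + 1)) : scal a (scal b y) = scal (a * b) y := by
  funext j; refine Fin.cases ?_ (fun j => ?_) j <;> simp [mul_assoc]

theorem scal_of_eq_zero (a : ℂ) {y : Cn (n + 1)} (hy : y 0 = 0) : scal a y = y := by
  funext j; refine Fin.cases ?_ (fun j => ?_) j <;> simp [hy]

theorem contDiff_scal {l : WithTop ℕ∞} : ContDiff ℝ l fun z : Cn (n + 1) × ℂ => scal z.2 z.1 := by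
  refine contDiff_pi.2 fun j => ?_
  have h : ∀ j, ContDiff ℝ l fun z : Cn (n + 1) × ℂ => z.1 j := fun j =>
    (contDiff_coord j).comp contDiff_fst
  refine Fin.cases ?_ (fun j => ?_) j
  · exact contDiff_snd.mul (h 0)
  · exact h j.succ

theorem hasDerivAt_scal {c : ℝ → ℂ} {c' : ℂ} {t : ℝ} (hc : HasDerivAt c c' t) (y : Cn (n + 1)) :
    HasDerivAt (fun t => scal (c t) y) (Pi.single 0 (c' * y 0) : Cn (n + 1)) t := by
  refine hasDerivAt_pi.2 fun j => ?_
  refine Fin.cases ?_ (fun j => ?_) j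
  · simpa using hc.mul_const (y 0)
  · simpa using hasDerivAt_const t (y j.succ)

/-- The derivative of `t ↦ h (c(t) z₀, z₁, …)`. -/
theorem hasDerivAt_comp_scal {h : Cn (n + 1) → ℂ} {c : ℝ → ℂ} {c' : ℂ} {t : ℝ}
    (hc : HasDerivAt c c' t) {y : Cn (n + 1)} (hh : DifferentiableAt ℝ h (scal (c t) y)) :
    HasDerivAt (fun t => h (scal (c t) y))
      (c' * y 0 * wirt h (scal (c t) y) + conj (c' * y 0) * wirtBar h (scal (c t) y)) t := by
  rw [← fderiv_single_eq]
  exact hh.hasFDerivAt.comp_hasDerivAt t (hasDerivAt_scal hc y)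

theorem contDiffAt_infty_of_forall {E W : Type*} [NormedAddCommGroup E] [NormedSpace ℝ E]
    [NormedAddCommGroup W] [NormedSpace ℝ W] {f : E → W} {x : E}
    (h : ∀ k : ℕ, ContDiffAt ℝ k f x) : ContDiffAt ℝ ∞ f x := contDiffAt_infty.2 h

/-- Every `scal a` fixes p because p₀ = 0; compactness of K makes the neighbourhood uniform in a. -/
theorem eventually_scal {P : Cn (n + 1) → Prop} {p : Cn (n + 1)} (hp : p 0 = 0)
    (h : ∀ᶠ y in 𝓝 p, P y) {K : Set ℂ} (hK : IsCompact K) :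
    ∀ᶠ y in 𝓝 p, ∀ a ∈ K, P (scal a y) := by
  refine hK.eventually_forall_of_forall_eventually fun a _ => ?_
  have : Filter.Tendsto (fun z : Cn (n + 1) × ℂ => scal z.2 z.1) (𝓝 (p, a)) (𝓝 p) := by
    have := (contDiff_scal (n := n) (l := 0)).continuous.continuousAt (x := (p, a))
    rw [ContinuousAt] at this
    simpa only [scal_of_eq_zero a hp] using this
  exact this.eventually h

theorem isCompact_image_ofReal (a b : ℝ) :
    IsCompact ((fun t : ℝ => (t : ℂ)) '' Set.Icc a b) := isCompact_Icc.image Complex.continuous_ofReal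

/-- A smooth function which is holomorphic and vanishes on `z₀ = 0` is divisible by `z₀`. -/
theorem exists_eq_coord_mul {h : Cn (n + 1) → ℂ} {p : Cn (n + 1)} (hp : p 0 = 0)
    (hh : ContDiffAt ℝ ∞ h p)
    (hol : ∀ᶠ y in 𝓝 p, ∀ v, fderiv ℝ h y (Complex.I • v) = Complex.I • fderiv ℝ h y v)
    (h0 : ∀ᶠ y in 𝓝 p, y 0 = 0 → h y = 0) :
    ∃ s : Cn (n + 1) → ℂ, ContDiffAt ℝ ∞ s p ∧ (∀ᶠ y in 𝓝 p, h y = y 0 * s y) ∧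
      s p = fderiv ℝ h p (Pi.single 0 1) := by
  have hbar : ∀ᶠ y in 𝓝 p, wirtBar h y = 0 := hol.mono fun y hy => by
    change (1 / 2 : ℂ) • (fderiv ℝ h y (Pi.single 0 1) +
      Complex.I • fderiv ℝ h y (Complex.I • (Pi.single 0 1 : Cn (n + 1)))) = 0
    rw [hy]
    simp only [smul_eq_mul]
    linear_combination (1 / 2) * (fderiv ℝ h y (Pi.single 0 1)) * Complex.I_mul_I
  have hw : wirt h p = fderiv ℝ h p (Pi.single 0 1) := by
    rw [fderiv_single_eq, hbar.self_of_nhds]; simp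
  have hws : ContDiffAt ℝ ∞ (wirt h) p := by rw [wirt_eq_dC]; exact hh.dC_infty
  -- Hadamard's quotient: since ∂h/∂z̄₀ = 0, the derivative of t ↦ h(tz₀, z₁, …) is z₀ times ∂h/∂z₀
  -- at the scaled point, and h vanishes at t = 0.
  refine ⟨fun y => ∫ t in (0 : ℝ)..1, wirt h (scal (t : ℂ) y), ?_, ?_, ?_⟩
  · refine contDiffAt_infty_of_forall fun k => contDiffAt_parametric_integral k zero_le_one
      fun t _ => ?_
    have h1 : ContDiffAt ℝ k (fun z : Cn (n + 1) × ℝ => scal (z.2 : ℂ) z.1) (p, t) :=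
      (contDiff_scal.comp (contDiff_fst.prodMk
        (Complex.ofRealCLM.contDiff.comp contDiff_snd))).contDiffAt
    refine ContDiffAt.comp (g := wirt h) (p, t) ?_ h1
    change ContDiffAt ℝ k (wirt h) (scal (t : ℂ) p)
    rw [scal_of_eq_zero _ hp]
    exact hws.of_le (natCast_le_infty k)
  · have hd : ∀ᶠ y in 𝓝 p, ContDiffAt ℝ 1 h y := (hh.of_le (natCast_le_infty 1)).eventually (by simp)
    filter_upwards [eventually_scal hp (hd.and (hbar.and h0)) (isCompact_image_ofReal 0 1)]
      with y hy
    have hy' : ∀ t ∈ Set.uIcc (0 : ℝ) 1, _ := fun t ht => hy _ ⟨t, by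
      rwa [Set.uIcc_of_le zero_le_one] at ht, rfl⟩
    have hder : ∀ t ∈ Set.uIcc (0 : ℝ) 1, HasDerivAt (fun t : ℝ => h (scal (t : ℂ) y))
        (y 0 * wirt h (scal (t : ℂ) y)) t := fun t ht => by
      have := hasDerivAt_comp_scal (h := h) (y := y) (Complex.ofRealCLM.hasDerivAt (x := t))
        ((hy' t ht).1.differentiableAt (by norm_num))
      simp only [Complex.ofRealCLM_apply, Complex.ofReal_one, one_mul] at this
      rw [(hy' t ht).2.1, mul_zero, add_zero] at this
      exact this
    have hcont : ContinuousOn (fun t : ℝ => y 0 * wirt h (scal (t : ℂ) y)) (Set.uIcc 0 1) := by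
      refine continuousOn_const.mul fun t ht => ContinuousAt.continuousWithinAt ?_
      have h1 : ContDiffAt ℝ 0 (wirt h) (scal (t : ℂ) y) := by
        rw [wirt_eq_dC]; exact (hy' t ht).1.dC (by norm_num)
      refine ContinuousAt.comp (f := fun t : ℝ => scal (t : ℂ) y) h1.continuousAt ?_
      exact (hasDerivAt_scal (Complex.ofRealCLM.hasDerivAt (x := t)) y).continuousAt
    have := intervalIntegral.integral_eq_sub_of_hasDerivAt hder hcont.intervalIntegrable
    rw [← intervalIntegral.integral_const_mul, this]
    have h00 : h (scal ((0 : ℝ) : ℂ) y) = 0 :=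
      (hy' 0 (by simp)).2.2 (by simp)
    rw [h00, Complex.ofReal_one, scal_one, sub_zero]
  · simp only [scal_of_eq_zero _ hp]
    rw [intervalIntegral.integral_const, hw]; simp

end Scaling

/-! ### Smooth functions and compactly supported forms -/

theorem contDiffGroupoid_complex_le (m : ℕ) :
    contDiffGroupoid ω 𝓘(ℂ, Cn m) ≤ contDiffGroupoid ∞ 𝓘(ℝ, Cn m) := by
  rw [contDiffGroupoid, contDiffGroupoid]
  apply groupoid_of_pregroupoid_le
  intro f s hfs
  have h : ContDiffOn ℂ ω f s := by
    simpa [contDiffPregroupoid] using hfs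
  have h2 : ContDiffOn ℝ ∞ f s := (h.restrict_scalars ℝ).of_le (by simp)
  simpa [contDiffPregroupoid] using h2

section SmoothFunctions

variable {m k : ℕ} {M : Type*} [TopologicalSpace M] [ChartedSpace (Cn m) M]

theorem isManifold_real [IsManifold 𝓘(ℂ, Cn m) ω M] : IsManifold 𝓘(ℝ, Cn m) ∞ M :=
  { toHasGroupoid := hasGroupoid_of_le inferInstance (contDiffGroupoid_complex_le m) }

variable (m) in
/-- The function `u` on `M` is smooth. -/
def SmoothFn (u : M → ℂ) : Prop :=
  ∀ φ ∈ holCharts m M, ∀ y ∈ φ.target, ContDiffAt ℝ ∞ (fun y => u (φ.symm y)) y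

theorem smoothFn_ofReal [IsManifold 𝓘(ℂ, Cn m) ω M] (f : C^∞⟮𝓘(ℝ, Cn m), M; 𝓘(ℝ, ℝ), ℝ⟯) :
    SmoothFn m fun x : M => ((f x : ℝ) : ℂ) := fun φ hφ y hy => by
  have : IsManifold 𝓘(ℝ, Cn m) ∞ M := isManifold_real
  have h1 : φ ∈ IsManifold.maximalAtlas 𝓘(ℝ, Cn m) ∞ M :=
    StructureGroupoid.maximalAtlas_mono (contDiffGroupoid_complex_le m) hφ
  have h2 : ContMDiffAt 𝓘(ℝ, Cn m) 𝓘(ℝ, ℝ) ∞ (fun y => f (φ.symm y)) y :=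
    (f.contMDiff _).comp y (contMDiffAt_symm_of_mem_maximalAtlas h1 hy)
  exact Complex.ofRealCLM.contDiff.contDiffAt.comp y (contMDiffAt_iff_contDiffAt.1 h2)

/-- The product of a function and a form. -/
def fmul (u : M → ℂ) (θ : Form m M k) : Form m M k := fun x => u x • θ x

theorem sum_fmul {ι : Type*} {s : Finset ι} {u : ι → M → ℂ} (hu : ∀ x, ∑ j ∈ s, u j x = 1)
    (θ : Form m M k) : ∑ j ∈ s, fmul (u j) θ = θ := by
  funext x
  have : (∑ j ∈ s, fmul (u j) θ) x = ∑ j ∈ s, u j x • θ x := Finset.sum_apply x s _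
  rw [this, ← Finset.sum_smul, hu, one_smul]

theorem fmul_sum {ι : Type*} {s : Finset ι} (u : M → ℂ) (θ : ι → Form m M k) :
    fmul u (∑ j ∈ s, θ j) = ∑ j ∈ s, fmul u (θ j) := by
  funext x
  have h1 : (∑ j ∈ s, fmul u (θ j)) x = ∑ j ∈ s, u x • θ j x := Finset.sum_apply x s _
  have h2 : (∑ j ∈ s, θ j) x = ∑ j ∈ s, θ j x := Finset.sum_apply x s _
  rw [h1, fmul, h2, Finset.smul_sum]

variable [IsManifold 𝓘(ℂ, Cn m) ω M]

/-- The image of K in M is compact, hence closed in the Hausdorff space M, and x lies outside it;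
this is what makes extension by zero smooth. -/
theorem ofChart_eventuallyEq_zero [T2Space M] {ψ : OpenPartialHomeomorph M (Cn m)}
    {F : Cn m → Covec m k} {K : Set (Cn m)} (hK : IsCompact K) (hKt : K ⊆ ψ.target)
    (hF : ∀ y ∈ ψ.target, y ∉ K → F y = 0) {x : M} (hx : x ∉ ψ.source) :
    ofChart ψ F =ᶠ[𝓝 x] (0 : Form m M k) := by
  have hc : IsClosed (ψ.symm '' K) := (hK.image_of_continuousOn (ψ.continuousOn_symm.mono hKt)).isClosed
  have hxK : x ∉ ψ.symm '' K := by
    rintro ⟨y, hy, rfl⟩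
    exact hx (ψ.map_target (hKt hy))
  filter_upwards [hc.isOpen_compl.mem_nhds hxK] with x' hx'
  by_cases h : x' ∈ ψ.source
  · rw [ofChart_of_mem _ h, hF _ (ψ.map_source h) fun h' => hx' ⟨_, h', ψ.left_inv h⟩]
    rfl
  · rw [ofChart_of_notMem _ h]; rfl

theorem inChart_ofChart_eventuallyEq {ψ : OpenPartialHomeomorph M (Cn m)} (hψ : ψ ∈ holCharts m M)
    (F : Cn m → Covec m k) {y : Cn m} (hy : y ∈ ψ.target) :
    inChart ψ (ofChart ψ F) =ᶠ[𝓝 y] F := by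
  filter_upwards [ψ.open_target.mem_nhds hy] with y' hy'
  exact inChart_ofChart hψ F hy'

theorem smoothAtPt_ofChart_of_mem {ψ : OpenPartialHomeomorph M (Cn m)} (hψ : ψ ∈ holCharts m M)
    {F : Cn m → Covec m k} {x : M} (hx : x ∈ ψ.source) (hF : ContDiffAt ℝ ∞ F (ψ x)) :
    SmoothAtPt (ofChart ψ F) x :=
  smoothAtPt_of_chart hψ hx
    (hF.congr_of_eventuallyEq (inChart_ofChart_eventuallyEq hψ F (ψ.map_source hx)))

theorem smoothAtPt_ofChart [T2Space M] {ψ : OpenPartialHomeomorph M (Cn m)} (hψ : ψ ∈ holCharts m M)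
    {F : Cn m → Covec m k} {K : Set (Cn m)} (hK : IsCompact K) (hKt : K ⊆ ψ.target)
    (hF0 : ∀ y ∈ ψ.target, y ∉ K → F y = 0) (hF : ∀ y ∈ ψ.target, ContDiffAt ℝ ∞ F y) (x : M) :
    SmoothAtPt (ofChart ψ F) x := by
  by_cases hx : x ∈ ψ.source
  · exact smoothAtPt_ofChart_of_mem hψ hx (hF _ (ψ.map_source hx))
  · exact (SmoothAtPt.zero x).congr (ofChart_eventuallyEq_zero hK hKt hF0 hx).symm

theorem delM_ofChart_of_mem {c : ℂ} {ψ : OpenPartialHomeomorph M (Cn m)} (hψ : ψ ∈ holCharts m M)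
    {F : Cn m → Covec m k} {x : M} (hx : x ∈ ψ.source) (hF : DifferentiableAt ℝ F (ψ x)) :
    delM c (ofChart ψ F) x = ofChart ψ (delC c F) x := by
  have h1 := inChart_ofChart_eventuallyEq hψ F (ψ.map_source hx)
  rw [delM_eq hψ hx (hF.congr_of_eventuallyEq h1), ofChart_of_mem _ hx, delC, h1.fderiv_eq]
  rfl

theorem delM_ofChart [T2Space M] {c : ℂ} {ψ : OpenPartialHomeomorph M (Cn m)}
    (hψ : ψ ∈ holCharts m M) {F : Cn m → Covec m k} {K : Set (Cn m)} (hK : IsCompact K)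
    (hKt : K ⊆ ψ.target) (hF0 : ∀ y ∈ ψ.target, y ∉ K → F y = 0)
    (hF : ∀ y ∈ ψ.target, ContDiffAt ℝ ∞ F y) :
    delM c (ofChart ψ F) = ofChart ψ (delC c F) := by
  funext x
  by_cases hx : x ∈ ψ.source
  · exact delM_ofChart_of_mem hψ hx ((hF _ (ψ.map_source hx)).differentiableAt (by simp))
  · rw [ofChart_of_notMem _ hx]
    exact (delM_congr (ofChart_eventuallyEq_zero hK hKt hF0 hx)).trans (congrFun (delM_zero c) x)

theorem dChart_smul (ψ : OpenPartialHomeomorph M (Cn m)) (x : M) (c : ℂ) (v : Cn m) :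
    dChart ψ x (c • v) = c • dChart ψ x v :=
  map_smul (mfderiv 𝓘(ℂ, Cn m) 𝓘(ℂ, Cn m) ψ x : Cn m →L[ℂ] Cn m) c v

theorem HasBidegree.comp {n p q : ℕ} {A : Covec n k} (hA : HasBidegree p q A) {L : Cn m →L[ℝ] Cn n}
    (hL : ∀ (c : ℂ) v, L (c • v) = c • L v) : HasBidegree p q (A.compContinuousLinearMap L) := by
  intro c v
  simp only [ContinuousAlternatingMap.compContinuousLinearMap_apply]
  rw [← hA]
  congr 1
  funext j
  exact hL c (v j)

theorem hasBidegree_ofChart {p q : ℕ} {ψ : OpenPartialHomeomorph M (Cn m)} {F : Cn m → Covec m k}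
    (hF : ∀ y, HasBidegree p q (F y)) (x : M) : HasBidegree p q (ofChart ψ F x) := by
  by_cases hx : x ∈ ψ.source
  · rw [ofChart_of_mem _ hx]
    exact (hF _).comp (dChart_smul ψ x)
  · rw [ofChart_of_notMem _ hx]
    exact HasBidegree.zero

/-- The sum of the images of `∂` and `∂̄` in top degree. -/
def aeppliExact (m : ℕ) (M : Type*) [TopologicalSpace M] [ChartedSpace (Cn m) M] :
    Submodule ℂ (Form m M (m + m)) :=
  delImage m M m m (m + m) ⊔ delBarImage m M m m (m + m)

theorem del_mem_aeppliExact {p : ℕ} {η : Form (p + 1) M (p + 1 + p)}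
    [ChartedSpace (Cn (p + 1)) M] (hη : η ∈ smoothForms (p + 1) M p (p + 1) (p + 1 + p)) :
    del η ∈ aeppliExact (p + 1) M :=
  Submodule.mem_sup_left (Submodule.subset_span ⟨p, rfl, η, hη, rfl⟩)

theorem delBar_mem_aeppliExact {p : ℕ} {η : Form (p + 1) M (p + 1 + p)}
    [ChartedSpace (Cn (p + 1)) M] (hη : η ∈ smoothForms (p + 1) M (p + 1) p (p + 1 + p)) :
    delBar η ∈ aeppliExact (p + 1) M :=
  Submodule.mem_sup_right (Submodule.subset_span ⟨p, rfl, η, hη, rfl⟩)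

/-- The primitive is u times the contraction of the volume form with the l-th coordinate field,
extended by zero; the extension is smooth because u vanishes off a compact subset of the chart. -/
theorem ofChart_dC_mem_aeppliExact [T2Space M] {c : ℂ} (hc : c = Complex.I ∨ c = -Complex.I)
    {ψ : OpenPartialHomeomorph M (Cn m)} (hψ : ψ ∈ holCharts m M) {u : Cn m → ℂ} {K : Set (Cn m)}
    (hK : IsCompact K) (hKt : K ⊆ ψ.target) (hu0 : ∀ y ∈ ψ.target, y ∉ K → u y = 0)
    (hu : ∀ y ∈ ψ.target, ContDiffAt ℝ ∞ u y) (l : Fin m) :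
    ofChart ψ (fun w => dC c (Pi.single l 1) u w • vol m) ∈ aeppliExact m M := by
  obtain _ | p := m
  · exact l.elim0
  have hcc : c * c = -1 := by rcases hc with rfl | rfl <;> simp
  let A : Covec (p + 1) (p + 1 + p + 1) := vol (p + 1)
  let F : Cn (p + 1) → Covec (p + 1) (p + 1 + p) := fun y => u y • iotaC c l A
  have hF0 : ∀ y ∈ ψ.target, y ∉ K → F y = 0 := fun y hy hyK => by
    change u y • _ = _
    rw [hu0 y hy hyK]; exact zero_smul ℂ (iotaC c l A)
  have hF : ∀ y ∈ ψ.target, ContDiffAt ℝ ∞ F y := fun y hy => (hu y hy).smul contDiffAt_const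
  have key : delM c (ofChart ψ F) = ofChart ψ (fun w => dC c (Pi.single l 1) u w • vol (p + 1)) := by
    rw [delM_ofChart hψ hK hKt hF0 hF]
    funext x
    by_cases hx : x ∈ ψ.source
    · rw [ofChart_of_mem _ hx, ofChart_of_mem _ hx]
      congr 1
      exact delC_smul_iotaC (n := p + 1) (k := p + 1 + p) hcc (by omega) A l ((hu _ (ψ.map_source hx)).differentiableAt (by simp))
    · rw [ofChart_of_notMem _ hx, ofChart_of_notMem _ hx]
  have hs : SmoothOn Set.univ (ofChart ψ F) :=
    (smoothOn_iff isOpen_univ).2 fun x _ => smoothAtPt_ofChart hψ hK hKt hF0 hF x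
  rw [← key]
  rcases hc with rfl | rfl
  · exact del_mem_aeppliExact ⟨hs, hasBidegree_ofChart fun y =>
      (hasBidegree_iotaC (n := p + 1) (k := p + 1 + p) (p := p) rfl (by omega) A l).smul (u y)⟩
  · rw [← delBar_eq_delM]
    exact delBar_mem_aeppliExact ⟨hs, hasBidegree_ofChart fun y =>
      (hasBidegree_iotaC_bar (n := p + 1) (k := p + 1 + p) (p := p) rfl (by omega) A l).smul (u y)⟩

end SmoothFunctions

/-! ### Polar forms -/

section PolarCovectors

variable {n k : ℕ}

theorem PolarAt.contDiffAt {f : Cn (n + 1) → ℂ} {p : Cn (n + 1)} (h : PolarAt f p) (hp : p 0 ≠ 0) :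
    ContDiffAt ℝ ∞ f p := by
  obtain ⟨a, b, G, hG, h⟩ := h
  refine (((contDiff_poleMon a b).contDiffAt.inv (poleMon_ne_zero hp)).mul hG).congr_of_eventuallyEq ?_
  filter_upwards [h, (continuous_apply 0).continuousAt.eventually_ne hp] with y h1 h2
  change f y = (poleMon a b y)⁻¹ * G y
  rw [← h1 h2, inv_mul_cancel_left₀ (poleMon_ne_zero h2)]

/-- Every coefficient of the form `F` has a pole along `z₀ = 0` at `p`. -/
def PolarCov (F : Cn (n + 1) → Covec (n + 1) k) (p : Cn (n + 1)) : Prop :=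
  ∀ L : Covec (n + 1) k →L[ℂ] ℂ, PolarAt (fun y => L (F y)) p

theorem PolarCov.contDiffAt {F : Cn (n + 1) → Covec (n + 1) k} {p : Cn (n + 1)} (h : PolarCov F p)
    (hp : p 0 ≠ 0) : ContDiffAt ℝ ∞ F p :=
  contDiffAt_covec_iff.2 fun v => (h (evalC v)).contDiffAt hp

theorem PolarCov.of_contDiffAt {F : Cn (n + 1) → Covec (n + 1) k} {p : Cn (n + 1)}
    (h : ContDiffAt ℝ ∞ F p) : PolarCov F p := fun L =>
  PolarAt.of_contDiffAt ((L.restrictScalars ℝ).contDiff.contDiffAt.comp p h)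

theorem PolarCov.of_exponents {F G : Cn (n + 1) → Covec (n + 1) k} {p : Cn (n + 1)} {a b : ℕ}
    (hG : ContDiffAt ℝ ∞ G p)
    (h : ∀ᶠ y in 𝓝 p, y 0 ≠ 0 → (y 0 ^ a * (conj (y 0)) ^ b) • F y = G y) : PolarCov F p := fun L => by
  refine PolarAt.of_exponents (a := a) (b := b) (G := fun y => L (G y))
    ((L.restrictScalars ℝ).contDiff.contDiffAt.comp p hG) (h.mono fun y hy h0 => ?_)
  rw [← hy h0, map_smul, smul_eq_mul]

theorem PolarCov.congr {F F' : Cn (n + 1) → Covec (n + 1) k} {p : Cn (n + 1)} (h : PolarCov F p)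
    (he : ∀ᶠ y in 𝓝 p, y 0 ≠ 0 → F y = F' y) : PolarCov F' p := fun L =>
  (h L).congr (he.mono fun _ hy h0 => congrArg L (hy h0))

/-- The coordinates of covectors with respect to a basis. -/
def coordC (j : Fin (Module.finrank ℂ (Covec n k))) : Covec n k →L[ℂ] ℂ :=
  LinearMap.toContinuousLinearMap ((Module.finBasis ℂ (Covec n k)).coord j)

theorem sum_coordC (A : Covec n k) :
    ∑ j, coordC j A • Module.finBasis ℂ (Covec n k) j = A :=
  (Module.finBasis ℂ (Covec n k)).sum_repr A

theorem PolarCov.exists_exponents {F : Cn (n + 1) → Covec (n + 1) k} {p : Cn (n + 1)}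
    (h : PolarCov F p) : ∃ (a b : ℕ) (G : Cn (n + 1) → Covec (n + 1) k), ContDiffAt ℝ ∞ G p ∧
      ∀ᶠ y in 𝓝 p, y 0 ≠ 0 → (y 0 ^ a * (conj (y 0)) ^ b) • F y = G y := by
  choose a b G hG hF using fun j => h (coordC j)
  -- The sum of all exponents dominates each of them and serves as a common exponent.
  let A := ∑ j, (a j + 1)
  let B := ∑ j, (b j + 1)
  have hA : ∀ j, a j + 1 ≤ A := fun j =>
    Finset.single_le_sum (f := fun j => a j + 1) (fun _ _ => Nat.zero_le _) (Finset.mem_univ j)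
  have hB : ∀ j, b j + 1 ≤ B := fun j =>
    Finset.single_le_sum (f := fun j => b j + 1) (fun _ _ => Nat.zero_le _) (Finset.mem_univ j)
  refine ⟨A, B, fun y => ∑ j, (y 0 ^ (A - (a j + 1)) * (conj (y 0)) ^ (B - (b j + 1)) * G j y) •
    Module.finBasis ℂ (Covec (n + 1) k) j, ?_, ?_⟩
  · exact ContDiffAt.sum fun j _ => ((((contDiff_coord 0).pow _).mul
      ((contDiff_conj_coord 0).pow _)).contDiffAt.mul (hG j)).smul contDiffAt_const
  · filter_upwards [Filter.eventually_all.2 hF] with y hy h0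
    conv_lhs => rw [← sum_coordC (F y), Finset.smul_sum]
    refine Finset.sum_congr rfl fun j _ => ?_
    rw [smul_smul, ← hy j h0]
    congr 1
    have e1 : y 0 ^ A = y 0 ^ (A - (a j + 1)) * y 0 ^ (a j + 1) := by
      rw [← pow_add, Nat.sub_add_cancel (hA j)]
    have e2 : conj (y 0) ^ B = conj (y 0) ^ (B - (b j + 1)) * conj (y 0) ^ (b j + 1) := by
      rw [← pow_add, Nat.sub_add_cancel (hB j)]
    rw [e1, e2, poleMon]; ring

/-- The pullback of covectors as a linear map. -/
def pullL {m : ℕ} (L : Cn m →L[ℝ] Cn n) : Covec n k →ₗ[ℂ] Covec m k where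
  toFun A := A.compContinuousLinearMap L
  map_add' _ _ := rfl
  map_smul' _ _ := rfl

/-- If T₀ = z₀s with s nonvanishing, a pole in T₀ is a pole of the same order in z₀; the unit
s^(a+1) s̄^(b+1) is absorbed in the numerator. -/
theorem PolarAt.comp {f : Cn (n + 1) → ℂ} {T : Cn (n + 1) → Cn (n + 1)} {s : Cn (n + 1) → ℂ}
    {p : Cn (n + 1)} (hf : PolarAt f (T p)) (hT : ContDiffAt ℝ ∞ T p) (hs : ContDiffAt ℝ ∞ s p)
    (hs0 : s p ≠ 0) (h : ∀ᶠ y in 𝓝 p, T y 0 = y 0 * s y) : PolarAt (fun y => f (T y)) p := by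
  obtain ⟨a, b, G, hG, hf⟩ := hf
  have hsc : ContDiffAt ℝ ∞ (fun y => s y ^ (a + 1) * (conj (s y)) ^ (b + 1)) p :=
    (hs.pow _).mul ((Complex.conjCLE.contDiff.contDiffAt.comp p hs).pow _)
  have hne : ∀ y, s y ≠ 0 → s y ^ (a + 1) * (conj (s y)) ^ (b + 1) ≠ 0 := fun y hy =>
    mul_ne_zero (pow_ne_zero _ hy) (pow_ne_zero _ (by simpa using hy))
  refine ⟨a, b, fun y => (s y ^ (a + 1) * (conj (s y)) ^ (b + 1))⁻¹ * G (T y),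
    (hsc.inv (hne p hs0)).mul (hG.comp p hT), ?_⟩
  filter_upwards [h, hT.continuousAt.eventually hf, hs.continuousAt.eventually_ne hs0]
    with y h1 h2 h3 h0
  rw [← h2 (by rw [h1]; exact mul_ne_zero h0 h3), poleMon, poleMon, h1, eq_inv_mul_iff_mul_eq₀ (hne y h3),
    map_mul]
  ring

theorem PolarCov.pullback {F : Cn (n + 1) → Covec (n + 1) k} {T : Cn (n + 1) → Cn (n + 1)}
    {s : Cn (n + 1) → ℂ} {p : Cn (n + 1)} (hF : PolarCov F (T p)) (hT : ContDiffAt ℝ ∞ T p)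
    (hs : ContDiffAt ℝ ∞ s p) (hs0 : s p ≠ 0) (h : ∀ᶠ y in 𝓝 p, T y 0 = y 0 * s y) :
    PolarCov (fun y => (F (T y)).compContinuousLinearMap (fderiv ℝ T y)) p := fun L => by
  have h1 : ∀ j, PolarAt (fun y => coordC j (F (T y)) * L
      ((Module.finBasis ℂ (Covec (n + 1) k) j).compContinuousLinearMap (fderiv ℝ T y))) p := fun j => by
    refine ((hF (coordC j)).comp hT hs hs0 h).mul (PolarAt.of_contDiffAt ?_)
    exact (L.restrictScalars ℝ).contDiff.contDiffAt.comp p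
      (contDiffAt_pullback (F := fun _ => _) hT le_rfl contDiffAt_const)
  refine (PolarAt.sum (s := Finset.univ) fun j _ => h1 j).congr (Filter.Eventually.of_forall fun y _ => ?_)
  rw [Finset.sum_apply]
  change _ = L (pullL (fderiv ℝ T y) (F (T y)))
  conv_rhs => rw [← sum_coordC (F (T y)), map_sum, map_sum]
  refine Finset.sum_congr rfl fun j _ => ?_
  rw [map_smul, map_smul, smul_eq_mul]; rfl

end PolarCovectors

/-! ### Polar forms on the manifold and changes of adapted charts -/

section PolarForms

variable {n k : ℕ} {X : Type*} [TopologicalSpace X] [ChartedSpace (Cn (n + 1)) X]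
  {D : Type*} {i : D → X} [IsManifold 𝓘(ℂ, Cn (n + 1)) ω X]

theorem fderiv_transition_surjective {m : ℕ} {M : Type*} [TopologicalSpace M] [ChartedSpace (Cn m) M]
    [IsManifold 𝓘(ℂ, Cn m) ω M] {φ ψ : OpenPartialHomeomorph M (Cn m)} (hφ : φ ∈ holCharts m M)
    (hψ : ψ ∈ holCharts m M) {y : Cn m} (hy : y ∈ φ.target) (hy' : φ.symm y ∈ ψ.source) (u : Cn m) :
    ∃ v, fderiv ℝ (fun y => ψ (φ.symm y)) y v = u := by
  refine ⟨dChart φ (φ.symm y) (dSymm ψ (ψ (φ.symm y)) u), ?_⟩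
  rw [fderiv_transition hφ hψ hy hy']
  have h1 := dSymm_comp_dChart hφ (φ.map_target hy)
  rw [φ.right_inv hy] at h1
  have h2 := dChart_comp_dSymm hψ (ψ.map_source hy')
  rw [ψ.left_inv hy'] at h2
  exact (congrArg (fun L : Cn m →L[ℝ] Cn m => dChart ψ (φ.symm y) (L (dSymm ψ (ψ (φ.symm y)) u))) h1).trans
    (congrArg (fun L : Cn m →L[ℝ] Cn m => L u) h2)

/-- The first coordinate of a transition map between adapted charts. -/
theorem IsAdapted.exists_transition {φ ψ : OpenPartialHomeomorph X (Cn (n + 1))}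
    (hφ : IsAdapted i φ) (hψ : IsAdapted i ψ) {p : Cn (n + 1)} (hp : p ∈ φ.target)
    (hp' : φ.symm p ∈ ψ.source) (hp0 : p 0 = 0) :
    ∃ s : Cn (n + 1) → ℂ, ContDiffAt ℝ ∞ s p ∧ s p ≠ 0 ∧
      (∀ᶠ y in 𝓝 p, ψ (φ.symm y) 0 = y 0 * s y) ∧
      ∀ v, fderiv ℝ (fun y => ψ (φ.symm y)) p v 0 = s p * v 0 := by
  set T := fun y => ψ (φ.symm y) with hTdef
  have hT : ContDiffAt ℝ ∞ T p := contDiffAt_transition hφ.1 hψ.1 hp hp'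
  have hder : ∀ y, DifferentiableAt ℝ T y → ∀ v, fderiv ℝ (fun y => T y 0) y v = fderiv ℝ T y v 0 :=
    fun y hy v => by
      have : HasFDerivAt (fun y => T y 0) ((ContinuousLinearMap.proj 0).comp (fderiv ℝ T y)) y :=
        (ContinuousLinearMap.proj (R := ℝ) (φ := fun _ : Fin (n + 1) => ℂ) 0).hasFDerivAt.comp y
          hy.hasFDerivAt
      rw [this.fderiv]; rfl
  have hev := eventually_mem_transition hφ.1 hψ.1 hp hp'
  -- Since both charts are adapted, the first coordinate of the transition map is holomorphic and
  -- vanishes on z₀ = 0, hence is divisible by z₀.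
  obtain ⟨s, hs, hTs, -⟩ := exists_eq_coord_mul (h := fun y => T y 0) hp0
    ((contDiff_coord 0).contDiffAt.comp p hT)
    (hev.mono fun y hy v => by
      have hd := (contDiffAt_transition hφ.1 hψ.1 hy.1 hy.2).differentiableAt (by simp)
      rw [hder y hd, hder y hd, fderiv_transition_smul hφ.1 hψ.1 hy.1 hy.2]; rfl)
    (hev.mono fun y hy h0 => by
      have := (hφ.symm_mem_range hy.1).2 h0
      exact (hψ.mem_iff _ hy.2).1 this)
  have hfd : ∀ v, fderiv ℝ T p v 0 = s p * v 0 := fun v => by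
    rw [← hder p (hT.differentiableAt (by simp))]
    have h1 : HasFDerivAt (fun y : Cn (n + 1) => y 0 * s y) _ p :=
      (ContinuousLinearMap.proj (R := ℝ) (φ := fun _ : Fin (n + 1) => ℂ) 0).hasFDerivAt.mul
        (hs.differentiableAt (by simp)).hasFDerivAt
    have h2 : (fun y => T y 0) =ᶠ[𝓝 p] fun y : Cn (n + 1) => y 0 * s y := hTs
    rw [h2.fderiv_eq, h1.fderiv]
    simp [hp0]
  refine ⟨s, hs, fun h0 => ?_, hTs, hfd⟩
  -- If s(p) were zero, the derivative of the transition map would miss e₀, although it is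
  -- surjective.
  obtain ⟨v, hv⟩ := fderiv_transition_surjective hφ.1 hψ.1 hp hp' (Pi.single 0 1)
  have := hfd v
  rw [hv, h0, zero_mul, Pi.single_eq_same] at this
  exact one_ne_zero this

variable (i) in
/-- The form `θ` is smooth or has a pole along the hypersurface at `x`. -/
def PolarFormAt (θ : Form (n + 1) X k) (x : X) : Prop :=
  ∀ φ, IsAdapted i φ → x ∈ φ.source → PolarCov (inChart φ θ) (φ x)

/-- At points of D a change of adapted charts multiplies z₀ by a unit, which preserves poles; off D
being polar means being smooth, which no chart can alter. -/
theorem PolarFormAt.of_chart {θ : Form (n + 1) X k} {x : X} {ψ : OpenPartialHomeomorph X (Cn (n + 1))}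
    (hψ : IsAdapted i ψ) (hx : x ∈ ψ.source) (h : PolarCov (inChart ψ θ) (ψ x)) :
    PolarFormAt i θ x := fun φ hφ hxφ => by
  have hy := φ.map_source hxφ
  have hy' : φ.symm (φ x) ∈ ψ.source := by rwa [φ.left_inv hxφ]
  by_cases h0 : φ x 0 = 0
  · obtain ⟨s, hs, hs0, hT, -⟩ := hφ.exists_transition hψ hy hy' h0
    refine (PolarCov.pullback (F := inChart ψ θ) (T := fun y => ψ (φ.symm y)) ?_
      (contDiffAt_transition hφ.1 hψ.1 hy hy') hs hs0 hT).congr ?_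
    · simpa only [φ.left_inv hxφ] using h
    · exact (inChart_transition_eventually hφ.1 hψ.1 θ hy hy').mono fun y h _ => h.symm
  · have h0' : ψ x 0 ≠ 0 := fun h => h0 ((hφ.mem_iff x hxφ).1 ((hψ.mem_iff x hx).2 h))
    exact PolarCov.of_contDiffAt (smoothAtPt_of_chart hψ.1 hx (h.contDiffAt h0') φ hφ.1 hxφ)

theorem SmoothAtPt.polarFormAt {θ : Form (n + 1) X k} {x : X} (h : SmoothAtPt θ x) :
    PolarFormAt i θ x := fun φ hφ hx => PolarCov.of_contDiffAt (h φ hφ.1 hx)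

omit [IsManifold 𝓘(ℂ, Cn (n + 1)) ω X] in
theorem inChart_congr_off {φ : OpenPartialHomeomorph X (Cn (n + 1))} (hφ : IsAdapted i φ)
    {θ η : Form (n + 1) X k} {x : X} (hx : x ∈ φ.source) (h : ∀ᶠ x in 𝓝 x, x ∉ Set.range i → θ x = η x) :
    ∀ᶠ y in 𝓝 (φ x), y 0 ≠ 0 → inChart φ θ y = inChart φ η y := by
  have : Filter.Tendsto φ.symm (𝓝 (φ x)) (𝓝 x) := by
    have := φ.continuousAt_symm (φ.map_source hx)
    rwa [ContinuousAt, φ.left_inv hx] at this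
  filter_upwards [this.eventually h, φ.open_target.mem_nhds (φ.map_source hx)] with y hy hyt h0
  rw [inChart_apply, hy fun h => h0 ((hφ.symm_mem_range hyt).1 h)]; rfl

theorem PolarFormAt.add {θ η : Form (n + 1) X k} {x : X} (h : PolarFormAt i θ x)
    (h' : PolarFormAt i η x) : PolarFormAt i (θ + η) x := fun φ hφ hx L =>
  ((h φ hφ hx L).add (h' φ hφ hx L)).congr (Filter.Eventually.of_forall fun y _ =>
    (map_add L (inChart φ θ y) (inChart φ η y)).symm)

theorem PolarFormAt.smul {θ : Form (n + 1) X k} {x : X} (c : ℂ) (h : PolarFormAt i θ x) :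
    PolarFormAt i (c • θ) x := fun φ hφ hx L =>
  ((h φ hφ hx L).const_mul c).congr (Filter.Eventually.of_forall fun y _ =>
    (map_smul L c (inChart φ θ y)).symm)

theorem PolarFormAt.sum {ι : Type*} {s : Finset ι} {θ : ι → Form (n + 1) X k} {x : X}
    (h : ∀ j ∈ s, PolarFormAt i (θ j) x) : PolarFormAt i (∑ j ∈ s, θ j) x := by
  classical
  induction s using Finset.induction_on with
  | empty => exact (SmoothAtPt.zero x).polarFormAt
  | insert a s ha ih =>
    rw [Finset.sum_insert ha]
    exact (h a (by simp)).add (ih fun j hj => h j (by simp [hj]))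

theorem PolarFormAt.fmul {u : X → ℂ} (hu : SmoothFn (n + 1) u) {θ : Form (n + 1) X k} {x : X}
    (h : PolarFormAt i θ x) : PolarFormAt i (fmul u θ) x := fun φ hφ hx L =>
  ((PolarAt.of_contDiffAt (hu φ hφ.1 _ (φ.map_source hx))).mul (h φ hφ hx L)).congr
    (Filter.Eventually.of_forall fun y _ => (map_smul L (u (φ.symm y)) (inChart φ θ y)).symm)

theorem PolarFormAt.inChart_contDiffAt {θ : Form (n + 1) X k} {φ : OpenPartialHomeomorph X (Cn (n + 1))}
    (hφ : IsAdapted i φ) {y : Cn (n + 1)} (hy : y ∈ φ.target) (h : PolarFormAt i θ (φ.symm y))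
    (h0 : y 0 ≠ 0) : ContDiffAt ℝ ∞ (inChart φ θ) y := by
  have := h φ hφ (φ.map_target hy)
  rw [φ.right_inv hy] at this
  exact this.contDiffAt h0

theorem PolarFormAt.delM {c : ℂ} (hc : c * c = -1) {θ : Form (n + 1) X k}
    (h : ∀ x, PolarFormAt i θ x) (x : X) : PolarFormAt i (delM c θ) x := fun φ hφ hx L => by
  have h1 : ∀ j : Fin (n + 1), PolarAt (_root_.dC c (Pi.single j 1)
      (fun y => L (covWedge (cProj c j) (inChart φ θ y)))) (φ x) := fun j =>
    (h x φ hφ hx (L.comp (covWedgeL (cProj c j)))).dC c _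
  refine (PolarAt.sum (s := Finset.univ) fun j _ => h1 j).congr ?_
  filter_upwards [φ.open_target.mem_nhds (φ.map_source hx)] with y hy h0
  have hd := (PolarFormAt.inChart_contDiffAt hφ hy (h _) h0).differentiableAt (n := ∞) (by simp)
  rw [Finset.sum_apply, inChart_delM hφ.1 hy hd, clm_delC hc L hd]

section Hypersurface

variable [TopologicalSpace D] [ChartedSpace (Cn n) D]

theorem PolarFormAt.smoothAtPt (hi : IsSmoothHypersurface n i) {θ : Form (n + 1) X k} {x : X}
    (h : PolarFormAt i θ x) (hx : x ∉ Set.range i) : SmoothAtPt θ x := by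
  obtain ⟨φ, hφ, hxφ, -⟩ := exists_isAdapted hi (x := x) Filter.univ_mem
  refine smoothAtPt_of_chart hφ.1 hxφ ((h φ hφ hxφ).contDiffAt fun h0 => hx ?_)
  exact (hφ.mem_iff x hxφ).2 h0

theorem polarFormAt_of_polesAlong (hi : IsSmoothHypersurface n i) {P : ℕ → Prop}
    {θ : Form (n + 1) X k} (h : SmoothOn (Set.range i)ᶜ θ) (h' : PolesAlong i P θ) (x : X) :
    PolarFormAt i θ x := by
  by_cases hx : x ∈ Set.range i
  · intro φ hφ hxφ
    obtain ⟨a, b, -, G, hG, he⟩ := h' φ hφ x hxφ hx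
    exact PolarCov.of_exponents hG he
  · exact ((smoothOn_iff hi.isClosed_range.isOpen_compl).1 h x hx).polarFormAt

theorem polarFormAt_iff (hi : IsSmoothHypersurface n i) {θ : Form (n + 1) X k} :
    (∀ x, PolarFormAt i θ x) ↔
      SmoothOn (Set.range i)ᶜ θ ∧ PolesAlong i (fun _ => True) θ := by
  refine ⟨fun h => ⟨(smoothOn_iff hi.isClosed_range.isOpen_compl).2 fun x hx =>
    (h x).smoothAtPt hi hx, fun φ hφ x hx _ => ?_⟩, fun h => polarFormAt_of_polesAlong hi h.1 h.2⟩
  obtain ⟨a, b, G, hG, he⟩ := (h x φ hφ hx).exists_exponents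
  exact ⟨a, b, trivial, G, hG, he⟩

end Hypersurface

end PolarForms

/-! ### The residue form of a polar form of top degree in an adapted chart -/

section ResidueForm

variable {n : ℕ} {X : Type*} [TopologicalSpace X] [ChartedSpace (Cn (n + 1)) X]

/-- The coefficient of a form of top degree in a chart. -/
def coef (φ : OpenPartialHomeomorph X (Cn (n + 1))) (θ : Form (n + 1) X (n + n + 1 + 1)) :
    Cn (n + 1) → ℂ := fun y => coefX n (inChart φ θ y)

theorem coef_add (φ : OpenPartialHomeomorph X (Cn (n + 1))) (θ η : Form (n + 1) X (n + n + 1 + 1)) :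
    coef φ (θ + η) = coef φ θ + coef φ η := by
  funext y; exact map_add (coefX n) (inChart φ θ y) (inChart φ η y)

theorem coef_fmul (φ : OpenPartialHomeomorph X (Cn (n + 1))) (u : X → ℂ)
    (θ : Form (n + 1) X (n + n + 1 + 1)) (y : Cn (n + 1)) :
    coef φ (fmul u θ) y = u (φ.symm y) * coef φ θ y :=
  map_smul (coefX n) (u (φ.symm y)) (inChart φ θ y)

theorem inChart_eq_coef_smul (φ : OpenPartialHomeomorph X (Cn (n + 1)))
    (θ : Form (n + 1) X (n + n + 1 + 1)) (y : Cn (n + 1)) : inChart φ θ y = coef φ θ y • volX n :=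
  eq_smul_volX _

variable {D : Type*} {i : D → X} [IsManifold 𝓘(ℂ, Cn (n + 1)) ω X]

theorem PolarFormAt.coef {θ : Form (n + 1) X (n + n + 1 + 1)} {x : X} (h : PolarFormAt i θ x)
    {φ : OpenPartialHomeomorph X (Cn (n + 1))} (hφ : IsAdapted i φ) (hx : x ∈ φ.source) :
    PolarAt (coef φ θ) (φ x) := h φ hφ hx (coefX n)

variable [TopologicalSpace D] [ChartedSpace (Cn n) D]

open Classical in
/-- The residue form of `θ`, computed in the chart `φ`, extended by zero outside of the chart. -/
def residueIn (i : D → X) (φ : OpenPartialHomeomorph X (Cn (n + 1)))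
    (θ : Form (n + 1) X (n + n + 1 + 1)) : Form n D (n + n) := fun p =>
  if i p ∈ φ.source then resF (_root_.coef φ θ) (φ (i p)) • restrictToD i φ p (tailPull (vol n)) else 0

theorem residueIn_of_mem {φ : OpenPartialHomeomorph X (Cn (n + 1))} (θ : Form (n + 1) X (n + n + 1 + 1))
    {p : D} (hp : i p ∈ φ.source) :
    residueIn i φ θ p = resF (coef φ θ) (φ (i p)) • restrictToD i φ p (tailPull (vol n)) := if_pos hp

theorem residueIn_of_notMem {φ : OpenPartialHomeomorph X (Cn (n + 1))}
    (θ : Form (n + 1) X (n + n + 1 + 1)) {p : D} (hp : i p ∉ φ.source) :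
    residueIn i φ θ p = 0 := if_neg hp

theorem residueIn_congr_at {φ : OpenPartialHomeomorph X (Cn (n + 1))} (hφ : IsAdapted i φ)
    {θ η : Form (n + 1) X (n + n + 1 + 1)} {p : D}
    (h : ∀ᶠ x in 𝓝 (i p), x ∉ Set.range i → θ x = η x) :
    residueIn i φ θ p = residueIn i φ η p := by
  by_cases hp : i p ∈ φ.source
  · rw [residueIn_of_mem _ hp, residueIn_of_mem _ hp, resF_congr (hφ.apply_zero hp)]
    exact (inChart_congr_off hφ hp h).mono fun y hy h0 => congrArg (coefX n) (hy h0)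
  · rw [residueIn_of_notMem _ hp, residueIn_of_notMem _ hp]

theorem residueIn_congr {φ : OpenPartialHomeomorph X (Cn (n + 1))} (hφ : IsAdapted i φ)
    {θ η : Form (n + 1) X (n + n + 1 + 1)} (h : ∀ x ∉ Set.range i, θ x = η x) :
    residueIn i φ θ = residueIn i φ η :=
  funext fun _ => residueIn_congr_at hφ (Filter.Eventually.of_forall h)

theorem residueIn_zero (φ : OpenPartialHomeomorph X (Cn (n + 1))) :
    residueIn i φ (0 : Form (n + 1) X (n + n + 1 + 1)) = 0 := by
  funext p
  by_cases hp : i p ∈ φ.source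
  · rw [residueIn_of_mem _ hp]
    have : resF (coef φ (0 : Form (n + 1) X (n + n + 1 + 1))) (φ (i p)) = 0 := by
      have h1 : coef φ (0 : Form (n + 1) X (n + n + 1 + 1)) = 0 := by
        funext y; exact map_zero (coefX n)
      rw [h1]; exact (IsResAt.zero _).resF_eq
    rw [this]
    exact zero_smul ℂ (restrictToD i φ p (tailPull (vol n)))
  · rw [residueIn_of_notMem _ hp]; rfl

theorem residueIn_eq_zero {φ : OpenPartialHomeomorph X (Cn (n + 1))} (hφ : IsAdapted i φ)
    {θ : Form (n + 1) X (n + n + 1 + 1)} {p : D} (h : ∀ᶠ x in 𝓝 (i p), θ x = 0) :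
    residueIn i φ θ p = 0 := by
  rw [residueIn_congr_at (η := (0 : Form (n + 1) X (n + n + 1 + 1))) hφ (h.mono fun x hx _ => hx),
    residueIn_zero φ]
  rfl

theorem residueIn_add {φ : OpenPartialHomeomorph X (Cn (n + 1))} (hφ : IsAdapted i φ)
    {θ η : Form (n + 1) X (n + n + 1 + 1)} (hθ : ∀ x, PolarFormAt i θ x) (hη : ∀ x, PolarFormAt i η x) :
    residueIn i φ (θ + η) = residueIn i φ θ + residueIn i φ η := by
  funext p
  change _ = residueIn i φ θ p + residueIn i φ η p
  by_cases hp : i p ∈ φ.source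
  · rw [residueIn_of_mem _ hp, residueIn_of_mem _ hp, residueIn_of_mem _ hp, coef_add,
      resF_add (hφ.apply_zero hp) ((hθ _).coef hφ hp) ((hη _).coef hφ hp)]
    exact add_smul (resF (coef φ θ) (φ (i p))) _ (restrictToD i φ p (tailPull (vol n)))
  · rw [residueIn_of_notMem _ hp, residueIn_of_notMem _ hp, residueIn_of_notMem _ hp, add_zero]

theorem residueIn_smul {φ : OpenPartialHomeomorph X (Cn (n + 1))} (hφ : IsAdapted i φ)
    {θ : Form (n + 1) X (n + n + 1 + 1)} (hθ : ∀ x, PolarFormAt i θ x) (c : ℂ) :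
    residueIn i φ (c • θ) = c • residueIn i φ θ := by
  funext p
  change _ = c • residueIn i φ θ p
  by_cases hp : i p ∈ φ.source
  · rw [residueIn_of_mem _ hp, residueIn_of_mem _ hp]
    have : coef φ (c • θ) = fun y => c * coef φ θ y := by
      funext y; exact map_smul (coefX n) c (inChart φ θ y)
    rw [this, resF_const_mul (hφ.apply_zero hp) ((hθ _).coef hφ hp)]
    exact mul_smul c _ (restrictToD i φ p (tailPull (vol n)))
  · rw [residueIn_of_notMem _ hp, residueIn_of_notMem _ hp]
    exact (smul_zero (M := ℂ) (A := Covec n (n + n)) c).symm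

theorem residueIn_sum {φ : OpenPartialHomeomorph X (Cn (n + 1))} (hφ : IsAdapted i φ)
    {ι : Type*} {s : Finset ι} {θ : ι → Form (n + 1) X (n + n + 1 + 1)}
    (hθ : ∀ j ∈ s, ∀ x, PolarFormAt i (θ j) x) :
    residueIn i φ (∑ j ∈ s, θ j) = ∑ j ∈ s, residueIn i φ (θ j) := by
  classical
  induction s using Finset.induction_on with
  | empty => exact residueIn_zero φ
  | insert a s ha ih =>
    rw [Finset.sum_insert ha, Finset.sum_insert ha, residueIn_add hφ (hθ a (by simp)) fun x =>
      PolarFormAt.sum fun j hj => hθ j (by simp [hj]) x, ih fun j hj => hθ j (by simp [hj])]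

variable [IsManifold 𝓘(ℂ, Cn n) ω D]

theorem residueIn_eq_ofChart [Nonempty D] (hi : IsSmoothHypersurface n i)
    {φ : OpenPartialHomeomorph X (Cn (n + 1))} (hφ : IsAdapted i φ)
    (θ : Form (n + 1) X (n + n + 1 + 1)) :
    residueIn i φ θ = ofChart (inducedChart hi hφ) fun w => resF (coef φ θ) (hyper n w) • vol n := by
  funext p
  by_cases hp : i p ∈ φ.source
  · rw [residueIn_of_mem _ hp, ofChart_of_mem _ ((mem_inducedChart_source hi hφ p).2 hp),
      hyper_inducedChart hi hφ hp, restrictToD_eq hi hφ hp, hyperPull_tailPull]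
    rfl
  · rw [residueIn_of_notMem _ hp]
    exact (ofChart_of_notMem _ fun h => hp ((mem_inducedChart_source hi hφ p).1 h)).symm

theorem inChart_eventually_zero {φ : OpenPartialHomeomorph X (Cn (n + 1))} {k : ℕ}
    {θ : Form (n + 1) X k} {K : Set X} (hK : IsClosed K) (hθ : ∀ x ∉ K, θ x = 0) {y : Cn (n + 1)}
    (hy : y ∈ φ.target) (hyK : φ.symm y ∉ K) : ∀ᶠ y' in 𝓝 y, inChart φ θ y' = 0 := by
  filter_upwards [(φ.continuousAt_symm hy).eventually (hK.isOpen_compl.mem_nhds hyK)] with y' hy'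
  rw [inChart_apply, hθ _ hy']; rfl

theorem compactSpace_hypersurface [CompactSpace X] (hi : IsSmoothHypersurface n i) : CompactSpace D :=
  (Topology.IsClosedEmbedding.mk hi.isSmoothEmbedding.isEmbedding hi.isClosed_range).compactSpace

theorem t2Space_hypersurface [T2Space X] (hi : IsSmoothHypersurface n i) : T2Space D :=
  hi.isSmoothEmbedding.isEmbedding.t2Space

variable [CompactSpace X]

theorem isCompact_inducedChart_image [Nonempty D] (hi : IsSmoothHypersurface n i)
    {φ : OpenPartialHomeomorph X (Cn (n + 1))} (hφ : IsAdapted i φ) {K : Set X} (hK : IsClosed K)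
    (hKφ : K ⊆ φ.source) : IsCompact (inducedChart hi hφ '' (i ⁻¹' K)) := by
  have : CompactSpace D := compactSpace_hypersurface hi
  exact (hK.preimage hi.isSmoothEmbedding.isEmbedding.continuous).isCompact.image_of_continuousOn
    ((inducedChart hi hφ).continuousOn.mono fun p hp => hKφ hp)

theorem inducedChart_image_subset [Nonempty D] (hi : IsSmoothHypersurface n i)
    {φ : OpenPartialHomeomorph X (Cn (n + 1))} (hφ : IsAdapted i φ) {K : Set X}
    (hKφ : K ⊆ φ.source) : inducedChart hi hφ '' (i ⁻¹' K) ⊆ (inducedChart hi hφ).target := by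
  rintro _ ⟨p, hp, rfl⟩
  exact (inducedChart hi hφ).map_source (hKφ hp)

theorem symm_hyper_notMem [Nonempty D] (hi : IsSmoothHypersurface n i)
    {φ : OpenPartialHomeomorph X (Cn (n + 1))} (hφ : IsAdapted i φ) {K : Set X} {w : Cn n}
    (hw : w ∈ (inducedChart hi hφ).target) (hwK : w ∉ inducedChart hi hφ '' (i ⁻¹' K)) :
    φ.symm (hyper n w) ∉ K := fun h => hwK
  ⟨(inducedChart hi hφ).symm w, by rwa [Set.mem_preimage, apply_inducedChart_symm hi hφ hw],
    (inducedChart hi hφ).right_inv hw⟩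

theorem smoothAtPt_residueIn [T2Space X] (hi : IsSmoothHypersurface n i)
    {φ : OpenPartialHomeomorph X (Cn (n + 1))} (hφ : IsAdapted i φ)
    {θ : Form (n + 1) X (n + n + 1 + 1)} (hθ : ∀ x, PolarFormAt i θ x) {K : Set X} (hK : IsClosed K)
    (hKφ : K ⊆ φ.source) (hθK : ∀ x ∉ K, θ x = 0) (p : D) : SmoothAtPt (residueIn i φ θ) p := by
  have : Nonempty D := ⟨p⟩
  have : T2Space D := t2Space_hypersurface hi
  rw [residueIn_eq_ofChart hi hφ]
  refine smoothAtPt_ofChart (inducedChart_mem_holCharts hi hφ)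
    (isCompact_inducedChart_image hi hφ hK hKφ) (inducedChart_image_subset hi hφ hKφ) ?_ ?_ p
  · intro w hw hwK
    have h1 : resF (coef φ θ) (hyper n w) = 0 := by
      rw [resF_congr (f' := 0) (hyper_zero w)]
      · exact (IsResAt.zero _).resF_eq
      · exact (inChart_eventually_zero hK hθK ((mem_inducedChart_target hi hφ w).1 hw)
          (symm_hyper_notMem hi hφ hw hwK)).mono fun y hy _ => (congrArg (coefX n) hy).trans (map_zero _)
    rw [h1]
    exact zero_smul ℂ (vol n)
  · intro w hw
    have h2 : hyper n w ∈ φ.target := (mem_inducedChart_target hi hφ w).1 hw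
    have h1 := (hθ (φ.symm (hyper n w))).coef hφ (φ.map_target h2)
    rw [φ.right_inv h2] at h1
    exact h1.contDiffAt_resF.smul contDiffAt_const

theorem residueIn_mem_smoothForms [T2Space X] (hi : IsSmoothHypersurface n i)
    {φ : OpenPartialHomeomorph X (Cn (n + 1))} (hφ : IsAdapted i φ)
    {θ : Form (n + 1) X (n + n + 1 + 1)} (hθ : ∀ x, PolarFormAt i θ x) {K : Set X} (hK : IsClosed K)
    (hKφ : K ⊆ φ.source) (hθK : ∀ x ∉ K, θ x = 0) : residueIn i φ θ ∈ smoothForms n D n n (n + n) :=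
  ⟨(smoothOn_iff isOpen_univ).2 fun p _ => smoothAtPt_residueIn hi hφ hθ hK hKφ hθK p,
    fun _ => hasBidegree_top rfl _⟩

/-- The residue form of an exact polar form with support in the chart is exact. -/
theorem residueIn_delM_mem [T2Space X] (hi : IsSmoothHypersurface n i) {c : ℂ}
    (hc : c = Complex.I ∨ c = -Complex.I)
    {φ : OpenPartialHomeomorph X (Cn (n + 1))} (hφ : IsAdapted i φ)
    {η : Form (n + 1) X (n + n + 1)} (hη : ∀ x, PolarFormAt i η x) {K : Set X} (hK : IsClosed K)
    (hKφ : K ⊆ φ.source) (hηK : ∀ x ∉ K, η x = 0) :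
    residueIn i φ (delM c η) ∈ aeppliExact n D := by
  cases isEmpty_or_nonempty D with
  | inl hD =>
    have : residueIn i φ (delM c η) = 0 := funext fun p => (hD.false p).elim
    rw [this]; exact Submodule.zero_mem _
  | inr hD =>
    have : T2Space D := t2Space_hypersurface hi
    have hcc : c * c = -1 := by rcases hc with rfl | rfl <;> simp
    let f : Fin (n + 1) → Cn (n + 1) → ℂ := fun j y =>
      coefX n (covWedge (cProj c j) (inChart φ η y))
    have hf : ∀ (j) (w : Cn n), w ∈ (inducedChart hi hφ).target → PolarAt (f j) (hyper n w) := by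
      intro j w hw
      have h2 : hyper n w ∈ φ.target := (mem_inducedChart_target hi hφ w).1 hw
      have h1 := hη (φ.symm (hyper n w)) φ hφ (φ.map_target h2) ((coefX n).comp (covWedgeL (cProj c j)))
      rwa [φ.right_inv h2] at h1
    have hzero : ∀ (j) (w : Cn n), w ∈ (inducedChart hi hφ).target →
        w ∉ inducedChart hi hφ '' (i ⁻¹' K) → resF (f j) (hyper n w) = 0 := fun j w hw hwK => by
      rw [resF_congr (f' := 0) (hyper_zero w)]
      · exact (IsResAt.zero _).resF_eq
      · exact (inChart_eventually_zero hK hηK ((mem_inducedChart_target hi hφ w).1 hw)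
          (symm_hyper_notMem hi hφ hw hwK)).mono fun y hy _ => by
            change coefX n (covWedge _ (inChart φ η y)) = 0
            rw [hy, covWedge_zero, map_zero]
    -- The coefficient of ∂η is a sum of derivatives ∂f_j/∂z_j (conjugate derivatives for ∂̄). The
    -- summand j = 0 has residue zero; in the others the derivative is tangent to D and comes out of
    -- the residue.
    have hres : ∀ w ∈ (inducedChart hi hφ).target, resF (coef φ (delM c η)) (hyper n w) =
        ∑ l : Fin n, dC c (Pi.single l 1) (fun w => resF (f l.succ) (hyper n w)) w := by
      intro w hw
      have h2 : hyper n w ∈ φ.target := (mem_inducedChart_target hi hφ w).1 hw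
      rw [resF_congr (f' := ∑ j, dC c (Pi.single j 1) (f j)) (hyper_zero w),
        resF_sum (hyper_zero w) fun j _ => (hf j w hw).dC c _, Fin.sum_univ_succ]
      · have h0 : resF (dC c (Pi.single 0 1) (f 0)) (hyper n w) = 0 := by
          rcases hc with rfl | rfl
          · rw [← wirt_eq_dC]; exact resF_wirt (hyper_zero w) (hf 0 w hw)
          · rw [← wirtBar_eq_dC]; exact resF_wirtBar (hyper_zero w) (hf 0 w hw)
        rw [h0, zero_add]
        refine Finset.sum_congr rfl fun l _ => ?_
        rw [← resF_dC (hf l.succ w hw)]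
        congr 2
        funext m
        refine Fin.cases ?_ (fun m => ?_) m
        · rw [hyper_zero, Pi.single_eq_of_ne (Fin.succ_ne_zero l).symm]
        · rw [hyper_succ, Pi.single_apply, Pi.single_apply]; simp
      · filter_upwards [φ.open_target.mem_nhds h2] with y hy h0
        have hd := (PolarFormAt.inChart_contDiffAt hφ hy (hη _) h0).differentiableAt (n := ∞) (by simp)
        rw [Finset.sum_apply, coef, inChart_delM hφ.1 hy hd, clm_delC hcc _ hd]
    have key : residueIn i φ (delM c η) = ∑ l : Fin n, ofChart (inducedChart hi hφ)
        (fun w => dC c (Pi.single l 1) (fun w => resF (f l.succ) (hyper n w)) w • vol n) := by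
      rw [residueIn_eq_ofChart hi hφ]
      funext p
      rw [show (∑ l : Fin n, ofChart (inducedChart hi hφ) (fun w =>
        dC c (Pi.single l 1) (fun w => resF (f l.succ) (hyper n w)) w • vol n)) p =
        ∑ l : Fin n, ofChart (inducedChart hi hφ) (fun w =>
        dC c (Pi.single l 1) (fun w => resF (f l.succ) (hyper n w)) w • vol n) p from
          Finset.sum_apply p _ _]
      by_cases hp : p ∈ (inducedChart hi hφ).source
      · rw [ofChart_of_mem _ hp, hres _ ((inducedChart hi hφ).map_source hp)]
        simp only [ofChart_of_mem _ hp]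
        ext v
        rw [ContinuousAlternatingMap.sum_apply]
        simp only [ContinuousAlternatingMap.compContinuousLinearMap_apply]
        exact (Finset.sum_mul _ _ _)
      · simp only [ofChart_of_notMem _ hp, Finset.sum_const_zero]
    rw [key]
    refine Submodule.sum_mem _ fun l _ => ofChart_dC_mem_aeppliExact hc
      (inducedChart_mem_holCharts hi hφ) (isCompact_inducedChart_image hi hφ hK hKφ)
      (inducedChart_image_subset hi hφ hKφ) (fun w hw hwK => hzero _ w hw hwK) (fun w hw => ?_) l
    exact (hf l.succ w hw).contDiffAt_resF

end ResidueForm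

/-! ### Independence of the residue form of the chart -/

section Independence

variable {n : ℕ} {X : Type*} [TopologicalSpace X] [ChartedSpace (Cn (n + 1)) X]
  [IsManifold 𝓘(ℂ, Cn (n + 1)) ω X]

theorem exists_partition [T2Space X] [CompactSpace X] {U : X → Set X} (hU : ∀ x, U x ∈ 𝓝 x) :
    ∃ (N : ℕ) (c : Fin N → X) (ρ : SmoothPartitionOfUnity (Fin N) 𝓘(ℝ, Cn (n + 1)) X Set.univ),
      ρ.IsSubordinate fun j => interior (U (c j)) := by
  have : IsManifold 𝓘(ℝ, Cn (n + 1)) ∞ X := isManifold_real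
  obtain ⟨t, ht⟩ := isCompact_univ.elim_finite_subcover (fun x => interior (U x))
    (fun x => isOpen_interior) fun x _ => Set.mem_iUnion.2 ⟨x, mem_interior_iff_mem_nhds.2 (hU x)⟩
  let e := t.equivFin
  obtain ⟨ρ, hρ⟩ := SmoothPartitionOfUnity.exists_isSubordinate 𝓘(ℝ, Cn (n + 1)) isClosed_univ
    (fun j : Fin t.card => interior (U (e.symm j))) (fun j => isOpen_interior) (fun x hx => by
      obtain ⟨y, hy, hxy⟩ := Set.mem_iUnion₂.1 (ht hx)
      exact Set.mem_iUnion.2 ⟨e ⟨y, hy⟩, by rwa [Equiv.symm_apply_apply]⟩)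
  exact ⟨t.card, fun j => e.symm j, ρ, hρ⟩

/-- The members of a partition of unity as complex-valued functions. -/
def partFn {ι : Type*} (ρ : SmoothPartitionOfUnity ι 𝓘(ℝ, Cn (n + 1)) X Set.univ) (j : ι) : X → ℂ :=
  fun x => ((ρ j x : ℝ) : ℂ)

theorem smoothFn_partFn {ι : Type*} (ρ : SmoothPartitionOfUnity ι 𝓘(ℝ, Cn (n + 1)) X Set.univ) (j : ι) :
    SmoothFn (n + 1) (partFn ρ j) := smoothFn_ofReal (ρ j)

theorem sum_partFn {ι : Type*} [Fintype ι]
    (ρ : SmoothPartitionOfUnity ι 𝓘(ℝ, Cn (n + 1)) X Set.univ) (x : X) :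
    ∑ j ∈ Finset.univ, partFn ρ j x = 1 := by
  have h := ρ.sum_eq_one (Set.mem_univ x)
  rw [finsum_eq_sum_of_fintype] at h
  simp only [partFn]
  rw [← Complex.ofReal_sum, h, Complex.ofReal_one]

theorem partFn_eq_zero {ι : Type*} {ρ : SmoothPartitionOfUnity ι 𝓘(ℝ, Cn (n + 1)) X Set.univ} {j : ι}
    {x : X} (hx : x ∉ tsupport (ρ j)) : partFn ρ j x = 0 := by
  rw [partFn, image_eq_zero_of_notMem_tsupport hx, Complex.ofReal_zero]

theorem fmul_eq_zero {k : ℕ} {u : X → ℂ} (θ : Form (n + 1) X k) {x : X} (h : u x = 0) :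
    fmul u θ x = 0 := by
  rw [fmul, h]; exact zero_smul ℂ (θ x)

variable {D : Type*} [TopologicalSpace D] [ChartedSpace (Cn n) D] {i : D → X}

theorem restrictToD_transition (hi : IsSmoothHypersurface n i) {φ ψ : OpenPartialHomeomorph X (Cn (n + 1))}
    (hφ : IsAdapted i φ) (hψ : IsAdapted i ψ) {p : D} (hp : i p ∈ φ.source) (hp' : i p ∈ ψ.source)
    {k : ℕ} (A : Covec (n + 1) k) :
    restrictToD i φ p A = restrictToD i ψ p
      (A.compContinuousLinearMap (fderiv ℝ (fun y => φ (ψ.symm y)) (ψ (i p)))) := by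
  have hid : MDifferentiableAt 𝓘(ℂ, Cn n) 𝓘(ℂ, Cn (n + 1)) i p :=
    (hi.isSmoothEmbedding.contMDiff p).mdifferentiableAt (by simp)
  have h1 := mfderiv_comp p (mdifferentiableAt_chart hφ.1 hp) hid
  have h2 := mfderiv_comp p (mdifferentiableAt_chart hψ.1 hp') hid
  ext v
  change A (fun j => (mfderiv 𝓘(ℂ, Cn n) 𝓘(ℂ, Cn (n + 1)) (fun q => φ (i q)) p :
      Cn n →L[ℂ] Cn (n + 1)) (v j)) = A fun j => fderiv ℝ (fun y => φ (ψ.symm y)) (ψ (i p))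
        ((mfderiv 𝓘(ℂ, Cn n) 𝓘(ℂ, Cn (n + 1)) (fun q => ψ (i q)) p : Cn n →L[ℂ] Cn (n + 1)) (v j))
  refine congrArg A (funext fun j => ?_)
  rw [fderiv_transition hψ.1 hφ.1 (ψ.map_source hp') (by rwa [ψ.left_inv hp']), ψ.left_inv hp']
  have h3 := dSymm_comp_dChart hψ.1 hp'
  have e1 := congrArg (fun L : Cn n →L[ℂ] Cn (n + 1) => L (v j)) h1
  have e2 := congrArg (fun L : Cn n →L[ℂ] Cn (n + 1) => L (v j)) h2
  refine e1.trans ?_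
  have e3 := congrArg (fun L : Cn (n + 1) →L[ℝ] Cn (n + 1) => L
    ((mfderiv 𝓘(ℂ, Cn n) 𝓘(ℂ, Cn (n + 1)) i p : Cn n →L[ℂ] Cn (n + 1)) (v j))) h3
  refine (congrArg (dChart φ (i p)) e3).symm.trans ?_
  exact congrArg (fun w => dChart φ (i p) (dSymm ψ (ψ (i p)) w)) e2.symm

/-- L multiplies dz₀ by s, so dz₀ ∧ dz̄₀ acquires the factor ss̄; it also preserves the hyperplane,
and the remaining factor is the pulled back volume form there. -/
theorem coefX_pullback_volX {L : Cn (n + 1) →L[ℝ] Cn (n + 1)} {s : ℂ} (hL : ∀ v, L v 0 = s * v 0) :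
    coefX n ((volX n).compContinuousLinearMap L) =
      s * conj s * hyperPull ((tailPull (vol n)).compContinuousLinearMap L) (realBasis n) := by
  rw [coefX_apply, ContinuousAlternatingMap.compContinuousLinearMap_apply]
  have : (fun j => L (frameX n j)) = Fin.cons (L (Pi.single 0 1)) (Fin.cons (L (Pi.single 0 Complex.I))
      fun j => L (hyper n (realBasis n j))) := by
    funext j
    refine Fin.cases ?_ (fun j => Fin.cases ?_ (fun j => ?_) j) j <;> simp [frameX]
  change Complex.I / 2 * volX n (fun j => L (frameX n j)) = _
  rw [this, volX, covWedge_covWedge_apply _ _ _ fun j => by rw [hL, hyper_zero, mul_zero], hL, hL]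
  simp only [Pi.single_eq_same, map_mul, map_one, Complex.conj_I]
  rw [hyperPull_apply, ContinuousAlternatingMap.compContinuousLinearMap_apply]
  change _ = _ * tailPull (vol n) fun j => L (hyper n (realBasis n j))
  linear_combination (-1) * s * conj s * (tailPull (vol n) fun j => L (hyper n (realBasis n j))) *
    Complex.I_mul_I

variable [IsManifold 𝓘(ℂ, Cn n) ω D]

/-- For a pole G/(z₀z̄₀) with G continuous, the residue is the boundary value G. A change of chart
replaces z₀z̄₀ by ss̄z₀z̄₀ and, at points of D, multiplies dz₀ ∧ dz̄₀ by the same ss̄. The factors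
cancel, and what is left is the transformation law of forms on D. -/
theorem residueIn_eq_of_simple (hi : IsSmoothHypersurface n i)
    {φ ψ : OpenPartialHomeomorph X (Cn (n + 1))} (hφ : IsAdapted i φ) (hψ : IsAdapted i ψ) {p : D}
    (hp : i p ∈ φ.source) (hp' : i p ∈ ψ.source) {θ : Form (n + 1) X (n + n + 1 + 1)}
    {G : Cn (n + 1) → ℂ} (hG : ContinuousAt G (φ (i p)))
    (h : ∀ᶠ y in 𝓝 (φ (i p)), y 0 ≠ 0 → poleMon 0 0 y * coef φ θ y = G y) :
    residueIn i φ θ p = residueIn i ψ θ p := by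
  have : Nonempty D := ⟨p⟩
  have hq := ψ.map_source hp'
  have hl := ψ.left_inv hp'
  have hq' : ψ.symm (ψ (i p)) ∈ φ.source := by rwa [hl]
  obtain ⟨s, hs, hs0, hT, hdT⟩ := hψ.exists_transition hφ hq hq' (hψ.apply_zero hp')
  have hTs := contDiffAt_transition hψ.1 hφ.1 hq hq'
  set T := fun y => φ (ψ.symm y) with hTdef
  have hTq : T (ψ (i p)) = φ (i p) := by rw [hTdef]; simp only [hl]
  set A := (tailPull (vol n)).compContinuousLinearMap (fderiv ℝ T (ψ (i p))) with hA
  have h1 : resF (coef φ θ) (φ (i p)) = G (φ (i p)) := by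
    refine (IsResAt.of_tendsto (hφ.apply_zero hp) ?_).resF_eq
    refine (hG.tendsto.mono_left nhdsWithin_le_nhds).congr' ?_
    filter_upwards [nhdsWithin_le_nhds h, self_mem_nhdsWithin] with y hy h0
    rw [← hy h0, poleMon]; simp
  have h2 : resF (coef ψ θ) (ψ (i p)) = G (φ (i p)) * hyperPull A (realBasis n) := by
    refine (IsResAt.of_tendsto (hψ.apply_zero hp') ?_).resF_eq
    have hc1 : ContinuousAt (fun y => G (T y)) (ψ (i p)) :=
      ContinuousAt.comp (f := T) (by rw [hTq]; exact hG) hTs.continuousAt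
    have hc2 : ContinuousAt (fun y => coefX n ((volX n).compContinuousLinearMap (fderiv ℝ T y)))
        (ψ (i p)) :=
      ((coefX n).restrictScalars ℝ).continuous.continuousAt.comp
        (contDiffAt_pullback (F := fun _ => volX n) hTs le_rfl contDiffAt_const).continuousAt
    have hc3 : ContinuousAt (fun y => (s y * conj (s y))⁻¹) (ψ (i p)) :=
      (hs.continuousAt.mul (Complex.continuous_conj.continuousAt.comp hs.continuousAt)).inv₀
        (mul_ne_zero hs0 (by simpa using hs0))
    have hc := (hc1.mul (hc3.mul hc2)).tendsto
    have hv : G (T (ψ (i p))) * ((s (ψ (i p)) * conj (s (ψ (i p))))⁻¹ *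
        coefX n ((volX n).compContinuousLinearMap (fderiv ℝ T (ψ (i p))))) =
        G (φ (i p)) * hyperPull A (realBasis n) := by
      rw [hTq, coefX_pullback_volX hdT, inv_mul_cancel_left₀ (mul_ne_zero hs0 (by simpa using hs0))]
    rw [← hv]
    refine (hc.mono_left nhdsWithin_le_nhds).congr' ?_
    have he : ∀ᶠ y in 𝓝 (ψ (i p)), T y 0 ≠ 0 → poleMon 0 0 (T y) * coef φ θ (T y) = G (T y) := by
      have := hTs.continuousAt.tendsto
      rw [hTq] at this
      exact this.eventually h
    filter_upwards [nhdsWithin_le_nhds he, nhdsWithin_le_nhds hT,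
      nhdsWithin_le_nhds (hs.continuousAt.eventually_ne hs0),
      nhdsWithin_le_nhds (inChart_transition_eventually hψ.1 hφ.1 θ hq hq'), self_mem_nhdsWithin]
      with y hy1 hy2 hy3 hy4 h0
    have hy2' : T y 0 = y 0 * s y := hy2
    have hT0 : T y 0 ≠ 0 := by rw [hy2']; exact mul_ne_zero h0 hy3
    have hco : coef ψ θ y = coef φ θ (T y) *
        coefX n ((volX n).compContinuousLinearMap (fderiv ℝ T y)) := by
      rw [coef, hy4, inChart_eq_coef_smul φ θ]
      exact map_smul (coefX n) (coef φ θ (T y)) ((volX n).compContinuousLinearMap (fderiv ℝ T y))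
    have hs' : conj (s y) ≠ 0 := by simpa using hy3
    change G (T y) * ((s y * conj (s y))⁻¹ *
      coefX n ((volX n).compContinuousLinearMap (fderiv ℝ T y))) = _
    rw [hco, ← hy1 hT0, poleMon, hy2', map_mul, zero_add, pow_one, pow_one]
    field_simp
  rw [residueIn_of_mem _ hp, residueIn_of_mem _ hp', h1, h2,
    restrictToD_transition hi hφ hψ hp hp', ← hTdef, ← hA, restrictToD_eq hi hψ hp',
    restrictToD_eq hi hψ hp', hyperPull_tailPull]
  conv_lhs => rw [eq_smul_vol (hyperPull A)]
  exact smul_smul (G (φ (i p))) (hyperPull A (realBasis n))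
    ((vol n).compContinuousLinearMap (dChart (inducedChart hi hψ) p))

/-- The form `u • ι` in a chart, where `ι` is the contraction of the volume form with `∂/∂z₀` (or
with `∂/∂z̄₀`). -/
def contractForm (c : ℂ) (φ : OpenPartialHomeomorph X (Cn (n + 1))) (u : Cn (n + 1) → ℂ) :
    Form (n + 1) X (n + n + 1) := ofChart φ fun y => u y • iotaC c 0 (volX n)

theorem contractForm_eq_zero {c : ℂ} {φ : OpenPartialHomeomorph X (Cn (n + 1))} {u : Cn (n + 1) → ℂ}
    {K : Set X} (hu : ∀ y ∈ φ.target, φ.symm y ∉ K → u y = 0) {x : X} (hx : x ∉ K) :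
    contractForm c φ u x = 0 := by
  by_cases hxφ : x ∈ φ.source
  · rw [contractForm, ofChart_of_mem _ hxφ, hu _ (φ.map_source hxφ) (by rwa [φ.left_inv hxφ])]
    ext v
    exact zero_mul (iotaC c 0 (volX n) fun j => dChart φ x (v j))
  · exact ofChart_of_notMem _ hxφ

theorem polarFormAt_contractForm {c : ℂ} {φ : OpenPartialHomeomorph X (Cn (n + 1))}
    (hφ : IsAdapted i φ) {u : Cn (n + 1) → ℂ} {K : Set X} (hK : IsClosed K) (hKφ : K ⊆ φ.source)
    (hu0 : ∀ y ∈ φ.target, φ.symm y ∉ K → u y = 0) (hu : ∀ y ∈ φ.target, PolarAt u y) (x : X) :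
    PolarFormAt i (contractForm c φ u) x := by
  by_cases hx : x ∈ φ.source
  · refine PolarFormAt.of_chart hφ hx fun L => ?_
    refine ((hu _ (φ.map_source hx)).mul (PolarAt.of_contDiffAt
      (contDiffAt_const (c := L (iotaC c 0 (volX n)))))).congr ?_
    filter_upwards [inChart_ofChart_eventuallyEq hφ.1 (fun y => u y • iotaC c 0 (volX n))
      (φ.map_source hx)] with y hy _
    rw [contractForm, hy, map_smul, smul_eq_mul]
  · refine ((SmoothAtPt.zero x).congr ?_).polarFormAt
    filter_upwards [hK.isOpen_compl.mem_nhds fun h => hx (hKφ h)] with x' hx'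
    exact (contractForm_eq_zero hu0 hx').symm

theorem coef_delM_contractForm {c : ℂ} (hc : c * c = -1) {φ : OpenPartialHomeomorph X (Cn (n + 1))}
    (hφ : φ ∈ holCharts (n + 1) X) {u : Cn (n + 1) → ℂ} {y : Cn (n + 1)} (hy : y ∈ φ.target)
    (hu : DifferentiableAt ℝ u y) :
    coef φ (delM c (contractForm c φ u)) y = dC c (Pi.single 0 1) u y := by
  have hd : DifferentiableAt ℝ (fun y => u y • iotaC c 0 (volX n)) y :=
    hu.smul (differentiableAt_const (iotaC c 0 (volX n)))
  have he := inChart_ofChart_eventuallyEq hφ (fun y => u y • iotaC c 0 (volX n)) hy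
  rw [coef, contractForm, inChart_delM hφ hy (he.differentiableAt_iff.2 hd)]
  have : delC c (inChart φ (ofChart φ fun y => u y • iotaC c 0 (volX n))) y =
      delC c (fun y => u y • iotaC c 0 (volX n)) y := by rw [delC, he.fderiv_eq]; rfl
  rw [this, delC_smul_iotaC hc (by omega) _ _ hu, map_smul, coefX_volX, smul_eq_mul, mul_one]

variable [T2Space X] [CompactSpace X]

/-- The support of η lies in both charts, so the residue of its derivative is exact whichever chart
is used. Adding such a derivative to θ does not change the difference modulo exact forms. -/
theorem residueIn_sub_mem_of_add (hi : IsSmoothHypersurface n i) {c : ℂ}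
    (hc : c = Complex.I ∨ c = -Complex.I) {φ ψ : OpenPartialHomeomorph X (Cn (n + 1))}
    (hφ : IsAdapted i φ) (hψ : IsAdapted i ψ) {K : Set X} (hK : IsClosed K) (hKφ : K ⊆ φ.source)
    (hKψ : K ⊆ ψ.source) {η : Form (n + 1) X (n + n + 1)} (hη : ∀ x, PolarFormAt i η x)
    (hηK : ∀ x ∉ K, η x = 0) {θ : Form (n + 1) X (n + n + 1 + 1)} (hθ : ∀ x, PolarFormAt i θ x)
    (h : residueIn i φ (θ + delM c η) - residueIn i ψ (θ + delM c η) ∈ aeppliExact n D) :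
    residueIn i φ θ - residueIn i ψ θ ∈ aeppliExact n D := by
  have hcc : c * c = -1 := by rcases hc with rfl | rfl <;> simp
  have hd := PolarFormAt.delM hcc hη
  rw [residueIn_add hφ hθ hd, residueIn_add hψ hθ hd] at h
  have h1 := residueIn_delM_mem hi hc hφ hη hK hKφ hηK
  have h2 := residueIn_delM_mem hi hc hψ hη hK hKψ hηK
  have := Submodule.add_mem _ (Submodule.sub_mem _ h h1) h2
  convert this using 1
  abel

theorem delM_eq_zero_of_closed {m k : ℕ} {M : Type*} [TopologicalSpace M] [ChartedSpace (Cn m) M]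
    {c : ℂ} {η : Form m M k} {K : Set M} (hK : IsClosed K) (hη : ∀ x ∉ K, η x = 0) {x : M}
    (hx : x ∉ K) : delM c η x = 0 := by
  have h : η =ᶠ[𝓝 x] (0 : Form m M k) := by
    filter_upwards [hK.isOpen_compl.mem_nhds hx] with x' hx' using hη x' hx'
  exact (delM_congr h).trans (congrFun (delM_zero c) x)

/-- Double induction on the pole orders. Each step adds an exact form that lowers one exponent by
one and differentiates the numerator once, which fits the assumed regularity C^(a+b). For a = b = 0
the residue forms agree pointwise. The relation with G is required on an open set containing the
support K, so that it holds near every point of K. -/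
theorem residueIn_sub_mem_of_exponents (hi : IsSmoothHypersurface n i)
    {φ ψ : OpenPartialHomeomorph X (Cn (n + 1))} (hφ : IsAdapted i φ) (hψ : IsAdapted i ψ)
    {K U : Set X} (hK : IsClosed K) (hU : IsOpen U) (hKU : K ⊆ U) (hUφ : U ⊆ φ.source)
    (hUψ : U ⊆ ψ.source) (a b : ℕ) (θ : Form (n + 1) X (n + n + 1 + 1)) (hθ : ∀ x, PolarFormAt i θ x)
    (hθK : ∀ x ∉ K, θ x = 0) (G : Cn (n + 1) → ℂ)
    (hG : ∀ y ∈ φ.target, φ.symm y ∈ U → ContDiffAt ℝ (a + b : ℕ) G y)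
    (h : ∀ y ∈ φ.target, φ.symm y ∈ U → y 0 ≠ 0 → poleMon a b y * coef φ θ y = G y) :
    residueIn i φ θ - residueIn i ψ θ ∈ aeppliExact n D := by
  have hev : ∀ y ∈ φ.target, φ.symm y ∈ U → ∀ᶠ y' in 𝓝 y, y' ∈ φ.target ∧ φ.symm y' ∈ U :=
    fun y hy hyU => (φ.isOpen_inter_preimage_symm hU).mem_nhds ⟨hy, hyU⟩
  have hpol : ∀ θ : Form (n + 1) X (n + n + 1 + 1), (∀ x, PolarFormAt i θ x) → ∀ y ∈ φ.target,
      PolarAt (coef φ θ) y := fun θ hθ y hy => by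
    have := (hθ (φ.symm y)).coef hφ (φ.map_target hy)
    rwa [φ.right_inv hy] at this
  have hcoef0 : ∀ θ : Form (n + 1) X (n + n + 1 + 1), (∀ x ∉ K, θ x = 0) → ∀ y, φ.symm y ∉ K →
      coef φ θ y = 0 := fun θ hθ y hy => by
    rw [coef, inChart_apply, hθ _ hy]; exact map_zero (coefX n)
  -- the reduction of the order of the pole by an exact form
  have step : ∀ (c : ℂ) (hc : c = Complex.I ∨ c = -Complex.I) (θ : Form (n + 1) X (n + n + 1 + 1))
      (_ : ∀ x, PolarFormAt i θ x) (_ : ∀ x ∉ K, θ x = 0) (m : Cn (n + 1) → ℂ) (_ : ContDiff ℝ ∞ m),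
      ∃ θ' : Form (n + 1) X (n + n + 1 + 1), (∀ x, PolarFormAt i θ' x) ∧ (∀ x ∉ K, θ' x = 0) ∧
        (∀ y ∈ φ.target, y 0 ≠ 0 →
          coef φ θ' y = coef φ θ y + dC c (Pi.single 0 1) (fun y => m y * coef φ θ y) y) ∧
        (residueIn i φ θ' - residueIn i ψ θ' ∈ aeppliExact n D →
          residueIn i φ θ - residueIn i ψ θ ∈ aeppliExact n D) := by
    intro c hc θ hθ hθK m hm
    have hcc : c * c = -1 := by rcases hc with rfl | rfl <;> simp
    have hu0 : ∀ y ∈ φ.target, φ.symm y ∉ K → m y * coef φ θ y = 0 := fun y _ hy => by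
      rw [hcoef0 θ hθK y hy, mul_zero]
    have hu : ∀ y ∈ φ.target, PolarAt (fun y => m y * coef φ θ y) y := fun y hy =>
      (PolarAt.of_contDiffAt hm.contDiffAt).mul (hpol θ hθ y hy)
    have hη := polarFormAt_contractForm (c := c) hφ hK (hKU.trans hUφ) hu0 hu
    have hηK : ∀ x ∉ K, contractForm c φ (fun y => m y * coef φ θ y) x = 0 := fun x hx =>
      contractForm_eq_zero hu0 hx
    refine ⟨θ + delM c (contractForm c φ fun y => m y * coef φ θ y),
      fun x => (hθ x).add (PolarFormAt.delM hcc hη x), fun x hx => ?_, fun y hy h0 => ?_,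
      residueIn_sub_mem_of_add hi hc hφ hψ hK (hKU.trans hUφ) (hKU.trans hUψ) hη hηK hθ⟩
    · change θ x + delM c _ x = 0
      rw [hθK x hx, delM_eq_zero_of_closed hK hηK hx, add_zero]
    · rw [coef_add, Pi.add_apply, coef_delM_contractForm hcc hφ.1 hy]
      exact ((hu y hy).contDiffAt h0).differentiableAt (by simp)
  induction a generalizing θ G with
  | succ a ih =>
    -- If f = G / (z₀^(a+2) z̄₀^(b+1)), then ∂(z₀f)/∂z₀ is (∂G/∂z₀) / (z₀^(a+1) z̄₀^(b+1)) minus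
    -- (a+1)f; dividing by a + 1 and adding f removes the pole of higher order.
    obtain ⟨θ', h1, h2, h3, h4⟩ := step Complex.I (Or.inl rfl) θ hθ hθK
      (fun y => ((a : ℂ) + 1)⁻¹ * y 0) (contDiff_const.mul (contDiff_coord 0))
    refine h4 (ih θ' h1 h2 (fun y => ((a : ℂ) + 1)⁻¹ * dC Complex.I (Pi.single 0 1) G y) ?_ ?_)
    · intro y hy hyU
      refine contDiffAt_const.mul ?_
      exact ContDiffAt.dC (hG y hy hyU) (by push_cast; rw [add_right_comm])
    · intro y hy hyU h0
      have ha : ((a : ℂ) + 1) ≠ 0 := Nat.cast_add_one_ne_zero a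
      have hf : DifferentiableAt ℝ (coef φ θ) y :=
        ((hpol θ hθ y hy).contDiffAt h0).differentiableAt (by simp)
      have hzf : DifferentiableAt ℝ (fun y : Cn (n + 1) => y 0 * coef φ θ y) y :=
        ((contDiff_coord 0 (l := 1)).differentiable (by simp) y).mul hf
      have e1 : G =ᶠ[𝓝 y] fun y => poleMon a b y * (y 0 * coef φ θ y) := by
        filter_upwards [hev y hy hyU, (continuous_apply 0).continuousAt.eventually_ne h0]
          with y' hy' h0'
        rw [← h y' hy'.1 hy'.2 h0', poleMon, poleMon]; ring
      have e2 : (fun y : Cn (n + 1) => ((a : ℂ) + 1)⁻¹ * y 0 * coef φ θ y) =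
          fun y => ((a : ℂ) + 1)⁻¹ * (y 0 * coef φ θ y) := by funext y; ring
      rw [h3 y hy h0, e2, e1.dC.eq_of_nhds, dC_mul (differentiableAt_const _) hzf, dC_const,
        dC_mul ((contDiff_poleMon a b (l := 1)).differentiable (by simp) y) hzf, dC_poleMon]
      simp only [Pi.single_eq_same, Complex.I_mul_I, map_one]
      rw [poleMon]
      field_simp
      ring
  | zero =>
    induction b generalizing θ G with
    | succ b ih =>
      obtain ⟨θ', h1, h2, h3, h4⟩ := step (-Complex.I) (Or.inr rfl) θ hθ hθK
        (fun y => ((b : ℂ) + 1)⁻¹ * conj (y 0)) (contDiff_const.mul (contDiff_conj_coord 0))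
      refine h4 (ih θ' h1 h2 (fun y => ((b : ℂ) + 1)⁻¹ * dC (-Complex.I) (Pi.single 0 1) G y) ?_ ?_)
      · intro y hy hyU
        exact contDiffAt_const.mul (ContDiffAt.dC (hG y hy hyU) (by push_cast; rw [add_assoc]))
      · intro y hy hyU h0
        have ha : ((b : ℂ) + 1) ≠ 0 := Nat.cast_add_one_ne_zero b
        have hf : DifferentiableAt ℝ (coef φ θ) y :=
          ((hpol θ hθ y hy).contDiffAt h0).differentiableAt (by simp)
        have hzf : DifferentiableAt ℝ (fun y : Cn (n + 1) => conj (y 0) * coef φ θ y) y :=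
          ((contDiff_conj_coord 0 (l := 1)).differentiable (by simp) y).mul hf
        have e1 : G =ᶠ[𝓝 y] fun y => poleMon 0 b y * (conj (y 0) * coef φ θ y) := by
          filter_upwards [hev y hy hyU, (continuous_apply 0).continuousAt.eventually_ne h0]
            with y' hy' h0'
          rw [← h y' hy'.1 hy'.2 h0', poleMon, poleMon]; ring
        have e2 : (fun y : Cn (n + 1) => ((b : ℂ) + 1)⁻¹ * conj (y 0) * coef φ θ y) =
            fun y => ((b : ℂ) + 1)⁻¹ * (conj (y 0) * coef φ θ y) := by funext y; ring
        rw [h3 y hy h0, e2, e1.dC.eq_of_nhds, dC_mul (differentiableAt_const _) hzf, dC_const,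
          dC_mul ((contDiff_poleMon 0 b (l := 1)).differentiable (by simp) y) hzf, dC_poleMon]
        simp only [Pi.single_eq_same, neg_mul, Complex.I_mul_I, map_one]
        rw [poleMon]
        field_simp
        push_cast
        ring
    | zero =>
      have : residueIn i φ θ = residueIn i ψ θ := by
        funext p
        by_cases hp : i p ∈ U
        · have hy := φ.map_source (hUφ hp)
          have hyU : φ.symm (φ (i p)) ∈ U := by rwa [φ.left_inv (hUφ hp)]
          exact residueIn_eq_of_simple hi hφ hψ (hUφ hp) (hUψ hp) (hG _ hy hyU).continuousAt
            ((hev _ hy hyU).mono fun y hy' => h y hy'.1 hy'.2)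
        · have h0 : ∀ᶠ x in 𝓝 (i p), θ x = 0 := by
            filter_upwards [hK.isOpen_compl.mem_nhds fun h => hp (hKU h)] with x hx using hθK x hx
          rw [residueIn_eq_zero hφ h0, residueIn_eq_zero hψ h0]
      rw [this, sub_self]
      exact Submodule.zero_mem _

/-- The class of the residue form does not depend on the chart. -/
theorem residueIn_sub_mem (hi : IsSmoothHypersurface n i)
    {φ ψ : OpenPartialHomeomorph X (Cn (n + 1))} (hφ : IsAdapted i φ) (hψ : IsAdapted i ψ)
    {K : Set X} (hK : IsClosed K) (hKφ : K ⊆ φ.source)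
    (hKψ : K ⊆ ψ.source) {θ : Form (n + 1) X (n + n + 1 + 1)} (hθ : ∀ x, PolarFormAt i θ x)
    (hθK : ∀ x ∉ K, θ x = 0) :
    residueIn i φ θ - residueIn i ψ θ ∈ aeppliExact n D := by
  -- Pole orders are available only locally. Near each point of K one triple (a, b, G) describes the
  -- coefficient, and the multiplier u restricts the form to that neighbourhood.
  have hloc : ∀ x : X, ∃ U ∈ 𝓝 x, ∀ u : X → ℂ, SmoothFn (n + 1) u → ∀ K' ⊆ interior U, IsClosed K' →
      (∀ x ∉ K', u x = 0) → residueIn i φ (fmul u θ) - residueIn i ψ (fmul u θ) ∈ aeppliExact n D := by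
    intro x
    by_cases hx : x ∈ K
    · obtain ⟨a, b, G, hG, h⟩ := (hθ x).coef hφ (hKφ hx)
      have hG' := (hG.of_le (natCast_le_infty (a + b))).eventually (natCast_ne_infty _)
      have hW : ∀ᶠ x' in 𝓝 x, (x' ∈ φ.source ∧ x' ∈ ψ.source) ∧ ContDiffAt ℝ (a + b : ℕ) G (φ x') ∧
          (φ x' 0 ≠ 0 → poleMon a b (φ x') * coef φ θ (φ x') = G (φ x')) :=
        Filter.Eventually.and (show ∀ᶠ x' in 𝓝 x, x' ∈ φ.source ∧ x' ∈ ψ.source from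
          Filter.inter_mem (φ.open_source.mem_nhds (hKφ hx)) (ψ.open_source.mem_nhds (hKψ hx)))
          ((φ.continuousAt (hKφ hx)).eventually (hG'.and h))
      refine ⟨_, hW, fun u hu K' hK'U hK' hu0 => ?_⟩
      have hsub : ∀ x' ∈ interior {x' | (x' ∈ φ.source ∧ x' ∈ ψ.source) ∧
          ContDiffAt ℝ (a + b : ℕ) G (φ x') ∧
          (φ x' 0 ≠ 0 → poleMon a b (φ x') * coef φ θ (φ x') = G (φ x'))}, _ :=
        fun x' hx' => interior_subset hx'
      refine residueIn_sub_mem_of_exponents hi hφ hψ hK' isOpen_interior hK'U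
        (fun x' hx' => (hsub x' hx').1.1) (fun x' hx' => (hsub x' hx').1.2) a b (fmul u θ)
        (fun x => (hθ x).fmul hu) (fun x hx => fmul_eq_zero θ (hu0 x hx))
        (fun y => u (φ.symm y) * G y) (fun y hy hyU => ?_) (fun y hy hyU h0 => ?_)
      · have h1 := (hsub _ hyU).2.1
        rw [φ.right_inv hy] at h1
        exact ((hu φ hφ.1 y hy).of_le (natCast_le_infty _)).mul h1
      · have h1 := (hsub _ hyU).2.2
        rw [φ.right_inv hy] at h1
        rw [coef_fmul, ← h1 h0]; ring
    · refine ⟨Kᶜ, hK.isOpen_compl.mem_nhds hx, fun u hu K' hK'U _ hu0 => ?_⟩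
      have : fmul u θ = 0 := by
        funext x'
        by_cases hx' : x' ∈ K
        · exact fmul_eq_zero θ (hu0 x' fun h => interior_subset (hK'U h) hx')
        · rw [fmul, hθK x' hx']
          exact smul_zero (M := ℂ) (A := Covec (n + 1) (n + n + 1 + 1)) _
      rw [this, residueIn_zero, residueIn_zero, sub_self]
      exact Submodule.zero_mem _
  choose U hU hmem using hloc
  obtain ⟨N, c, ρ, hρ⟩ := exists_partition (n := n) hU
  have hsum := sum_fmul (sum_partFn ρ) θ
  have hpol : ∀ j ∈ Finset.univ, ∀ x, PolarFormAt i (fmul (partFn ρ j) θ) x := fun j _ x =>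
    (hθ x).fmul (smoothFn_partFn ρ j)
  rw [← hsum, residueIn_sum hφ hpol, residueIn_sum hψ hpol, ← Finset.sum_sub_distrib]
  exact Submodule.sum_mem _ fun j _ => hmem _ _ (smoothFn_partFn ρ j) _ (hρ j) (isClosed_tsupport _)
    fun x hx => partFn_eq_zero hx

end Independence

/-! ### The residue class -/

section ResidueClass

variable {n : ℕ} {X : Type*} [TopologicalSpace X] [ChartedSpace (Cn (n + 1)) X]
  [IsManifold 𝓘(ℂ, Cn (n + 1)) ω X] {D : Type*} [TopologicalSpace D] [ChartedSpace (Cn n) D]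
  {i : D → X}

theorem delM_sum {m k : ℕ} {M : Type*} [TopologicalSpace M] [ChartedSpace (Cn m) M] {c : ℂ}
    {ι : Type*} {s : Finset ι} {θ : ι → Form m M k} {x : M}
    (h : ∀ j, DifferentiableAt ℝ (inChart (chartAt (Cn m) x) (θ j)) (chartAt (Cn m) x x)) :
    delM c (∑ j ∈ s, θ j) x = ∑ j ∈ s, delM c (θ j) x := by
  classical
  suffices h' : DifferentiableAt ℝ (inChart (chartAt (Cn m) x) (∑ j ∈ s, θ j)) (chartAt (Cn m) x x) ∧
      delM c (∑ j ∈ s, θ j) x = ∑ j ∈ s, delM c (θ j) x from h'.2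
  induction s using Finset.induction_on with
  | empty =>
    exact ⟨differentiableAt_const (0 : Covec m k), congrFun (delM_zero c) x⟩
  | insert a s ha ih =>
    rw [Finset.sum_insert ha, Finset.sum_insert ha]
    refine ⟨(h a).add ih.1, ?_⟩
    rw [← ih.2, delM, inChart_add, delC_add (h a) ih.1]
    rfl

/-- The residue form of a polar form with respect to a residue cover. -/
def residueSum (C : ResidueCover n i) (θ : Form (n + 1) X (n + n + 1 + 1)) : Form n D (n + n) :=
  ∑ j, residueIn i (C.φ j) (fmul (partFn C.ρ j) θ)

theorem fmul_add {m k : ℕ} {M : Type*} (u : M → ℂ) (θ η : Form m M k) :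
    fmul u (θ + η) = fmul u θ + fmul u η := funext fun x => smul_add (u x) (θ x) (η x)

theorem fmul_smul {m k : ℕ} {M : Type*} (u : M → ℂ) (c : ℂ) (θ : Form m M k) :
    fmul u (c • θ) = c • fmul u θ := funext fun x => smul_comm (u x) c (θ x)

theorem residueSum_congr (C : ResidueCover n i) {θ η : Form (n + 1) X (n + n + 1 + 1)}
    (h : ∀ x ∉ Set.range i, θ x = η x) : residueSum C θ = residueSum C η :=
  Finset.sum_congr rfl fun j _ => residueIn_congr (C.adapted j) fun x hx => by
    rw [fmul, fmul, h x hx]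

theorem residueSum_add (C : ResidueCover n i) {θ η : Form (n + 1) X (n + n + 1 + 1)}
    (hθ : ∀ x, PolarFormAt i θ x) (hη : ∀ x, PolarFormAt i η x) :
    residueSum C (θ + η) = residueSum C θ + residueSum C η := by
  rw [residueSum, residueSum, residueSum, ← Finset.sum_add_distrib]
  refine Finset.sum_congr rfl fun j _ => ?_
  rw [fmul_add, residueIn_add (C.adapted j) (fun x => (hθ x).fmul (smoothFn_partFn C.ρ j))
    fun x => (hη x).fmul (smoothFn_partFn C.ρ j)]

theorem residueSum_smul (C : ResidueCover n i) {θ : Form (n + 1) X (n + n + 1 + 1)}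
    (hθ : ∀ x, PolarFormAt i θ x) (c : ℂ) :
    residueSum C (c • θ) = c • residueSum C θ := by
  rw [residueSum, residueSum, Finset.smul_sum]
  refine Finset.sum_congr rfl fun j _ => ?_
  rw [fmul_smul, residueIn_smul (C.adapted j) fun x => (hθ x).fmul (smoothFn_partFn C.ρ j)]

theorem residueSum_sum (C : ResidueCover n i) {ι : Type*} {s : Finset ι}
    {θ : ι → Form (n + 1) X (n + n + 1 + 1)} (hθ : ∀ j ∈ s, ∀ x, PolarFormAt i (θ j) x) :
    residueSum C (∑ l ∈ s, θ l) = ∑ l ∈ s, residueSum C (θ l) := by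
  simp only [residueSum]
  rw [Finset.sum_comm]
  refine Finset.sum_congr rfl fun j _ => ?_
  rw [fmul_sum, residueIn_sum (C.adapted j) fun l hl x => (hθ l hl x).fmul (smoothFn_partFn C.ρ j)]

variable [T2Space X] [CompactSpace X] [IsManifold 𝓘(ℂ, Cn n) ω D]

theorem residueSum_mem_smoothForms (hi : IsSmoothHypersurface n i) (C : ResidueCover n i)
    {θ : Form (n + 1) X (n + n + 1 + 1)} (hθ : ∀ x, PolarFormAt i θ x) :
    residueSum C θ ∈ smoothForms n D n n (n + n) :=
  Submodule.sum_mem _ fun j _ => residueIn_mem_smoothForms hi (C.adapted j)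
    (fun x => (hθ x).fmul (smoothFn_partFn C.ρ j)) (isClosed_tsupport _) (C.subordinate j)
    fun _ hx => fmul_eq_zero θ (partFn_eq_zero hx)

/-- For a form with support in the domain of an adapted chart, the residue class can be computed
in this chart. -/
theorem residueSum_sub_residueIn_mem (hi : IsSmoothHypersurface n i) (C : ResidueCover n i)
    {φ : OpenPartialHomeomorph X (Cn (n + 1))} (hφ : IsAdapted i φ) {K : Set X} (hK : IsClosed K)
    (hKφ : K ⊆ φ.source) {θ : Form (n + 1) X (n + n + 1 + 1)} (hθ : ∀ x, PolarFormAt i θ x)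
    (hθK : ∀ x ∉ K, θ x = 0) : residueSum C θ - residueIn i φ θ ∈ aeppliExact n D := by
  have hpol : ∀ j ∈ Finset.univ, ∀ x, PolarFormAt i (fmul (partFn C.ρ j) θ) x := fun j _ x =>
    (hθ x).fmul (smoothFn_partFn C.ρ j)
  have h1 : residueIn i φ θ = ∑ j, residueIn i φ (fmul (partFn C.ρ j) θ) := by
    rw [← residueIn_sum hφ hpol, sum_fmul (sum_partFn C.ρ)]
  rw [h1, residueSum, ← Finset.sum_sub_distrib]
  -- Each piece is supported in K ∩ tsupport (ρ_j), which lies in both φ_j and φ, so the comparison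
  -- of two charts applies.
  refine Submodule.sum_mem _ fun j hj => residueIn_sub_mem hi (C.adapted j) hφ
    ((isClosed_tsupport (C.ρ j)).inter hK) (fun x hx => C.subordinate j hx.1) (fun x hx => hKφ hx.2)
    (hpol j hj) fun x hx => ?_
  by_cases h : x ∈ tsupport (C.ρ j)
  · rw [fmul, hθK x fun h' => hx ⟨h, h'⟩]
    exact smul_zero (M := ℂ) (A := Covec (n + 1) (n + n + 1 + 1)) _
  · exact fmul_eq_zero θ (partFn_eq_zero h)

/-- Splitting θ by the second partition of unity leaves pieces supported in single charts of the
second cover, where the residue class for the first cover is the one computed in that chart. -/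
theorem residueSum_sub_mem (hi : IsSmoothHypersurface n i) (C C' : ResidueCover n i)
    {θ : Form (n + 1) X (n + n + 1 + 1)} (hθ : ∀ x, PolarFormAt i θ x) :
    residueSum C θ - residueSum C' θ ∈ aeppliExact n D := by
  have hpol : ∀ j ∈ Finset.univ, ∀ x, PolarFormAt i (fmul (partFn C'.ρ j) θ) x := fun j _ x =>
    (hθ x).fmul (smoothFn_partFn C'.ρ j)
  have h1 : residueSum C θ = ∑ j, residueSum C (fmul (partFn C'.ρ j) θ) := by
    rw [← residueSum_sum C hpol, sum_fmul (sum_partFn C'.ρ)]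
  rw [h1, residueSum.eq_1 C' θ, ← Finset.sum_sub_distrib]
  exact Submodule.sum_mem _ fun j hj => residueSum_sub_residueIn_mem hi C (C'.adapted j)
    (isClosed_tsupport _) (C'.subordinate j) (hpol j hj) fun x hx => fmul_eq_zero θ (partFn_eq_zero hx)

/-- The partition of unity is applied to η and not to its derivative: each piece is then the
derivative of a form supported in one chart, so its residue form is exact. -/
theorem residueSum_delM_mem (hi : IsSmoothHypersurface n i) (C : ResidueCover n i) {c : ℂ}
    (hc : c = Complex.I ∨ c = -Complex.I) {η : Form (n + 1) X (n + n + 1)}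
    (hη : ∀ x, PolarFormAt i η x) : residueSum C (delM c η) ∈ aeppliExact n D := by
  have hcc : c * c = -1 := by rcases hc with rfl | rfl <;> simp
  have hpol : ∀ j, ∀ x, PolarFormAt i (fmul (partFn C.ρ j) η) x := fun j x =>
    (hη x).fmul (smoothFn_partFn C.ρ j)
  have h1 : residueSum C (delM c η) = ∑ j, residueSum C (delM c (fmul (partFn C.ρ j) η)) := by
    rw [← residueSum_sum C fun j _ => PolarFormAt.delM hcc (hpol j)]
    refine residueSum_congr C fun x hx => ?_
    have hs : ∀ j, DifferentiableAt ℝ (inChart (chartAt (Cn (n + 1)) x) (fmul (partFn C.ρ j) η))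
        (chartAt (Cn (n + 1)) x x) := fun j =>
      ((hpol j x).smoothAtPt hi hx _ (chartAt_mem_holCharts x)
        (mem_chart_source _ x)).differentiableAt (by simp)
    have h2 : (∑ j, delM c (fmul (partFn C.ρ j) η)) x = ∑ j, delM c (fmul (partFn C.ρ j) η) x :=
      Finset.sum_apply x _ _
    rw [h2]
    conv_lhs => rw [← sum_fmul (sum_partFn C.ρ) η]
    exact delM_sum hs
  rw [h1]
  refine Submodule.sum_mem _ fun j _ => ?_
  have h2 : ∀ x ∉ tsupport (C.ρ j), fmul (partFn C.ρ j) η x = 0 := fun x hx =>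
    fmul_eq_zero η (partFn_eq_zero hx)
  have h3 := residueSum_sub_residueIn_mem hi C (C.adapted j) (isClosed_tsupport (C.ρ j))
    (C.subordinate j) (PolarFormAt.delM hcc (hpol j)) fun x hx =>
      delM_eq_zero_of_closed (isClosed_tsupport (C.ρ j)) h2 hx
  have h4 := residueIn_delM_mem hi hc (C.adapted j) (hpol j) (isClosed_tsupport (C.ρ j))
    (C.subordinate j) h2
  have := Submodule.add_mem _ h3 h4
  rwa [sub_add_cancel] at this

theorem polarFormAt_of_mem_quasiForms (hi : IsSmoothHypersurface n i) {p q k : ℕ}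
    {θ : Form (n + 1) X k} (hθ : θ ∈ quasiForms n i p q k) (x : X) : PolarFormAt i θ x :=
  polarFormAt_of_polesAlong hi hθ.1 hθ.2.2 x

/-- For a fixed cover the residue form is linear in θ, so it suffices to test the two kinds of
generators of the exact forms. -/
theorem residueSum_mem_of_quasiExact (hi : IsSmoothHypersurface n i) (C : ResidueCover n i)
    {θ : quasiForms n i (n + 1) (n + 1) (n + n + 1 + 1)} (hθ : θ ∈ quasiExact n i) :
    residueSum C θ.1 ∈ aeppliExact n D := by
  let L : quasiForms n i (n + 1) (n + 1) (n + n + 1 + 1) →ₗ[ℂ] Form n D (n + n) :=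
    { toFun := fun θ => residueSum C θ.1
      map_add' := fun θ η => residueSum_add C (polarFormAt_of_mem_quasiForms hi θ.2)
        (polarFormAt_of_mem_quasiForms hi η.2)
      map_smul' := fun c θ => residueSum_smul C (polarFormAt_of_mem_quasiForms hi θ.2) c }
  have : quasiExact n i ≤ (aeppliExact n D).comap L := by
    refine sup_le (Submodule.span_le.2 ?_) (Submodule.span_le.2 ?_)
    · rintro θ ⟨η, hη, h⟩
      change residueSum C θ.1 ∈ aeppliExact n D
      rw [residueSum_congr C h]
      exact residueSum_delM_mem hi C (Or.inl rfl) (polarFormAt_of_mem_quasiForms hi hη)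
    · rintro θ ⟨η, hη, h⟩
      change residueSum C θ.1 ∈ aeppliExact n D
      rw [residueSum_congr C h, delBar_eq_delM]
      exact residueSum_delM_mem hi C (Or.inr rfl) (polarFormAt_of_mem_quasiForms hi hη)
  exact this hθ

theorem dC_iterate_clm {m : ℕ} {V W : Type*} [NormedAddCommGroup V] [NormedSpace ℝ V] [NormedSpace ℂ V]
    [IsScalarTower ℝ ℂ V] [NormedAddCommGroup W] [NormedSpace ℝ W] [NormedSpace ℂ W]
    [IsScalarTower ℝ ℂ W] {c : ℂ} {v : Cn m} (L : V →L[ℂ] W) {F : Cn m → V} {s : Set (Cn m)}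
    (hs : IsOpen s) (hF : ∀ y ∈ s, ContDiffAt ℝ ∞ F y) (j : ℕ) :
    ∀ y ∈ s, (dC c v)^[j] (fun y => L (F y)) y = L ((dC c v)^[j] F y) := by
  induction j with
  | zero => exact fun y _ => rfl
  | succ j ih =>
    intro y hy
    have h1 : (dC c v)^[j] (fun y => L (F y)) =ᶠ[𝓝 y] fun y => L ((dC c v)^[j] F y) := by
      filter_upwards [hs.mem_nhds hy] with y' hy' using ih y' hy'
    rw [Function.iterate_succ_apply', Function.iterate_succ_apply', h1.dC.eq_of_nhds,
      dC_clm L (((hF y hy).dC_iterate_infty j).differentiableAt (by simp))]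

theorem wirt_iterate_clm {V : Type*} [NormedAddCommGroup V] [NormedSpace ℝ V] [NormedSpace ℂ V]
    [IsScalarTower ℝ ℂ V] (L : V →L[ℂ] ℂ) {F : Cn (n + 1) → V} {s : Set (Cn (n + 1))} (hs : IsOpen s)
    (hF : ∀ y ∈ s, ContDiffAt ℝ ∞ F y) (a b : ℕ) {y : Cn (n + 1)} (hy : y ∈ s) :
    wirt^[a] (wirtBar^[b] fun y => L (F y)) y = L (wirt^[a] (wirtBar^[b] F) y) := by
  rw [wirt_eq_dC, wirt_eq_dC, wirtBar_eq_dC, wirtBar_eq_dC,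
    ← dC_iterate_clm L hs (fun y hy => (hF y hy).dC_iterate_infty b) a y hy]
  have h1 : (dC (-Complex.I) (Pi.single 0 1))^[b] (fun y => L (F y)) =ᶠ[𝓝 y]
      fun y => L ((dC (-Complex.I) (Pi.single 0 1))^[b] F y) := by
    filter_upwards [hs.mem_nhds hy] with y' hy' using dC_iterate_clm L hs hF b y' hy'
  exact (h1.dC_iterate a).eq_of_nhds

/-- The coefficient of the restriction of a covector to the hyperplane. -/
def hyperCoef (n : ℕ) : Covec (n + 1) (n + n) →L[ℂ] ℂ := evalC fun j => hyper n (realBasis n j)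

theorem hyperCoef_apply (A : Covec (n + 1) (n + n)) : hyperCoef n A = hyperPull A (realBasis n) := rfl

omit [T2Space X] [CompactSpace X] in
theorem restrictToD_eq_smul (hi : IsSmoothHypersurface n i) {φ : OpenPartialHomeomorph X (Cn (n + 1))}
    (hφ : IsAdapted i φ) {p : D} (hp : i p ∈ φ.source) (A : Covec (n + 1) (n + n)) :
    restrictToD i φ p A = hyperCoef n A • restrictToD i φ p (tailPull (vol n)) := by
  have : Nonempty D := ⟨p⟩
  rw [restrictToD_eq hi hφ hp, restrictToD_eq hi hφ hp, hyperPull_tailPull, eq_smul_vol (hyperPull A)]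
  rfl

-- Connects the explicit formula of the definition with the intrinsic residue: the coefficient of
-- ρ_jθ has the numerator ρ_jg, read on the hyperplane, over the pole monomial, and taking this
-- coefficient commutes with the Wirtinger derivatives.
omit [T2Space X] [CompactSpace X] in
theorem term_eq_residueIn (hi : IsSmoothHypersurface n i) (C : ResidueCover n i) (j : Fin C.N) {a b : ℕ}
    {g : Cn (n + 1) → Covec (n + 1) (n + n)} (hg : ContDiffOn ℝ ∞ g (C.φ j).target)
    {θ : Form (n + 1) X (n + n + 1 + 1)}
    (h : ∀ x ∈ tsupport (C.ρ j), x ∉ Set.range i → inChart (C.φ j) θ (C.φ j x) =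
      (C.φ j x 0 ^ (a + 1) * (conj (C.φ j x 0)) ^ (b + 1))⁻¹ •
        covWedge (dzZero n) (covWedge (dzBarZero n) (g (C.φ j x)))) :
    C.term j a b g = residueIn i (C.φ j) (fmul (partFn C.ρ j) θ) := by
  funext p
  by_cases hp : i p ∈ (C.φ j).source
  · set φ := C.φ j with hφdef
    have hφ := C.adapted j
    have hsm : ∀ y ∈ φ.target, ContDiffAt ℝ ∞ (fun y => partFn C.ρ j (φ.symm y) • g y) y := fun y hy =>
      (smoothFn_partFn C.ρ j φ hφ.1 y hy).smul (hg.contDiffAt (φ.open_target.mem_nhds hy))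
    have hy := φ.map_source hp
    have h1 : C.term j a b g p = (1 / ((a.factorial : ℂ) * (b.factorial : ℂ))) • restrictToD i φ p
        (wirt^[a] (wirtBar^[b] fun y => partFn C.ρ j (φ.symm y) • g y) (φ (i p))) := if_pos hp
    have h2 : resF (coef φ (fmul (partFn C.ρ j) θ)) (φ (i p)) =
        resVal a b (fun y => hyperCoef n (partFn C.ρ j (φ.symm y) • g y)) (φ (i p)) := by
      refine resF_eq_resVal (hφ.apply_zero hp) ?_ ?_
      · exact ((hyperCoef n).restrictScalars ℝ).contDiff.contDiffAt.comp _
          ((hsm _ hy).of_le (natCast_le_infty _))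
      · filter_upwards [φ.open_target.mem_nhds hy] with y hyt h0
        rw [coef_fmul, map_smul, smul_eq_mul]
        -- The decomposition of θ is prescribed only on the support of ρ_j; elsewhere both sides
        -- vanish.
        by_cases hs : φ.symm y ∈ tsupport (C.ρ j)
        · have h3 := h _ hs fun h' => h0 ((hφ.symm_mem_range hyt).1 h')
          rw [φ.right_inv hyt] at h3
          rw [coef, h3, map_smul, coefX_covWedge, ← hyperCoef_apply, smul_eq_mul, poleMon]
          have : y 0 ^ (a + 1) * (conj (y 0)) ^ (b + 1) ≠ 0 := poleMon_ne_zero h0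
          rw [mul_left_comm, mul_inv_cancel_left₀ this]
        · rw [partFn_eq_zero hs]; ring
    rw [h1, residueIn_of_mem _ hp, h2, resVal,
      wirt_iterate_clm (hyperCoef n) φ.open_target hsm a b hy, restrictToD_eq_smul hi hφ hp, one_div]
    exact smul_smul (((a.factorial : ℂ) * (b.factorial : ℂ))⁻¹) _
      (restrictToD i φ p (tailPull (vol n)))
  · rw [residueIn_of_notMem _ hp]
    exact if_neg hp

-- Pole orders and numerators thereby disappear: among all choices in the definition only the cover
-- and its partition of unity still matter.
omit [T2Space X] [CompactSpace X] in
theorem IsAeppliResidueForm.exists_eq (hi : IsSmoothHypersurface n i)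
    {θ : Form (n + 1) X (n + n + 1 + 1)} {R : Form n D (n + n)} (h : IsAeppliResidueForm i θ R) :
    ∃ C : ResidueCover n i, R = residueSum C θ := by
  obtain ⟨C, a, b, g, hg, -, h, rfl⟩ := h
  exact ⟨C, Finset.sum_congr rfl fun j _ => term_eq_residueIn hi C j (hg j) (h j)⟩

/-- The well-definedness of the Aeppli residue: independence of the representative for one fixed
cover, followed by independence of the cover. -/
theorem residue_sub_mem (hi : IsSmoothHypersurface n i)
    {θ θ' : quasiForms n i (n + 1) (n + 1) (n + n + 1 + 1)}
    (h : (Submodule.Quotient.mk θ : AeppliPolar n i) = Submodule.Quotient.mk θ') (C C' : ResidueCover n i) :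
    residueSum C θ.1 - residueSum C' θ'.1 ∈ aeppliExact n D := by
  have h1 := residueSum_mem_of_quasiExact hi C ((Submodule.Quotient.eq _).1 h)
  have hp := polarFormAt_of_mem_quasiForms hi θ.2
  have hp' := polarFormAt_of_mem_quasiForms hi θ'.2
  have h2 : residueSum C (θ - θ').1 = residueSum C θ.1 - residueSum C θ'.1 := by
    have h3 : (θ - θ').1 = θ.1 + (-1 : ℂ) • θ'.1 := by
      rw [neg_one_smul, ← sub_eq_add_neg]; rfl
    rw [h3, residueSum_add C hp fun x => (hp' x).smul _, residueSum_smul C hp', neg_one_smul,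
      sub_eq_add_neg]
  rw [h2] at h1
  have := Submodule.add_mem _ h1 (residueSum_sub_mem hi C C' hp')
  rwa [sub_add_sub_cancel] at this

/-- The residue form of a semi-meromorphic form vanishes. -/
theorem residueIn_eq_zero_of_semi {φ : OpenPartialHomeomorph X (Cn (n + 1))} (hφ : IsAdapted i φ)
    {θ : Form (n + 1) X (n + n + 1 + 1)} (hθ : PolesAlong i (fun b => b = 0) θ) {u : X → ℂ}
    (hu : SmoothFn (n + 1) u) : residueIn i φ (fmul u θ) = 0 := by
  funext p
  by_cases hp : i p ∈ φ.source
  · obtain ⟨a, b, rfl, g, hg, h⟩ := hθ φ hφ _ hp ⟨p, rfl⟩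
    have h1 : resF (coef φ (fmul u θ)) (φ (i p)) = 0 := by
      have hu' := hu φ hφ.1 _ (φ.map_source hp)
      let G : Cn (n + 1) → ℂ := fun y => u (φ.symm y) * (y 0 * coefX n (g y))
      have hG : ContDiffAt ℝ ∞ G (φ (i p)) :=
        hu'.mul ((contDiff_coord 0).contDiffAt.mul
          (((coefX n).restrictScalars ℝ).contDiff.contDiffAt.comp _ hg))
      -- With b = 0 the assumed pole is still z̄₀⁻¹, so the numerator acquires a factor z̄₀. No
      -- derivative ∂/∂z̄₀ is taken, the derivatives ∂/∂z₀ do not see this factor, and it vanishes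
      -- on D.
      rw [resF_eq_resVal (hφ.apply_zero hp) (a := a) (b := 0)
        (G := fun y => conj (y 0) * G y) (((contDiff_conj_coord 0).contDiffAt.mul hG).of_le
          (natCast_le_infty _))]
      · rw [resVal, Function.iterate_zero, id, wirt_eq_dC]
        have h2 := dC_iterate_smul_of_zero (c := Complex.I) (v := Pi.single 0 1)
          (f := fun y : Cn (n + 1) => conj (y 0)) (F := G) (p := φ (i p))
          (Filter.Eventually.of_forall fun y => (contDiff_conj_coord 0 (l := 1)).differentiable (by simp) y)
          (Filter.Eventually.of_forall fun y => by rw [dC_conj_coord]; simp) a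
          (hG.of_le (natCast_le_infty _))
        have h3 := h2.eq_of_nhds
        simp only [smul_eq_mul] at h3
        rw [h3, hφ.apply_zero hp]; simp
      · filter_upwards [h] with y hy h0
        rw [coef_fmul, poleMon, coef]
        change _ = conj (y 0) * (u (φ.symm y) * (y 0 * coefX n (g y)))
        rw [← hy h0, map_smul, smul_eq_mul]; ring
    rw [residueIn_of_mem _ hp, h1]
    exact zero_smul ℂ (restrictToD i φ p (tailPull (vol n)))
  · rw [residueIn_of_notMem _ hp]; rfl

theorem residueSum_eq_zero_of_semi (C : ResidueCover n i) {θ : Form (n + 1) X (n + n + 1 + 1)}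
    (hθ : PolesAlong i (fun b => b = 0) θ) : residueSum C θ = 0 :=
  Finset.sum_eq_zero fun j _ => residueIn_eq_zero_of_semi (C.adapted j) hθ (smoothFn_partFn C.ρ j)

end ResidueClass

/-! ### Averages over rotations of the first coordinate -/

section Rotation

variable {n : ℕ}

/-- The point `e^{it}` of the unit circle. -/
def circ (t : ℝ) : ℂ := Complex.exp (t * Complex.I)

theorem circ_zero : circ 0 = 1 := by simp [circ]

theorem circ_add (s t : ℝ) : circ (s + t) = circ s * circ t := by
  rw [circ, circ, circ, ← Complex.exp_add]; push_cast; ring_nf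

theorem circ_add_two_pi (t : ℝ) : circ (t + 2 * Real.pi) = circ t := by
  rw [circ_add]
  have : circ (2 * Real.pi) = 1 := by rw [circ]; push_cast; exact Complex.exp_two_pi_mul_I
  rw [this, mul_one]

theorem norm_circ (t : ℝ) : ‖circ t‖ = 1 := Complex.norm_exp_ofReal_mul_I t

theorem circ_ne_zero (t : ℝ) : circ t ≠ 0 := Complex.exp_ne_zero _

theorem circ_mem_sphere (t : ℝ) : circ t ∈ Metric.sphere (0 : ℂ) 1 := by
  rw [mem_sphere_zero_iff_norm, norm_circ]

theorem contDiff_circ {l : WithTop ℕ∞} : ContDiff ℝ l circ :=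
  Complex.contDiff_exp.comp (Complex.ofRealCLM.contDiff.mul contDiff_const)

theorem hasDerivAt_circ (t : ℝ) : HasDerivAt circ (Complex.I * circ t) t := by
  have h1 : HasDerivAt (fun t : ℝ => (t : ℂ) * Complex.I) (1 * Complex.I) t :=
    (HasDerivAt.ofReal_comp (hasDerivAt_id t)).mul_const _
  refine HasDerivAt.congr_deriv (f := fun t : ℝ => Complex.exp (t * Complex.I)) h1.cexp ?_
  rw [circ]; ring

theorem eventually_scal_circ {P : Cn (n + 1) → Prop} {p : Cn (n + 1)} (hp : p 0 = 0)
    (h : ∀ᶠ y in 𝓝 p, P y) : ∀ᶠ y in 𝓝 p, ∀ t, P (scal (circ t) y) :=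
  (eventually_scal hp h (isCompact_sphere (0 : ℂ) 1)).mono fun _ hy t => hy _ (circ_mem_sphere t)

/-- Off `z₀ = 0`, the function `h` is homogeneous of weight `a` under rotations of `z₀`. -/
def HasWeightAt (a : ℕ) (h : Cn (n + 1) → ℂ) (q : Cn (n + 1)) : Prop :=
  ∀ᶠ y in 𝓝 q, y 0 ≠ 0 → ∀ s, h (scal (circ s) y) = circ s ^ a * h y

/-- Euler's relation for rotations: the weight identity is differentiated at s = 0, where the
rotation field acts as i(z₀ ∂/∂z₀ - z̄₀ ∂/∂z̄₀). -/
theorem euler_of_weight {a : ℕ} {h : Cn (n + 1) → ℂ} {y : Cn (n + 1)} (hd : DifferentiableAt ℝ h y)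
    (hw : ∀ s, h (scal (circ s) y) = circ s ^ a * h y) :
    y 0 * wirt h y - conj (y 0) * wirtBar h y = a * h y := by
  have h1 := hasDerivAt_comp_scal (h := h) (hasDerivAt_circ 0) (y := y)
    (by rwa [circ_zero, scal_one])
  have h2 : HasDerivAt (fun s => h (scal (circ s) y)) (a * circ 0 ^ (a - 1) * (Complex.I * circ 0) * h y) 0 := by
    have := ((hasDerivAt_circ 0).pow a).mul_const (h y)
    refine this.congr_of_eventuallyEq (Filter.Eventually.of_forall fun s => ?_)
    exact hw s
  have h3 := h1.unique h2
  simp only [circ_zero, scal_one, one_pow, mul_one, map_mul, Complex.conj_I] at h3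
  linear_combination (-Complex.I) * h3 + (y 0 * wirt h y - conj (y 0) * wirtBar h y - a * h y) *
    Complex.I_mul_I

/-- A smooth function of positive weight is divisible by `z₀`. -/
theorem exists_eq_coord_mul_of_weight {a : ℕ} {h : Cn (n + 1) → ℂ} {q : Cn (n + 1)} (hq : q 0 = 0)
    (hh : ContDiffAt ℝ ∞ h q) (hw : HasWeightAt (a + 1) h q) :
    ∃ g : Cn (n + 1) → ℂ, ContDiffAt ℝ ∞ g q ∧ ∀ᶠ y in 𝓝 q, y 0 ≠ 0 → h y = y 0 * g y := by
  have hs : ∀ t : ℝ, ContDiffAt ℝ ∞ (fun z : Cn (n + 1) × ℝ => scal (z.2 : ℂ) z.1) (q, t) := fun t =>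
    ContDiff.contDiffAt ((contDiff_scal (n := n)).comp
      (contDiff_fst.prodMk (Complex.ofRealCLM.contDiff.comp contDiff_snd)))
  have hwh : ContDiffAt ℝ ∞ (wirt h) q := by rw [wirt_eq_dC]; exact hh.dC_infty
  -- Euler's relation at the scaled point eliminates ∂h/∂z̄₀ and gives d/dt (t^(a+1) h(tz₀, …)) =
  -- 2z₀ t^(a+1) (∂h/∂z₀)(tz₀, …). Since a + 1 > 0 the boundary term at t = 0 vanishes, and the
  -- integral from 0 to 1 is h itself.
  refine ⟨fun y => 2 * ∫ t in (0 : ℝ)..1, (t : ℂ) ^ (a + 1) * wirt h (scal t y),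
    contDiffAt_const.mul (contDiffAt_infty_of_forall fun k => ?_), ?_⟩
  · refine contDiffAt_parametric_integral k zero_le_one fun t _ => ?_
    refine ContDiffAt.of_le ?_ (natCast_le_infty k)
    refine ContDiffAt.mul (f := fun z : Cn (n + 1) × ℝ => (z.2 : ℂ) ^ (a + 1))
      (g := fun z : Cn (n + 1) × ℝ => wirt h (scal (z.2 : ℂ) z.1)) ?_ ?_
    · exact ((Complex.ofRealCLM.contDiff.comp contDiff_snd).pow _).contDiffAt
    · exact ContDiffAt.comp (q, t) (g := wirt h) (by simpa only [scal_of_eq_zero (t : ℂ) hq] using hwh)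
        (hs t)
  · have hc1 := (hwh.of_le (natCast_le_infty 0)).eventually (natCast_ne_infty 0)
    filter_upwards [eventually_scal hq (((hh.eventually_differentiableAt (by simp)).and hc1).and hw)
      (isCompact_image_ofReal 0 1)] with y hy h0
    have hy' : ∀ t ∈ Set.Icc (0 : ℝ) 1, (DifferentiableAt ℝ h (scal t y) ∧
        ContDiffAt ℝ (0 : ℕ) (wirt h) (scal t y)) ∧ (scal (t : ℂ) y 0 ≠ 0 →
          ∀ s, h (scal (circ s) (scal t y)) = circ s ^ (a + 1) * h (scal t y)) :=
      fun t ht => hy t ⟨t, ht, rfl⟩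
    have hcs : ∀ t : ℝ, ContinuousAt (fun t : ℝ => scal (t : ℂ) y) t := fun t =>
      ((contDiff_scal (n := n) (l := 0)).continuous.comp
        (continuous_const.prodMk Complex.continuous_ofReal)).continuousAt
    have hd : ∀ t ∈ Set.Icc (0 : ℝ) 1, HasDerivAt (fun t : ℝ => h (scal t y))
        (y 0 * wirt h (scal t y) + conj (y 0) * wirtBar h (scal t y)) t := fun t ht => by
      have := hasDerivAt_comp_scal (h := h) (HasDerivAt.ofReal_comp (hasDerivAt_id t)) (y := y)
        (hy' t ht).1.1
      simpa using this
    have key := intervalIntegral.integral_eq_sub_of_hasDerivAt_of_le (a := 0) (b := 1)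
      (f := fun t : ℝ => (t : ℂ) ^ (a + 1) * h (scal t y))
      (f' := fun t : ℝ => 2 * y 0 * ((t : ℂ) ^ (a + 1) * wirt h (scal t y))) zero_le_one ?_ ?_ ?_
    · rw [intervalIntegral.integral_const_mul] at key
      simp only [Complex.ofReal_one, one_pow, one_mul, Complex.ofReal_zero, scal_one] at key
      rw [zero_pow (Nat.succ_ne_zero a), zero_mul, sub_zero] at key
      rw [← key]; ring
    · exact fun t ht => ((Complex.continuous_ofReal.pow (a + 1)).continuousAt.mul
        (hd t ht).continuousAt).continuousWithinAt
    · intro t ht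
      have ht' : t ∈ Set.Icc (0 : ℝ) 1 := ⟨ht.1.le, ht.2.le⟩
      have htc : (t : ℂ) ≠ 0 := by exact_mod_cast ht.1.ne'
      have hpow : HasDerivAt (fun t : ℝ => (t : ℂ) ^ (a + 1)) (((a : ℂ) + 1) * (t : ℂ) ^ a) t := by
        have := (HasDerivAt.ofReal_comp (hasDerivAt_id t)).pow (a + 1)
        simpa [Pi.pow_def] using this
      have he := euler_of_weight (hy' t ht').1.1 ((hy' t ht').2 (by
        rw [scal_zero_apply]; exact mul_ne_zero htc h0))
      rw [scal_zero_apply, map_mul, Complex.conj_ofReal] at he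
      refine (hpow.mul (hd t ht')).congr_deriv ?_
      push_cast at he
      linear_combination (-(t : ℂ) ^ a) * he
    · refine ContinuousOn.intervalIntegrable ?_
      rw [Set.uIcc_of_le zero_le_one]
      intro t ht
      refine ContinuousAt.continuousWithinAt (continuousAt_const.mul
        ((Complex.continuous_ofReal.pow (a + 1)).continuousAt.mul ?_))
      exact ContinuousAt.comp (f := fun t : ℝ => scal (t : ℂ) y) (hy' t ht).1.2.continuousAt (hcs t)

/-- Division by z₀ lowers the weight by one, so the previous division can be repeated a times. -/
theorem exists_eq_coord_pow_mul_of_weight (a : ℕ) {h : Cn (n + 1) → ℂ} {q : Cn (n + 1)} (hq : q 0 = 0)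
    (hh : ContDiffAt ℝ ∞ h q) (hw : HasWeightAt a h q) :
    ∃ g : Cn (n + 1) → ℂ, ContDiffAt ℝ ∞ g q ∧ ∀ᶠ y in 𝓝 q, y 0 ≠ 0 → h y = y 0 ^ a * g y := by
  induction a generalizing h with
  | zero => exact ⟨h, hh, Filter.Eventually.of_forall fun y _ => by simp⟩
  | succ a ih =>
    obtain ⟨g, hg, hhg⟩ := exists_eq_coord_mul_of_weight hq hh hw
    obtain ⟨g', hg', hgg'⟩ := ih hg (by
      filter_upwards [hw, eventually_scal_circ hq hhg, hhg] with y h1 h2 h3 h0 s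
      have h4 := h1 h0 s
      have hc := circ_ne_zero s
      have hc0 : circ s * y 0 ≠ 0 := mul_ne_zero hc h0
      rw [h2 s (by rwa [scal_zero_apply]), h3 h0, scal_zero_apply] at h4
      apply mul_left_cancel₀ hc0
      rw [h4]; ring)
    refine ⟨g', hg', ?_⟩
    filter_upwards [hhg, hgg'] with y h1 h2 h0
    rw [h1 h0, h2 h0]; ring

/-- The average of `w(t) f(e^{it} z₀, z₁, …)`. -/
def rotMean (w : ℝ → ℂ) (f : Cn (n + 1) → ℂ) (y : Cn (n + 1)) : ℂ :=
  (2 * Real.pi : ℂ)⁻¹ * ∫ t in (0 : ℝ)..(2 * Real.pi), w t * f (scal (circ t) y)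

theorem contDiff_scal_circ {l : WithTop ℕ∞} :
    ContDiff ℝ l fun z : Cn (n + 1) × ℝ => scal (circ z.2) z.1 :=
  (contDiff_scal (n := n)).comp (contDiff_fst.prodMk (contDiff_circ.comp contDiff_snd))

theorem contDiffAt_rotMean {w : ℝ → ℂ} (hw : ContDiff ℝ ∞ w) {f : Cn (n + 1) → ℂ} {y : Cn (n + 1)}
    (hf : ∀ t, ContDiffAt ℝ ∞ f (scal (circ t) y)) : ContDiffAt ℝ ∞ (rotMean w f) y := by
  refine contDiffAt_const.mul (contDiffAt_infty_of_forall fun k => ?_)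
  refine contDiffAt_parametric_integral k (by positivity) fun t _ => ?_
  refine ContDiffAt.of_le ?_ (natCast_le_infty k)
  exact ContDiffAt.mul (f := fun z : Cn (n + 1) × ℝ => w z.2)
    (g := fun z : Cn (n + 1) × ℝ => f (scal (circ z.2) z.1)) (hw.comp contDiff_snd).contDiffAt
    (ContDiffAt.comp (y, t) (g := f) (hf t) contDiff_scal_circ.contDiffAt)

/-- The monomial is homogeneous under rotations, so moving it inside the integral only changes the
weight function w. -/
theorem monomial_mul_rotMean {w : ℝ → ℂ} {f G : Cn (n + 1) → ℂ} {q : Cn (n + 1)} (hq : q 0 = 0)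
    {a b : ℕ} (h : ∀ᶠ y in 𝓝 q, y 0 ≠ 0 → y 0 ^ a * (conj (y 0)) ^ b * f y = G y) :
    ∀ᶠ y in 𝓝 q, y 0 ≠ 0 → y 0 ^ a * (conj (y 0)) ^ b * rotMean w f y =
      rotMean (fun t => w t * (circ t ^ a * conj (circ t) ^ b)⁻¹) G y := by
  filter_upwards [eventually_scal_circ hq h] with y hy h0
  rw [rotMean, rotMean, mul_left_comm, ← intervalIntegral.integral_const_mul]
  congr 1
  refine intervalIntegral.integral_congr fun t _ => ?_
  have hc := circ_ne_zero t
  have hc' : conj (circ t) ≠ 0 := by simpa using hc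
  have := hy t (by rw [scal_zero_apply]; exact mul_ne_zero hc h0)
  rw [scal_zero_apply, map_mul] at this
  change y 0 ^ a * (conj (y 0)) ^ b * (w t * f (scal (circ t) y)) =
    w t * (circ t ^ a * conj (circ t) ^ b)⁻¹ * G (scal (circ t) y)
  rw [← this, mul_pow, mul_pow]
  field_simp

theorem contDiff_weight {w : ℝ → ℂ} (hw : ContDiff ℝ ∞ w) (a b : ℕ) :
    ContDiff ℝ ∞ fun t => w t * (circ t ^ a * conj (circ t) ^ b)⁻¹ :=
  hw.mul (((contDiff_circ.pow a).mul ((Complex.conjCLE.contDiff.comp contDiff_circ).pow b)).inv fun t =>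
    mul_ne_zero (pow_ne_zero _ (circ_ne_zero t)) (pow_ne_zero _ (by simpa using circ_ne_zero t)))

theorem PolarAt.rotMean {w : ℝ → ℂ} (hw : ContDiff ℝ ∞ w) {f : Cn (n + 1) → ℂ} {y : Cn (n + 1)}
    (hf : ∀ t, PolarAt f (scal (circ t) y)) : PolarAt (rotMean w f) y := by
  by_cases h0 : y 0 = 0
  · have := hf 0
    rw [scal_of_eq_zero _ h0] at this
    obtain ⟨a, b, G, hG, h⟩ := this
    exact PolarAt.of_exponents (contDiffAt_rotMean (contDiff_weight hw (a + 1) (b + 1)) fun t => by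
      rwa [scal_of_eq_zero _ h0]) (monomial_mul_rotMean h0 h)
  · exact PolarAt.of_contDiffAt (contDiffAt_rotMean hw fun t => (hf t).contDiffAt (by
      rw [scal_zero_apply]; exact mul_ne_zero (circ_ne_zero t) h0))

theorem rotMean_one_scal (f : Cn (n + 1) → ℂ) (s : ℝ) (y : Cn (n + 1)) :
    rotMean (fun _ => 1) f (scal (circ s) y) = rotMean (fun _ => 1) f y := by
  rw [rotMean, rotMean]
  congr 1
  have hper : Function.Periodic (fun t => (1 : ℂ) * f (scal (circ t) y)) (2 * Real.pi) := fun t => by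
    simp only [circ_add_two_pi]
  have h1 := hper.intervalIntegral_add_eq s 0
  rw [zero_add] at h1
  rw [← h1]
  have h2 := intervalIntegral.integral_comp_add_right (a := 0) (b := 2 * Real.pi)
    (fun t => (1 : ℂ) * f (scal (circ t) y)) s
  rw [zero_add, add_comm (2 * Real.pi) s] at h2
  rw [← h2]
  simp only [scal_scal, circ_add]

/-- The mean of a function with a pole `z₀^{-a}` extends smoothly. -/
theorem exists_contDiffAt_rotMean {f G : Cn (n + 1) → ℂ} {q : Cn (n + 1)} (hq : q 0 = 0) {a : ℕ}
    (hG : ContDiffAt ℝ ∞ G q) (h : ∀ᶠ y in 𝓝 q, y 0 ≠ 0 → y 0 ^ a * f y = G y) :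
    ∃ g : Cn (n + 1) → ℂ, ContDiffAt ℝ ∞ g q ∧ ∀ᶠ y in 𝓝 q, y 0 ≠ 0 → rotMean (fun _ => 1) f y = g y := by
  -- z₀^a times the mean is a weighted mean of G, hence smooth. As the mean is rotation invariant,
  -- the product has weight a and is divisible by z₀^a; the quotient is the required extension.
  have h1 := monomial_mul_rotMean (w := fun _ => 1) hq (b := 0) (f := f) (G := G) (a := a)
    (h.mono fun y hy h0 => by rw [pow_zero, mul_one]; exact hy h0)
  obtain ⟨g, hg, he⟩ := exists_eq_coord_pow_mul_of_weight a hq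
    (contDiffAt_rotMean (f := G) (contDiff_weight contDiff_const a 0) fun t => by
      rwa [scal_of_eq_zero _ hq]) (by
      filter_upwards [h1, eventually_scal_circ hq h1] with y h2 h3 h0 s
      rw [← h2 h0, ← h3 s (by rw [scal_zero_apply]; exact mul_ne_zero (circ_ne_zero s) h0),
        rotMean_one_scal, scal_zero_apply]
      ring)
  refine ⟨g, hg, ?_⟩
  filter_upwards [h1, he] with y h2 h3 h0
  have := (h2 h0).trans (h3 h0)
  rw [pow_zero, mul_one] at this
  exact mul_left_cancel₀ (pow_ne_zero a h0) this

/-- The difference of a function and its mean is a sum of derivatives. -/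
theorem wirt_add_wirtBar_rotMean {f : Cn (n + 1) → ℂ} {y : Cn (n + 1)}
    (hf : ∀ t, ContDiffAt ℝ ∞ f (scal (circ t) y)) :
    wirt (fun y => (Complex.I * y 0) * rotMean (fun t => t) f y) y +
      wirtBar (fun y => (-Complex.I * conj (y 0)) * rotMean (fun t => t) f y) y =
      f y - rotMean (fun _ => 1) f y := by
  set H := rotMean (fun t => (t : ℂ)) f with hH
  have hHs : ContDiffAt ℝ ∞ H y := contDiffAt_rotMean Complex.ofRealCLM.contDiff hf
  have hHd : DifferentiableAt ℝ H y := hHs.differentiableAt (by simp)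
  let g : ℝ → ℂ := fun t => f (scal (circ t) y)
  have hg : Continuous g := continuous_iff_continuousAt.2 fun t =>
    ContinuousAt.comp (f := fun t => scal (circ t) y) (hf t).continuousAt
      ((contDiff_scal_circ (n := n) (l := 0)).continuous.comp
        (continuous_const.prodMk continuous_id)).continuousAt
  have hper : Function.Periodic g (2 * Real.pi) := fun t => by
    change f _ = f _; rw [circ_add_two_pi]
  have hpi : (2 * Real.pi : ℂ) ≠ 0 := by
    exact_mod_cast (by positivity : (2 * Real.pi : ℝ) ≠ 0)
  let P : ℝ → ℂ := fun x => ∫ t in (0 : ℝ)..x, (t : ℂ) * g t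
  have htg : Continuous fun t : ℝ => (t : ℂ) * g t := Complex.continuous_ofReal.mul hg
  have hP : ∀ x : ℝ, HasDerivAt P ((x : ℂ) * g x) x := fun x =>
    intervalIntegral.integral_hasDerivAt_right (htg.intervalIntegrable _ _)
      htg.aestronglyMeasurable.stronglyMeasurableAtFilter htg.continuousAt
  -- On the rotated point, shifting the variable by s turns the weight t into t - s on [s, s + 2π].
  -- The term with s is integrated over one full period and so does not depend on the starting
  -- point.
  have h1 : ∀ s : ℝ, H (scal (circ s) y) = (2 * Real.pi : ℂ)⁻¹ *
      (P (s + 2 * Real.pi) - P s - s * ∫ t in (0 : ℝ)..(2 * Real.pi), g t) := fun s => by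
    rw [hH, rotMean]
    congr 1
    have e1 : ∀ t, f (scal (circ t) (scal (circ s) y)) = g (t + s) := fun t => by
      change _ = f _; rw [scal_scal, circ_add]
    simp only [e1]
    have e2 := intervalIntegral.integral_comp_add_right (a := 0) (b := 2 * Real.pi)
      (fun t => ((t : ℂ) - s) * g t) s
    have e3 : (fun t : ℝ => ((t + s : ℝ) - (s : ℂ)) * g (t + s)) = fun t : ℝ => (t : ℂ) * g (t + s) := by
      funext t; push_cast; ring
    rw [e3, zero_add, add_comm (2 * Real.pi) s] at e2
    rw [e2]
    have e4 := hper.intervalIntegral_add_eq s 0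
    rw [zero_add] at e4
    have hsg : Continuous fun t : ℝ => (s : ℂ) * g t := continuous_const.mul hg
    rw [← e4, intervalIntegral.integral_interval_sub_left (htg.intervalIntegrable _ _)
      (htg.intervalIntegrable _ _), ← intervalIntegral.integral_const_mul,
      ← intervalIntegral.integral_sub (htg.intervalIntegrable _ _)
        (hsg.intervalIntegrable _ _)]
    exact intervalIntegral.integral_congr fun t _ => by ring
  -- The weight t jumps by 2π over one turn. The boundary term at 2π gives f(y), and differentiating
  -- the factor s gives minus the mean.
  have h2 : HasDerivAt (fun s => H (scal (circ s) y)) (f y - rotMean (fun _ => 1) f y) 0 := by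
    have hP1 : HasDerivAt (fun s => P (s + 2 * Real.pi)) (((2 * Real.pi : ℝ) : ℂ) * g (2 * Real.pi)) 0 := by
      have := HasDerivAt.comp_add_const (f := P) 0 (2 * Real.pi) (by rw [zero_add]; exact hP _)
      exact this
    have hP2 := hP 0
    have hP3 : HasDerivAt (fun s : ℝ => (s : ℂ) * ∫ t in (0 : ℝ)..(2 * Real.pi), g t)
        (1 * ∫ t in (0 : ℝ)..(2 * Real.pi), g t) 0 :=
      (HasDerivAt.ofReal_comp (hasDerivAt_id (0 : ℝ))).mul_const _
    have h3 := ((hP1.sub hP2).sub hP3).const_mul (2 * Real.pi : ℂ)⁻¹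
    refine (h3.congr_of_eventuallyEq (Filter.Eventually.of_forall fun s => h1 s)).congr_deriv ?_
    have hg0 : g (2 * Real.pi) = f y := by
      have := hper 0
      rw [zero_add] at this
      rw [this]; change f _ = _; rw [circ_zero, scal_one]
    rw [hg0, rotMean]
    simp only [one_mul, Complex.ofReal_zero, zero_mul, sub_zero]
    push_cast
    rw [mul_sub, inv_mul_cancel_left₀ hpi]
  -- The derivative of H under rotation is also iz₀ ∂H/∂z₀ - iz̄₀ ∂H/∂z̄₀. This is the left side of
  -- the claim, because the two terms ±iH from the product rule cancel.
  have h4 := hasDerivAt_comp_scal (h := H) (hasDerivAt_circ 0) (y := y)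
    (by rwa [circ_zero, scal_one])
  have h5 := h4.unique h2
  simp only [circ_zero, scal_one, mul_one, map_mul, Complex.conj_I] at h5
  have hc1 : DifferentiableAt ℝ (fun y : Cn (n + 1) => Complex.I * y 0) y :=
    ((contDiff_const.mul (contDiff_coord 0)).contDiffAt (n := 1)).differentiableAt (by simp)
  have hc2 : DifferentiableAt ℝ (fun y : Cn (n + 1) => -Complex.I * conj (y 0)) y :=
    ((contDiff_const.mul (contDiff_conj_coord 0)).contDiffAt (n := 1)).differentiableAt (by simp)
  have hz1 : DifferentiableAt ℝ (fun y : Cn (n + 1) => y 0) y :=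
    ((contDiff_coord 0).contDiffAt (n := 1)).differentiableAt (by simp)
  have hz2 : DifferentiableAt ℝ (fun y : Cn (n + 1) => conj (y 0)) y :=
    ((contDiff_conj_coord 0).contDiffAt (n := 1)).differentiableAt (by simp)
  rw [← h5, wirt_eq_dC, wirtBar_eq_dC, dC_mul hc1 hHd, dC_mul hc2 hHd,
    dC_mul (f := fun _ => Complex.I) (differentiableAt_const _) hz1,
    dC_mul (f := fun _ => -Complex.I) (differentiableAt_const _) hz2, dC_const, dC_const, dC_coord,
    dC_conj_coord, Pi.single_eq_same, map_one]
  ring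

end Rotation

/-! ### Semi-meromorphic classes -/

section SmoothAcross

variable {n k : ℕ} {X : Type*} [TopologicalSpace X] [ChartedSpace (Cn (n + 1)) X]
  [IsManifold 𝓘(ℂ, Cn (n + 1)) ω X] {D : Type*} {i : D → X}

variable (i) in
/-- Off the hypersurface, the form `θ` agrees near `x` with a form which is smooth at `x`. -/
def SmoothAcrossAt (θ : Form (n + 1) X k) (x : X) : Prop :=
  ∀ φ, IsAdapted i φ → x ∈ φ.source → ∃ G : Cn (n + 1) → Covec (n + 1) k,
    ContDiffAt ℝ ∞ G (φ x) ∧ ∀ᶠ y in 𝓝 (φ x), y 0 ≠ 0 → inChart φ θ y = G y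

theorem SmoothAtPt.smoothAcrossAt {θ : Form (n + 1) X k} {x : X} (h : SmoothAtPt θ x) :
    SmoothAcrossAt i θ x := fun φ hφ hx =>
  ⟨_, h φ hφ.1 hx, Filter.Eventually.of_forall fun _ _ => rfl⟩

theorem SmoothAcrossAt.add {θ η : Form (n + 1) X k} {x : X} (h : SmoothAcrossAt i θ x)
    (h' : SmoothAcrossAt i η x) : SmoothAcrossAt i (θ + η) x := fun φ hφ hx => by
  obtain ⟨G, hG, he⟩ := h φ hφ hx
  obtain ⟨G', hG', he'⟩ := h' φ hφ hx
  refine ⟨G + G', hG.add hG', ?_⟩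
  filter_upwards [he, he'] with y h1 h2 h0
  rw [inChart_add, Pi.add_apply, Pi.add_apply, h1 h0, h2 h0]

theorem SmoothAcrossAt.sum {ι : Type*} {s : Finset ι} {θ : ι → Form (n + 1) X k} {x : X}
    (h : ∀ j ∈ s, SmoothAcrossAt i (θ j) x) : SmoothAcrossAt i (∑ j ∈ s, θ j) x := by
  classical
  induction s using Finset.induction_on with
  | empty => exact (SmoothAtPt.zero x).smoothAcrossAt
  | insert a s ha ih =>
    rw [Finset.sum_insert ha]
    exact (h a (by simp)).add (ih fun j hj => h j (by simp [hj]))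

theorem SmoothAcrossAt.of_chart {θ : Form (n + 1) X k} {x : X}
    {ψ : OpenPartialHomeomorph X (Cn (n + 1))} (hψ : IsAdapted i ψ) (hx : x ∈ ψ.source)
    {G : Cn (n + 1) → Covec (n + 1) k} (hG : ContDiffAt ℝ ∞ G (ψ x))
    (h : ∀ᶠ y in 𝓝 (ψ x), y 0 ≠ 0 → inChart ψ θ y = G y) : SmoothAcrossAt i θ x := fun φ hφ hxφ => by
  have hy := φ.map_source hxφ
  have hy' : φ.symm (φ x) ∈ ψ.source := by rwa [φ.left_inv hxφ]
  have hT := contDiffAt_transition hφ.1 hψ.1 hy hy'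
  refine ⟨fun y => (G (ψ (φ.symm y))).compContinuousLinearMap (fderiv ℝ (fun y => ψ (φ.symm y)) y),
    contDiffAt_pullback hT le_rfl (by rwa [φ.left_inv hxφ]), ?_⟩
  have h2 := hT.continuousAt.tendsto
  rw [φ.left_inv hxφ] at h2
  filter_upwards [eventually_mem_transition hφ.1 hψ.1 hy hy', h2.eventually h] with y h3 h4 h0
  rw [inChart_transition hφ.1 hψ.1 θ h3.1 h3.2, h4 fun h5 => h0 ?_]
  exact (hφ.symm_mem_range h3.1).1 ((hψ.mem_iff _ h3.2).2 h5)

theorem scal_circ_mem_ball {q y : Cn (n + 1)} (hq : q 0 = 0) {r : ℝ} (hy : y ∈ Metric.ball q r) (t : ℝ) :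
    scal (circ t) y ∈ Metric.ball q r := by
  have hr : 0 < r := lt_of_le_of_lt dist_nonneg (Metric.mem_ball.1 hy)
  rw [Metric.mem_ball, dist_pi_lt_iff hr] at hy ⊢
  intro j
  refine Fin.cases ?_ (fun j => ?_) j
  · have := hy 0
    rw [hq, dist_zero_right] at this ⊢
    rwa [scal_zero_apply, norm_mul, norm_circ, one_mul]
  · exact hy j.succ

/-- A ball of the maximum norm centred on z₀ = 0 is stable under rotations of the first coordinate,
so the chart is restricted to such a ball. -/
theorem IsAdapted.exists_rotation_invariant {φ : OpenPartialHomeomorph X (Cn (n + 1))}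
    (hφ : IsAdapted i φ) {p : D} (hp : i p ∈ φ.source) :
    ∃ ψ : OpenPartialHomeomorph X (Cn (n + 1)), IsAdapted i ψ ∧ i p ∈ ψ.source ∧
      ∀ y ∈ ψ.target, ∀ t, scal (circ t) y ∈ ψ.target := by
  obtain ⟨r, hr, hb⟩ := Metric.isOpen_iff.1 φ.open_target _ (φ.map_source hp)
  have ho : IsOpen (φ.source ∩ φ ⁻¹' Metric.ball (φ (i p)) r) :=
    φ.isOpen_inter_preimage Metric.isOpen_ball
  have hmem : ∀ y, y ∈ (φ.restr (φ.source ∩ φ ⁻¹' Metric.ball (φ (i p)) r)).target ↔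
      y ∈ Metric.ball (φ (i p)) r := fun y => by
    rw [OpenPartialHomeomorph.restr_target, ho.interior_eq]
    constructor
    · rintro ⟨h1, h2, h3⟩
      rwa [Set.mem_preimage, φ.right_inv h1] at h3
    · intro h
      refine ⟨hb h, φ.map_target (hb h), ?_⟩
      rwa [Set.mem_preimage, φ.right_inv (hb h)]
  refine ⟨φ.restr _, hφ.restr ho, ?_, fun y hy t => (hmem _).2
    (scal_circ_mem_ball (hφ.apply_zero hp) ((hmem y).1 hy) t)⟩
  rw [OpenPartialHomeomorph.restr_source' _ _ ho]
  exact ⟨hp, hp, Metric.mem_ball_self hr⟩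

variable [TopologicalSpace D] [ChartedSpace (Cn n) D]

theorem PolarFormAt.smoothAcrossAt (hi : IsSmoothHypersurface n i) {θ : Form (n + 1) X k} {x : X}
    (h : PolarFormAt i θ x) (hx : x ∉ Set.range i) : SmoothAcrossAt i θ x :=
  (h.smoothAtPt hi hx).smoothAcrossAt

theorem contractForm_mem_quasiForms (hi : IsSmoothHypersurface n i)
    {φ : OpenPartialHomeomorph X (Cn (n + 1))} {u : Cn (n + 1) → ℂ}
    (h : ∀ x, PolarFormAt i (contractForm Complex.I φ u) x) :
    contractForm Complex.I φ u ∈ quasiForms n i n (n + 1) (n + n + 1) :=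
  ⟨((polarFormAt_iff hi).1 h).1, fun _ _ => hasBidegree_ofChart (fun y =>
    (hasBidegree_iotaC (n := n + 1) (k := n + n + 1) (p := n) rfl (by omega) _ _).smul (u y)) _,
    ((polarFormAt_iff hi).1 h).2⟩

theorem contractForm_mem_quasiForms_bar (hi : IsSmoothHypersurface n i)
    {φ : OpenPartialHomeomorph X (Cn (n + 1))} {u : Cn (n + 1) → ℂ}
    (h : ∀ x, PolarFormAt i (contractForm (-Complex.I) φ u) x) :
    contractForm (-Complex.I) φ u ∈ quasiForms n i (n + 1) n (n + n + 1) :=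
  ⟨((polarFormAt_iff hi).1 h).1, fun _ _ => hasBidegree_ofChart (fun y =>
    (hasBidegree_iotaC_bar (n := n + 1) (k := n + n + 1) (p := n) rfl (by omega) _ _).smul (u y)) _,
    ((polarFormAt_iff hi).1 h).2⟩

theorem mem_quasiForms_top (hi : IsSmoothHypersurface n i) {θ : Form (n + 1) X (n + n + 1 + 1)}
    (h : ∀ x, PolarFormAt i θ x) : θ ∈ quasiForms n i (n + 1) (n + 1) (n + n + 1 + 1) :=
  ⟨((polarFormAt_iff hi).1 h).1, fun _ _ => hasBidegree_top (by omega) _, ((polarFormAt_iff hi).1 h).2⟩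

variable [T2Space X] [CompactSpace X] [IsManifold 𝓘(ℂ, Cn n) ω D]

/-- In a rotation invariant chart let f be the coefficient of uθ and H its mean with weight t.
Subtracting ∂ and ∂̄ of the contracted volume forms with coefficients iz₀H and -iz̄₀H leaves the
plain mean of f, which extends smoothly because the pole of f involves z₀ only. -/
theorem exists_smoothing_near (hi : IsSmoothHypersurface n i) {θ : Form (n + 1) X (n + n + 1 + 1)}
    (hθ : ∀ x, PolarFormAt i θ x) (hθ' : PolesAlong i (fun b => b = 0) θ) (x : X) :
    ∃ U ∈ 𝓝 x, ∀ u : X → ℂ, SmoothFn (n + 1) u → ∀ K ⊆ interior U, IsClosed K → (∀ x ∉ K, u x = 0) →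
      ∃ ξ ∈ quasiForms n i n (n + 1) (n + n + 1), ∃ ξ' ∈ quasiForms n i (n + 1) n (n + n + 1),
        ∀ x, SmoothAcrossAt i (fmul u θ + (delM Complex.I ξ + delM (-Complex.I) ξ')) x := by
  by_cases hx : x ∈ Set.range i
  · obtain ⟨p, rfl⟩ := hx
    obtain ⟨φ₀, hφ₀, hp₀, -⟩ := exists_isAdapted hi (x := i p) Filter.univ_mem
    obtain ⟨φ, hφ, hp, hrot⟩ := hφ₀.exists_rotation_invariant hp₀
    refine ⟨φ.source, φ.open_source.mem_nhds hp, fun u hu K hKφ hK hu0 => ?_⟩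
    rw [φ.open_source.interior_eq] at hKφ
    have hpol : ∀ x, PolarFormAt i (fmul u θ) x := fun x => (hθ x).fmul hu
    have hzero : ∀ x ∉ K, fmul u θ x = 0 := fun x hx => fmul_eq_zero θ (hu0 x hx)
    set f := coef φ (fmul u θ) with hf
    have hfpol : ∀ y ∈ φ.target, PolarAt f y := fun y hy => by
      have := (hpol (φ.symm y)).coef hφ (φ.map_target hy)
      rwa [φ.right_inv hy] at this
    have hf0 : ∀ y ∈ φ.target, y ∉ φ '' K → f y = 0 := fun y hy hyK => by
      rw [hf, coef, inChart_apply, hzero _ fun h => hyK ⟨_, h, φ.right_inv hy⟩]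
      exact map_zero (coefX n)
    -- H(y) uses the values of f at the points obtained from y by rotation through t in [0, 2π]. So
    -- it vanishes unless y comes from φ(K) by rotation through some -t, and these points form a
    -- compact subset of the chart.
    let K₁ : Set (Cn (n + 1)) := (fun z : Cn (n + 1) × ℝ => scal (circ z.2) z.1) ''
      ((φ '' K) ×ˢ Set.Icc (-(2 * Real.pi)) 0)
    have hK₁ : IsCompact K₁ := ((hK.isCompact.image_of_continuousOn (φ.continuousOn.mono hKφ)).prod
      isCompact_Icc).image (contDiff_scal_circ (l := 0)).continuous
    have hK₁t : K₁ ⊆ φ.target := by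
      rintro _ ⟨⟨_, t⟩, ⟨⟨x, hx, rfl⟩, -⟩, rfl⟩
      exact hrot _ (φ.map_source (hKφ hx)) t
    set H := rotMean (fun t => (t : ℂ)) f with hH
    have hHpol : ∀ y ∈ φ.target, PolarAt H y := fun y hy =>
      PolarAt.rotMean Complex.ofRealCLM.contDiff fun t => hfpol _ (hrot y hy t)
    have hH0 : ∀ y ∈ φ.target, y ∉ K₁ → H y = 0 := fun y hy hyK => by
      rw [hH, rotMean, intervalIntegral.integral_congr (g := fun _ => (0 : ℂ)),
        intervalIntegral.integral_zero, mul_zero]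
      intro t ht
      rw [Set.uIcc_of_le (by positivity)] at ht
      change _ * f _ = 0
      rw [hf0 _ (hrot y hy t) fun h => hyK ⟨(_, -t), ⟨h, neg_le_neg ht.2, by
        simpa using ht.1⟩, ?_⟩, mul_zero]
      change scal (circ (-t)) (scal (circ t) y) = y
      rw [scal_scal, ← circ_add, neg_add_cancel, circ_zero, scal_one]
    let K₂ : Set X := φ.symm '' K₁
    have hK₂ : IsClosed K₂ := (hK₁.image_of_continuousOn (φ.continuousOn_symm.mono hK₁t)).isClosed
    have hK₂φ : K₂ ⊆ φ.source := by
      rintro _ ⟨y, hy, rfl⟩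
      exact φ.map_target (hK₁t hy)
    have hH0' : ∀ y ∈ φ.target, φ.symm y ∉ K₂ → H y = 0 := fun y hy hyK =>
      hH0 y hy fun h => hyK ⟨y, h, rfl⟩
    -- The two derivatives of the unsigned functions add up to f minus its mean; the factor -1 makes
    -- the sum with f equal to the mean.
    let u₁ : Cn (n + 1) → ℂ := fun y => (-1) * ((Complex.I * y 0) * H y)
    let u₂ : Cn (n + 1) → ℂ := fun y => (-1) * ((-Complex.I * conj (y 0)) * H y)
    have hu₁0 : ∀ y ∈ φ.target, φ.symm y ∉ K₂ → u₁ y = 0 := fun y hy hyK => by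
      change _ * (_ * H y) = 0; rw [hH0' y hy hyK]; ring
    have hu₂0 : ∀ y ∈ φ.target, φ.symm y ∉ K₂ → u₂ y = 0 := fun y hy hyK => by
      change _ * (_ * H y) = 0; rw [hH0' y hy hyK]; ring
    have hz1 : ContDiff ℝ ∞ fun y : Cn (n + 1) => Complex.I * y 0 := contDiff_const.mul (contDiff_coord 0)
    have hz2 : ContDiff ℝ ∞ fun y : Cn (n + 1) => -Complex.I * conj (y 0) :=
      contDiff_const.mul (contDiff_conj_coord 0)
    have hu₁ : ∀ y ∈ φ.target, PolarAt u₁ y := fun y hy =>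
      ((PolarAt.of_contDiffAt hz1.contDiffAt).mul (hHpol y hy)).const_mul _
    have hu₂ : ∀ y ∈ φ.target, PolarAt u₂ y := fun y hy =>
      ((PolarAt.of_contDiffAt hz2.contDiffAt).mul (hHpol y hy)).const_mul _
    have hξ := polarFormAt_contractForm (c := Complex.I) hφ hK₂ hK₂φ hu₁0 hu₁
    have hξ' := polarFormAt_contractForm (c := -Complex.I) hφ hK₂ hK₂φ hu₂0 hu₂
    refine ⟨_, contractForm_mem_quasiForms hi hξ, _, contractForm_mem_quasiForms_bar hi hξ', fun x => ?_⟩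
    have htot : ∀ x, PolarFormAt i (fmul u θ + (delM Complex.I (contractForm Complex.I φ u₁) +
        delM (-Complex.I) (contractForm (-Complex.I) φ u₂))) x := fun x =>
      (hpol x).add ((PolarFormAt.delM (by simp) hξ x).add (PolarFormAt.delM (by simp) hξ' x))
    by_cases hxD : x ∈ Set.range i
    swap
    · exact (htot x).smoothAcrossAt hi hxD
    by_cases hxφ : x ∈ φ.source
    · have h0 : φ x 0 = 0 := (hφ.mem_iff x hxφ).1 hxD
      -- The order a may depend on the point x of D. This is harmless, since the mean is a single
      -- function and its extension is tested at one point at a time.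
      obtain ⟨a, b, rfl, g, hg, he⟩ := hθ' φ hφ x hxφ hxD
      obtain ⟨g', hg', he'⟩ := exists_contDiffAt_rotMean (f := f) h0 (a := a)
        (G := fun y => u (φ.symm y) * coefX n (g y))
        ((hu φ hφ.1 _ (φ.map_source hxφ)).mul
          (((coefX n).restrictScalars ℝ).contDiff.contDiffAt.comp _ hg)) (by
        filter_upwards [he] with y hy h0
        rw [← hy h0, hf, coef_fmul, pow_zero, mul_one, map_smul, smul_eq_mul, coef]; ring)
      refine SmoothAcrossAt.of_chart hφ hxφ (G := fun y => g' y • volX n) (hg'.smul contDiffAt_const) ?_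
      filter_upwards [he', φ.open_target.mem_nhds (φ.map_source hxφ)] with y hy hyt h0
      have hfs : ∀ t, ContDiffAt ℝ ∞ f (scal (circ t) y) := fun t =>
        (hfpol _ (hrot y hyt t)).contDiffAt (by
          rw [scal_zero_apply]; exact mul_ne_zero (circ_ne_zero t) h0)
      have hHd : DifferentiableAt ℝ H y := ((hHpol y hyt).contDiffAt h0).differentiableAt (by simp)
      have hm1 : DifferentiableAt ℝ (fun y => (Complex.I * y 0) * H y) y :=
        ((hz1.contDiffAt).differentiableAt (by simp)).mul hHd
      have hm2 : DifferentiableAt ℝ (fun y => (-Complex.I * conj (y 0)) * H y) y :=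
        ((hz2.contDiffAt).differentiableAt (by simp)).mul hHd
      rw [inChart_eq_coef_smul]
      congr 1
      have hc1 : coef φ (delM Complex.I (contractForm Complex.I φ u₁)) y =
          dC Complex.I (Pi.single 0 1) u₁ y :=
        coef_delM_contractForm (by simp) hφ.1 hyt ((differentiableAt_const _).mul hm1)
      have hc2 : coef φ (delM (-Complex.I) (contractForm (-Complex.I) φ u₂)) y =
          dC (-Complex.I) (Pi.single 0 1) u₂ y :=
        coef_delM_contractForm (by simp) hφ.1 hyt ((differentiableAt_const _).mul hm2)
      have hd1 := dC_mul (c := Complex.I) (v := Pi.single 0 1) (f := fun _ => (-1 : ℂ))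
        (differentiableAt_const _) hm1
      have hd2 := dC_mul (c := -Complex.I) (v := Pi.single 0 1) (f := fun _ => (-1 : ℂ))
        (differentiableAt_const _) hm2
      rw [dC_const] at hd1 hd2
      rw [coef_add, coef_add, Pi.add_apply, Pi.add_apply, hc1, hc2, hd1, hd2, ← hy h0, ← hf]
      have := wirt_add_wirtBar_rotMean hfs
      rw [← hH, wirt_eq_dC, wirtBar_eq_dC] at this
      linear_combination (-1) * this
    · refine ((SmoothAtPt.zero x).congr ?_).smoothAcrossAt
      filter_upwards [(hK.union hK₂).isOpen_compl.mem_nhds fun h => hxφ (h.elim (@hKφ x) (@hK₂φ x))]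
        with x' hx'
      have h1 : x' ∉ K := fun h => hx' (Or.inl h)
      have h2 : x' ∉ K₂ := fun h => hx' (Or.inr h)
      change 0 = fmul u θ x' + (delM Complex.I _ x' + delM (-Complex.I) _ x')
      rw [hzero x' h1, delM_eq_zero_of_closed hK₂ (fun x hx => contractForm_eq_zero hu₁0 hx) h2,
        delM_eq_zero_of_closed hK₂ (fun x hx => contractForm_eq_zero hu₂0 hx) h2, add_zero, add_zero]
  · refine ⟨(Set.range i)ᶜ, hi.isClosed_range.isOpen_compl.mem_nhds hx, fun u hu K hKU hK hu0 =>
      ⟨0, Submodule.zero_mem _, 0, Submodule.zero_mem _, fun x => ?_⟩⟩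
    rw [delM_zero, delM_zero, add_zero, add_zero]
    by_cases hxK : x ∈ K
    · exact ((hθ x).fmul hu).smoothAcrossAt hi (interior_subset (hKU hxK))
    · refine ((SmoothAtPt.zero x).congr ?_).smoothAcrossAt
      filter_upwards [hK.isOpen_compl.mem_nhds hxK] with x' hx'
      exact (fmul_eq_zero θ (hu0 x' hx')).symm

/-- A semi-meromorphic class is represented by a form which extends smoothly across the
hypersurface. -/
theorem exists_smooth_representative (hi : IsSmoothHypersurface n i)
    (θ : quasiForms n i (n + 1) (n + 1) (n + n + 1 + 1)) (hθ : PolesAlong i (fun b => b = 0) θ.1) :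
    ∃ θ' : quasiForms n i (n + 1) (n + 1) (n + n + 1 + 1),
      (Submodule.Quotient.mk θ' : AeppliPolar n i) = Submodule.Quotient.mk θ ∧
      ∀ x, SmoothAcrossAt i θ'.1 x := by
  have hp := polarFormAt_of_mem_quasiForms hi θ.2
  choose U hU hmem using exists_smoothing_near hi hp hθ
  obtain ⟨N, c, ρ, hρ⟩ := exists_partition (n := n) hU
  choose ξ hξ ξ' hξ' hs using fun j => hmem (c j) (partFn ρ j) (smoothFn_partFn ρ j) _ (hρ j)
    (isClosed_tsupport _) fun x hx => partFn_eq_zero hx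
  have hd : ∀ j x, PolarFormAt i (delM Complex.I (ξ j)) x := fun j =>
    PolarFormAt.delM (by simp) (polarFormAt_of_mem_quasiForms hi (hξ j))
  have hd' : ∀ j x, PolarFormAt i (delM (-Complex.I) (ξ' j)) x := fun j =>
    PolarFormAt.delM (by simp) (polarFormAt_of_mem_quasiForms hi (hξ' j))
  let e : Fin N → quasiForms n i (n + 1) (n + 1) (n + n + 1 + 1) := fun j =>
    ⟨delM Complex.I (ξ j), mem_quasiForms_top hi (hd j)⟩
  let e' : Fin N → quasiForms n i (n + 1) (n + 1) (n + n + 1 + 1) := fun j =>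
    ⟨delM (-Complex.I) (ξ' j), mem_quasiForms_top hi (hd' j)⟩
  refine ⟨θ + ∑ j, (e j + e' j), ?_, fun x => ?_⟩
  · rw [Submodule.Quotient.eq, add_sub_cancel_left]
    refine Submodule.sum_mem _ fun j _ => Submodule.add_mem _ (Submodule.mem_sup_left
      (Submodule.subset_span ⟨ξ j, hξ j, fun x _ => rfl⟩)) (Submodule.mem_sup_right
      (Submodule.subset_span ⟨ξ' j, hξ' j, fun x _ => ?_⟩))
    rw [delBar_eq_delM]
  · have h1 : (θ + ∑ j, (e j + e' j)).1 = ∑ j, (fmul (partFn ρ j) θ.1 +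
        (delM Complex.I (ξ j) + delM (-Complex.I) (ξ' j))) := by
      have h2 : (∑ j, (fmul (partFn ρ j) θ.1 + (delM Complex.I (ξ j) + delM (-Complex.I) (ξ' j)))) =
          (∑ j, fmul (partFn ρ j) θ.1) + ∑ j, (delM Complex.I (ξ j) + delM (-Complex.I) (ξ' j)) :=
        Finset.sum_add_distrib
      rw [h2, sum_fmul (sum_partFn ρ), Submodule.coe_add, Submodule.coe_sum]
      rfl
    rw [h1]
    exact SmoothAcrossAt.sum fun j _ => hs j x

theorem exists_residueCover {P : OpenPartialHomeomorph X (Cn (n + 1)) → Prop}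
    (hP : ∀ x, ∃ φ, IsAdapted i φ ∧ x ∈ φ.source ∧ P φ) :
    ∃ C : ResidueCover n i, ∀ j, P (C.φ j) := by
  choose φ hφ hx hPφ using hP
  obtain ⟨N, c, ρ, hρ⟩ := exists_partition (n := n) fun x => (φ x).open_source.mem_nhds (hx x)
  exact ⟨⟨N, fun j => φ (c j), ρ, fun j => hφ _, fun j => (hρ j).trans interior_subset⟩, fun j => hPφ _⟩

theorem tailPull_update {m : ℕ} (A : Covec n m) (v : Fin m → Cn (n + 1)) (j : Fin m) (z : ℂ) :
    tailPull A (Function.update v j (Pi.single 0 z)) = 0 := by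
  rw [tailPull_apply]
  refine A.map_coord_zero j ?_
  rw [Function.update_self]
  funext l
  simp [tailL_apply]

theorem omitsDz_smul_tailPull {m : ℕ} (c : ℂ) (A : Covec n m) : OmitsDz (c • tailPull A) := fun v j => by
  change c * tailPull A _ = Complex.I * (c * tailPull A _)
  rw [tailPull_update, tailPull_update]; ring

theorem omitsDzBar_smul_tailPull {m : ℕ} (c : ℂ) (A : Covec n m) : OmitsDzBar (c • tailPull A) :=
  fun v j => by
    change c * tailPull A _ = -Complex.I * (c * tailPull A _)
    rw [tailPull_update, tailPull_update]; ring

theorem isAeppliResidueForm_residueSum (hi : IsSmoothHypersurface n i) (C : ResidueCover n i)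
    {θ : Form (n + 1) X (n + n + 1 + 1)} (a b : Fin C.N → ℕ)
    (h : ∀ j, ∀ y ∈ (C.φ j).target, ContDiffAt ℝ ∞ (fun y : Cn (n + 1) =>
      y 0 ^ (a j + 1) * (conj (y 0)) ^ (b j + 1) * coef (C.φ j) θ y) y) :
    IsAeppliResidueForm i θ (residueSum C θ) := by
  have hg : ∀ j, ContDiffOn ℝ ∞ (fun y : Cn (n + 1) =>
      (y 0 ^ (a j + 1) * (conj (y 0)) ^ (b j + 1) * coef (C.φ j) θ y) • tailPull (vol n))
      (C.φ j).target := fun j y hy => ((h j y hy).smul contDiffAt_const).contDiffWithinAt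
  have heq : ∀ j, ∀ x ∈ tsupport (C.ρ j), x ∉ Set.range i → inChart (C.φ j) θ (C.φ j x) =
      (C.φ j x 0 ^ (a j + 1) * (conj (C.φ j x 0)) ^ (b j + 1))⁻¹ • covWedge (dzZero n)
        (covWedge (dzBarZero n) ((C.φ j x 0 ^ (a j + 1) * (conj (C.φ j x 0)) ^ (b j + 1) *
          coef (C.φ j) θ (C.φ j x)) • tailPull (vol n))) := fun j x hx hxD => by
    have h0 : C.φ j x 0 ≠ 0 := fun h => hxD (((C.adapted j).mem_iff x (C.subordinate j hx)).2 h)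
    have h1 : C.φ j x 0 ^ (a j + 1) * (conj (C.φ j x 0)) ^ (b j + 1) ≠ 0 := poleMon_ne_zero h0
    rw [covWedge_smul, covWedge_smul, smul_smul, inChart_eq_coef_smul]
    change _ = _ • volX n
    congr 1
    rw [inv_mul_cancel_left₀ h1]
  refine ⟨C, a, b, _, hg, fun j y _ => ⟨omitsDz_smul_tailPull _ _, omitsDzBar_smul_tailPull _ _⟩, heq,
    Finset.sum_congr rfl fun j _ => (term_eq_residueIn hi C j (hg j) (heq j)).symm⟩

/-- Pole orders one suffice on every chart: the numerator is z₀z̄₀ times the coefficient, which is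
smooth at every point. No bound on pole orders has to be found. -/
theorem isAeppliResidueForm_of_smoothAcross (hi : IsSmoothHypersurface n i) (C : ResidueCover n i)
    {θ : Form (n + 1) X (n + n + 1 + 1)} (hθ : ∀ x, SmoothAcrossAt i θ x) :
    IsAeppliResidueForm i θ (residueSum C θ) := by
  refine isAeppliResidueForm_residueSum hi C (fun _ => 0) (fun _ => 0) fun j y hy => ?_
  obtain ⟨G, hG, he⟩ := hθ ((C.φ j).symm y) (C.φ j) (C.adapted j) ((C.φ j).map_target hy)
  rw [(C.φ j).right_inv hy] at hG he
  have h1 : ContDiffAt ℝ ∞ (fun y' : Cn (n + 1) =>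
      y' 0 ^ (0 + 1) * (conj (y' 0)) ^ (0 + 1) * coefX n (G y')) y :=
    (((contDiff_coord 0).pow (0 + 1)).mul ((contDiff_conj_coord 0).pow (0 + 1))).contDiffAt.mul
      (((coefX n).restrictScalars ℝ).contDiff.contDiffAt.comp y hG)
  refine h1.congr_of_eventuallyEq ?_
  filter_upwards [he] with y' h'
  -- On D itself the value of θ is arbitrary, but the factor z₀z̄₀ makes both sides zero.
  by_cases h0 : y' 0 = 0
  · rw [h0]; ring
  · rw [← h' h0, coef]

/-- Every residue of the class is compared with that of the semi-meromorphic representative, whose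
residue form is zero. That some residue exists at all is seen on a representative extending smoothly
across D; for the given one no chart with a uniform pole order need exist. -/
theorem aeppliResidues_eq_zero (hi : IsSmoothHypersurface n i) (c : AeppliPolar n i)
    (hc : IsSemiMeromorphicClass i c) : aeppliResidues i c = {0} := by
  obtain ⟨θ, hθ, rfl⟩ := hc
  have hzero : ∀ s ∈ aeppliResidues i (Submodule.Quotient.mk θ : AeppliPolar n i), s = 0 := by
    rintro _ ⟨θ', h1, R, hR, rfl⟩
    obtain ⟨C, hC⟩ := hR.exists_eq hi
    have h2 := residue_sub_mem hi h1 C C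
    rw [residueSum_eq_zero_of_semi C hθ.2.2, sub_zero, ← hC] at h2
    exact (Submodule.Quotient.mk_eq_zero _).2 h2
  refine Set.Subset.antisymm hzero ?_
  rw [Set.singleton_subset_iff]
  obtain ⟨θ', h1, h2⟩ := exists_smooth_representative hi θ hθ.2.2
  obtain ⟨C, -⟩ := exists_residueCover (i := i) (P := fun _ => True) fun x => by
      obtain ⟨φ, hφ, hx, -⟩ := exists_isAdapted hi (x := x) Filter.univ_mem
      exact ⟨φ, hφ, hx, trivial⟩
  have h3 : (Submodule.Quotient.mk (⟨residueSum C θ'.1, residueSum_mem_smoothForms hi C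
      (polarFormAt_of_mem_quasiForms hi θ'.2)⟩ : smoothForms n D n n (n + n)) : AeppliTop n D) ∈
      aeppliResidues i (Submodule.Quotient.mk θ : AeppliPolar n i) :=
    ⟨θ', h1, _, isAeppliResidueForm_of_smoothAcross hi C h2, rfl⟩
  rw [hzero _ h3] at h3
  exact h3

end SmoothAcross

/-! ### The wedge product of covectors -/

section Wedge

open Equiv

variable {n k l m : ℕ}

/-- The signed sum of `f` over all permutations of its arguments. -/
def altSum {α : Type*} (f : (Fin m → α) → ℂ) (v : Fin m → α) : ℂ :=
  ∑ σ : Perm (Fin m), ((Perm.sign σ : ℤ) : ℂ) * f fun j => v (σ j)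

theorem sign_mul_self_complex {ι : Type*} [Fintype ι] [DecidableEq ι] (σ : Perm ι) :
    ((Perm.sign σ : ℤ) : ℂ) * ((Perm.sign σ : ℤ) : ℂ) = 1 := by
  rw [← Int.cast_mul, ← Units.val_mul, Int.units_mul_self]; simp

theorem altSum_comp {α : Type*} (f : (Fin m → α) → ℂ) (π : Perm (Fin m)) (v : Fin m → α) :
    altSum (fun w => f fun j => w (π j)) v = ((Perm.sign π : ℤ) : ℂ) * altSum f v := by
  rw [altSum, altSum, Finset.mul_sum]
  refine Fintype.sum_equiv (Equiv.mulRight π) _ _ fun σ => ?_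
  rw [Equiv.coe_mulRight, Perm.sign_mul, Units.val_mul, Int.cast_mul, ← mul_assoc, mul_left_comm,
    sign_mul_self_complex, mul_one]
  rfl

theorem altSum_finsetSum {α ι : Type*} (s : Finset ι) (f : ι → (Fin m → α) → ℂ) (v : Fin m → α) :
    altSum (fun w => ∑ j ∈ s, f j w) v = ∑ j ∈ s, altSum (f j) v := by
  simp only [altSum, Finset.mul_sum]
  exact Finset.sum_comm

theorem altSum_const_mul {α : Type*} (c : ℂ) (f : (Fin m → α) → ℂ) (v : Fin m → α) :
    altSum (fun w => c * f w) v = c * altSum f v := by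
  simp only [altSum, Finset.mul_sum]
  exact Finset.sum_congr rfl fun σ _ => by ring

/-- A signed sum over the permutations of some of the arguments is absorbed by the signed sum
over the permutations of all arguments. -/
theorem altSum_absorb {α : Type*} {a : ℕ} (ι : Perm (Fin a) → Perm (Fin m))
    (hι : ∀ τ, Perm.sign (ι τ) = Perm.sign τ) (f : (Fin m → α) → ℂ) (v : Fin m → α) :
    altSum (fun w => ∑ τ, ((Perm.sign τ : ℤ) : ℂ) * f fun j => w (ι τ j)) v =
      (a.factorial : ℂ) * altSum f v := by
  have h (τ : Perm (Fin a)) : altSum (fun w => ((Perm.sign τ : ℤ) : ℂ) * f fun j => w (ι τ j)) v =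
      altSum f v := by
    rw [altSum_const_mul, altSum_comp, hι, ← mul_assoc, sign_mul_self_complex, one_mul]
  rw [altSum_finsetSum, Finset.sum_congr rfl fun τ _ => h τ, Finset.sum_const, Finset.card_univ,
    Fintype.card_perm, Fintype.card_fin, nsmul_eq_mul]

/-- The position of the arguments of the two factors of a wedge product. -/
def wedgeEquiv (h : k + l = m) : Fin k ⊕ Fin l ≃ Fin m := finSumFinEquiv.trans (finCongr h)

/-- A sum over shuffles times k! l! is the signed sum over all permutations. Identities for wedge
products are proved for these full sums, where rearranging arguments is easy, and the factorials are
cancelled afterwards. -/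
theorem factorial_mul_wedgeCovec (h : k + l = m) (A : Covec n k) (B : Covec n l) (v : Fin m → Cn n) :
    (k.factorial : ℂ) * l.factorial * wedgeCovec h A B v =
      altSum (fun w => A (fun i => w (wedgeEquiv h (Sum.inl i))) *
        B fun j => w (wedgeEquiv h (Sum.inr j))) v := by
  have h1 := congrArg (LinearMap.mul' ℝ ℂ) (congrFun (congrArg DFunLike.coe
    (MultilinearMap.domCoprod_alternization_eq A.toAlternatingMap B.toAlternatingMap))
      fun s => v (wedgeEquiv h s))
  rw [MultilinearMap.alternatization_apply, map_sum, AlternatingMap.smul_apply, map_nsmul,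
    Fintype.card_fin, Fintype.card_fin, nsmul_eq_mul, Nat.cast_mul] at h1
  refine h1.symm.trans (Fintype.sum_equiv (wedgeEquiv h).permCongr _ _ fun σ => ?_)
  rw [Perm.sign_permCongr, Units.smul_def, map_zsmul, zsmul_eq_mul]
  congr 1
  simp only [permCongr_apply, symm_apply_apply]
  rfl

/-- The left covector is alternating, so its signed sum is (k+1)! times itself. Its k + 1 terms
differ by signed cycles of the arguments and contribute equally to the signed sum; cancelling k + 1
gives the claim. -/
theorem factorial_mul_alternatizeUncurryFin (L : Cn n →L[ℝ] Covec n k) (v : Fin (k + 1) → Cn n) :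
    (k.factorial : ℂ) * ContinuousAlternatingMap.alternatizeUncurryFin L v =
      altSum (fun w => L (w 0) fun j => w j.succ) v := by
  set A := ContinuousAlternatingMap.alternatizeUncurryFin L with hA
  have h0 : altSum (fun w => A w) v = ((k + 1).factorial : ℂ) * A v := by
    have (σ : Perm (Fin (k + 1))) : ((Perm.sign σ : ℤ) : ℂ) * A (fun j => v (σ j)) = A v := by
      have := A.map_perm v σ
      change A (fun j => v (σ j)) = _ at this
      rw [this, Units.smul_def, zsmul_eq_mul, ← mul_assoc, sign_mul_self_complex, one_mul]
      rfl
    rw [altSum, Finset.sum_congr rfl fun σ _ => this σ, Finset.sum_const, Finset.card_univ,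
      Fintype.card_perm, Fintype.card_fin, nsmul_eq_mul]
  have h1 : altSum (fun w => A w) v = (k + 1 : ℕ) * altSum (fun w => L (w 0) fun j => w j.succ) v := by
    have (w : Fin (k + 1) → Cn n) : A w = ∑ j : Fin (k + 1), (-1) ^ (j : ℕ) *
        (L (w ((Fin.cycleRange j).symm 0)) fun i => w ((Fin.cycleRange j).symm i.succ)) := by
      rw [hA, ContinuousAlternatingMap.alternatizeUncurryFin_apply]
      refine Finset.sum_congr rfl fun j _ => ?_
      rw [zsmul_eq_mul, Fin.cycleRange_symm_zero]
      simp only [Fin.cycleRange_symm_succ]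
      push_cast
      rfl
    simp only [this]
    rw [altSum_finsetSum]
    rw [Finset.sum_congr rfl fun j _ => (altSum_const_mul _ _ _).trans (congrArg _
      (altSum_comp (fun w : Fin (k + 1) → Cn n => L (w 0) fun i => w i.succ) (Fin.cycleRange j).symm v))]
    have h2 (j : Fin (k + 1)) (z : ℂ) : (-1) ^ (j : ℕ) *
        (((Perm.sign (Fin.cycleRange j).symm : ℤ) : ℂ) * z) = z := by
      rw [Perm.sign_symm, Fin.sign_cycleRange]
      push_cast
      rw [← mul_assoc, ← mul_pow]; simp
    rw [Finset.sum_congr rfl fun j _ => h2 j _, Finset.sum_const, Finset.card_univ, Fintype.card_fin,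
      nsmul_eq_mul]
  rw [h0, Nat.factorial_succ, Nat.cast_mul, mul_assoc] at h1
  exact mul_left_cancel₀ (by exact_mod_cast Nat.succ_ne_zero k) h1

theorem factorial_mul_covWedge (ℓ : Cn n →L[ℝ] ℂ) (A : Covec n k) (v : Fin (k + 1) → Cn n) :
    (k.factorial : ℂ) * covWedge ℓ A v = altSum (fun w => ℓ (w 0) * A fun j => w j.succ) v :=
  factorial_mul_alternatizeUncurryFin _ v

theorem factorial_complex_ne_zero (k : ℕ) : (k.factorial : ℂ) ≠ 0 := by
  exact_mod_cast k.factorial_ne_zero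

theorem wedgeCovec_ext {h : k + l = m} {A : Covec n k} {B : Covec n l} {C : Covec n m}
    (hC : ∀ v, (k.factorial : ℂ) * l.factorial * C v =
      altSum (fun w => A (fun i => w (wedgeEquiv h (Sum.inl i))) *
        B fun j => w (wedgeEquiv h (Sum.inr j))) v) : wedgeCovec h A B = C := by
  ext v
  exact mul_left_cancel₀ (mul_ne_zero (factorial_complex_ne_zero k) (factorial_complex_ne_zero l))
    ((factorial_mul_wedgeCovec h A B v).trans (hC v).symm)

theorem wedgeCovec_add_left (h : k + l = m) (A A' : Covec n k) (B : Covec n l) :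
    wedgeCovec h (A + A') B = wedgeCovec h A B + wedgeCovec h A' B := wedgeCovec_ext fun v => by
  rw [ContinuousAlternatingMap.add_apply, mul_add, factorial_mul_wedgeCovec, factorial_mul_wedgeCovec,
    altSum, altSum, altSum, ← Finset.sum_add_distrib]
  refine Finset.sum_congr rfl fun σ _ => ?_
  rw [ContinuousAlternatingMap.add_apply]; ring

theorem wedgeCovec_add_right (h : k + l = m) (A : Covec n k) (B B' : Covec n l) :
    wedgeCovec h A (B + B') = wedgeCovec h A B + wedgeCovec h A B' := wedgeCovec_ext fun v => by
  rw [ContinuousAlternatingMap.add_apply, mul_add, factorial_mul_wedgeCovec, factorial_mul_wedgeCovec,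
    altSum, altSum, altSum, ← Finset.sum_add_distrib]
  refine Finset.sum_congr rfl fun σ _ => ?_
  rw [ContinuousAlternatingMap.add_apply]; ring

theorem wedgeCovec_smul_left (h : k + l = m) (c : ℂ) (A : Covec n k) (B : Covec n l) :
    wedgeCovec h (c • A) B = c • wedgeCovec h A B := wedgeCovec_ext fun v => by
  rw [ContinuousAlternatingMap.smul_apply, smul_eq_mul, mul_left_comm, factorial_mul_wedgeCovec,
    ← altSum_const_mul]
  refine Finset.sum_congr rfl fun σ _ => congrArg _ ?_
  simp only [ContinuousAlternatingMap.smul_apply, smul_eq_mul]; ring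

theorem wedgeCovec_smul_right (h : k + l = m) (c : ℂ) (A : Covec n k) (B : Covec n l) :
    wedgeCovec h A (c • B) = c • wedgeCovec h A B := wedgeCovec_ext fun v => by
  rw [ContinuousAlternatingMap.smul_apply, smul_eq_mul, mul_left_comm, factorial_mul_wedgeCovec,
    ← altSum_const_mul]
  refine Finset.sum_congr rfl fun σ _ => congrArg _ ?_
  simp only [ContinuousAlternatingMap.smul_apply, smul_eq_mul]; ring

theorem wedgeCovec_pullback {n' : ℕ} (h : k + l = m) (A : Covec n k) (B : Covec n l)
    (L : Cn n' →L[ℝ] Cn n) : wedgeCovec h (A.compContinuousLinearMap L) (B.compContinuousLinearMap L) =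
      (wedgeCovec h A B).compContinuousLinearMap L := wedgeCovec_ext fun v =>
  factorial_mul_wedgeCovec h A B fun j => L (v j)

/-- The wedge product as a bilinear map over `ℂ`. -/
def wedgeL (n : ℕ) (h : k + l = m) : Covec n k →L[ℂ] (Covec n l →L[ℂ] Covec n m) :=
  LinearMap.toContinuousLinearMap (E := Covec n k) (F' := Covec n l →L[ℂ] Covec n m)
    { toFun := fun A => LinearMap.toContinuousLinearMap (E := Covec n l) (F' := Covec n m)
        { toFun := wedgeCovec h A
          map_add' := wedgeCovec_add_right h A
          map_smul' := fun c B => wedgeCovec_smul_right h c A B }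
      map_add' := fun A A' => by ext1 B; exact wedgeCovec_add_left h A A' B
      map_smul' := fun c A => by ext1 B; exact wedgeCovec_smul_left h c A B }

theorem wedgeCovec_sub_left (h : k + l = m) (A A' : Covec n k) (B : Covec n l) :
    wedgeCovec h (A - A') B = wedgeCovec h A B - wedgeCovec h A' B :=
  ((wedgeL n h).flip B).map_sub A A'

/-- The antisymmetrization of `v ↦ L v ∧ B` is the wedge product with `B`. -/
theorem wedgeCovec_alternatizeUncurryFin (h : k + l = m) (h' : k + 1 + l = m + 1)
    (L : Cn n →L[ℝ] Covec n k) (L' : Cn n →L[ℝ] Covec n m) (B : Covec n l)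
    (hL : ∀ v, L' v = wedgeCovec h (L v) B) :
    wedgeCovec h' (ContinuousAlternatingMap.alternatizeUncurryFin L) B =
      ContinuousAlternatingMap.alternatizeUncurryFin L' := by
  refine wedgeCovec_ext fun v => ?_
  -- The common product before antisymmetrization: after clearing factorials, both sides are
  -- multiples of its signed sum.
  let f : (Fin (m + 1) → Cn n) → ℂ := fun w =>
    (L (w 0) fun j => w (wedgeEquiv h (Sum.inl j)).succ) * B fun j => w (wedgeEquiv h (Sum.inr j)).succ
  have h0 : wedgeEquiv h' (Sum.inl 0) = 0 := Fin.ext (by simp [wedgeEquiv])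
  have h1 (j : Fin k) : wedgeEquiv h' (Sum.inl j.succ) = (wedgeEquiv h (Sum.inl j)).succ :=
    Fin.ext (by simp [wedgeEquiv])
  have h2 (j : Fin l) : wedgeEquiv h' (Sum.inr j) = (wedgeEquiv h (Sum.inr j)).succ :=
    Fin.ext (by simp [wedgeEquiv]; omega)
  have e1 : (k.factorial : ℂ) * altSum (fun w : Fin (m + 1) → Cn n =>
      ContinuousAlternatingMap.alternatizeUncurryFin L (fun i => w (wedgeEquiv h' (Sum.inl i))) *
        B fun j => w (wedgeEquiv h' (Sum.inr j))) v = ((k + 1).factorial : ℂ) * altSum f v := by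
    rw [← altSum_const_mul, ← altSum_absorb (fun τ => (wedgeEquiv h').permCongr (Perm.sumCongr τ 1))
      fun τ => by rw [Perm.sign_permCongr, Perm.sign_sumCongr, Perm.sign_one, mul_one]]
    congr 1
    funext w
    rw [← mul_assoc, factorial_mul_alternatizeUncurryFin, altSum, Finset.sum_mul]
    refine Finset.sum_congr rfl fun τ _ => ?_
    simp only [f, ← h0, ← h1, ← h2, permCongr_apply, symm_apply_apply, Perm.sumCongr_apply,
      Sum.map_inl, Sum.map_inr, Perm.one_apply]
    ring
  have e2 : (m.factorial : ℂ) * ((k.factorial : ℂ) * l.factorial *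
      ContinuousAlternatingMap.alternatizeUncurryFin L' v) = (m.factorial : ℂ) * altSum f v := by
    rw [mul_left_comm, factorial_mul_alternatizeUncurryFin, ← altSum_const_mul, ← altSum_absorb
      (fun τ => Perm.decomposeFin.symm (0, τ)) fun τ => by simp]
    congr 1
    funext w
    rw [hL, factorial_mul_wedgeCovec, altSum]
    refine Finset.sum_congr rfl fun τ _ => ?_
    simp only [f, Perm.decomposeFin_symm_apply_zero, Perm.decomposeFin_symm_apply_succ, Equiv.swap_self,
      Equiv.refl_apply]
  have e3 := mul_left_cancel₀ (factorial_complex_ne_zero m) e2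
  refine mul_left_cancel₀ (factorial_complex_ne_zero k) ?_
  rw [e1, ← e3]; ring

theorem wedgeCovec_covWedge_left (h : k + l = m) (h' : k + 1 + l = m + 1) (ℓ : Cn n →L[ℝ] ℂ)
    (A : Covec n k) (B : Covec n l) :
    wedgeCovec h' (covWedge ℓ A) B = covWedge ℓ (wedgeCovec h A B) :=
  wedgeCovec_alternatizeUncurryFin h h' _ _ B fun v => (wedgeCovec_smul_left h (ℓ v) A B).symm

/-- The argument of ℓ is moved from position k to the front by a cycle of k + 1 places, whose sign
is (-1)^k. -/
theorem wedgeCovec_covWedge_right (h : k + l = m) (h' : k + (l + 1) = m + 1) (ℓ : Cn n →L[ℝ] ℂ)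
    (A : Covec n k) (B : Covec n l) :
    wedgeCovec h' A (covWedge ℓ B) = (-1 : ℂ) ^ k • covWedge ℓ (wedgeCovec h A B) := by
  refine wedgeCovec_ext fun v => ?_
  let f : (Fin (m + 1) → Cn n) → ℂ := fun w => ℓ (w 0) *
    ((A fun j => w (wedgeEquiv h (Sum.inl j)).succ) * B fun j => w (wedgeEquiv h (Sum.inr j)).succ)
  let q : Fin (m + 1) := wedgeEquiv h' (Sum.inr 0)
  have hq : (q : ℕ) = k := by simp [q, wedgeEquiv]
  have h0 : Fin.cycleRange q (wedgeEquiv h' (Sum.inr 0)) = 0 := Fin.cycleRange_self q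
  have h1 (j : Fin k) :
      Fin.cycleRange q (wedgeEquiv h' (Sum.inl j)) = (wedgeEquiv h (Sum.inl j)).succ := by
    rw [← Fin.cycleRange_succAbove q]
    congr 1
    rw [Fin.succAbove_of_castSucc_lt _ _ (Fin.lt_def.2 (by simp [hq, wedgeEquiv]))]
    exact Fin.ext (by simp [wedgeEquiv])
  have h2 (j : Fin l) :
      Fin.cycleRange q (wedgeEquiv h' (Sum.inr j.succ)) = (wedgeEquiv h (Sum.inr j)).succ := by
    rw [← Fin.cycleRange_succAbove q]
    congr 1
    rw [Fin.succAbove_of_le_castSucc _ _ (Fin.le_def.2 (by simp [hq, wedgeEquiv]))]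
    exact Fin.ext (by simp [wedgeEquiv]; omega)
  have e1 : (l.factorial : ℂ) * altSum (fun w : Fin (m + 1) → Cn n =>
      A (fun i => w (wedgeEquiv h' (Sum.inl i))) *
        covWedge ℓ B fun j => w (wedgeEquiv h' (Sum.inr j))) v =
      ((l + 1).factorial : ℂ) * altSum (fun w => f fun j => w ((Fin.cycleRange q).symm j)) v := by
    rw [← altSum_const_mul, ← altSum_absorb (fun τ => (wedgeEquiv h').permCongr (Perm.sumCongr 1 τ))
      fun τ => by rw [Perm.sign_permCongr, Perm.sign_sumCongr, Perm.sign_one, one_mul]]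
    congr 1
    funext w
    rw [mul_left_comm, factorial_mul_covWedge, altSum, Finset.mul_sum]
    refine Finset.sum_congr rfl fun τ _ => ?_
    simp only [f, ← h0, ← h1, ← h2, permCongr_apply, symm_apply_apply, Perm.sumCongr_apply,
      Sum.map_inl, Sum.map_inr, Perm.one_apply]
    ring
  have e2 : (m.factorial : ℂ) * ((k.factorial : ℂ) * l.factorial * covWedge ℓ (wedgeCovec h A B) v) =
      (m.factorial : ℂ) * altSum f v := by
    rw [mul_left_comm, factorial_mul_covWedge, ← altSum_const_mul, ← altSum_absorb
      (fun τ => Perm.decomposeFin.symm (0, τ)) fun τ => by simp]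
    congr 1
    funext w
    rw [mul_left_comm, factorial_mul_wedgeCovec, altSum, Finset.mul_sum]
    refine Finset.sum_congr rfl fun τ _ => ?_
    simp only [f, Perm.decomposeFin_symm_apply_zero, Perm.decomposeFin_symm_apply_succ, Equiv.swap_self,
      Equiv.refl_apply]
    ring
  have e3 := mul_left_cancel₀ (factorial_complex_ne_zero m) e2
  rw [altSum_comp, Perm.sign_symm, Fin.sign_cycleRange, hq, ← e3] at e1
  refine mul_left_cancel₀ (factorial_complex_ne_zero l) ?_
  rw [e1, ContinuousAlternatingMap.smul_apply, smul_eq_mul]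
  push_cast
  ring

theorem HasBidegree.wedge {p q p' q' : ℕ} (h : k + l = m) {A : Covec n k} {B : Covec n l}
    (hA : HasBidegree p q A) (hB : HasBidegree p' q' B) :
    HasBidegree (p + p') (q + q') (wedgeCovec h A B) := fun c v => by
  let L : Cn n →L[ℝ] Cn n := (c • ContinuousLinearMap.id ℂ (Cn n)).restrictScalars ℝ
  have h1 : A.compContinuousLinearMap L = (c ^ p * conj c ^ q) • A := by ext w; exact hA c w
  have h2 : B.compContinuousLinearMap L = (c ^ p' * conj c ^ q') • B := by ext w; exact hB c w
  have h3 := wedgeCovec_pullback h A B L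
  rw [h1, h2, wedgeCovec_smul_left, wedgeCovec_smul_right, smul_smul] at h3
  refine (congrFun (congrArg DFunLike.coe h3.symm) v).trans ?_
  rw [ContinuousAlternatingMap.smul_apply, smul_eq_mul]; ring

theorem conjCovec_apply (A : Covec n k) (v : Fin k → Cn n) : conjCovec A v = conj (A v) := rfl

theorem conjCovec_smul (c : ℂ) (A : Covec n k) : conjCovec (c • A) = conj c • conjCovec A := by
  ext v
  exact map_mul (starRingEnd ℂ) c (A v)

theorem conjCovec_pullback {n' : ℕ} (A : Covec n k) (L : Cn n' →L[ℝ] Cn n) :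
    conjCovec (A.compContinuousLinearMap L) = (conjCovec A).compContinuousLinearMap L := rfl

theorem HasBidegree.conj {p q : ℕ} {A : Covec n k} (hA : HasBidegree p q A) :
    HasBidegree q p (conjCovec A) := fun c v => by
  rw [conjCovec_apply, hA c v, conjCovec_apply]
  simp only [map_mul, map_pow, Complex.conj_conj]; ring

theorem conjCovec_covWedge_dzZero (A : Covec (n + 1) k) :
    conjCovec (covWedge (dzZero n) A) = covWedge (dzBarZero n) (conjCovec A) := by
  ext v
  rw [conjCovec_apply, covWedge_apply, covWedge_apply, map_sum]
  refine Finset.sum_congr rfl fun j _ => ?_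
  simp only [map_mul, map_pow, map_neg, map_one]
  rfl

/-- Complex conjugation of covectors as a real-linear map. -/
def conjCovecL (n k : ℕ) : Covec n k →L[ℝ] Covec n k :=
  LinearMap.toContinuousLinearMap
    { toFun := conjCovec
      map_add' := fun A B => by ext v; exact map_add (starRingEnd ℂ) (A v) (B v)
      map_smul' := fun c A => by
        ext v
        exact (Complex.conjCLE : ℂ →L[ℝ] ℂ).map_smul c (A v) }

/-- If `∂̄G = 0` then `∂(F ∧ Ḡ) = ∂F ∧ Ḡ`. -/
theorem delC_wedge_conj (h : k + l = m) (h' : k + 1 + l = m + 1) {F : Cn n → Covec n k}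
    {G : Cn n → Covec n l} {y : Cn n} (hF : DifferentiableAt ℝ F y) (hG : DifferentiableAt ℂ G y) :
    delC Complex.I (fun y => wedgeCovec h (F y) (conjCovec (G y))) y =
      wedgeCovec h' (delC Complex.I F y) (conjCovec (G y)) := by
  have hG' := (hG.hasFDerivAt.restrictScalars ℝ)
  have hc : HasFDerivAt (fun y => conjCovec (G y))
      ((conjCovecL n l).comp ((fderiv ℂ G y).restrictScalars ℝ)) y :=
    (conjCovecL n l).hasFDerivAt.comp y hG'
  let b : Covec n k →L[ℝ] Covec n l →L[ℝ] Covec n m :=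
    (ContinuousLinearMap.restrictScalarsL ℂ (Covec n l) (Covec n m) ℝ ℝ).comp
      ((wedgeL n h).restrictScalars ℝ)
  have hw := b.hasFDerivAt_of_bilinear hF.hasFDerivAt hc
  symm
  refine wedgeCovec_alternatizeUncurryFin h h' _ _ _ fun v => ?_
  have hw' : fderiv ℝ (fun y => wedgeCovec h (F y) (conjCovec (G y))) y = _ := hw.fderiv
  rw [hw', typePart_apply, typePart_apply]
  have hk (v : Cn n) : (b.precompR (Cn n) (F y) ((conjCovecL n l).comp
      ((fderiv ℂ G y).restrictScalars ℝ)) + b.precompL (Cn n) (fderiv ℝ F y) (conjCovec (G y))) v =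
      wedgeCovec h (F y) (conjCovec (fderiv ℂ G y v)) +
        wedgeCovec h (fderiv ℝ F y v) (conjCovec (G y)) := rfl
  have hI : fderiv ℂ G y (Complex.I • v) = Complex.I • fderiv ℂ G y v := map_smul _ _ _
  have hs (A A' : Covec n k) (B : Covec n l) : wedgeCovec h ((1 / 2 : ℂ) • (A - Complex.I • A')) B =
      (1 / 2 : ℂ) • (wedgeCovec h A B - Complex.I • wedgeCovec h A' B) := by
    rw [wedgeCovec_smul_left, wedgeCovec_sub_left, wedgeCovec_smul_left]
  -- The derivative of the conjugate of G is antilinear, so its contributions along v and iv cancel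
  -- in the complex linear part.
  rw [hk, hk, hI, hs, conjCovec_smul, Complex.conj_I, wedgeCovec_smul_right]
  congr 1
  rw [smul_add, smul_smul, mul_neg, Complex.I_mul_I, neg_neg, one_smul]
  abel

end Wedge

/-! ### Holomorphic functions of several variables -/

section Holomorphic

open Metric

variable {m : ℕ} {f : Cn m → ℂ} {U : Set (Cn m)}

theorem norm_fderiv_le_of_bounded {p : Cn m} {r M : ℝ} (hr : 0 < r) (hf : DifferentiableOn ℂ f (ball p r))
    (hM : ∀ y ∈ ball p r, ‖f y‖ ≤ M) : ‖fderiv ℂ f p‖ ≤ (M + M) / r :=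
  Complex.norm_fderiv_le_div_of_mapsTo_ball hf (fun y hy => by
    rw [mem_closedBall, dist_eq_norm]
    exact (norm_sub_le _ _).trans (add_le_add (hM y hy) (hM p (mem_ball_self hr)))) hr

/-- Cauchy's formula on a small circle in the complex line through y in direction v expresses the
derivative as an integral over values of f, which is differentiated in y under the integral sign.
Continuity of the derivative of f is not yet known, so domination comes from a Lipschitz bound,
itself a consequence of Cauchy's estimate. -/
theorem DifferentiableOn.fderiv_apply_const (hU : IsOpen U) (hf : DifferentiableOn ℂ f U) (v : Cn m) :
    DifferentiableOn ℂ (fun y => fderiv ℂ f y v) U := by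
  intro p hp
  refine DifferentiableAt.differentiableWithinAt ?_
  obtain ⟨R, hR, hRU⟩ := nhds_basis_closedBall.mem_iff.1 (hU.mem_nhds hp)
  obtain ⟨M, hM⟩ := (isCompact_closedBall p R).exists_bound_of_continuousOn (hf.continuousOn.mono hRU)
  have hRU' : ball p R ⊆ U := ball_subset_closedBall.trans hRU
  -- Three margins of size r: base points lie within r of p, the circles reach out by less than r,
  -- and Cauchy's estimate uses a ball of radius r around each point met.
  set r := R / 3 with hr
  have hr0 : 0 < r := by positivity
  have hlip : LipschitzOnWith (Real.toNNReal ((M + M) / r)) f (ball p (r + r)) := by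
    refine Convex.lipschitzOnWith_of_nnnorm_fderiv_le (𝕜 := ℂ) (fun y hy => ?_) (fun y hy => ?_)
      (convex_ball _ _)
    · exact hf.differentiableAt (hU.mem_nhds (hRU' (ball_subset_ball (by linarith) hy)))
    · have hsub : ball y r ⊆ ball p R := ball_subset_ball' (by rw [mem_ball] at hy; linarith)
      rw [← NNReal.coe_le_coe, coe_nnnorm]
      exact (norm_fderiv_le_of_bounded hr0 (hf.mono (hsub.trans hRU'))
        fun z hz => hM z (ball_subset_closedBall (hsub hz))).trans (Real.le_coe_toNNReal _)
  obtain ⟨ε, hε, hεv⟩ : ∃ ε : ℝ, 0 < ε ∧ ε * ‖v‖ < r := by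
    refine ⟨r / (‖v‖ + 1), by positivity, ?_⟩
    rw [div_mul_eq_mul_div, div_lt_iff₀ (by positivity)]
    nlinarith [norm_nonneg v]
  have hmem {y : Cn m} {s : ℝ} (hy : y ∈ ball p s) {z : ℂ} (hz : ‖z‖ ≤ ε) : y + z • v ∈ ball p (s + r) := by
    rw [mem_ball, dist_eq_norm] at hy ⊢
    calc ‖y + z • v - p‖ = ‖(y - p) + z • v‖ := by congr 1; abel
      _ ≤ ‖y - p‖ + ‖z‖ * ‖v‖ := (norm_add_le _ _).trans_eq (by rw [norm_smul])
      _ < s + r := by nlinarith [norm_nonneg v]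
  have hcm (t : ℝ) : ‖circleMap 0 ε t‖ ≤ ε := by simp [abs_of_pos hε]
  let c : ℝ → ℂ := fun t => _root_.deriv (circleMap 0 ε) t * ((circleMap 0 ε t - 0) ^ 2)⁻¹
  have hc : Continuous c := by
    refine Continuous.mul ?_ (Continuous.inv₀ (((continuous_circleMap 0 ε).sub continuous_const).pow 2)
      fun t => ?_)
    · exact ((continuous_circleMap 0 ε).mul continuous_const).congr fun t => (deriv_circleMap 0 ε t).symm
    · rw [sub_zero]
      exact pow_ne_zero _ (circleMap_ne_center hε.ne')
  have hline (y : Cn m) : Continuous fun t : ℝ => y + circleMap 0 ε t • v :=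
    continuous_const.add ((continuous_circleMap 0 ε).smul continuous_const)
  have hcont {y : Cn m} (hy : y ∈ ball p r) : Continuous fun t => c t * f (y + circleMap 0 ε t • v) :=
    hc.mul (hlip.continuousOn.comp_continuous (hline y) fun t => hmem hy (hcm t))
  have key : ∀ y ∈ ball p r, fderiv ℂ f y v = (2 * Real.pi * Complex.I : ℂ)⁻¹ •
      ∫ t in (0 : ℝ)..2 * Real.pi, c t * f (y + circleMap 0 ε t • v) := fun y hy => by
    have hy' : DifferentiableAt ℂ f y :=
      hf.differentiableAt (hU.mem_nhds (hRU' (ball_subset_ball (by linarith) hy)))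
    have h1 : HasDerivAt (fun z : ℂ => y + z • v) v 0 := by
      simpa using ((hasDerivAt_id (0 : ℂ)).smul_const v).const_add y
    have h2 : HasDerivAt (fun z : ℂ => f (y + z • v)) (fderiv ℂ f y v) 0 :=
      HasFDerivAt.comp_hasDerivAt (l := f) (f := fun z : ℂ => y + z • v) 0
        (by rw [zero_smul, add_zero]; exact hy'.hasFDerivAt) h1
    have ho : IsOpen ((fun z : ℂ => y + z • v) ⁻¹' U) := hU.preimage (by fun_prop)
    have h3 := Complex.two_pi_I_inv_smul_circleIntegral_sub_sq_inv_smul_of_differentiable ho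
      (c := 0) (R := ε) (w₀ := 0) (f := fun z : ℂ => f (y + z • v)) (fun z hz =>
        hRU' (ball_subset_ball (by linarith) (hmem hy (by simpa using hz))))
      (hf.comp (by fun_prop) fun z hz => hz) (mem_ball_self hε)
    rw [← h2.deriv, ← h3, circleIntegral]
    congr 1
    refine intervalIntegral.integral_congr fun t _ => ?_
    simp only [smul_eq_mul, c, mul_assoc]
  have hnhds : ball p r ∈ 𝓝 p := ball_mem_nhds p hr0
  have hI := (intervalIntegral.hasFDerivAt_integral_of_dominated_loc_of_lip (𝕜 := ℂ)
    (μ := MeasureTheory.volume) (a := 0) (b := 2 * Real.pi)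
    (F := fun (y : Cn m) (t : ℝ) => c t * f (y + circleMap 0 ε t • v))
    (F' := fun t => c t • fderiv ℂ f (p + circleMap 0 ε t • v)) (x₀ := p) (s := ball p r)
    (bound := fun t => ‖c t‖ * ((M + M) / r)) hnhds
    (Filter.eventually_of_mem hnhds fun y hy => (hcont hy).aestronglyMeasurable)
    ((hcont (mem_ball_self hr0)).intervalIntegrable _ _)
    ((hc.measurable.smul ((measurable_fderiv ℂ f).comp (hline p).measurable)).aestronglyMeasurable)
    (Filter.Eventually.of_forall fun t _ => ?_)
    ((hc.norm.mul continuous_const).intervalIntegrable _ _)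
    (Filter.Eventually.of_forall fun t _ => ?_)).2
  · refine DifferentiableAt.congr_of_eventuallyEq (hI.differentiableAt.const_smul
      (2 * Real.pi * Complex.I : ℂ)⁻¹) (Filter.eventually_of_mem hnhds key)
  · have hMr : 0 ≤ (M + M) / r := by
      have := (norm_nonneg _).trans (hM p (mem_closedBall_self hR.le))
      positivity
    refine LipschitzOnWith.of_dist_le_mul fun y hy z hz => ?_
    have h1 := hlip.dist_le_mul _ (hmem hy (hcm t)) _ (hmem hz (hcm t))
    rw [dist_add_right, Real.coe_toNNReal _ hMr] at h1
    rw [dist_eq_norm, ← mul_sub, norm_mul, Real.coe_nnabs, abs_of_nonneg (by positivity), mul_assoc,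
      ← dist_eq_norm]
    exact mul_le_mul_of_nonneg_left h1 (norm_nonneg _)
  · have h1 : DifferentiableAt ℂ f (p + circleMap 0 ε t • v) := hf.differentiableAt (hU.mem_nhds
      (hRU' (ball_subset_ball (by linarith) (hmem (mem_ball_self hr0) (hcm t)))))
    exact ((hasFDerivAt_comp_add_right _).2 h1.hasFDerivAt).const_smul (c t)

/-- Holomorphic functions of several variables are smooth. -/
theorem DifferentiableOn.contDiffOn_complex (hU : IsOpen U) (hf : DifferentiableOn ℂ f U) :
    ContDiffOn ℂ ∞ f U := by
  refine contDiffOn_infty.2 fun k => ?_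
  induction k generalizing f with
  | zero => exact contDiffOn_zero.2 hf.continuousOn
  | succ k ih =>
    rw [Nat.cast_succ, contDiffOn_succ_iff_fderiv_of_isOpen hU]
    exact ⟨hf, fun h => by simp at h, contDiffOn_clm_apply.2 fun v => ih (hf.fderiv_apply_const hU v)⟩

end Holomorphic

/-! ### Covectors of top holomorphic degree -/

section TopHolomorphic

variable {m k : ℕ}

/-- The identity A((1 + ti)v) = (1 + ti)^p A(v), differentiated at t = 0. -/
theorem HasBidegree.sum_update {p : ℕ} {A : Covec m k} (hA : HasBidegree p 0 A) (v : Fin k → Cn m) :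
    ∑ j, A (Function.update v j (Complex.I • v j)) = (p * Complex.I) * A v := by
  have h1 : HasDerivAt (fun t : ℝ => v + t • fun j => Complex.I • v j) (fun j => Complex.I • v j) 0 := by
    simpa using ((hasDerivAt_id (0 : ℝ)).smul_const (fun j => Complex.I • v j)).const_add v
  have h2 : HasDerivAt (fun t : ℝ => A (v + t • fun j => Complex.I • v j))
      (∑ j, A (Function.update v j (Complex.I • v j))) 0 := by
    have h3 := A.toContinuousMultilinearMap.hasFDerivAt (x := v)
    have h4 := HasFDerivAt.comp_hasDerivAt (l := A.toContinuousMultilinearMap)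
      (f := fun t : ℝ => v + t • fun j => Complex.I • v j) 0 (by rw [zero_smul, add_zero]; exact h3) h1
    refine h4.congr_deriv ?_
    rw [ContinuousMultilinearMap.linearDeriv_apply]
    rfl
  have h5 (t : ℝ) : A (v + t • fun j => Complex.I • v j) = (1 + (t : ℂ) * Complex.I) ^ p * A v := by
    have := hA (1 + t * Complex.I) v
    rw [pow_zero, mul_one] at this
    rw [← this]
    congr 1
    funext j
    change v j + t • (Complex.I • v j) = _
    rw [add_smul, one_smul, mul_smul]
    rfl
  have h6 : HasDerivAt (fun t : ℝ => (1 + (t : ℂ) * Complex.I) ^ p * A v) ((p * Complex.I) * A v) 0 := by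
    have h7 : HasDerivAt (fun t : ℝ => 1 + (t : ℂ) * Complex.I) Complex.I 0 := by
      simpa using ((Complex.ofRealCLM.hasDerivAt (x := 0)).mul_const Complex.I).const_add 1
    refine ((h7.pow p).mul_const (A v)).congr_deriv ?_
    simp
  simp only [h5] at h2
  exact h2.unique h6

/-- A `k`-covector of bidegree `(k,0)` is complex multilinear. -/
theorem HasBidegree.map_update_I {A : Covec m k} (hA : HasBidegree k 0 A) (v : Fin k → Cn m)
    (j : Fin k) : A (Function.update v j (Complex.I • v j)) = Complex.I * A v := by
  -- Twice the antilinear part of A in the slot j. The aim is to show that it vanishes.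
  let B : (Fin k → Cn m) → ℂ := fun v => A v + Complex.I * A (Function.update v j (Complex.I • v j))
  have hnorm (v : Fin k → Cn m) (l : Fin k) :
      ∏ r, ‖Function.update v l (Complex.I • v l) r‖ = ∏ r, ‖v r‖ := by
    refine Finset.prod_congr rfl fun r _ => ?_
    by_cases h : r = l
    · subst h; rw [Function.update_self, norm_smul, Complex.norm_I, one_mul]
    · rw [Function.update_of_ne h]
  have hB0 (v : Fin k → Cn m) : ‖B v‖ ≤ (‖A‖ + ‖A‖) * ∏ r, ‖v r‖ := by
    refine (norm_add_le _ _).trans ?_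
    rw [norm_mul, Complex.norm_I, one_mul, add_mul]
    refine add_le_add (A.le_opNorm v) ((A.le_opNorm _).trans_eq ?_)
    rw [hnorm]
  have hself (v : Fin k → Cn m) : B (Function.update v j (Complex.I • v j)) = -Complex.I * B v := by
    have h : Complex.I • Complex.I • v j = -v j := by
      rw [smul_smul, Complex.I_mul_I, neg_one_smul]
    have hneg : A (Function.update v j (-v j)) = -A v :=
      (A.toAlternatingMap.map_update_neg v j (v j)).trans (by rw [Function.update_eq_self]; rfl)
    simp only [B, Function.update_self, Function.update_idem, h]
    rw [hneg]
    linear_combination A (Function.update v j (Complex.I • v j)) * Complex.I_mul_I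
  -- Multiplying each slot in turn by i gives the total ki · B. The antilinear slot j contributes -i
  -- · B, so the other k - 1 slots must contribute (k+1)i · B.
  have hsum (v : Fin k → Cn m) : ∑ l ∈ Finset.univ.erase j, B (Function.update v l (Complex.I • v l)) =
      ((k + 1 : ℕ) * Complex.I) * B v := by
    have h1 : ∑ l, B (Function.update v l (Complex.I • v l)) = (k * Complex.I) * B v := by
      have h2 : ∑ l, A (Function.update (Function.update v l (Complex.I • v l)) j
          (Complex.I • Function.update v l (Complex.I • v l) j)) =
          (k * Complex.I) * A (Function.update v j (Complex.I • v j)) := by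
        rw [← hA.sum_update]
        refine Finset.sum_congr rfl fun l _ => ?_
        by_cases h : l = j
        · subst h; simp
        · rw [Function.update_of_ne h, Function.update_of_ne (Ne.symm h), Function.update_comm h]
      simp only [B]
      rw [Finset.sum_add_distrib, ← Finset.mul_sum, hA.sum_update, h2]
      ring
    rw [← Finset.add_sum_erase _ _ (Finset.mem_univ j), hself] at h1
    push_cast
    linear_combination h1
  have hk : ((Finset.univ.erase j).card : ℝ) = k - 1 := by
    rw [Finset.card_erase_of_mem (Finset.mem_univ j), Finset.card_univ, Fintype.card_fin,
      Nat.cast_sub (by have := j.2; omega), Nat.cast_one]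
  -- The other k - 1 slots contribute at most k - 1 times the bound for B, so every bound improves
  -- by the factor (k-1)/(k+1) < 1; iterating forces B = 0.
  have hstep (K : ℝ) (hK : ∀ v, ‖B v‖ ≤ K * ∏ r, ‖v r‖) (v : Fin k → Cn m) :
      ‖B v‖ ≤ ((k - 1) / (k + 1) * K) * ∏ r, ‖v r‖ := by
    have h1 : ((k : ℝ) + 1) * ‖B v‖ ≤ (k - 1) * (K * ∏ r, ‖v r‖) := by
      calc ((k : ℝ) + 1) * ‖B v‖ = ‖((k + 1 : ℕ) * Complex.I) * B v‖ := by
            rw [norm_mul, norm_mul, Complex.norm_I, mul_one, Complex.norm_natCast]; push_cast; rfl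
        _ = ‖∑ l ∈ Finset.univ.erase j, B (Function.update v l (Complex.I • v l))‖ := by rw [hsum]
        _ ≤ ∑ l ∈ Finset.univ.erase j, K * ∏ r, ‖v r‖ := norm_sum_le_of_le _ fun l _ =>
            (hK _).trans_eq (by rw [hnorm])
        _ = (k - 1) * (K * ∏ r, ‖v r‖) := by rw [Finset.sum_const, nsmul_eq_mul, hk]
    have h2 : (0 : ℝ) < k + 1 := by positivity
    rw [div_mul_eq_mul_div, div_mul_eq_mul_div, le_div_iff₀ h2]
    linarith
  have hpow (s : ℕ) : ∀ v, ‖B v‖ ≤ (((k : ℝ) - 1) / (k + 1)) ^ s * (‖A‖ + ‖A‖) * ∏ r, ‖v r‖ := by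
    induction s with
    | zero => simpa using hB0
    | succ s ih => intro v; rw [pow_succ', mul_assoc _ (_ ^ s)]; exact hstep _ ih v
  have hlim : Filter.Tendsto (fun s : ℕ => (((k : ℝ) - 1) / (k + 1)) ^ s * (‖A‖ + ‖A‖) * ∏ r, ‖v r‖)
      Filter.atTop (𝓝 0) := by
    have h1 : (1 : ℝ) ≤ k := by exact_mod_cast Nat.one_le_iff_ne_zero.2 (by have := j.2; omega)
    have := (tendsto_pow_atTop_nhds_zero_of_lt_one (r := ((k : ℝ) - 1) / (k + 1))
      (div_nonneg (by linarith) (by linarith)) (by rw [div_lt_one (by linarith)]; linarith)).mul_const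
        ((‖A‖ + ‖A‖) * ∏ r, ‖v r‖)
    simpa [mul_assoc] using this
  have h0 : B v = 0 := norm_le_zero_iff.1 (ge_of_tendsto' hlim fun s => hpow s v)
  linear_combination (-Complex.I) * h0 + (A (Function.update v j (Complex.I • v j))) * Complex.I_mul_I

theorem HasBidegree.map_update_smul {A : Covec m k} (hA : HasBidegree k 0 A) (v : Fin k → Cn m)
    (j : Fin k) (c : ℂ) (w : Cn m) :
    A (Function.update v j (c • w)) = c * A (Function.update v j w) := by
  have h1 : c • w = c.re • w + c.im • (Complex.I • w) := by
    conv_lhs => rw [← Complex.re_add_im c, add_smul, mul_smul]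
    rfl
  have h2 := hA.map_update_I (Function.update v j w) j
  rw [Function.update_self, Function.update_idem] at h2
  rw [h1, A.map_update_add, A.map_update_smul, A.map_update_smul, h2, Complex.real_smul,
    Complex.real_smul]
  conv_rhs => rw [← Complex.re_add_im c]
  ring

/-- The standard complex frame. -/
def frameC (m : ℕ) : Fin m → Cn m := fun j => Pi.single j 1

/-- A covector of bidegree (m,0) and degree m is an alternating complex multilinear map in m vectors
of ℂᵐ, hence a multiple of the determinant. -/
theorem HasBidegree.eq_mul_det {A : Covec m m} (hA : HasBidegree m 0 A) (v : Fin m → Cn m) :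
    A v = A (frameC m) * (Pi.basisFun ℂ (Fin m)).det v := by
  let f : (Cn m) [⋀^Fin m]→ₗ[ℂ] ℂ :=
    { toFun := A
      map_update_add' := by
        intro inst v j x y
        obtain rfl : inst = instDecidableEqFin m := Subsingleton.elim _ _
        exact A.map_update_add v j x y
      map_update_smul' := by
        intro inst v j c x
        obtain rfl : inst = instDecidableEqFin m := Subsingleton.elim _ _
        exact hA.map_update_smul v j c x
      map_eq_zero_of_eq' := fun v i j h h' => A.map_eq_zero_of_eq v h h' }
  have h := congrFun (congrArg DFunLike.coe (f.eq_smul_basis_det (Pi.basisFun ℂ (Fin m)))) v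
  rw [AlternatingMap.smul_apply, smul_eq_mul] at h
  have hb : (⇑(Pi.basisFun ℂ (Fin m)) : Fin m → Cn m) = frameC m := by
    funext j; rw [Pi.basisFun_apply]; rfl
  rw [hb] at h
  exact h

theorem HasBidegree.covWedge_dzZero {p : ℕ} {A : Covec (m + 1) k} (hA : HasBidegree p 0 A) :
    HasBidegree (p + 1) 0 (covWedge (dzZero m) A) := fun c v => by
  rw [covWedge_apply, covWedge_apply, Finset.mul_sum]
  refine Finset.sum_congr rfl fun j _ => ?_
  have h := hA c (j.removeNth v)
  change A (j.removeNth fun j => c • v j) = _ at h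
  rw [h, dzZero_apply, dzZero_apply, Pi.smul_apply, smul_eq_mul]
  ring

/-- The covector `dz₀ ∧ ⋯ ∧ dz_{m-1}`. -/
def detC : (m : ℕ) → Covec m m
  | 0 => ContinuousAlternatingMap.constOfIsEmpty ℝ (Cn 0) (Fin 0) 1
  | m + 1 => covWedge (dzZero m) (tailPull (detC m))

theorem hasBidegree_tailPull {p q : ℕ} {A : Covec m k} (hA : HasBidegree p q A) :
    HasBidegree p q (tailPull A) := hA.comp fun c v => map_smul (tailL m) c v

theorem hasBidegree_detC : ∀ m : ℕ, HasBidegree m 0 (detC m)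
  | 0 => fun c v => by simp [detC]
  | m + 1 => (hasBidegree_tailPull (hasBidegree_detC m)).covWedge_dzZero

theorem detC_frameC : ∀ m : ℕ, detC m (frameC m) = 1
  | 0 => rfl
  | m + 1 => by
    have h : frameC (m + 1) = Fin.cons (Pi.single 0 1) fun j : Fin m => Pi.single j.succ 1 := by
      funext j
      refine Fin.cases rfl (fun j => rfl) j
    rw [detC, h, covWedge_cons_of_eq_zero _ _ fun j => by simp [dzZero_apply], dzZero_apply,
      Pi.single_eq_same, one_mul, tailPull_apply]
    refine Eq.trans ?_ (detC_frameC m)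
    congr 1
    funext j
    funext l
    simp [frameC, tailL_apply, Pi.single_apply]

/-- The coefficient of a covector of top holomorphic degree. -/
def topC (m : ℕ) : Covec m m →L[ℂ] ℂ := evalC (frameC m)

theorem HasBidegree.eq_smul_detC {A : Covec m m} (hA : HasBidegree m 0 A) : A = topC m A • detC m := by
  ext v
  rw [ContinuousAlternatingMap.smul_apply, smul_eq_mul, hA.eq_mul_det,
    (hasBidegree_detC m).eq_mul_det, detC_frameC, one_mul]
  rfl

end TopHolomorphic

/-! ### Meromorphic forms -/

section Meromorphic

variable {n k : ℕ} {X : Type*} [TopologicalSpace X] [ChartedSpace (Cn (n + 1)) X]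
  [IsManifold 𝓘(ℂ, Cn (n + 1)) ω X] {D : Type*} {i : D → X}

theorem HasBidegree.inChart {m : ℕ} {M : Type*} [TopologicalSpace M] [ChartedSpace (Cn m) M]
    {p q : ℕ} {θ : Form m M k} {φ : OpenPartialHomeomorph M (Cn m)} {y : Cn m}
    (h : HasBidegree p q (θ (φ.symm y))) : HasBidegree p q (inChart φ θ y) :=
  h.comp fun c v => map_smul (mfderiv 𝓘(ℂ, Cn m) 𝓘(ℂ, Cn m) φ.symm y : Cn m →L[ℂ] Cn m) c v

variable [TopologicalSpace D] [ChartedSpace (Cn n) D]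

theorem IsMeromorphicForm.mem_semiForms (hi : IsSmoothHypersurface n i) {p : ℕ}
    {θ : Form (n + 1) X k} (h : IsMeromorphicForm i p θ) : θ ∈ semiForms n i p 0 k := by
  refine ⟨fun φ hφ y hy => ?_, h.bidegree, fun φ hφ x hx hxD => ?_⟩
  · have ho : IsOpen (φ.target ∩ φ.symm ⁻¹' (Set.range i)ᶜ) :=
      φ.isOpen_inter_preimage_symm hi.isClosed_range.isOpen_compl
    refine (contDiffAt_covec_iff.2 fun v => ?_).contDiffWithinAt
    have hv : DifferentiableOn ℂ (fun y => inChart φ θ y v) (φ.target ∩ φ.symm ⁻¹' (Set.range i)ᶜ) :=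
      (evalC v).differentiable.comp_differentiableOn (h.holomorphic φ hφ)
    exact ((hv.contDiffOn_complex ho).contDiffAt (ho.mem_nhds hy)).restrict_scalars ℝ
  · obtain ⟨m, g, hg, he⟩ := h.pole φ hφ x hx hxD
    refine ⟨m, 0, rfl, g, (hg.contDiffAt (n := ∞)).restrict_scalars ℝ, ?_⟩
    simpa using he

theorem IsMeromorphicForm.differentiableAt (hi : IsSmoothHypersurface n i) {p : ℕ}
    {θ : Form (n + 1) X k} (h : IsMeromorphicForm i p θ) {φ : OpenPartialHomeomorph X (Cn (n + 1))}
    (hφ : φ ∈ holCharts (n + 1) X) {y : Cn (n + 1)} (hy : y ∈ φ.target)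
    (hyD : φ.symm y ∉ Set.range i) : DifferentiableAt ℂ (inChart φ θ) y :=
  (h.holomorphic φ hφ).differentiableAt
    ((φ.isOpen_inter_preimage_symm hi.isClosed_range.isOpen_compl).mem_nhds ⟨hy, hyD⟩)

theorem IsMeromorphicForm.inChart_eq {θ : Form (n + 1) X (n + 1)} (h : IsMeromorphicForm i (n + 1) θ)
    {φ : OpenPartialHomeomorph X (Cn (n + 1))} (hφ : IsAdapted i φ) {y : Cn (n + 1)}
    (hy : y ∈ φ.target) (h0 : y 0 ≠ 0) :
    inChart φ θ y = topC (n + 1) (inChart φ θ y) • detC (n + 1) :=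
  (HasBidegree.inChart (h.bidegree _ fun h' => h0 ((hφ.symm_mem_range hy).1 h'))).eq_smul_detC

/-- Near a point of the hypersurface, a meromorphic form of top degree is a multiple of
`dz₀ ∧ ⋯ ∧ dz_n` by a holomorphic function divided by a power of `z₀`. -/
theorem IsMeromorphicForm.exists_coef {θ : Form (n + 1) X (n + 1)} (h : IsMeromorphicForm i (n + 1) θ)
    {φ : OpenPartialHomeomorph X (Cn (n + 1))} (hφ : IsAdapted i φ) {x : X} (hx : x ∈ φ.source)
    {a : ℕ} {g : Cn (n + 1) → Covec (n + 1) (n + 1)} (hg : AnalyticAt ℂ g (φ x))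
    (he : ∀ᶠ y in 𝓝 (φ x), y 0 ≠ 0 → y 0 ^ a • inChart φ θ y = g y) :
    ∃ u : Cn (n + 1) → ℂ, AnalyticAt ℂ u (φ x) ∧
      ∀ᶠ y in 𝓝 (φ x), y 0 ≠ 0 → y 0 ^ a • inChart φ θ y = u y • detC (n + 1) := by
  refine ⟨fun y => topC (n + 1) (g y), ((topC (n + 1)).analyticAt _).comp hg, ?_⟩
  filter_upwards [he, φ.open_target.mem_nhds (φ.map_source hx)] with y h1 hy h0
  rw [← h1 h0, map_smul, smul_eq_mul, mul_smul, ← h.inChart_eq hφ hy h0]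

theorem inChart_wedge {m k l r : ℕ} {M : Type*} [TopologicalSpace M] [ChartedSpace (Cn m) M]
    (h : k + l = r) (φ : OpenPartialHomeomorph M (Cn m)) (θ : Form m M k) (η : Form m M l) (y : Cn m) :
    inChart φ (wedge h θ η) y = wedgeCovec h (inChart φ θ y) (inChart φ η y) :=
  (wedgeCovec_pullback h _ _ _).symm

theorem inChart_conjForm {m k : ℕ} {M : Type*} [TopologicalSpace M] [ChartedSpace (Cn m) M]
    (φ : OpenPartialHomeomorph M (Cn m)) (θ : Form m M k) (y : Cn m) :
    inChart φ (conjForm θ) y = conjCovec (inChart φ θ y) := rfl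

theorem contDiffAt_wedgeCovec {m k l r : ℕ} (h : k + l = r) {E : Type*} [NormedAddCommGroup E]
    [NormedSpace ℝ E] {F : E → Covec m k} {G : E → Covec m l} {y : E} {s : WithTop ℕ∞}
    (hF : ContDiffAt ℝ s F y) (hG : ContDiffAt ℝ s G y) :
    ContDiffAt ℝ s (fun y => wedgeCovec h (F y) (G y)) y := by
  let b : Covec m k →L[ℝ] Covec m l →L[ℝ] Covec m r :=
    (ContinuousLinearMap.restrictScalarsL ℂ (Covec m l) (Covec m r) ℝ ℝ).comp
      ((wedgeL m h).restrictScalars ℝ)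
  exact (b.contDiff.contDiffAt.comp y hF).clm_apply hG

theorem contDiffAt_conjCovec {m k : ℕ} {E : Type*} [NormedAddCommGroup E] [NormedSpace ℝ E]
    {F : E → Covec m k} {y : E} {s : WithTop ℕ∞} (hF : ContDiffAt ℝ s F y) :
    ContDiffAt ℝ s (fun y => conjCovec (F y)) y := (conjCovecL m k).contDiff.contDiffAt.comp y hF

theorem PolarFormAt.wedge_conj {k l r : ℕ} (h : k + l = r) {θ : Form (n + 1) X k}
    {η : Form (n + 1) X l} {x : X} (hθ : PolarFormAt i θ x) (hη : PolarFormAt i η x) :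
    PolarFormAt i (wedge h θ (conjForm η)) x := fun φ hφ hx => by
  obtain ⟨a, b, G, hG, he⟩ := PolarCov.exists_exponents (hθ φ hφ hx)
  obtain ⟨a', b', G', hG', he'⟩ := PolarCov.exists_exponents (hη φ hφ hx)
  -- Conjugation exchanges the exponents of z₀ and z̄₀ in the second factor.
  refine PolarCov.of_exponents (a := a + b') (b := b + a')
    (contDiffAt_wedgeCovec h hG (contDiffAt_conjCovec hG')) ?_
  filter_upwards [he, he'] with y h1 h2 h0
  rw [← h1 h0, ← h2 h0, conjCovec_smul, wedgeCovec_smul_left, wedgeCovec_smul_right, smul_smul,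
    inChart_wedge, inChart_conjForm]
  congr 1
  simp only [map_mul, map_pow, Complex.conj_conj]
  ring

/-- If `β` is holomorphic near `x` then `∂(η ∧ β̄) = ∂η ∧ β̄` at `x`. -/
theorem del_wedge_conj {m k l r : ℕ} {M : Type*} [TopologicalSpace M] [ChartedSpace (Cn m) M]
    [IsManifold 𝓘(ℂ, Cn m) ω M] (h : k + l = r) (h' : k + 1 + l = r + 1) {η : Form m M k}
    {β : Form m M l} {ψ : OpenPartialHomeomorph M (Cn m)} (hψ : ψ ∈ holCharts m M) {x : M}
    (hx : x ∈ ψ.source) (hη : DifferentiableAt ℝ (inChart ψ η) (ψ x))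
    (hβ : DifferentiableAt ℂ (inChart ψ β) (ψ x)) :
    del (wedge h η (conjForm β)) x = wedge h' (del η) (conjForm β) x := by
  have h1 := delC_wedge_conj h h' hη hβ
  have h2 : inChart ψ (wedge h η (conjForm β)) = fun y =>
      wedgeCovec h (inChart ψ η y) (conjCovec (inChart ψ β y)) := funext fun y => inChart_wedge h _ _ _ y
  let b : Covec m k →L[ℝ] Covec m l →L[ℝ] Covec m r :=
    (ContinuousLinearMap.restrictScalarsL ℂ (Covec m l) (Covec m r) ℝ ℝ).comp
      ((wedgeL m h).restrictScalars ℝ)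
  have hd : DifferentiableAt ℝ (fun y => wedgeCovec h (inChart ψ η y) (conjCovec (inChart ψ β y))) (ψ x) := by
    have hc : DifferentiableAt ℝ (fun y => conjCovec (inChart ψ β y)) (ψ x) :=
      ((conjCovecL m l).hasFDerivAt.comp (ψ x) (hβ.restrictScalars ℝ).hasFDerivAt).differentiableAt
    exact (b.hasFDerivAt_of_bilinear hη.hasFDerivAt hc.hasFDerivAt).differentiableAt
  rw [del_eq_delM, delM_eq hψ hx (by rw [h2]; exact hd), h2, h1, ← wedgeCovec_pullback,
    ← conjCovec_pullback, ← form_eq hψ β hx, ← delM_eq hψ hx hη]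
  rfl

end Meromorphic

/-! ### The Poincaré residue -/

section Poincare

variable {n : ℕ} {X : Type*} [TopologicalSpace X] [ChartedSpace (Cn (n + 1)) X]
  [IsManifold 𝓘(ℂ, Cn (n + 1)) ω X] {D : Type*} {i : D → X}
  [TopologicalSpace D] [ChartedSpace (Cn n) D]

theorem neBot_nhdsWithin_ne (p : Cn (n + 1)) : (𝓝[{y | y 0 ≠ 0}] p).NeBot := by
  have h : Dense {y : Cn (n + 1) | y 0 ≠ 0} :=
    (dense_compl_singleton (0 : ℂ)).preimage (isOpenMap_eval (X := fun _ : Fin (n + 1) => ℂ) 0)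
  exact mem_closure_iff_nhdsWithin_neBot.1 (h p)

theorem eq_of_eventually_eq_off {V : Type*} [TopologicalSpace V] [T2Space V] {f g : Cn (n + 1) → V}
    {p : Cn (n + 1)} (hf : ContinuousAt f p) (hg : ContinuousAt g p)
    (h : ∀ᶠ y in 𝓝 p, y 0 ≠ 0 → f y = g y) : f p = g p := by
  have := neBot_nhdsWithin_ne p
  refine tendsto_nhds_unique_of_eventuallyEq (l := 𝓝[{y | y 0 ≠ 0}] p) (hf.tendsto.mono_left nhdsWithin_le_nhds)
    (hg.tendsto.mono_left nhdsWithin_le_nhds) ?_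
  filter_upwards [self_mem_nhdsWithin, h.filter_mono nhdsWithin_le_nhds] with y hy h1 using h1 hy

/-- Evaluation on e₀ followed by vectors of the hyperplane isolates A, because dz₀ vanishes on those
vectors. -/
theorem hyperPull_eq_of_covWedge_eq {k : ℕ} {A B : Covec (n + 1) k}
    (h : covWedge (dzZero n) A = covWedge (dzZero n) B) : hyperPull A = hyperPull B := by
  ext v
  have h1 := congrFun (congrArg DFunLike.coe h) (Fin.cons (Pi.single 0 1) fun j => hyper n (v j))
  rw [covWedge_cons_of_eq_zero _ _ fun j => hyper_zero (v j),
    covWedge_cons_of_eq_zero _ _ fun j => hyper_zero (v j), dzZero_apply, Pi.single_eq_same, one_mul,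
    one_mul] at h1
  exact h1

theorem covWedge_smul_left {m k : ℕ} (c : ℂ) (ℓ : Cn m →L[ℝ] ℂ) (A : Covec m k) :
    covWedge (c • ℓ) A = c • covWedge ℓ A := by
  ext v
  rw [ContinuousAlternatingMap.smul_apply, covWedge_apply, covWedge_apply, smul_eq_mul, Finset.mul_sum]
  refine Finset.sum_congr rfl fun j _ => ?_
  rw [smul_apply, smul_eq_mul]; ring

variable (i) in
/-- The form `B` is given by the leading coefficients of `β` along the hypersurface: `B = u|_D dz₁ ∧ ⋯ ∧ dz_n`
whenever `z₀ β = u dz₀ ∧ ⋯ ∧ dz_n` in adapted coordinates. -/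
def IsLeadingForm (β : Form (n + 1) X (n + 1)) (B : Form n D n) : Prop :=
  ∀ ⦃p φ⦄, IsAdapted i φ → i p ∈ φ.source → ∀ u : Cn (n + 1) → ℂ, ContinuousAt u (φ (i p)) →
    (∀ᶠ y in 𝓝 (φ (i p)), y 0 ≠ 0 → y 0 • inChart φ β y = u y • detC (n + 1)) →
    B p = u (φ (i p)) • restrictToD i φ p (tailPull (detC n))

theorem exists_leading_coef {β : Form (n + 1) X (n + 1)} (hβ : IsMeromorphicForm i (n + 1) β)
    (hs : HasSimplePole i β) {φ : OpenPartialHomeomorph X (Cn (n + 1))} (hφ : IsAdapted i φ) {p : D}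
    (hp : i p ∈ φ.source) : ∃ u : Cn (n + 1) → ℂ, AnalyticAt ℂ u (φ (i p)) ∧
      ∀ᶠ y in 𝓝 (φ (i p)), y 0 ≠ 0 → y 0 • inChart φ β y = u y • detC (n + 1) := by
  obtain ⟨g, hg, he⟩ := hs φ hφ _ hp ⟨p, rfl⟩
  obtain ⟨u, hu, he'⟩ := hβ.exists_coef hφ hp (a := 1) hg (by simpa using he)
  exact ⟨u, hu, by simpa using he'⟩

variable [IsManifold 𝓘(ℂ, Cn n) ω D]

/-- The residue of a decomposition `β = dz₀/z₀ ∧ g + τ` is given by the leading coefficient of `β` in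
any other adapted coordinates. -/
theorem restrictToD_eq_leading (hi : IsSmoothHypersurface n i) {β : Form (n + 1) X (n + 1)}
    {φ ψ : OpenPartialHomeomorph X (Cn (n + 1))} (hφ : IsAdapted i φ) (hψ : IsAdapted i ψ) {p : D}
    (hp : i p ∈ φ.source) (hp' : i p ∈ ψ.source) {g : Cn (n + 1) → Covec (n + 1) n}
    {τ : Cn (n + 1) → Covec (n + 1) (n + 1)} (hg : ContDiffAt ℝ ∞ g (φ (i p)))
    (hτ : ContDiffAt ℝ ∞ τ (φ (i p))) (he : ∀ᶠ y in 𝓝 (φ (i p)), y 0 ≠ 0 →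
      inChart φ β y = (y 0)⁻¹ • covWedge (dzZero n) (g y) + τ y)
    {u : Cn (n + 1) → ℂ} (hu : ContinuousAt u (ψ (i p)))
    (hu' : ∀ᶠ y in 𝓝 (ψ (i p)), y 0 ≠ 0 → y 0 • inChart ψ β y = u y • detC (n + 1)) :
    restrictToD i φ p (g (φ (i p))) = u (ψ (i p)) • restrictToD i ψ p (tailPull (detC n)) := by
  have : Nonempty D := ⟨p⟩
  set q := ψ (i p) with hq
  have hqt : q ∈ ψ.target := ψ.map_source hp'
  have hqs : ψ.symm q = i p := ψ.left_inv hp'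
  have hqφ : ψ.symm q ∈ φ.source := by rwa [hqs]
  obtain ⟨s, hs, hs0, hTs, hT0⟩ := hψ.exists_transition hφ hqt hqφ (hψ.apply_zero hp')
  set T : Cn (n + 1) → Cn (n + 1) := fun y => φ (ψ.symm y) with hT
  have hTc := contDiffAt_transition hψ.1 hφ.1 hqt hqφ
  have hTq : T q = φ (i p) := by rw [hT]; exact congrArg φ hqs
  have hF : ContinuousAt (fun y => (covWedge (dzZero n) (g (T y))).compContinuousLinearMap (fderiv ℝ T y)) q :=
    (contDiffAt_pullback (F := fun y => covWedge (dzZero n) (g y)) (T := T) hTc le_rfl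
      (((covWedgeL (dzZero n)).restrictScalars ℝ).contDiff.contDiffAt.comp _ (by rwa [hTq]))).continuousAt
  have hF' : ContinuousAt (fun y => (τ (T y)).compContinuousLinearMap (fderiv ℝ T y)) q :=
    (contDiffAt_pullback (F := τ) (T := T) hTc le_rfl (by rwa [hTq])).continuousAt
  have hc : Filter.Tendsto T (𝓝 q) (𝓝 (φ (i p))) := by
    have h : Filter.Tendsto T (𝓝 q) (𝓝 (T q)) := hTc.continuousAt.tendsto
    rwa [hTq] at h
  -- The decomposition is pulled back to ψ, multiplied by z₀, and compared on the hyperplane by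
  -- continuity from the complement. There z₀/T₀ becomes s⁻¹, and the term with τ is multiplied by
  -- zero.
  have h1 : u q • detC (n + 1) = (s q)⁻¹ •
      (covWedge (dzZero n) (g (T q))).compContinuousLinearMap (fderiv ℝ T q) +
      (q 0) • (τ (T q)).compContinuousLinearMap (fderiv ℝ T q) := by
    refine eq_of_eventually_eq_off (f := fun y => u y • detC (n + 1)) (g := fun y => (s y)⁻¹ •
      (covWedge (dzZero n) (g (T y))).compContinuousLinearMap (fderiv ℝ T y) +
      (y 0) • (τ (T y)).compContinuousLinearMap (fderiv ℝ T y)) (hu.smul continuousAt_const)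
      (((hs.continuousAt.inv₀ hs0).smul hF).add ((continuous_apply 0).continuousAt.smul hF')) ?_
    filter_upwards [hu', hTs, hc.eventually he, eventually_mem_transition hψ.1 hφ.1 hqt hqφ,
      hs.continuousAt.eventually_ne hs0] with y h2 h3 h4 h5 h6 h0
    have h7 : T y 0 ≠ 0 := by
      change φ (ψ.symm y) 0 ≠ 0
      rw [h3]; exact mul_ne_zero h0 h6
    have h8 := inChart_transition hψ.1 hφ.1 β h5.1 h5.2
    have h9 : inChart ψ β y = ((T y 0)⁻¹ • covWedge (dzZero n) (g (T y)) +
        τ (T y)).compContinuousLinearMap (fderiv ℝ T y) := by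
      rw [← h4 h7]; exact h8
    have h10 : y 0 * (T y 0)⁻¹ = (s y)⁻¹ := by
      change y 0 * (φ (ψ.symm y) 0)⁻¹ = _
      rw [h3, mul_inv, mul_inv_cancel_left₀ h0]
    rw [← h2 h0, h9, ← h10, mul_smul]
    ext v
    exact mul_add _ _ _
  -- At q the transition map pulls dz₀ back to s dz₀, which cancels the factor s⁻¹. Both sides are
  -- then of the form dz₀ ∧ A and determine A on the hyperplane.
  have h2 : (dzZero n).comp (fderiv ℝ T q) = s q • dzZero n := by
    ext1 v
    exact hT0 v
  have hq0 : q 0 = 0 := hψ.apply_zero hp'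
  have h3 : (q 0) • (τ (T q)).compContinuousLinearMap (fderiv ℝ T q) = 0 := by
    rw [hq0]; ext v; exact zero_mul _
  rw [h3, add_zero, covWedge_pullback, h2, covWedge_smul_left, smul_smul, inv_mul_cancel₀ hs0, one_smul,
    detC, ← covWedge_smul] at h1
  have h4 := hyperPull_eq_of_covWedge_eq h1
  rw [restrictToD_transition hi hφ hψ hp hp', restrictToD_eq hi hψ hp', restrictToD_eq hi hψ hp', ← hTq,
    ← h4]
  rfl

/-- B is defined at each point by one chosen chart and one leading coefficient;
`restrictToD_eq_leading` shows that all other choices give the same value. -/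
theorem exists_isLeadingForm (hi : IsSmoothHypersurface n i) {β : Form (n + 1) X (n + 1)}
    (hβ : IsMeromorphicForm i (n + 1) β) (hs : HasSimplePole i β) :
    ∃ B : Form n D n, IsLeadingForm i β B := by
  choose φ hφ hp using fun p => exists_isAdapted_of_mem hi p
  choose u hu he using fun p => exists_leading_coef hβ hs (hφ p) (hp p)
  refine ⟨fun p => u p (φ p (i p)) • restrictToD i (φ p) p (tailPull (detC n)),
    fun p ψ hψ hpψ v hv hv' => ?_⟩
  refine restrictToD_eq_leading hi (hφ p) hψ (hp p) hpψ (g := fun y => u p y • tailPull (detC n)) (τ := 0)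
    ((((hu p).contDiffAt (n := ∞)).restrict_scalars ℝ).smul contDiffAt_const) contDiffAt_const ?_ hv hv'
  filter_upwards [he p] with y hy h0
  rw [covWedge_smul, ← detC, ← hy h0, smul_smul, inv_mul_cancel₀ h0, one_smul]
  exact (add_zero _).symm

theorem IsLeadingForm.isPoincareResidue_iff (hi : IsSmoothHypersurface n i) {β : Form (n + 1) X (n + 1)}
    (hβ : IsMeromorphicForm i (n + 1) β) (hs : HasSimplePole i β) {B : Form n D n}
    (hB : IsLeadingForm i β B) (B' : Form n D n) : IsPoincareResidue i β B' ↔ B' = B := by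
  constructor
  · refine fun h => funext fun p => ?_
    obtain ⟨φ, hφ, hp, g, τ, hg, hτ, -, he, h'⟩ := h p
    obtain ⟨u, hu, hu'⟩ := exists_leading_coef hβ hs hφ hp
    rw [h', restrictToD_eq_leading hi hφ hφ hp hp hg hτ he hu.continuousAt hu',
      hB hφ hp u hu.continuousAt hu']
  · rintro rfl p
    obtain ⟨φ, hφ, hp⟩ := exists_isAdapted_of_mem hi p
    obtain ⟨u, hu, hu'⟩ := exists_leading_coef hβ hs hφ hp
    refine ⟨φ, hφ, hp, fun y => u y • tailPull (detC n), 0,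
      ((hu.contDiffAt (n := ∞)).restrict_scalars ℝ).smul contDiffAt_const, contDiffAt_const,
      Filter.Eventually.of_forall fun y v j => (mul_zero _).symm, ?_, hB hφ hp u hu.continuousAt hu'⟩
    filter_upwards [hu'] with y hy h0
    rw [covWedge_smul, ← detC, ← hy h0, smul_smul, inv_mul_cancel₀ h0, one_smul]
    exact (add_zero _).symm

/-- In the induced coordinates on the hypersurface the residue is holomorphic. -/
theorem IsLeadingForm.exists_eventuallyEq [Nonempty D] (hi : IsSmoothHypersurface n i) {β : Form (n + 1) X (n + 1)}
    (hβ : IsMeromorphicForm i (n + 1) β) (hs : HasSimplePole i β) {B : Form n D n}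
    (hB : IsLeadingForm i β B) {φ : OpenPartialHomeomorph X (Cn (n + 1))} (hφ : IsAdapted i φ) {p : D}
    (hp : i p ∈ φ.source) : ∃ h : Cn n → ℂ, AnalyticAt ℂ h (inducedChart hi hφ p) ∧
      B =ᶠ[𝓝 p] ofChart (inducedChart hi hφ) fun w => h w • detC n := by
  obtain ⟨u, hu, hu'⟩ := exists_leading_coef hβ hs hφ hp
  refine ⟨fun w => u (hyper n w), ?_, ?_⟩
  · refine AnalyticAt.comp (g := u) ?_ ((hyper n).analyticAt _)
    rwa [hyper_inducedChart hi hφ hp]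
  · have hc : ContinuousAt (fun q => φ (i q)) p :=
      (φ.continuousAt hp).comp hi.isSmoothEmbedding.isEmbedding.continuous.continuousAt
    filter_upwards [hc.eventually hu.eventually_analyticAt, hc.eventually hu'.eventually_nhds,
      (inducedChart hi hφ).open_source.mem_nhds hp] with q h1 h2 hq
    have hq' : i q ∈ φ.source := hq
    rw [hB hφ hq' u h1.continuousAt h2, ofChart_of_mem _ hq, restrictToD_eq hi hφ hq', hyperPull_tailPull,
      hyper_inducedChart hi hφ hq']
    rfl

theorem IsLeadingForm.mem_smoothForms (hi : IsSmoothHypersurface n i) {β : Form (n + 1) X (n + 1)}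
    (hβ : IsMeromorphicForm i (n + 1) β) (hs : HasSimplePole i β) {B : Form n D n}
    (hB : IsLeadingForm i β B) : B ∈ smoothForms n D n 0 n := by
  refine ⟨(smoothOn_iff isOpen_univ).2 fun p _ => ?_, fun p => ?_⟩ <;>
  · have : Nonempty D := ⟨p⟩
    obtain ⟨φ, hφ, hp⟩ := exists_isAdapted_of_mem hi p
    obtain ⟨h, hh, he⟩ := hB.exists_eventuallyEq hi hβ hs hφ hp
    first
    | exact (smoothAtPt_ofChart_of_mem (inducedChart_mem_holCharts hi hφ) hp
        (((hh.contDiffAt (n := ∞)).restrict_scalars ℝ).smul contDiffAt_const)).congr he.symm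
    | rw [he.eq_of_nhds]
      exact hasBidegree_ofChart (fun y => (hasBidegree_detC n).smul _) p

theorem IsLeadingForm.differentiableAt [Nonempty D] (hi : IsSmoothHypersurface n i) {β : Form (n + 1) X (n + 1)}
    (hβ : IsMeromorphicForm i (n + 1) β) (hs : HasSimplePole i β) {B : Form n D n}
    (hB : IsLeadingForm i β B) {φ : OpenPartialHomeomorph X (Cn (n + 1))} (hφ : IsAdapted i φ) {p : D}
    (hp : i p ∈ φ.source) :
    DifferentiableAt ℂ (inChart (inducedChart hi hφ) B) (inducedChart hi hφ p) := by
  obtain ⟨h, hh, he⟩ := hB.exists_eventuallyEq hi hβ hs hφ hp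
  have h1 := (inChart_congr (show p ∈ (inducedChart hi hφ).source from hp) he).trans
    (inChart_ofChart_eventuallyEq (inducedChart_mem_holCharts hi hφ) _
      ((inducedChart hi hφ).map_source hp))
  exact (hh.differentiableAt.smul (differentiableAt_const _)).congr_of_eventuallyEq h1

/-- `∂(η ∧ B̄) = ∂η ∧ B̄` on the hypersurface. -/
theorem IsLeadingForm.del_wedge_conj (hi : IsSmoothHypersurface n i) {β : Form (n + 1) X (n + 1)}
    (hβ : IsMeromorphicForm i (n + 1) β) (hs : HasSimplePole i β) {B : Form n D n}
    (hB : IsLeadingForm i β B) {k r : ℕ} (h : k + n = r) (h' : k + 1 + n = r + 1) {η : Form n D k}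
    (hη : SmoothOn Set.univ η) : del (wedge h η (conjForm B)) = wedge h' (del η) (conjForm B) := by
  funext p
  have : Nonempty D := ⟨p⟩
  obtain ⟨φ, hφ, hp⟩ := exists_isAdapted_of_mem hi p
  refine _root_.del_wedge_conj h h' (inducedChart_mem_holCharts hi hφ) hp ?_
    (hB.differentiableAt hi hβ hs hφ hp)
  exact ((smoothOn_iff isOpen_univ).1 hη p trivial _ (inducedChart_mem_holCharts hi hφ) hp).differentiableAt
    (by simp)

theorem wedge_conj_mem_smoothForms {m p q p' q' k l r : ℕ} {M : Type*} [TopologicalSpace M]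
    [ChartedSpace (Cn m) M] (h : k + l = r) {θ : Form m M k} {η : Form m M l} (hθ : θ ∈ smoothForms m M p q k)
    (hη : η ∈ smoothForms m M p' q' l) :
    wedge h θ (conjForm η) ∈ smoothForms m M (p + q') (q + p') r := by
  refine ⟨(smoothOn_iff isOpen_univ).2 fun x _ φ hφ hx => ?_, fun x => (hθ.2 x).wedge h (hη.2 x).conj⟩
  exact (contDiffAt_wedgeCovec h ((smoothOn_iff isOpen_univ).1 hθ.1 x trivial φ hφ hx)
    (contDiffAt_conjCovec ((smoothOn_iff isOpen_univ).1 hη.1 x trivial φ hφ hx))).congr_of_eventuallyEq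
    (Filter.Eventually.of_forall fun y => inChart_wedge h φ θ _ y)

end Poincare

/-! ### The residue of a product -/

section Product

theorem dC_conj_eq_zero {m : ℕ} {u : Cn m → ℂ} {y : Cn m} (hu : DifferentiableAt ℂ u y) (a : ℂ) (v : Cn m) :
    dC Complex.I v (fun y => a * conj (u y)) y = 0 := by
  have h1 : HasFDerivAt (fun y => conj (u y))
      ((Complex.conjCLE : ℂ →L[ℝ] ℂ).comp ((fderiv ℂ u y).restrictScalars ℝ)) y :=
    (Complex.conjCLE : ℂ →L[ℝ] ℂ).hasFDerivAt.comp y (hu.hasFDerivAt.restrictScalars ℝ)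
  refine (dC_const_smul (c := Complex.I) (v := v) (V := ℂ) a (fun y => conj (u y)) y).trans ?_
  rw [dC_apply, h1.fderiv]
  have h2 : conj (fderiv ℂ u y (Complex.I • v)) = -Complex.I * conj (fderiv ℂ u y v) := by
    rw [map_smul, smul_eq_mul, map_mul, Complex.conj_I]
  change a • ((1 / 2 : ℂ) • (conj (fderiv ℂ u y v) - Complex.I • conj (fderiv ℂ u y (Complex.I • v)))) = 0
  rw [h2]
  simp only [smul_eq_mul]
  linear_combination (a * (1 / 2) * conj (fderiv ℂ u y v)) * Complex.I_mul_I

/-- The wedge product with a fixed form on the right. -/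
def wedgeRight {m k l r : ℕ} {M : Type*} (h : k + l = r) (η : Form m M l) :
    Form m M k →ₗ[ℂ] Form m M r where
  toFun θ := wedge h θ η
  map_add' θ θ' := funext fun x => wedgeCovec_add_left h (θ x) (θ' x) (η x)
  map_smul' c θ := funext fun x => wedgeCovec_smul_left h c (θ x) (η x)

variable {n : ℕ} {X : Type*} [TopologicalSpace X] [ChartedSpace (Cn (n + 1)) X]
  [IsManifold 𝓘(ℂ, Cn (n + 1)) ω X] {D : Type*} {i : D → X}
  [TopologicalSpace D] [ChartedSpace (Cn n) D] [IsManifold 𝓘(ℂ, Cn n) ω D]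

/-- The wedge product with the conjugate of `dz₁ ∧ ⋯ ∧ dz_n`, restricted to the hypersurface. -/
def pairC (n : ℕ) : Covec (n + 1) n →L[ℂ] ℂ :=
  (hyperCoef n).comp ((wedgeL (n + 1) (rfl : n + n = n + n)).flip (conjCovec (tailPull (detC n))))

/-- The factor dz̄₀ has to be moved to the left across the n-covector A; this is the origin of the
sign (-1)^n in the theorem. -/
theorem coefX_wedge_detC (A : Covec (n + 1) n) (h : n + 1 + (n + 1) = n + n + 1 + 1) :
    coefX n (wedgeCovec h (covWedge (dzZero n) A) (conjCovec (detC (n + 1)))) =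
      (-1) ^ n * pairC n A := by
  rw [detC, conjCovec_covWedge_dzZero, wedgeCovec_covWedge_left (m := n + n + 1) (by omega),
    wedgeCovec_covWedge_right (m := n + n) rfl, covWedge_smul, map_smul, coefX_covWedge]
  rfl

theorem wedge_restrictToD (hi : IsSmoothHypersurface n i) {φ : OpenPartialHomeomorph X (Cn (n + 1))}
    (hφ : IsAdapted i φ) {p : D} (hp : i p ∈ φ.source) (A : Covec (n + 1) n) :
    wedgeCovec (rfl : n + n = n + n) (restrictToD i φ p A) (conjCovec (restrictToD i φ p (tailPull (detC n)))) =
      pairC n A • restrictToD i φ p (tailPull (vol n)) := by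
  refine Eq.trans ?_ (restrictToD_eq_smul hi hφ hp
    (wedgeCovec rfl A (conjCovec (tailPull (detC n)))))
  let L : Cn n →L[ℝ] Cn (n + 1) :=
    (mfderiv 𝓘(ℂ, Cn n) 𝓘(ℂ, Cn (n + 1)) (fun q => φ (i q)) p : Cn n →L[ℂ] Cn (n + 1)).restrictScalars ℝ
  have h1 := wedgeCovec_pullback (rfl : n + n = n + n) A (conjCovec (tailPull (detC n))) L
  have h2 : conjCovec (restrictToD i φ p (tailPull (detC n))) =
      (conjCovec (tailPull (detC n))).compContinuousLinearMap L := rfl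
  rw [h2]
  exact h1

theorem wedgeCovec_smul_conj_smul (s : ℕ) {m k l r : ℕ} {h : k + l = r} {A : Covec m k} {T : Covec m l}
    {V : Covec m r} {P : ℂ} (hV : wedgeCovec h A (conjCovec T) = P • V) (c b : ℂ) :
    wedgeCovec h (c • A) (conjCovec (b • T)) =
      (-1 : ℂ) ^ s • (c * (((-1) ^ s * conj b) * P)) • V := by
  have h1 : ((-1 : ℂ) ^ s) * (-1) ^ s = 1 := by rw [← mul_pow]; simp
  rw [conjCovec_smul, wedgeCovec_smul_left, wedgeCovec_smul_right, hV]
  ext w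
  change c * (conj b * (P * V w)) = (-1 : ℂ) ^ s * ((c * (((-1) ^ s * conj b) * P)) * V w)
  linear_combination (-(c * conj b * P * V w)) * h1

/-- The formula of (b) holds for each chart and pointwise on D. In α ∧ β̄ the derivatives ∂/∂z₀
prescribed by the pole of α fall only on ρ_jg, since the leading coefficient u of β enters as ū,
which they do not see. -/
theorem wedge_term_eq (hi : IsSmoothHypersurface n i) (C : ResidueCover n i) (j : Fin C.N) {a : ℕ}
    {g : Cn (n + 1) → Covec (n + 1) n} (hg : ContDiffOn ℝ ∞ g (C.φ j).target)
    {α β : Form (n + 1) X (n + 1)} (h : ∀ x ∈ tsupport (C.ρ j), x ∉ Set.range i →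
      inChart (C.φ j) α (C.φ j x) = (C.φ j x 0 ^ (a + 1))⁻¹ • covWedge (dzZero n) (g (C.φ j x)))
    (hβ : IsMeromorphicForm i (n + 1) β) (hs : HasSimplePole i β) {B : Form n D n}
    (hB : IsLeadingForm i β B) (hw : n + 1 + (n + 1) = n + n + 1 + 1) :
    wedge rfl (C.term j a 0 g) (conjForm B) =
      (-1 : ℂ) ^ n • residueIn i (C.φ j) (fmul (partFn C.ρ j) (wedge hw α (conjForm β))) := by
  funext p
  change wedgeCovec rfl (C.term j a 0 g p) (conjCovec (B p)) = (-1 : ℂ) ^ n • residueIn i (C.φ j) _ p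
  by_cases hp : i p ∈ (C.φ j).source
  · set φ := C.φ j with hφdef
    have hφ := C.adapted j
    obtain ⟨u, hu, hu'⟩ := exists_leading_coef hβ hs hφ hp
    have hy := φ.map_source hp
    have hsm : ∀ y ∈ φ.target, ContDiffAt ℝ ∞ (fun y => partFn C.ρ j (φ.symm y) • g y) y := fun y hy =>
      (smoothFn_partFn C.ρ j φ hφ.1 y hy).smul (hg.contDiffAt (φ.open_target.mem_nhds hy))
    have huc : ContDiffAt ℝ ∞ (fun y => (-1) ^ n * conj (u y)) (φ (i p)) :=
      contDiffAt_const.mul (Complex.conjCLE.contDiff.contDiffAt.comp _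
        ((hu.contDiffAt (n := ∞)).restrict_scalars ℝ))
    set F : Cn (n + 1) → Covec (n + 1) n := fun y => partFn C.ρ j (φ.symm y) • g y with hF
    have hΛ : ContDiffAt ℝ ∞ (fun y => pairC n (F y)) (φ (i p)) :=
      ((pairC n).restrictScalars ℝ).contDiff.contDiffAt.comp _ (hsm _ hy)
    have h1 : C.term j a 0 g p = (1 / ((a.factorial : ℂ) * ((0).factorial : ℂ))) • restrictToD i φ p
        (wirt^[a] F (φ (i p))) := if_pos hp
    -- The pole in z̄₀ is the simple pole of β̄, so the second order is 0 and no derivative ∂/∂z̄₀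
    -- occurs.
    have h2 : resF (coef φ (fmul (partFn C.ρ j) (wedge hw α (conjForm β)))) (φ (i p)) =
        resVal a 0 (fun y => ((-1) ^ n * conj (u y)) • pairC n (F y)) (φ (i p)) := by
      refine resF_eq_resVal (hφ.apply_zero hp) ((huc.smul hΛ).of_le (natCast_le_infty _)) ?_
      filter_upwards [φ.open_target.mem_nhds hy, hu'] with y hyt h3 h0
      rw [coef_fmul, hF]
      simp only [map_smul, smul_eq_mul]
      by_cases hsu : φ.symm y ∈ tsupport (C.ρ j)
      · have h4 := h _ hsu fun h' => h0 ((hφ.symm_mem_range hyt).1 h')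
        rw [φ.right_inv hyt] at h4
        have h5 : inChart φ β y = ((y 0)⁻¹ * u y) • detC (n + 1) := by
          rw [mul_smul, ← h3 h0, smul_smul, inv_mul_cancel₀ h0, one_smul]
        rw [coef, inChart_wedge, inChart_conjForm, h4, h5, conjCovec_smul, wedgeCovec_smul_left,
          wedgeCovec_smul_right, map_smul, map_smul, coefX_wedge_detC, smul_eq_mul, smul_eq_mul, poleMon,
          map_mul, map_inv₀]
        have h6 : conj (y 0) ≠ 0 := by simpa using h0
        field_simp
        ring
      · rw [partFn_eq_zero hsu]; ring
    -- As u is holomorphic near φ(i p), its conjugate leaves the iterated derivative and is simply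
    -- evaluated at the point.
    have h3 : wirt^[a] (fun y => ((-1) ^ n * conj (u y)) • pairC n (F y)) (φ (i p)) =
        ((-1) ^ n * conj (u (φ (i p)))) * pairC n (wirt^[a] F (φ (i p))) := by
      have h4 := (dC_iterate_smul_of_zero (c := Complex.I) (v := Pi.single 0 1)
        (f := fun y => (-1) ^ n * conj (u y)) (F := fun y => pairC n (F y))
        (huc.eventually_differentiableAt (by simp))
        (hu.eventually_analyticAt.mono fun y hy => dC_conj_eq_zero hy.differentiableAt _ _) a
        (hΛ.of_le (natCast_le_infty _))).eq_of_nhds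
      refine h4.trans ?_
      rw [dC_iterate_clm (pairC n) φ.open_target hsm a _ hy]
      rfl
    have h5 : resVal a 0 (fun y => ((-1) ^ n * conj (u y)) • pairC n (F y)) (φ (i p)) =
        ((a.factorial : ℂ) * ((0).factorial : ℂ))⁻¹ *
          (((-1) ^ n * conj (u (φ (i p)))) * pairC n (wirt^[a] F (φ (i p)))) := by
      rw [← h3]; rfl
    rw [h1, hB hφ hp u hu.continuousAt hu']
    refine (wedgeCovec_smul_conj_smul n (wedge_restrictToD hi hφ hp _) _ _).trans ?_
    rw [residueIn_of_mem _ hp, h2, h5, one_div]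
  · have h1 : C.term j a 0 g p = 0 := if_neg hp
    rw [h1, residueIn_of_notMem _ hp]
    refine Eq.trans ((wedgeL n (rfl : n + n = n + n)).flip (conjCovec (B p))).map_zero ?_
    exact (smul_zero (A := Covec n (n + n)) ((-1 : ℂ) ^ n)).symm

theorem wedge_residue_eq (hi : IsSmoothHypersurface n i) {α β : Form (n + 1) X (n + 1)} {R : Form n D n}
    (hR : IsConjDolbeaultResidueForm i α R) (hβ : IsMeromorphicForm i (n + 1) β) (hs : HasSimplePole i β)
    {B : Form n D n} (hB : IsLeadingForm i β B) (hw : n + 1 + (n + 1) = n + n + 1 + 1) :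
    ∃ C : ResidueCover n i, wedge rfl R (conjForm B) =
      (-1 : ℂ) ^ n • residueSum C (wedge hw α (conjForm β)) := by
  obtain ⟨C, a, g, hg, -, h, rfl⟩ := hR
  refine ⟨C, ?_⟩
  have h1 := map_sum (wedgeRight (rfl : n + n = n + n) (conjForm B)) (fun j => C.term j (a j) 0 (g j))
    Finset.univ
  refine h1.trans ?_
  rw [residueSum, Finset.smul_sum]
  exact Finset.sum_congr rfl fun j _ => wedge_term_eq hi C j (hg j) (h j) hβ hs hB hw

/-- B is holomorphic on D, so ∂η ∧ B̄ = ∂(η ∧ B̄); changing the representative of the residue of α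
changes the product by an exact form. -/
theorem IsLeadingForm.wedge_mem_aeppliExact (hi : IsSmoothHypersurface n i) {β : Form (n + 1) X (n + 1)}
    (hβ : IsMeromorphicForm i (n + 1) β) (hs : HasSimplePole i β) {B : Form n D n}
    (hB : IsLeadingForm i β B) {R : Form n D n} (hR : R ∈ delImage n D n 0 n) :
    wedge rfl R (conjForm B) ∈ aeppliExact n D := by
  suffices h : delImage n D n 0 n ≤ (aeppliExact n D).comap (wedgeRight rfl (conjForm B)) from h hR
  -- If D has dimension 0 there are no forms of lower degree and the image of ∂ is zero.
  obtain _ | m := n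
  · exact bot_le
  · refine Submodule.span_le.2 ?_
    rintro _ ⟨p, hp, η, hη, rfl⟩
    obtain rfl : p = m := by omega
    have h1 := hB.del_wedge_conj hi hβ hs (r := p + 1 + p) (by omega) (by omega) hη.1
    have h2 := wedge_conj_mem_smoothForms (r := p + 1 + p) (by omega) hη (hB.mem_smoothForms hi hβ hs)
    rw [add_zero, zero_add] at h2
    have h3 := del_mem_aeppliExact h2
    rw [h1] at h3
    exact h3

theorem polarFormAt_of_mem_semiForms (hi : IsSmoothHypersurface n i) {p q k : ℕ} {θ : Form (n + 1) X k}
    (hθ : θ ∈ semiForms n i p q k) (x : X) : PolarFormAt i θ x :=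
  polarFormAt_of_polesAlong hi hθ.1 hθ.2.2 x

theorem wedge_conj_mem_quasiForms (hi : IsSmoothHypersurface n i) {p q p' q' k l r : ℕ} (h : k + l = r)
    {θ : Form (n + 1) X k} {η : Form (n + 1) X l} (hθ : θ ∈ semiForms n i p q k)
    (hη : η ∈ semiForms n i p' q' l) : wedge h θ (conjForm η) ∈ quasiForms n i (p + q') (q + p') r := by
  have h1 := (polarFormAt_iff hi).1 fun x => (polarFormAt_of_mem_semiForms hi hθ x).wedge_conj h
    (polarFormAt_of_mem_semiForms hi hη x)
  exact ⟨h1.1, fun x hx => (hθ.2.1 x hx).wedge h (hη.2.1 x hx).conj, h1.2⟩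

/-- Off D the form β is holomorphic, so ∂η ∧ β̄ = ∂(η ∧ β̄) with η ∧ β̄ quasi-meromorphic. Hence the
wedge product with β̄ descends to the cohomology classes. -/
theorem wedge_mk_eq (hi : IsSmoothHypersurface n i) {β : Form (n + 1) X (n + 1)}
    (hβ : IsMeromorphicForm i (n + 1) β) (hw : n + 1 + (n + 1) = n + n + 1 + 1)
    (hmem : ∀ θ : semiForms n i (n + 1) 0 (n + 1),
      wedge hw θ.1 (conjForm β) ∈ quasiForms n i (n + 1) (n + 1) (n + n + 1 + 1))
    {α α' : semiForms n i (n + 1) 0 (n + 1)}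
    (h : (Submodule.Quotient.mk α : ConjDolbeaultPolar n i) = Submodule.Quotient.mk α') :
    (Submodule.Quotient.mk ⟨_, hmem α⟩ : AeppliPolar n i) = Submodule.Quotient.mk ⟨_, hmem α'⟩ := by
  let L : semiForms n i (n + 1) 0 (n + 1) →ₗ[ℂ] quasiForms n i (n + 1) (n + 1) (n + n + 1 + 1) :=
    { toFun := fun θ => ⟨_, hmem θ⟩
      map_add' := fun θ θ' => Subtype.ext ((wedgeRight hw (conjForm β)).map_add θ.1 θ'.1)
      map_smul' := fun c θ => Subtype.ext ((wedgeRight hw (conjForm β)).map_smul c θ.1) }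
  have hL : semiDelExact n i ≤ (quasiExact n i).comap L := by
    refine Submodule.span_le.2 ?_
    rintro θ ⟨η, hη, he⟩
    refine Submodule.mem_sup_left (Submodule.subset_span ⟨wedge (by omega) η (conjForm β), ?_, fun x hx => ?_⟩)
    · have := wedge_conj_mem_quasiForms (r := n + n + 1) hi (by omega) hη (hβ.mem_semiForms hi)
      rwa [add_zero, zero_add] at this
    · have hc := chartAt_mem_holCharts (m := n + 1) x
      have hxc := mem_chart_source (Cn (n + 1)) x
      refine Eq.trans ?_ (del_wedge_conj (r := n + n + 1) (by omega) hw hc hxc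
        ((((smoothOn_iff hi.isClosed_range.isOpen_compl).1 hη.1 x hx) _ hc hxc).differentiableAt (by simp))
        (hβ.differentiableAt hi hc ((chartAt (Cn (n + 1)) x).map_source hxc)
          (by rwa [(chartAt (Cn (n + 1)) x).left_inv hxc]))).symm
      exact congrArg (fun A => wedgeCovec hw A (conjForm β x)) (he x hx)
  have h1 := hL ((Submodule.Quotient.eq _).1 h)
  rw [Submodule.mem_comap, map_sub] at h1
  exact (Submodule.Quotient.eq _).2 h1

end Product

/-! ### Existence of residue forms of meromorphic forms -/

section Existence

variable {n : ℕ} {X : Type*} [TopologicalSpace X] [ChartedSpace (Cn (n + 1)) X]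
  [IsManifold 𝓘(ℂ, Cn (n + 1)) ω X] {D : Type*} {i : D → X}

theorem IsAdapted.exists_restr_of_eventually {φ : OpenPartialHomeomorph X (Cn (n + 1))}
    (hφ : IsAdapted i φ) {x : X} (hx : x ∈ φ.source) {P : Cn (n + 1) → Prop}
    (hP : ∀ᶠ y in 𝓝 (φ x), P y) :
    ∃ s : Set X, IsAdapted i (φ.restr s) ∧ x ∈ (φ.restr s).source ∧ ∀ y ∈ (φ.restr s).target, P y := by
  obtain ⟨O, hO, hOo, hxO⟩ := eventually_nhds_iff.1 hP
  have ho : IsOpen (φ.source ∩ φ ⁻¹' O) := φ.isOpen_inter_preimage hOo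
  refine ⟨φ.source ∩ φ ⁻¹' O, hφ.restr ho, ?_, fun y hy => hO y ?_⟩
  · rw [OpenPartialHomeomorph.restr_source' _ _ ho]
    exact ⟨hx, hx, hxO⟩
  · rw [OpenPartialHomeomorph.restr_target, ho.interior_eq] at hy
    obtain ⟨h1, h2, h3⟩ := hy
    rwa [Set.mem_preimage, φ.right_inv h1] at h3

variable [TopologicalSpace D] [ChartedSpace (Cn n) D]

/-- For a meromorphic form the cleared numerator is analytic, which is an open condition, so one
pole order serves on a whole neighbourhood. -/
theorem IsMeromorphicForm.eventually_contDiffAt (hi : IsSmoothHypersurface n i) {p k : ℕ}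
    {θ : Form (n + 1) X k} (h : IsMeromorphicForm i p θ) {φ : OpenPartialHomeomorph X (Cn (n + 1))}
    (hφ : IsAdapted i φ) {x : X} (hx : x ∈ φ.source) :
    ∃ a : ℕ, ∀ᶠ y in 𝓝 (φ x), ContDiffAt ℝ ∞ (fun y => y 0 ^ (a + 1) • inChart φ θ y) y := by
  by_cases hxD : x ∈ Set.range i
  · obtain ⟨a, g, hg, he⟩ := h.pole φ hφ x hx hxD
    refine ⟨a, ?_⟩
    filter_upwards [hg.eventually_analyticAt, he.eventually_nhds] with y hy hey
    have h1 : ContDiffAt ℝ ∞ (fun y : Cn (n + 1) => y 0 • g y) y :=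
      (contDiff_coord 0).contDiffAt.smul ((hy.contDiffAt (n := ∞)).restrict_scalars ℝ)
    refine h1.congr_of_eventuallyEq (hey.mono fun y' h' => ?_)
    -- The additional factor z₀ makes the product vanish on D, whatever values θ takes there.
    by_cases h0 : y' 0 = 0
    · change y' 0 ^ (a + 1) • inChart φ θ y' = y' 0 • g y'
      rw [h0, pow_succ, mul_zero]
      exact (zero_smul ℂ (inChart φ θ y')).trans (zero_smul ℂ (g y')).symm
    · change y' 0 ^ (a + 1) • inChart φ θ y' = y' 0 • g y'
      rw [← h' h0, pow_succ', mul_smul]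
  · refine ⟨0, ?_⟩
    have ho : IsOpen (φ.target ∩ φ.symm ⁻¹' (Set.range i)ᶜ) :=
      φ.isOpen_inter_preimage_symm hi.isClosed_range.isOpen_compl
    have hm : φ x ∈ φ.target ∩ φ.symm ⁻¹' (Set.range i)ᶜ :=
      ⟨φ.map_source hx, by rwa [Set.mem_preimage, φ.left_inv hx]⟩
    filter_upwards [ho.mem_nhds hm] with y hy
    exact ((contDiff_coord 0).pow (0 + 1)).contDiffAt.smul
      (((h.mem_semiForms hi).1 φ hφ.1).contDiffAt (ho.mem_nhds hy))

variable [T2Space X] [CompactSpace X] [IsManifold 𝓘(ℂ, Cn n) ω D]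

theorem exists_residueCover_of_meromorphic (hi : IsSmoothHypersurface n i) {p q k l : ℕ}
    {α : Form (n + 1) X k} {β : Form (n + 1) X l} (hα : IsMeromorphicForm i p α)
    (hβ : IsMeromorphicForm i q β) :
    ∃ (C : ResidueCover n i) (a b : Fin C.N → ℕ), ∀ j, ∀ y ∈ (C.φ j).target,
      ContDiffAt ℝ ∞ (fun y => y 0 ^ (a j + 1) • inChart (C.φ j) α y) y ∧
      ContDiffAt ℝ ∞ (fun y => y 0 ^ (b j + 1) • inChart (C.φ j) β y) y := by
  obtain ⟨C, hC⟩ := exists_residueCover (i := i) (P := fun φ => ∃ a b : ℕ, ∀ y ∈ φ.target,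
      ContDiffAt ℝ ∞ (fun y => y 0 ^ (a + 1) • inChart φ α y) y ∧
      ContDiffAt ℝ ∞ (fun y => y 0 ^ (b + 1) • inChart φ β y) y) fun x => by
    obtain ⟨φ, hφ, hx, -⟩ := exists_isAdapted hi (x := x) Filter.univ_mem
    obtain ⟨a, ha⟩ := hα.eventually_contDiffAt hi hφ hx
    obtain ⟨b, hb⟩ := hβ.eventually_contDiffAt hi hφ hx
    obtain ⟨s, hs, hxs, h⟩ := hφ.exists_restr_of_eventually hx (ha.and hb)
    exact ⟨_, hs, hxs, a, b, h⟩
  choose a b hab using hC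
  exact ⟨C, a, b, hab⟩

theorem isAeppliResidueForm_wedge_conj (hi : IsSmoothHypersurface n i) {α β : Form (n + 1) X (n + 1)}
    (hw : n + 1 + (n + 1) = n + n + 1 + 1) {C : ResidueCover n i} {a b : Fin C.N → ℕ}
    (h : ∀ j, ∀ y ∈ (C.φ j).target,
      ContDiffAt ℝ ∞ (fun y => y 0 ^ (a j + 1) • inChart (C.φ j) α y) y ∧
      ContDiffAt ℝ ∞ (fun y => y 0 ^ (b j + 1) • inChart (C.φ j) β y) y) :
    IsAeppliResidueForm i (wedge hw α (conjForm β)) (residueSum C (wedge hw α (conjForm β))) := by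
  refine isAeppliResidueForm_residueSum hi C a b fun j y hy => ?_
  have h1 := ((coefX n).restrictScalars ℝ).contDiff.contDiffAt.comp y
    (contDiffAt_wedgeCovec hw (h j y hy).1 (contDiffAt_conjCovec (h j y hy).2))
  refine h1.congr_of_eventuallyEq (Filter.Eventually.of_forall fun y => ?_)
  change y 0 ^ (a j + 1) * (conj (y 0)) ^ (b j + 1) *
    coefX n (inChart (C.φ j) (wedge hw α (conjForm β)) y) = coefX n (wedgeCovec hw (y 0 ^ (a j + 1) • inChart (C.φ j) α y)
    (conjCovec (y 0 ^ (b j + 1) • inChart (C.φ j) β y)))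
  rw [conjCovec_smul, wedgeCovec_smul_left, wedgeCovec_smul_right, map_smul, map_smul, inChart_wedge,
    inChart_conjForm, smul_eq_mul, smul_eq_mul, map_pow, mul_assoc]

theorem resVal_eq_zero {m : ℕ} (a : ℕ) {f : Cn (m + 1) → ℂ} {y : Cn (m + 1)}
    (hf : f =ᶠ[𝓝 y] fun _ => 0) : resVal a 0 f y = 0 := by
  have h2 : wirt^[a] f y = 0 := by
    refine (hf.dC_iterate (V := ℂ) (c := Complex.I) (v := Pi.single 0 1) a).eq_of_nhds.trans ?_
    rw [Function.iterate_fixed (funext fun y => dC_const (V := ℂ) 0 y)]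
  change _ * wirt^[a] f y = 0
  rw [h2, mul_zero]

theorem wirt_iterate_smul_const {m : ℕ} {V : Type*} [NormedAddCommGroup V] [NormedSpace ℝ V]
    [NormedSpace ℂ V] [IsScalarTower ℝ ℂ V] (B : V) {s : Set (Cn (m + 1))} (hs : IsOpen s)
    {f : Cn (m + 1) → ℂ} (hf : ∀ y ∈ s, ContDiffAt ℝ ∞ f y) (a : ℕ) :
    ∀ y ∈ s, wirt^[a] (fun y => f y • B) y = wirt^[a] f y • B :=
  dC_iterate_clm (c := Complex.I) (v := Pi.single 0 1) ((ContinuousLinearMap.id ℂ ℂ).smulRight B) hs hf a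

theorem ResidueCover.term_eq_ofChart [Nonempty D] (hi : IsSmoothHypersurface n i) (C : ResidueCover n i)
    (j : Fin C.N) (a : ℕ) {u : Cn (n + 1) → ℂ} (hu : ContDiffOn ℝ ∞ u (C.φ j).target) {k : ℕ}
    (A : Covec n k) :
    C.term j a 0 (fun y => u y • tailPull A) = ofChart (inducedChart hi (C.adapted j)) fun w =>
      resVal a 0 (fun y => partFn C.ρ j ((C.φ j).symm y) * u y) (hyper n w) • A := by
  funext p
  by_cases hp : i p ∈ (C.φ j).source
  · have hφ := C.adapted j
    have hy := (C.φ j).map_source hp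
    have h1 : C.term j a 0 (fun y => u y • tailPull A) p =
        (1 / ((a.factorial : ℂ) * ((0).factorial : ℂ))) • restrictToD i (C.φ j) p
        (wirt^[a] (fun y => partFn C.ρ j ((C.φ j).symm y) • u y • tailPull A) (C.φ j (i p))) := if_pos hp
    have h2 := wirt_iterate_smul_const (tailPull A) (C.φ j).open_target
        (f := fun y => partFn C.ρ j ((C.φ j).symm y) * u y)
        (fun y hy => (smoothFn_partFn C.ρ j _ hφ.1 y hy).mul
          (hu.contDiffAt ((C.φ j).open_target.mem_nhds hy))) a _ hy
    simp only [mul_smul] at h2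
    rw [h1, h2, ofChart_of_mem _ ((mem_inducedChart_source hi hφ p).2 hp), hyper_inducedChart hi hφ hp,
      restrictToD_eq hi hφ hp, resVal, one_div]
    have h4 : ∀ c : ℂ, hyperPull (c • tailPull A) = c • A := fun c =>
      congrArg (fun B => c • B) (hyperPull_tailPull A)
    rw [h4, mul_smul]
    rfl
  · exact (if_neg hp : C.term j a 0 (fun y => u y • tailPull A) p = 0).trans
      (ofChart_of_notMem _ fun h => hp ((mem_inducedChart_source hi (C.adapted j) p).1 h)).symm

theorem ResidueCover.term_mem_smoothForms (hi : IsSmoothHypersurface n i) (C : ResidueCover n i)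
    (j : Fin C.N) (a : ℕ) {u : Cn (n + 1) → ℂ} (hu : ContDiffOn ℝ ∞ u (C.φ j).target) {p q k : ℕ}
    {A : Covec n k} (hA : HasBidegree p q A) :
    C.term j a 0 (fun y => u y • tailPull A) ∈ smoothForms n D p q k := by
  cases isEmpty_or_nonempty D with
  | inl hD =>
    have : C.term j a 0 (fun y => u y • tailPull A) = 0 := funext fun p => (hD.false p).elim
    rw [this]; exact Submodule.zero_mem _
  | inr hD =>
    have : T2Space D := t2Space_hypersurface hi
    have hφ := C.adapted j
    rw [C.term_eq_ofChart hi j a hu A]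
    refine ⟨(smoothOn_iff isOpen_univ).2 fun p _ => smoothAtPt_ofChart (inducedChart_mem_holCharts hi hφ)
      (isCompact_inducedChart_image hi hφ (isClosed_tsupport _) (C.subordinate j))
      (inducedChart_image_subset hi hφ (C.subordinate j)) ?_ ?_ p,
      fun _ => hasBidegree_ofChart (fun w => hA.smul _) _⟩
    · intro w hw hwK
      have h1 : (fun y => partFn C.ρ j ((C.φ j).symm y) * u y) =ᶠ[𝓝 (hyper n w)] fun _ => 0 := by
        filter_upwards [((C.φ j).continuousAt_symm ((mem_inducedChart_target hi hφ w).1 hw)).eventually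
          ((isClosed_tsupport (C.ρ j)).isOpen_compl.mem_nhds (symm_hyper_notMem hi hφ hw hwK))] with y hy
        rw [partFn_eq_zero hy, zero_mul]
      have h3 := resVal_eq_zero a h1
      rw [h3]
      exact zero_smul ℂ A
    · intro w hw
      have hy := (mem_inducedChart_target hi hφ w).1 hw
      have h1 : ContDiffAt ℝ ∞ (fun y => partFn C.ρ j ((C.φ j).symm y) * u y) (hyper n w) :=
        (smoothFn_partFn C.ρ j _ hφ.1 _ hy).mul (hu.contDiffAt ((C.φ j).open_target.mem_nhds hy))
      exact ((h1.resVal a 0).comp w contDiff_hyper.contDiffAt).smul contDiffAt_const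

/-- On charts with a uniform pole order, α is dz₀ ∧ g / z₀^(a+1), where g is a smooth function times
dz₁ ∧ ⋯ ∧ dz_n. The resulting terms are of bidegree (n,0) and vanish outside compact subsets of the
induced charts. -/
theorem exists_isConjDolbeaultResidueForm (hi : IsSmoothHypersurface n i) {α : Form (n + 1) X (n + 1)}
    (hα : IsMeromorphicForm i (n + 1) α) :
    ∃ R ∈ smoothForms n D n 0 n, IsConjDolbeaultResidueForm i α R := by
  obtain ⟨C, a, b, h⟩ := exists_residueCover_of_meromorphic hi hα hα
  have hu : ∀ j, ContDiffOn ℝ ∞ (fun y => topC (n + 1) (y 0 ^ (a j + 1) • inChart (C.φ j) α y))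
      (C.φ j).target := fun j y hy =>
    (((topC (n + 1)).restrictScalars ℝ).contDiff.contDiffAt.comp y (h j y hy).1).contDiffWithinAt
  refine ⟨∑ j, C.term j (a j) 0 fun y =>
      topC (n + 1) (y 0 ^ (a j + 1) • inChart (C.φ j) α y) • tailPull (detC n),
    Submodule.sum_mem _ fun j _ => C.term_mem_smoothForms hi j (a j) (hu j) (hasBidegree_detC n),
    C, a, _, fun j y hy => ((hu j) y hy).smul contDiffWithinAt_const,
    fun j y _ => omitsDz_smul_tailPull _ _, fun j x hx hxD => ?_, rfl⟩
  have hφ := C.adapted j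
  have hxs := C.subordinate j hx
  have h0 : C.φ j x 0 ≠ 0 := fun h' => hxD ((hφ.mem_iff x hxs).2 h')
  have h1 := hα.inChart_eq hφ ((C.φ j).map_source hxs) h0
  change _ = (C.φ j x 0 ^ (a j + 1))⁻¹ • covWedge (dzZero n)
    (topC (n + 1) (C.φ j x 0 ^ (a j + 1) • inChart (C.φ j) α (C.φ j x)) • tailPull (detC n))
  rw [covWedge_smul, map_smul, smul_eq_mul, smul_smul, inv_mul_cancel_left₀ (pow_ne_zero _ h0)]
  exact h1

end Existence

end

/-! ### The theorem -/

theorem proposition3p8 {n : ℕ}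
    {X : Type*} [TopologicalSpace X] [T2Space X] [CompactSpace X]
    [ChartedSpace (Cn (n + 1)) X] [IsManifold 𝓘(ℂ, Cn (n + 1)) ω X]
    {D : Type*} [TopologicalSpace D]
    [ChartedSpace (Cn n) D] [IsManifold 𝓘(ℂ, Cn n) ω D]
    (i : D → X) (hi : IsSmoothHypersurface n i) :
    (∀ c : AeppliPolar n i, IsSemiMeromorphicClass i c → aeppliResidues i c = {0}) ∧
    (∀ α β : Form (n + 1) X (n + 1),
      IsMeromorphicForm i (n + 1) α → IsMeromorphicForm i (n + 1) β → HasSimplePole i β →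
      ∃ (hα : α ∈ semiForms n i (n + 1) 0 (n + 1))
        (hαβ : wedge (by omega) α (conjForm β) ∈
          quasiForms n i (n + 1) (n + 1) (n + n + 1 + 1))
        (B : Form n D n) (s : AeppliTop n D),
        (∀ B', IsPoincareResidue i β B' ↔ B' = B) ∧
        (conjDolbeaultResidues i (Submodule.Quotient.mk ⟨α, hα⟩)).Nonempty ∧
        (∀ r ∈ conjDolbeaultResidues i (Submodule.Quotient.mk ⟨α, hα⟩),
          ∀ R : smoothForms n D n 0 n, Submodule.Quotient.mk R = r →
            ∃ hRB : wedge rfl R.1 (conjForm B) ∈ smoothForms n D n n (n + n),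
              Submodule.Quotient.mk ⟨_, hRB⟩ = s) ∧
        aeppliResidues i (Submodule.Quotient.mk ⟨_, hαβ⟩) = {((-1 : ℂ) ^ n) • s}) := by
  refine ⟨fun c hc => aeppliResidues_eq_zero hi c hc, fun α β hα hβ hs => ?_⟩
  have hw : n + 1 + (n + 1) = n + n + 1 + 1 := by omega
  have hmem : ∀ θ : semiForms n i (n + 1) 0 (n + 1),
      wedge hw θ.1 (conjForm β) ∈ quasiForms n i (n + 1) (n + 1) (n + n + 1 + 1) := fun θ => by
    have h := wedge_conj_mem_quasiForms hi hw θ.2 (hβ.mem_semiForms hi)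
    rwa [add_zero, zero_add] at h
  have hαs := hα.mem_semiForms hi
  obtain ⟨B, hB⟩ := exists_isLeadingForm hi hβ hs
  obtain ⟨C, a, b, hC⟩ := exists_residueCover_of_meromorphic hi hα hβ
  have hθ := hmem ⟨α, hαs⟩
  have hS := residueSum_mem_smoothForms hi C (polarFormAt_of_mem_quasiForms hi hθ)
  let S : smoothForms n D n n (n + n) := ⟨_, hS⟩
  have hsign : ((-1 : ℂ) ^ n) * (-1) ^ n = 1 := by rw [← mul_pow]; simp
  have hsmul : (-1 : ℂ) ^ n • (Submodule.Quotient.mk ((-1 : ℂ) ^ n • S) : AeppliTop n D) =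
      Submodule.Quotient.mk S := by
    rw [← Submodule.Quotient.mk_smul, smul_smul, hsign, one_smul]
  -- The class s is (-1)^n times the class of the residue form S of α ∧ β̄ for the cover C; since
  -- (-1)^n is its own inverse, (-1)^n • s is the class of S.
  refine ⟨hαs, hθ, B, Submodule.Quotient.mk ((-1 : ℂ) ^ n • S), hB.isPoincareResidue_iff hi hβ hs, ?_, ?_, ?_⟩
  · obtain ⟨R, hR, hRα⟩ := exists_isConjDolbeaultResidueForm hi hα
    exact ⟨_, ⟨α, hαs⟩, rfl, ⟨R, hR⟩, hRα, rfl⟩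
  · rintro _ ⟨α', hα', R', hR', rfl⟩ R hR
    have hRB : wedge rfl R.1 (conjForm B) ∈ smoothForms n D n n (n + n) := by
      have h := wedge_conj_mem_smoothForms (rfl : n + n = n + n) R.2 (hB.mem_smoothForms hi hβ hs)
      rwa [add_zero, zero_add] at h
    refine ⟨hRB, (Submodule.Quotient.eq _).2 ?_⟩
    -- R' is a residue form of a possibly different representative α', and R only shares its class.
    -- So R is replaced by R', then R' ∧ B̄ by the residue form of α' ∧ β̄, and finally α' by α and
    -- the cover C' by C, each time modulo exact forms.
    obtain ⟨C', hC'⟩ := wedge_residue_eq hi hR' hβ hs hB hw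
    have h0 : R - R' ∈ (delImage n D n 0 n).submoduleOf (smoothForms n D n 0 n) :=
      (Submodule.Quotient.eq _).1 hR
    have h1 : wedge rfl (R.1 - R'.1) (conjForm B) ∈ aeppliExact n D :=
      hB.wedge_mem_aeppliExact hi hβ hs h0
    have h2 := Submodule.smul_mem _ ((-1 : ℂ) ^ n)
      (residue_sub_mem hi (wedge_mk_eq hi hβ hw hmem hα') C' C)
    have h3 : wedge rfl R.1 (conjForm B) - (-1 : ℂ) ^ n • residueSum C (wedge hw α (conjForm β)) ∈
        aeppliExact n D := by
      have h4 := Submodule.add_mem _ h1 h2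
      have h5 : wedge rfl (R.1 - R'.1) (conjForm B) =
          wedge rfl R.1 (conjForm B) - wedge rfl R'.1 (conjForm B) :=
        (wedgeRight (rfl : n + n = n + n) (conjForm B)).map_sub R.1 R'.1
      rw [h5, hC', smul_sub, sub_add_sub_cancel] at h4
      exact h4
    exact h3
  · rw [hsmul]
    refine Set.Subset.antisymm ?_ ?_
    · rintro _ ⟨θ, hθ', R, hR, rfl⟩
      obtain ⟨C', hC'⟩ := hR.exists_eq hi
      refine (Submodule.Quotient.eq _).2 ?_
      have h := residue_sub_mem hi hθ' C' C
      rw [← hC'] at h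
      exact h
    -- The value is attained by α ∧ β̄ itself with the cover C, on whose charts fixed exponents
    -- clear the poles of α and β.
    · rintro _ rfl
      exact ⟨⟨_, hθ⟩, rfl, S, isAeppliResidueForm_wedge_conj hi hw hC, rfl⟩
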